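/- **Setting.** Let $d\ge 2$, $N\ge1$, $m\ge 2$, $M\ge 0$ be integers. Let $\mathcal O\subset\mathbb R^N$ be open with $0\in\mathcal O$, let $A_1,\dots,A_d:\mathcal O\to\mathcal M_N(\mathbb R)$ be smooth, and let $B\in\mathcal M_{M\times N}(\mathbb R)$ be of maximal rank. For $T>0$ put $\omega_T=(-\infty,T]\times\mathbb R^{d-1}\ni z'=(t,y)$, $\Omega_T=\omega_T\times\mathbb R_+\ni z=(z',x_d)$, $\mathbb T=\mathbb R/2\pi\mathbb Z$. Write $A(\eta,\xi)=\sum_{i<d}\eta_iA_i(0)+\xi A_d(0)$ and $L(0,(\tau,\eta,\xi))=\tau I+A(\eta,\xi)$; $(\tau,\eta,\xi)\in\mathbb R^{1+d}$ is *characteristic* if $\det L(0,(\tau,\eta,\xi))=0$. Put $\tilde A_0=A_d^{-1}$, $\tilde A_i=A_d^{-1}A_i$ for $1\le i\le d-1$, $\tilde L(0,\partial_z)=\tilde A_0(0)\partial_t+\sum_{i=1}^{d-1}\tilde A_i(0)\partial_{y_i}+\partial_{x_d}$, and $\tilde L_1(u,\zeta)=\sum_{i=0}^{d-1}\zeta^i\,d\tilde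 A_i(0)\cdot u$ for $\zeta=(\zeta^0,\dots,\zeta^{d-1})\in\mathbb R^d$ (complex linear in $u\in\mathbb C^N$). For $\sigma\in\mathbb C,\eta\in\mathbb R^{d-1}$ let $\mathcal A(\sigma,\eta)=-iA_d(0)^{-1}\big(\sigma I+\sum_{j<d}\eta_jA_j(0)\big)$. **Assumptions.** 1. $A_d(u)$ is invertible for all $u\in\mathcal O$. 2. There are real functions $\tau_1<\dots<\tau_N$, analytic on $\mathbb R^d\setminus\{0\}$, such that $\det(\tau I+A(\eta,\xi))=\prod_{k}(\tau-\tau_k(\eta,\xi))$ for all $\tau\in\mathbb R$ and $(\eta,\xi)\ne0$. If $\tau=\tau_k(\eta,\xi)$ with $(\eta,\xi)\neq0$, the characteristic frequency $(\tau,\eta,\xi)$ is called *incoming*, *outgoing*, *glancing* if $\partial_\xi\tau_k(\eta,\xi)$ is $<0$, $>0$, $=0$ respectively. 3. (Uniform Kreiss–Lopatinskii.) For $\operatorname{Im}\sigma<0$ let $E_-(\sigma,\eta)$ be the sum of the generalized eigenspaces of $\mathcal A(\sigma,\eta)$ for eigenvalues of negative real part; for $\operatorname{Im}\sigma=0$,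 $(\sigma,\eta)\ne0$, let $E_-(\sigma,\eta)$ be its extension by limits. Then $\ker B\cap E_-(\sigma,\eta)=\{0\}$ whenever $\operatorname{Im}\sigma\le0$, $(\sigma,\eta)\neq 0$, and $M=\dim E_-(\sigma,\eta)$ for $\operatorname{Im}\sigma<0$. 4. If $\partial_\xi\tau_k(\eta,\xi)=0$ with $(\eta,\xi)\neq0$, then $\partial^2_\xi\tau_k(\eta,\xi)\ne0$. 5. $\zeta_1,\dots,\zeta_m\in\mathbb R^d\setminus\{0\}$ are linearly independent over $\mathbb Q$. For $n\in\mathbb Z^m$ put $n\cdot\boldsymbol\zeta=\sum_jn_j\zeta_j$. Let $\mathcal G$ be the set of $\zeta\in\mathbb R^d\setminus\{0\}$ such that $(\zeta,\xi)$ is a glancing characteristic frequency for some $\xi\in\mathbb R$; no $n\cdot\boldsymbol\zeta$ with $n\ne0$ belongs to $\mathcal G$. 6. There are $c>0$ and $a_1\in\mathbb R$ such that $|n\cdot\boldsymbol\zeta-g|\ge c\,|n\cdot\boldsymbol\zeta|^{-a_1}$ for all $n\ne0$ and $g\in\mathcal G$. 7. An integer combination of two incoming (resp. outgoing) frequencies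 of the form $(n\cdot\boldsymbol\zeta,\xi)$, $n\in\mathbb Z^m\setminus\{0\}$, is never outgoing (resp. incoming). 8. (Resonances.) For $\alpha\in\mathbb R^{1+d}$ let $\pi_\alpha$ be the projector of $\mathbb C^N$ onto the eigenspace of $A(\eta,\xi)$ for the eigenvalue $-\tau$ along the other eigenspaces if $\alpha=(\tau,\eta,\xi)\neq 0$ is characteristic, $\pi_\alpha=0$ if $\alpha$ is not characteristic, $\pi_0=I$; let $\tilde\pi_\alpha=A_d(0)^{-1}\pi_\alpha A_d(0)$. Let $\mathcal B$ be the set of $m$-tuples of (jointly) coprime integers whose first nonzero entry is positive, and $E(n,\xi)$ a real unit vector spanning $\ker L(0,(n\cdot\boldsymbol\zeta,\xi))$ when $n\ne 0$ and $(n\cdot\boldsymbol\zeta,\xi)$ is characteristic, with $E(\lambda n,\lambda\xi)=E(n,\xi)$ for $\lambda\in\mathbb Z\setminus\{0\}$. If $(n_p,\xi_p)+(n_q,\xi_q)=(n_r,\xi_r)$ with all three characteristic, $\Gamma((n_p,\xi_p),(n_q,\xi_q))$ is defined by $\tilde\pi_{(n_r\cdot\boldsymbol\zeta,\xi_r)}\tilde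 L_1(E(n_p,\xi_p),n_q\cdot\boldsymbol\zeta)E(n_q,\xi_q)=\Gamma\,\tilde\pi_{(n_r\cdot\boldsymbol\zeta,\xi_r)}E(n_r,\xi_r)$. For $C_0>0$, $n_r\in\mathcal B$ and $(n_r\cdot\boldsymbol\zeta,\xi_r)$ characteristic, consider the tuples $(\lambda_p,\lambda_q,\lambda_r,n_p,n_q,\xi_p,\xi_q)$ with $\lambda$'s nonzero jointly coprime integers, $n_p,n_q\in\mathcal B$, $(n_p\cdot\boldsymbol\zeta,\xi_p)$ and $(n_q\cdot\boldsymbol\zeta,\xi_q)$ characteristic and non collinear, and $\lambda_p(n_p\cdot\boldsymbol\zeta,\xi_p)+\lambda_q(n_q\cdot\boldsymbol\zeta,\xi_q)=\lambda_r(n_r\cdot\boldsymbol\zeta,\xi_r)$. Those with $|\Gamma(\lambda_p(n_p,\xi_p),\lambda_q(n_q,\xi_q))+\Gamma(\lambda_p(n_p,\xi_p),-\lambda_r(n_r,\xi_r))|\le C_0|\lambda_p(n_p,\xi_p)|$ form $\mathcal R_1(n_r,\xi_r)$, the others $\mathcal R_2(n_r,\xi_r)$. It is assumed that for some $C_0>0$: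 the union of the $\mathcal R_2(n,\xi)$ over $n\in\mathcal B$ and $\xi$ with $(n\cdot\boldsymbol\zeta,\xi)$ incoming is finite; the union of the $\mathcal R_1(n,\xi)\cup\mathcal R_2(n,\xi)$ over $n\in\mathcal B$ and $\xi$ with $(n\cdot\boldsymbol\zeta,\xi)$ outgoing is finite; and $|\tilde\pi_{(n\cdot\boldsymbol\zeta,\xi)}E(n,\xi)|\ge1/C_0$ for all $n\in\mathcal B$ and $\xi$ with $(n\cdot\boldsymbol\zeta,\xi)$ incoming and $\mathcal R_1(n,\xi)\neq\emptyset$. Let $G\in H^\infty(\mathbb R^d\times\mathbb T^m)$ vanish for $t<0$ and have zero mean in $\theta\in\mathbb T^m$. Let $h\ge\max\{1,(3+a_1)/2\}$ be an integer and $s_0=h+(d+m)/2$. **Profiles.** $H^s_+(\omega_T\times\mathbb T^m)$ is the space of ($\mathbb C^N$-valued) functions of $H^s(\omega_T\times\mathbb T^m)$ vanishing for $t<0$. $\mathcal E_{s,T}$ is the space of bounded continuous functions of $(x_d,\psi_d)\in\mathbb R_+^2$ with values in $H^s_+(\omega_T\times\mathbb T^m)$, with the sup norm. $\mathcal P^{\rm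 osc}_{s,T}$ is the closure in $\mathcal E_{s,T}$ of the finite sums $\sum_\xi U_\xi(z,\theta)e^{i\xi\psi_d}$, $\xi\in\mathbb R$, with $U_\xi\in\mathcal C_b(\mathbb R_+^{x_d},H^s_+(\omega_T\times\mathbb T^m))$; $\mathcal P^{\rm ev}_{s,T}$ is the space of $U\in\mathcal E_{s,T}$ which for each $x_d\ge 0$ tend to $0$ in $H^s(\omega_T\times\mathbb T^m)$ as $\psi_d\to\infty$; $\mathcal P_{s,T}=\mathcal P^{\rm osc}_{s,T}\oplus\mathcal P^{\rm ev}_{s,T}\ni U=U^{\rm osc}+U^{\rm ev}$. Index by $n\in\mathbb Z^m$ the Fourier coefficients in $\theta$, and by $(n,\xi)$ those in $(\theta,\psi_d)$, the latter being $\lim_{R\to\infty}\frac1R\int_0^R(\cdot)_ne^{-i\xi\psi_d}\,d\psi_d$. For $\zeta=(\tau,\eta)\in\mathbb R^d\setminus\{0\}$ let $\Pi^e(\zeta)$ be the projector onto the sum of the generalized eigenspaces of $\mathcal A(\zeta)$ for eigenvalues of negative real part, along the sum of the other ones. Define $$\mathbf E\,U=\sum_{n,\xi}\pi_{(n\cdot\boldsymbol\zeta,\xi)}U^{\rm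 osc}_{n,\xi}(z)\,e^{in\cdot\theta}e^{i\xi\psi_d}+\sum_{n\ne0}e^{\psi_d\mathcal A(n\cdot\boldsymbol\zeta)}\Pi^e(n\cdot\boldsymbol\zeta)U^{\rm ev}_n(z,0)\,e^{in\cdot\theta},\qquad \tilde{\mathbf E}^i\,U=\sum_{n,\xi}\tilde\pi_{(n\cdot\boldsymbol\zeta,\xi)}U^{\rm osc}_{n,\xi}(z)\,e^{in\cdot\theta}e^{i\xi\psi_d},$$ equalities between such series being understood coefficient by coefficient, and derivatives in the sense of distributions. The *leading-profile system* is $$\mathbf E\,U=U,\qquad \tilde{\mathbf E}^i\Big[\tilde L(0,\partial_z)U+\sum_{j=1}^m\tilde L_1(U,\zeta_j)\,\partial_{\theta_j}U\Big]=0,\qquad B\,U_{|x_d=0,\psi_d=0}=G,\qquad U_{|t\le0}=0 .$$ **Statement.** Let $V^*$ be any bound of the group velocities: $|\nabla\tau_k(\eta,\xi)|\le V^*$ for all $k$ and all $(\eta,\xi)\ne0$. Let $T>0$, let $s>s_0$ be an integer, and let $U\in\mathcal P_{s,T}$ be a solution of the leading-profile system. Then $U^{\rm osc}$ vanishes outside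 the dihedron $\{(t,y,x_d)\in\Omega_T:\ 0\le x_d\le V^*t\}$; that is, for all $x_d,\psi_d\ge0$, $U^{\rm osc}(t,y,x_d,\theta,\psi_d)=0$ for almost every $(t,y,\theta)\in\omega_T\times\mathbb T^m$ such that $0\le x_d\le V^*t$ does not hold. -/

import Mathlib

open MeasureTheory Filter Topology
open scoped ContDiff ENNReal NNReal

namespace MultiphaseOptics

noncomputable section

/-! Notation. The space dimension is `d = k + 1`.
* A boundary frequency `(τ, η)` and a boundary point `z' = (t, y)` are elements of `Euc (k + 1)`
  whose coordinate `0` is `τ`, resp. `t`.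
* A spatial frequency `(η, ξ)` is an element of `Euc (k + 1)` whose last coordinate is `ξ`. -/

abbrev Euc (n : ℕ) := EuclideanSpace ℝ (Fin n)

abbrev CVec (n : ℕ) := EuclideanSpace ℂ (Fin n)

/-! ### Spectral projectors -/

section Spectral

variable {E : Type*} [AddCommGroup E] [Module ℂ E]

/-- Sum of the generalized eigenspaces of `f` whose eigenvalue belongs to `S`. -/
def spectralPart (f : Module.End ℂ E) (S : Set ℂ) : Submodule ℂ E :=
  ⨆ μ ∈ S, f.maxGenEigenspace μ

theorem isCompl_spectralPart [FiniteDimensional ℂ E] (f : Module.End ℂ E) (S : Set ℂ) :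
    IsCompl (spectralPart f S) (spectralPart f Sᶜ) := by
  constructor
  · exact iSupIndep.disjoint_biSup_biSup f.independent_maxGenEigenspace disjoint_compl_right
  · rw [codisjoint_iff, eq_top_iff, ← Module.End.iSup_maxGenEigenspace_eq_top f]
    refine iSup_le fun μ => ?_
    by_cases h : μ ∈ S
    · exact le_sup_of_le_left (le_biSup (fun ν => f.maxGenEigenspace ν) h)
    · exact le_sup_of_le_right
        (le_biSup (fun ν => f.maxGenEigenspace ν) (show μ ∈ Sᶜ from h))

/-- Projection onto the generalized eigenspaces with eigenvalue in `S`, along the other ones. -/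
def spectralProj [FiniteDimensional ℂ E] (f : Module.End ℂ E) (S : Set ℂ) : Module.End ℂ E :=
  Submodule.projection (spectralPart f S) (spectralPart f Sᶜ) (isCompl_spectralPart f S)

end Spectral

/-- A real matrix, acting on complex vectors. -/
def cAct {a b : ℕ} (P : Matrix (Fin a) (Fin b) ℝ) : CVec b →ₗ[ℂ] CVec a :=
  Matrix.toEuclideanLin (P.map Complex.ofReal)

/-- A real vector, seen as a complex vector. -/
def toC {n : ℕ} (e : Euc n) : CVec n := WithLp.toLp 2 fun i => (e i : ℂ)

/-! ### The hyperbolic system -/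

/-- The data of the boundary value problem
`∂_t u + ∑_{i<d} A_i(u) ∂_i u + A_d(u) ∂_d u = 0`, `B u = ε g` on `{x_d = 0}`:
the coefficients are smooth on the open set `O ∋ 0` and `B` has maximal rank.
`A i` are the tangential matrices and `An` is `A_d`. -/
structure BVP (k N M : ℕ) where
  O : Set (Euc N)
  A : Fin k → Euc N → Matrix (Fin N) (Fin N) ℝ
  An : Euc N → Matrix (Fin N) (Fin N) ℝ
  B : Matrix (Fin M) (Fin N) ℝ
  isOpen_O : IsOpen O
  zero_mem : (0 : Euc N) ∈ O
  smooth_A : ∀ i a b, ContDiffOn ℝ ∞ (fun u => A i u a b) O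
  smooth_An : ∀ a b, ContDiffOn ℝ ∞ (fun u => An u a b) O
  rank_B : B.rank = min M N

variable {k N M m : ℕ}

/-- The spatial frequency `(η, ξ)` of the frequency `(ζ, ξ)`, where `ζ = (τ, η)`. -/
def spat (ζ : Euc (k + 1)) (ξ : ℝ) : Euc (k + 1) :=
  WithLp.toLp 2 (Fin.snoc (α := fun _ => ℝ) (fun i : Fin k => ζ i.succ) ξ)

namespace BVP

variable (S : BVP k N M)

def Noncharacteristic : Prop := ∀ u ∈ S.O, IsUnit (S.An u).det

/-- `A(η, ξ) = ∑ η_i A_i(0) + ξ A_d(0)`. -/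
def symb (w : Euc (k + 1)) : Matrix (Fin N) (Fin N) ℝ :=
  ∑ i : Fin k, w i.castSucc • S.A i 0 + w (Fin.last k) • S.An 0

/-- `L(0, (τ, η, ξ)) = τ I + A(η, ξ)`. -/
def L (ζ : Euc (k + 1)) (ξ : ℝ) : Matrix (Fin N) (Fin N) ℝ :=
  ζ 0 • (1 : Matrix (Fin N) (Fin N) ℝ) + S.symb (spat ζ ξ)

def IsCharacteristic (ζ : Euc (k + 1)) (ξ : ℝ) : Prop := (S.L ζ ξ).det = 0

/-- Strict hyperbolicity, with characteristic roots `τ_1 < ⋯ < τ_N`. -/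
structure StrictlyHyperbolic (τ : Fin N → Euc (k + 1) → ℝ) : Prop where
  analytic : ∀ j, AnalyticOnNhd ℝ (τ j) {0}ᶜ
  strictMono : ∀ w, w ≠ 0 → StrictMono fun j => τ j w
  factor : ∀ w, w ≠ 0 → ∀ t : ℝ,
    (t • (1 : Matrix (Fin N) (Fin N) ℝ) + S.symb w).det = ∏ j, (t - τ j w)

/-- `Ã_0 = A_d⁻¹` and `Ã_i = A_d⁻¹ A_i` for the tangential indices. -/
def Atil (i : Fin (k + 1)) (u : Euc N) : Matrix (Fin N) (Fin N) ℝ :=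
  Fin.cases (motive := fun _ => Matrix (Fin N) (Fin N) ℝ) (S.An u)⁻¹
    (fun j => (S.An u)⁻¹ * S.A j u) i

/-- The derivative of `Ã_i` at `0` in the direction of the `c`-th basis vector. -/
def dAtil (i : Fin (k + 1)) (c : Fin N) : Matrix (Fin N) (Fin N) ℝ :=
  Matrix.of fun a b => fderiv ℝ (fun u => S.Atil i u a b) 0 (EuclideanSpace.single c 1)

/-- `L̃_1(u, ζ) = ∑_i ζ^i dÃ_i(0)·u`, extended complex linearly to complex `u`. -/
def L1 (u : CVec N) (ζ : Euc (k + 1)) : CVec N →ₗ[ℂ] CVec N :=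
  ∑ i, ∑ c, ((ζ i : ℂ) * u c) • cAct (S.dAtil i c)

/-! #### Projectors -/

/-- `π_α`, `α = (ζ, ξ)`: the spectral projector of `A(η, ξ)` for the eigenvalue `-τ`. It is the
projector on `ker L(0, α)` for a characteristic frequency, `0` for a noncharacteristic one,
and the identity for `α = 0`. -/
def proj (ζ : Euc (k + 1)) (ξ : ℝ) : Module.End ℂ (CVec N) :=
  spectralProj (cAct (S.symb (spat ζ ξ))) {-(ζ 0 : ℂ)}

/-- `π̃_α = A_d(0)⁻¹ π_α A_d(0)`. -/
def projTil (ζ : Euc (k + 1)) (ξ : ℝ) : Module.End ℂ (CVec N) :=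
  cAct (S.An 0)⁻¹ ∘ₗ S.proj ζ ξ ∘ₗ cAct (S.An 0)

/-- `𝒜(σ, η) = -i A_d(0)⁻¹ (σ I + ∑ η_j A_j(0))`. -/
def calA (σ : ℂ) (η : Euc k) : Matrix (Fin N) (Fin N) ℂ :=
  (-Complex.I) • (((S.An 0)⁻¹.map Complex.ofReal) *
    (σ • (1 : Matrix (Fin N) (Fin N) ℂ) + ∑ j, (η j : ℂ) • (S.A j 0).map Complex.ofReal))

/-- The sum of the generalized eigenspaces of `𝒜(σ, η)` for eigenvalues of negative real part. -/
def stablePart (σ : ℂ) (η : Euc k) : Submodule ℂ (CVec N) :=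
  spectralPart (Matrix.toEuclideanLin (S.calA σ η)) {μ | μ.re < 0}

/-- The bundle `E_-` over `{Im σ < 0}`. -/
def stableBundle : Set (ℂ × Euc k × CVec N) :=
  {q | q.1.im < 0 ∧ q.2.2 ∈ S.stablePart q.1 q.2.1}

/-- The stable space `E_-(σ, η)`: the stable subspace of `𝒜(σ, η)` if `Im σ < 0`, and the limit of
these subspaces (fibre of the closure of the bundle) if `Im σ = 0`. -/
def stableSpace (σ : ℂ) (η : Euc k) : Set (CVec N) :=
  if σ.im < 0 then (S.stablePart σ η : Set (CVec N)) else {v | (σ, η, v) ∈ closure S.stableBundle}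

/-- Uniform Kreiss–Lopatinskii condition; `M` is the dimension of the stable subspace. -/
structure UniformKreissLopatinskii : Prop where
  injective : ∀ (σ : ℂ) (η : Euc k), σ.im ≤ 0 → (σ, η) ≠ 0 →
    ∀ v ∈ S.stableSpace σ η, cAct S.B v = 0 → v = 0
  finrank_eq : ∀ (σ : ℂ) (η : Euc k), σ.im < 0 → Module.finrank ℂ (S.stablePart σ η) = M

/-- The matrix `𝒜(ζ)` at a real boundary frequency. -/
def calAReal (ζ : Euc (k + 1)) : Matrix (Fin N) (Fin N) ℂ :=
  S.calA (ζ 0) (WithLp.toLp 2 fun j : Fin k => ζ j.succ)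

/-- `Π^e(ζ)`: projection on the stable elliptic component (eigenvalues of `𝒜(ζ)` of negative real
part) along the sum of all the other generalized eigenspaces. -/
def projEll (ζ : Euc (k + 1)) : Module.End ℂ (CVec N) :=
  spectralProj (Matrix.toEuclideanLin (S.calAReal ζ)) {μ | μ.re < 0}

end BVP

/-! ### Incoming, outgoing and glancing frequencies -/

/-- `∂_ξ f`, for `f` a function of `(η, ξ)`. -/
def dxi (f : Euc (k + 1) → ℝ) (w : Euc (k + 1)) : ℝ :=
  fderiv ℝ f w (EuclideanSpace.single (Fin.last k) 1)

section Frequencies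

variable (τ : Fin N → Euc (k + 1) → ℝ)

def Incoming (ζ : Euc (k + 1)) (ξ : ℝ) : Prop :=
  spat ζ ξ ≠ 0 ∧ ∃ j, ζ 0 = τ j (spat ζ ξ) ∧ dxi (τ j) (spat ζ ξ) < 0

def Outgoing (ζ : Euc (k + 1)) (ξ : ℝ) : Prop :=
  spat ζ ξ ≠ 0 ∧ ∃ j, ζ 0 = τ j (spat ζ ξ) ∧ 0 < dxi (τ j) (spat ζ ξ)

def Glancing (ζ : Euc (k + 1)) (ξ : ℝ) : Prop :=
  spat ζ ξ ≠ 0 ∧ ∃ j, ζ 0 = τ j (spat ζ ξ) ∧ dxi (τ j) (spat ζ ξ) = 0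

/-- The glancing set `𝒢` of boundary frequencies. -/
def glancingSet : Set (Euc (k + 1)) := {ζ | ζ ≠ 0 ∧ ∃ ξ : ℝ, Glancing τ ζ ξ}

/-- Where `∂_ξ τ_j` vanishes, `∂_ξ² τ_j` does not. -/
def NondegenerateGlancing : Prop :=
  ∀ j w, w ≠ 0 → dxi (τ j) w = 0 → dxi (dxi (τ j)) w ≠ 0

/-- `V` bounds all the group velocities `∇τ_j`. -/
def BoundsGroupVelocities (V : ℝ) : Prop := ∀ j w, w ≠ 0 → ‖fderiv ℝ (τ j) w‖ ≤ V

end Frequencies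

/-- The boundary frequency `n·ζ = n_1 ζ_1 + ⋯ + n_m ζ_m`. -/
def bfreq (ζ : Fin m → Euc (k + 1)) (n : Fin m → ℤ) : Euc (k + 1) := ∑ j, (n j : ℝ) • ζ j

section Assumptions

variable (S : BVP k N M) (τ : Fin N → Euc (k + 1) → ℝ) (ζ : Fin m → Euc (k + 1))

/-- `ζ_1, …, ζ_m` are linearly independent over `ℚ`. -/
def RationallyIndependent : Prop := ∀ n : Fin m → ℤ, bfreq ζ n = 0 → n = 0

def NoGlancing : Prop := ∀ n : Fin m → ℤ, n ≠ 0 → bfreq ζ n ∉ glancingSet τ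

/-- Small divisors: `dist(ζ', 𝒢) ≥ c |ζ'|^{-a₁}` on the nonzero frequencies `ζ'` of the group. -/
def SmallDivisors (a₁ : ℝ) : Prop :=
  ∃ c : ℝ, 0 < c ∧ ∀ n : Fin m → ℤ, n ≠ 0 → ∀ g ∈ glancingSet τ,
    c * ‖bfreq ζ n‖ ^ (-a₁) ≤ dist (bfreq ζ n) g

/-- Integer combinations of two frequencies satisfying `P`, both lifted from the group, never
satisfy `Q`. -/
def NeverResonate (P Q : Euc (k + 1) → ℝ → Prop) : Prop :=
  ∀ (n₁ n₂ : Fin m → ℤ) (ξ₁ ξ₂ : ℝ), n₁ ≠ 0 → n₂ ≠ 0 → P (bfreq ζ n₁) ξ₁ → P (bfreq ζ n₂) ξ₂ →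
    ∀ l₁ l₂ : ℤ, ¬ Q (l₁ • bfreq ζ n₁ + l₂ • bfreq ζ n₂) (l₁ * ξ₁ + l₂ * ξ₂)

/-- Incoming frequencies do not resonate to give outgoing ones, and conversely. -/
structure NoMixedResonance : Prop where
  inc : NeverResonate ζ (Incoming τ) (Outgoing τ)
  out : NeverResonate ζ (Outgoing τ) (Incoming τ)

/-! #### Resonances -/

/-- `m`-tuples of coprime integers whose first nonzero entry is positive. -/
def Primitive (n : Fin m → ℤ) : Prop :=
  Finset.univ.gcd n = 1 ∧ ∃ j, 0 < n j ∧ ∀ i, i < j → n i = 0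

/-- A tuple `(λ_p, λ_q, λ_r, n_p, n_q, ξ_p, ξ_q)`. -/
structure ResTuple (m : ℕ) where
  lp : ℤ
  lq : ℤ
  lr : ℤ
  np : Fin m → ℤ
  nq : Fin m → ℤ
  xp : ℝ
  xq : ℝ

/-- The tuple is a resonance giving `λ_r (n_r·ζ, ξ_r)`. -/
structure IsResonance (nr : Fin m → ℤ) (xr : ℝ) (r : ResTuple m) : Prop where
  lp_ne : r.lp ≠ 0
  lq_ne : r.lq ≠ 0
  lr_ne : r.lr ≠ 0
  coprime : Int.gcd (Int.gcd r.lp r.lq) r.lr = 1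
  np_prim : Primitive r.np
  nq_prim : Primitive r.nq
  char_p : S.IsCharacteristic (bfreq ζ r.np) r.xp
  char_q : S.IsCharacteristic (bfreq ζ r.nq) r.xq
  noncollinear : LinearIndependent ℝ ![(bfreq ζ r.np, r.xp), (bfreq ζ r.nq, r.xq)]
  eq_bdry : r.lp • bfreq ζ r.np + r.lq • bfreq ζ r.nq = r.lr • bfreq ζ nr
  eq_norm : r.lp * r.xp + r.lq * r.xq = r.lr * xr

/-- `e` is a unit real vector of the line `ker L(0, (n·ζ, ξ))`. -/
def IsUnitKer (n : Fin m → ℤ) (x : ℝ) (e : Euc N) : Prop :=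
  ‖e‖ = 1 ∧ Matrix.mulVec (S.L (bfreq ζ n) x) e.ofLp = 0

/-- `g` is the resonance coefficient `Γ((n₁, x₁), (n₂, x₂))` computed with the unit kernel vectors
`e₁`, `e₂` and `e`, the last one for the resonant frequency `(n₁ + n₂, x₁ + x₂)`. -/
def IsGamma (n₂ : Fin m → ℤ) (n : Fin m → ℤ) (x : ℝ) (e₁ e₂ e : Euc N) (g : ℝ) : Prop :=
  S.projTil (bfreq ζ n) x (S.L1 (toC e₁) (bfreq ζ n₂) (toC e₂)) =
    (g : ℂ) • S.projTil (bfreq ζ n) x (toC e)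

/-- Type 1: `|Γ(λ_p p, λ_q q) + Γ(λ_p p, -λ_r r)| ≤ C₀ |λ_p (n_p, ξ_p)|`. The left-hand side does
not depend on the choice of the unit kernel vectors. -/
def IsType1 (C₀ : ℝ) (nr : Fin m → ℤ) (xr : ℝ) (r : ResTuple m) : Prop :=
  ∀ ep eq er : Euc N, IsUnitKer S ζ r.np r.xp ep → IsUnitKer S ζ r.nq r.xq eq →
    IsUnitKer S ζ nr xr er → ∀ g₁ g₂ : ℝ,
    IsGamma S ζ (r.lq • r.nq) (r.lr • nr) (r.lr * xr) ep eq er g₁ →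
    IsGamma S ζ (-(r.lr • nr)) (-(r.lq • r.nq)) (-(r.lq * r.xq)) ep er eq g₂ →
    |g₁ + g₂| ≤ C₀ * Real.sqrt (∑ j, ((r.lp : ℝ) * r.np j) ^ 2 + (r.lp * r.xp) ^ 2)

/-- `ℛ_1(n_r, ξ_r)`. -/
def resSet1 (C₀ : ℝ) (nr : Fin m → ℤ) (xr : ℝ) : Set (ResTuple m) :=
  {r | IsResonance S ζ nr xr r ∧ IsType1 S ζ C₀ nr xr r}

/-- `ℛ_2(n_r, ξ_r)`. -/
def resSet2 (C₀ : ℝ) (nr : Fin m → ℤ) (xr : ℝ) : Set (ResTuple m) :=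
  {r | IsResonance S ζ nr xr r ∧ ¬ IsType1 S ζ C₀ nr xr r}

/-- The assumption on the set of resonances. -/
def ControlledResonances : Prop :=
  ∃ C₀ : ℝ, 0 < C₀ ∧
    {r | ∃ n x, Primitive n ∧ Incoming τ (bfreq ζ n) x ∧ r ∈ resSet2 S ζ C₀ n x}.Finite ∧
    {r | ∃ n x, Primitive n ∧ Outgoing τ (bfreq ζ n) x ∧
      r ∈ resSet1 S ζ C₀ n x ∪ resSet2 S ζ C₀ n x}.Finite ∧
    ∀ n x, Primitive n → Incoming τ (bfreq ζ n) x → (resSet1 S ζ C₀ n x).Nonempty →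
      ∀ e, IsUnitKer S ζ n x e → 1 / C₀ ≤ ‖S.projTil (bfreq ζ n) x (toC e)‖

end Assumptions

/-! ### Function spaces

Functions of `(z', θ)` with `z'` in a set `D` of `ℝ^d` and `θ` in the torus `(ℝ/2πℤ)^m`; the torus
is represented by the box `(0, 2π]^m`, with periodic test functions. -/

/-- The box `(0, 2π]^m`. -/
def box (m : ℕ) : Set (Euc m) := {θ | ∀ j, θ j ∈ Set.Ioc 0 (2 * Real.pi)}

/-- `ω_T = (-∞, T] × ℝ^{d-1}`. -/
def omegaT (k : ℕ) (T : ℝ) : Set (Euc (k + 1)) := {z | z 0 ≤ T}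

/-- The measure `dz' dθ` on `D × 𝕋^m`. -/
def torusMeasure (D : Set (Euc (k + 1))) (m : ℕ) : Measure (Euc (k + 1) × Euc m) :=
  volume.restrict (D ×ˢ box m)

/-- `L²(D × 𝕋^m; ℂ^n)`. -/
abbrev L2 (D : Set (Euc (k + 1))) (m n : ℕ) := Lp (CVec n) 2 (torusMeasure D m)

/-- Smooth test functions on `D × 𝕋^m`. -/
structure IsTest (D : Set (Euc (k + 1))) (φ : Euc (k + 1) × Euc m → ℝ) : Prop where
  smooth : ContDiff ℝ ∞ φ
  periodic : ∀ z θ j, φ (z, θ + EuclideanSpace.single j (2 * Real.pi)) = φ (z, θ)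
  support : ∃ K : Set (Euc (k + 1)), IsCompact K ∧ K ⊆ interior D ∧ ∀ z θ, z ∉ K → φ (z, θ) = 0

/-- The coordinate directions in `(z', θ)`. -/
def dir : Fin (k + 1) ⊕ Fin m → Euc (k + 1) × Euc m
  | Sum.inl i => (EuclideanSpace.single i 1, 0)
  | Sum.inr j => (0, EuclideanSpace.single j 1)

variable {D : Set (Euc (k + 1))} {n : ℕ}

/-- `v` is the weak derivative of `u` in the direction `e`. -/
def IsWeakDeriv (e : Fin (k + 1) ⊕ Fin m) (u v : L2 D m n) : Prop :=
  ∀ φ : Euc (k + 1) × Euc m → ℝ, IsTest D φ →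
    ∫ p, fderiv ℝ φ p (dir e) • u p ∂(torusMeasure D m) =
      -∫ p, φ p • v p ∂(torusMeasure D m)

/-- A norm of `H^s(D × 𝕋^m)`: the sum of the `L²` norms of the iterated weak derivatives of order
at most `s` (with multiplicities); it is `⊤` exactly when `u` is not in `H^s`. -/
def sobolevENorm : ℕ → L2 D m n → ℝ≥0∞
  | 0, u => ‖u‖ₑ
  | s + 1, u => ‖u‖ₑ +
      ∑ e : Fin (k + 1) ⊕ Fin m, ⨅ v : L2 D m n, ⨅ _ : IsWeakDeriv e u v, sobolevENorm s v

/-- The `n`-th Fourier coefficient in `θ`. -/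
def thetaCoef (u : L2 D m n) (ν : Fin m → ℤ) (z : Euc (k + 1)) : CVec n :=
  ((2 * Real.pi) ^ m)⁻¹ •
    ∫ θ in box m, Complex.exp (-Complex.I * ∑ j, (ν j : ℂ) * θ j) • u (z, θ)

/-! A profile is a function `U x_d ψ_d` with values in `L²(ω_T × 𝕋^m)`; only its values for
`x_d, ψ_d ≥ 0` matter. -/

/-- Profiles on `Ω_T × 𝕋^m × ℝ_+`. -/
abbrev Profile (k m N : ℕ) (T : ℝ) := ℝ → ℝ → L2 (omegaT k T) m N

section Profiles

variable {T : ℝ} (s : ℕ)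

/-- The space `ℰ_{s,T}`: bounded continuous functions of `(x_d, ψ_d) ∈ ℝ_+ × ℝ_+` with values in the
space of functions of `H^s(ω_T × 𝕋^m)` that vanish for negative times. -/
structure MemE (U : Profile k m N T) : Prop where
  bounded : ∃ C : ℝ≥0, ∀ x ψ : ℝ, 0 ≤ x → 0 ≤ ψ → sobolevENorm s (U x ψ) ≤ C
  continuous : ∀ x ψ : ℝ, 0 ≤ x → 0 ≤ ψ →
    Tendsto (fun q : ℝ × ℝ => sobolevENorm s (U q.1 q.2 - U x ψ))
      (𝓝[Set.Ici 0 ×ˢ Set.Ici 0] (x, ψ)) (𝓝 0)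
  zero : ∀ x ψ : ℝ, 0 ≤ x → 0 ≤ ψ →
    ∀ᵐ p ∂(torusMeasure (omegaT k T) m), p.1 0 < 0 → U x ψ p = 0

/-- Trigonometric polynomials in `ψ_d`. -/
def IsTrigPoly (P : Profile k m N T) : Prop :=
  ∃ (F : Finset ℝ) (c : ℝ → ℝ → L2 (omegaT k T) m N),
    (∀ ξ ∈ F, MemE s (fun x _ => c ξ x)) ∧
    ∀ x ψ : ℝ, 0 ≤ x → 0 ≤ ψ →
      P x ψ = ∑ ξ ∈ F, Complex.exp (Complex.I * (ψ * ξ : ℝ)) • c ξ x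

/-- Oscillating profiles: the closure of the trigonometric polynomials in `ℰ_{s,T}`. -/
def MemOsc (U : Profile k m N T) : Prop :=
  MemE s U ∧ ∀ ε : ℝ≥0, 0 < ε → ∃ P : Profile k m N T, IsTrigPoly s P ∧
    ∀ x ψ : ℝ, 0 ≤ x → 0 ≤ ψ → sobolevENorm s (U x ψ - P x ψ) ≤ ε

/-- Evanescent profiles: they tend to `0` in `H^s` as `ψ_d → ∞`, for every fixed `x_d`. -/
def MemEv (U : Profile k m N T) : Prop :=
  MemE s U ∧ ∀ x : ℝ, 0 ≤ x → Tendsto (fun ψ => sobolevENorm s (U x ψ)) atTop (𝓝 0)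

end Profiles

/-- `a` is the Fourier component at frequency `ξ` of the almost periodic function `W`:
`a = lim R⁻¹ ∫_0^R e^{-iξψ} W(ψ) dψ`. -/
def IsFreqPart {F : Type*} [NormedAddCommGroup F] [NormedSpace ℂ F] (W : ℝ → F) (ξ : ℝ) (a : F) :
    Prop :=
  Tendsto (fun R : ℝ => ((R⁻¹ : ℝ) : ℂ) •
    ∫ ψ in (0 : ℝ)..R, Complex.exp (-Complex.I * (ξ * ψ : ℝ)) • W ψ) atTop (𝓝 a)

/-! ### The leading profile system -/

section LeadingProfile

variable (S : BVP k N M) (ζ : Fin m → Euc (k + 1)) {T : ℝ}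

/-- `(Vosc, Vev)` are the oscillating and evanescent parts of `E (Uosc + Uev)`:
the mode `(n, ξ)` of `Vosc` is `π_{(n·ζ,ξ)}` applied to that of `Uosc`; the mode `n` of `Vev` at
`ψ_d` is `e^{ψ_d 𝒜(n·ζ)} Π^e(n·ζ)` applied to that of `Uev` at `ψ_d = 0` if `n ≠ 0`, and is `0` if
`n = 0`. -/
structure IsProjE (Uosc Uev Vosc Vev : Profile k m N T) : Prop where
  osc : ∀ (x ξ : ℝ) (a b : L2 (omegaT k T) m N), 0 ≤ x →
    IsFreqPart (Uosc x) ξ a → IsFreqPart (Vosc x) ξ b → ∀ ν : Fin m → ℤ,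
    ∀ᵐ z ∂(volume.restrict (omegaT k T)),
      thetaCoef b ν z = S.proj (bfreq ζ ν) ξ (thetaCoef a ν z)
  ev : ∀ x ψ : ℝ, 0 ≤ x → 0 ≤ ψ → ∀ ν : Fin m → ℤ, ∀ᵐ z ∂(volume.restrict (omegaT k T)),
      thetaCoef (Vev x ψ) ν z = if ν = 0 then 0 else
        Matrix.toEuclideanLin (NormedSpace.exp ((ψ : ℂ) • S.calAReal (bfreq ζ ν)))
          (S.projEll (bfreq ζ ν) (thetaCoef (Uev x 0) ν z))

/-- The `n`-th Fourier coefficient in `θ`, tested against `χ(z', x_d)`, of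
`L̃(0,∂_z) U + ∑_j L̃_1(U, ζ_j) ∂_{θ_j} U`, where `L̃(0,∂_z) = ∑_i Ã_i(0) ∂_i + ∂_{x_d}` is applied in
the sense of distributions and `DU j` stands for `∂_{θ_j} U`. (Up to the factor `(2π)^m`.) -/
def testedMode (U : Profile k m N T) (DU : Fin m → Profile k m N T)
    (χ : Euc (k + 1) × ℝ → ℝ) (ν : Fin m → ℤ) (ψ : ℝ) : CVec N :=
  ∫ x in Set.Ioi (0 : ℝ), ∫ p,
    Complex.exp (-Complex.I * ∑ j, (ν j : ℂ) * p.2 j) •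
      (-(∑ i, fderiv ℝ χ (p.1, x) (EuclideanSpace.single i 1, 0) • cAct (S.Atil i 0) (U x ψ p))
        - fderiv ℝ χ (p.1, x) (0, 1) • U x ψ p
        + χ (p.1, x) • ∑ j, S.L1 (U x ψ p) (ζ j) (DU j x ψ p)) ∂(torusMeasure (omegaT k T) m)

/-- The equation `E^i [L̃(0,∂_z) U + ∑_j L̃_1(U, ζ_j) ∂_{θ_j} U] = 0`: for all `(n, ξ)`, the component
of frequency `(n, ξ)` of the bracket in `(θ, ψ_d)` belongs to the kernel of `π̃_{(n·ζ,ξ)}`, in the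
sense of distributions in `z = (z', x_d)`. -/
def SolvesInterior (U : Profile k m N T) : Prop :=
  ∃ DU : Fin m → Profile k m N T,
    (∀ j x ψ, 0 ≤ x → 0 ≤ ψ → IsWeakDeriv (Sum.inr j) (U x ψ) (DU j x ψ)) ∧
    ∀ (ν : Fin m → ℤ) (ξ : ℝ) (χ : Euc (k + 1) × ℝ → ℝ), ContDiff ℝ ∞ χ → HasCompactSupport χ →
      tsupport χ ⊆ {q | q.1 0 < T ∧ 0 < q.2} →
      IsFreqPart (fun ψ => S.projTil (bfreq ζ ν) ξ (testedMode S ζ U DU χ ν ψ)) ξ 0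

/-- `U = Uosc + Uev` belongs to `𝒫_{s,T}`, with these oscillating and evanescent parts, and is a
solution of the leading profile system with boundary source `G`. -/
structure IsLeadingProfile (s : ℕ) (G : L2 (Set.univ : Set (Euc (k + 1))) m M)
    (U Uosc Uev : Profile k m N T) : Prop where
  memOsc : MemOsc s Uosc
  memEv : MemEv s Uev
  decomp : ∀ x ψ : ℝ, 0 ≤ x → 0 ≤ ψ → U x ψ = Uosc x ψ + Uev x ψ
  polarization : IsProjE S ζ Uosc Uev Uosc Uev
  interior : SolvesInterior S ζ U
  boundary : ∀ᵐ p ∂(torusMeasure (omegaT k T) m), cAct S.B (U 0 0 p) = G p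
  initial : ∀ x ψ : ℝ, 0 ≤ x → 0 ≤ ψ →
    ∀ᵐ p ∂(torusMeasure (omegaT k T) m), p.1 0 ≤ 0 → U x ψ p = 0

end LeadingProfile

/-- The boundary source: in `H^∞(ℝ^d × 𝕋^m)`, zero for negative times, of zero mean in `θ`. -/
structure IsBoundarySource (G : L2 (Set.univ : Set (Euc (k + 1))) m M) : Prop where
  smooth : ∀ s : ℕ, sobolevENorm s G < ⊤
  zero : ∀ᵐ p ∂(torusMeasure (Set.univ : Set (Euc (k + 1))) m), p.1 0 < 0 → G p = 0
  mean : ∀ᵐ z : Euc (k + 1), thetaCoef G 0 z = 0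

end

end MultiphaseOptics

open MultiphaseOptics

/-!
The dihedron is a domain of determinacy for the leading-profile system: information travels at
most at the speed `V` of the group velocities, and enters only through the boundary, so that in the
region `x_d > V t`, which the backward flows do not leave before time `0`, the vanishing of the past
forces the oscillating part `Uosc` to vanish. The boundary condition, hence the
Kreiss–Lopatinskii condition, plays no role there, and neither do the resonance assumptions:
the equation is read as a *linear* one in the first factor of `L̃₁(U, ζ_j) ∂_{θ_j} U`, whose second
factor is bounded by Sobolev embedding (`s > 1 + (d + m) / 2`).

*Reduction to modes.* By polarization, only the frequencies `(n, ξ)` with `ξ` among the at most `N`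
roots of `det L(0, (n·ζ, ξ))` occur in `Uosc`. After localization in `z'` by a cutoff, the decay of
Fourier coefficients makes `∑ (1 + |n|) |f_{n,ξ}|` bounded (`MemOsc.exists_modeBound`), where
`f_{n,ξ}` is the amplitude `modeAmp`; hence `Uosc` is the sum of its modes
(`ModeBound.ae_osc_eq`), as almost periodic functions are determined by their Fourier components.
The evanescent part drops out of the interior equation when `ψ_d → ∞`
(`IsLeadingProfile.isFreqPart_osc`). Testing the rest mode by mode gives `ModeBound.mode_equation`.

*Oscillating modes.* For `n·ζ ≠ 0` and every direction `e`, `π A(e) π = -(∂_e τ_j) π`, and `|∇τ_j| ≤ V`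
(`BVP.StrictlyHyperbolic.exists_velocity`). So each
`f_{n,ξ}` solves a transport equation (`ModeBound.mode_transport`). As a pair of modes feeds a single
mode and the projectors are uniformly bounded, the sources satisfy `∑ |h_α| ≤ C ∑ |f_α|`
pointwise. The `L¹` estimate `transport_estimate`, with weight `e^{-γt}`, in the regions
`backwardRegion`, gives `γ Y ≤ C Y < ∞` for the total weighted mass `Y` of the modes, so `Y = 0` for
large `γ` (`ModeBound.ae_modeAmp_eq_zero_of_mean`), as soon as the mean mode vanishes.

*Mean mode.* By rational independence, the only mode with `n·ζ = 0` is `(0, 0)`. Its quadratic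
source is zero: the pairs `(α, -α)` and `(-α, α)` cancel, since the two amplitudes are on the same
line (`ModeBound.quadSource_mean`). It solves the linear system with constant coefficients
`L(0, ∂) f = 0`. Since `A_d(0)` is diagonalizable with eigenvalues bounded by `V`, after pairing with
band-limited functions of the tangential variable `y`, on which `∂_y` acts as a bounded operator,
this is a system of transport equations in `(t, x_d)` with bounded coupling, and the same weighted
estimate applies (`ae_eq_zero_of_system`).

The argument gives the result for almost every `x_d`; continuity in `x_d` from above does the
rest (`osc_eq_zero`).
-/

namespace MultiphaseOptics

noncomputable section

/-! ### Spectral projectors of the symbol -/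

section Spectral

variable {E : Type*} [AddCommGroup E] [Module ℂ E]

theorem spectralPart_singleton (f : Module.End ℂ E) (μ : ℂ) :
    spectralPart f {μ} = f.maxGenEigenspace μ := by simp [spectralPart]

theorem maxGenEigenspace_smul (f : Module.End ℂ E) {c : ℂ} (hc : c ≠ 0) (μ : ℂ) :
    (c • f).maxGenEigenspace (c * μ) = f.maxGenEigenspace μ := by
  ext v
  simp only [Module.End.mem_maxGenEigenspace]
  refine exists_congr fun n => ?_
  have : c • f - (c * μ) • (1 : Module.End ℂ E) = c • (f - μ • 1) := by
    rw [smul_sub, smul_smul]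
  rw [this, smul_pow, LinearMap.smul_apply, smul_eq_zero]
  simp [hc]

variable [FiniteDimensional ℂ E]

theorem spectralProj_apply_of_mem {f : Module.End ℂ E} {S : Set ℂ} {μ : ℂ} (h : μ ∈ S) {v : E}
    (hv : v ∈ f.maxGenEigenspace μ) : spectralProj f S v = v :=
  Submodule.projection_apply_of_mem_left _ (Submodule.mem_iSup_of_mem μ
    (Submodule.mem_iSup_of_mem h hv))

theorem spectralProj_apply_of_notMem {f : Module.End ℂ E} {S : Set ℂ} {μ : ℂ} (h : μ ∉ S) {v : E}
    (hv : v ∈ f.maxGenEigenspace μ) : spectralProj f S v = 0 :=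
  Submodule.projection_apply_of_mem_right _ (Submodule.mem_iSup_of_mem μ
    (Submodule.mem_iSup_of_mem (show μ ∈ Sᶜ from h) hv))

theorem spectralProj_singleton_mem (f : Module.End ℂ E) (μ : ℂ) (v : E) :
    spectralProj f {μ} v ∈ f.maxGenEigenspace μ := by
  rw [← spectralPart_singleton]
  exact Submodule.projection_apply_mem (isCompl_spectralPart f {μ}) v

theorem spectralProj_idem (f : Module.End ℂ E) (μ : ℂ) (v : E) :
    spectralProj f {μ} (spectralProj f {μ} v) = spectralProj f {μ} v :=
  spectralProj_apply_of_mem (Set.mem_singleton μ) (spectralProj_singleton_mem f μ v)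

theorem end_ext_maxGenEigenspace (f : Module.End ℂ E) {P Q : Module.End ℂ E}
    (h : ∀ μ, ∀ v ∈ f.maxGenEigenspace μ, P v = Q v) : P = Q := by
  have : (⊤ : Submodule ℂ E) ≤ LinearMap.eqLocus P Q := by
    rw [← Module.End.iSup_maxGenEigenspace_eq_top f]
    exact iSup_le fun μ v hv => h μ v hv
  exact LinearMap.ext fun v => this (Submodule.mem_top)

theorem spectralProj_singleton_eq_zero {f : Module.End ℂ E} {μ : ℂ}
    (h : ¬ f.HasEigenvalue μ) : spectralProj f {μ} = 0 := by
  refine LinearMap.ext fun v => ?_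
  have h1 := spectralProj_singleton_mem f μ v
  have h2 : f.maxGenEigenspace μ = ⊥ := by
    by_contra hne
    apply h
    exact Module.End.HasUnifEigenvalue.lt zero_lt_one
      (show f.HasUnifEigenvalue μ ⊤ from hne)
  rw [h2] at h1
  simpa using h1

theorem spectralProj_smul (f : Module.End ℂ E) {c : ℂ} (hc : c ≠ 0) (μ : ℂ) :
    spectralProj (c • f) {c * μ} = spectralProj f {μ} := by
  refine end_ext_maxGenEigenspace f fun ν v hv => ?_
  by_cases h : ν = μ
  · subst h
    rw [spectralProj_apply_of_mem (Set.mem_singleton ν) hv,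
      spectralProj_apply_of_mem (Set.mem_singleton (c * ν))]
    rwa [maxGenEigenspace_smul f hc]
  · rw [spectralProj_apply_of_notMem (S := {μ}) h hv,
      spectralProj_apply_of_notMem (f := c • f) (S := {c * μ}) (μ := c * ν)]
    · simpa [hc] using h
    · rwa [maxGenEigenspace_smul f hc]

end Spectral

theorem cAct_smul {a b : ℕ} (r : ℝ) (P : Matrix (Fin a) (Fin b) ℝ) :
    cAct (r • P) = (r : ℂ) • cAct P := by
  rw [cAct, cAct, ← map_smul]
  congr 1
  ext i j
  simp

theorem cAct_add {a b : ℕ} (P Q : Matrix (Fin a) (Fin b) ℝ) :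
    cAct (P + Q) = cAct P + cAct Q := by
  rw [cAct, cAct, cAct, ← map_add]
  congr 1
  ext i j
  simp

theorem cAct_sum {ι : Type*} {a b : ℕ} (s : Finset ι) (P : ι → Matrix (Fin a) (Fin b) ℝ) :
    cAct (∑ i ∈ s, P i) = ∑ i ∈ s, cAct (P i) := by
  classical
  induction s using Finset.induction_on with
  | empty =>
    rw [Finset.sum_empty, Finset.sum_empty]
    have := cAct_smul (0 : ℝ) (0 : Matrix (Fin a) (Fin b) ℝ)
    simpa using this
  | insert i s hi ih => rw [Finset.sum_insert hi, Finset.sum_insert hi, cAct_add, ih]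

theorem cAct_mul {a b c : ℕ} (P : Matrix (Fin a) (Fin b) ℝ) (Q : Matrix (Fin b) (Fin c) ℝ)
    (v : CVec c) : cAct (P * Q) v = cAct P (cAct Q v) := by
  have : (P * Q).map Complex.ofReal = P.map Complex.ofReal * Q.map Complex.ofReal := by
    exact Matrix.map_mul (f := Complex.ofRealHom)
  rw [cAct, this, Matrix.toEuclideanLin, Matrix.toLpLin_mul 2 2 2]
  rfl

theorem cAct_one {a : ℕ} (v : CVec a) : cAct (1 : Matrix (Fin a) (Fin a) ℝ) v = v := by
  have : (1 : Matrix (Fin a) (Fin a) ℝ).map Complex.ofReal = 1 := by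
    ext i j; by_cases h : i = j <;> simp [Matrix.one_apply, h]
  rw [cAct, this]
  simp [Matrix.toEuclideanLin]

variable {k N M : ℕ}

namespace BVP

variable (S : BVP k N M)

theorem symb_add (w w' : Euc (k + 1)) : S.symb (w + w') = S.symb w + S.symb w' := by
  simp only [symb, PiLp.add_apply, add_smul, Finset.sum_add_distrib]
  abel

theorem symb_smul (r : ℝ) (w : Euc (k + 1)) : S.symb (r • w) = r • S.symb w := by
  simp only [symb, PiLp.smul_apply, smul_eq_mul, smul_add, Finset.smul_sum, smul_smul]

theorem symb_zero : S.symb 0 = 0 := by simpa using S.symb_smul 0 0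

theorem symb_single_last : S.symb (EuclideanSpace.single (Fin.last k) 1) = S.An 0 := by
  simp [symb]

theorem symb_single_castSucc (i : Fin k) :
    S.symb (EuclideanSpace.single i.castSucc 1) = S.A i 0 := by
  rw [symb, Finset.sum_eq_single i]
  · simp
  · intro j _ hj
    simp [hj]
  · simp

/-- The symbol `A(η, ξ)` as an endomorphism of `ℂ^N`. -/
def symbEnd (w : Euc (k + 1)) : Module.End ℂ (CVec N) := cAct (S.symb w)

theorem symbEnd_add (w w' : Euc (k + 1)) : S.symbEnd (w + w') = S.symbEnd w + S.symbEnd w' := by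
  rw [symbEnd, symb_add, cAct_add]; rfl

theorem symbEnd_smul (r : ℝ) (w : Euc (k + 1)) : S.symbEnd (r • w) = (r : ℂ) • S.symbEnd w := by
  rw [symbEnd, symb_smul, cAct_smul]; rfl

theorem symbEnd_eq_sum (w : Euc (k + 1)) :
    S.symbEnd w = ∑ i, (w i : ℂ) • S.symbEnd (EuclideanSpace.single i 1) := by
  have : w = ∑ i, w i • (EuclideanSpace.single i (1 : ℝ) : Euc (k + 1)) := by
    ext j
    simp [Pi.single_apply]
  conv_lhs => rw [this]
  rw [symbEnd, map_sum_symb, cAct_sum]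
  · refine Finset.sum_congr rfl fun i _ => ?_
    rw [symb_smul, cAct_smul]; rfl
where
  map_sum_symb : S.symb (∑ i, w i • (EuclideanSpace.single i (1 : ℝ) : Euc (k + 1))) =
      ∑ i, S.symb (w i • (EuclideanSpace.single i (1 : ℝ) : Euc (k + 1))) :=
    map_sum (AddMonoidHom.mk' S.symb S.symb_add) _ _

theorem continuous_symbEnd {X : Type*} [TopologicalSpace X] {s : Set X} {w : X → Euc (k + 1)}
    {v : X → CVec N} (hw : ContinuousOn w s) (hv : ContinuousOn v s) :
    ContinuousOn (fun x => S.symbEnd (w x) (v x)) s := by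
  have : (fun x => S.symbEnd (w x) (v x)) =
      fun x => ∑ i, ((w x i : ℝ) : ℂ) • S.symbEnd (EuclideanSpace.single i 1) (v x) := by
    ext1 x
    rw [symbEnd_eq_sum]
    simp
  rw [this]
  refine continuousOn_finsetSum _ fun i _ => ContinuousOn.fun_smul ?_ ?_
  · exact Complex.continuous_ofReal.comp_continuousOn
      ((EuclideanSpace.proj (𝕜 := ℝ) i).continuous.comp_continuousOn hw)
  · exact (LinearMap.continuous_of_finiteDimensional _).comp_continuousOn hv

end BVP

namespace BVP.StrictlyHyperbolic

variable {S : BVP k N M} {τ : Fin N → Euc (k + 1) → ℝ}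

theorem charpoly_symb (hτ : S.StrictlyHyperbolic τ) {w : Euc (k + 1)} (hw : w ≠ 0) :
    (S.symb w).charpoly = ∏ j, (Polynomial.X - Polynomial.C (-τ j w)) := by
  refine Polynomial.funext fun s => ?_
  rw [Matrix.eval_charpoly, Polynomial.eval_prod]
  have h1 : Matrix.scalar (Fin N) s - S.symb w =
      -((-s) • (1 : Matrix (Fin N) (Fin N) ℝ) + S.symb w) := by
    rw [Matrix.scalar_apply, ← Matrix.smul_one_eq_diagonal]
    simp [sub_eq_add_neg, add_comm]
  rw [h1, Matrix.det_neg, hτ.factor w hw]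
  rw [← Finset.card_univ, ← Finset.prod_const, ← Finset.prod_mul_distrib]
  refine Finset.prod_congr rfl fun j _ => ?_
  simp
  ring

theorem charpoly_symbEnd (hτ : S.StrictlyHyperbolic τ) {w : Euc (k + 1)} (hw : w ≠ 0) :
    (S.symbEnd w).charpoly = ∏ j, (Polynomial.X - Polynomial.C (-(τ j w : ℂ))) := by
  have h1 : (S.symbEnd w).charpoly = ((S.symb w).map Complex.ofReal).charpoly := by
    rw [symbEnd, cAct, Matrix.toEuclideanLin, Matrix.toLpLin_eq_toLin, Matrix.charpoly_toLin]
  have h2 := Matrix.charpoly_map (S.symb w) Complex.ofRealHom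
  rw [h1]
  refine h2.trans ?_
  rw [hτ.charpoly_symb hw, Polynomial.map_prod]
  refine Finset.prod_congr rfl fun j _ => ?_
  simp

theorem eigenvalues_injective (hτ : S.StrictlyHyperbolic τ) {w : Euc (k + 1)} (hw : w ≠ 0) :
    Function.Injective fun j => -(τ j w : ℂ) := by
  intro i j h
  have : τ i w = τ j w := by simpa using h
  exact (hτ.strictMono w hw).injective this

theorem hasEigenvalue_iff (hτ : S.StrictlyHyperbolic τ) {w : Euc (k + 1)} (hw : w ≠ 0) (μ : ℂ) :
    (S.symbEnd w).HasEigenvalue μ ↔ ∃ j, μ = -(τ j w : ℂ) := by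
  rw [Module.End.hasEigenvalue_iff_isRoot_charpoly, hτ.charpoly_symbEnd hw,
    Polynomial.IsRoot.def, Polynomial.eval_prod, Finset.prod_eq_zero_iff]
  simp [add_eq_zero_iff_eq_neg]

theorem maxGenEigenspace_eq (hτ : S.StrictlyHyperbolic τ) {w : Euc (k + 1)} (hw : w ≠ 0) (μ : ℂ) :
    (S.symbEnd w).maxGenEigenspace μ = (S.symbEnd w).eigenspace μ := by
  refine (Module.End.IsSemisimple.isFinitelySemisimple ?_).maxGenEigenspace_eq_eigenspace μ
  refine Module.End.isSemisimple_of_squarefree_aeval_eq_zero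
    (p := ∏ j, (Polynomial.X - Polynomial.C (-(τ j w : ℂ)))) ?_ ?_
  · exact (Polynomial.separable_prod_X_sub_C_iff.2 (hτ.eigenvalues_injective hw)).squarefree
  · rw [← hτ.charpoly_symbEnd hw, LinearMap.aeval_self_charpoly]

theorem finrank_maxGenEigenspace_le_one (hτ : S.StrictlyHyperbolic τ) {w : Euc (k + 1)}
    (hw : w ≠ 0) (μ : ℂ) : Module.finrank ℂ ((S.symbEnd w).maxGenEigenspace μ) ≤ 1 := by
  rw [LinearMap.finrank_maxGenEigenspace_eq, hτ.charpoly_symbEnd hw, ← Polynomial.count_roots]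
  refine Multiset.nodup_iff_count_le_one.1 ?_ μ
  exact Polynomial.nodup_roots
    (Polynomial.separable_prod_X_sub_C_iff.2 (hτ.eigenvalues_injective hw))

/-- The spectral projectors are the Lagrange interpolation polynomials of the symbol. -/
theorem spectralProj_eq_aeval (hτ : S.StrictlyHyperbolic τ) {w : Euc (k + 1)} (hw : w ≠ 0)
    (j : Fin N) : spectralProj (S.symbEnd w) {-(τ j w : ℂ)} =
      Polynomial.aeval (S.symbEnd w)
        (Lagrange.basis Finset.univ (fun l => -(τ l w : ℂ)) j) := by
  refine end_ext_maxGenEigenspace (S.symbEnd w) fun μ v hv => ?_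
  by_cases hv0 : v = 0
  · simp [hv0]
  have hv' := hv
  rw [hτ.maxGenEigenspace_eq hw] at hv'
  have hev : (S.symbEnd w).HasEigenvector μ v := ⟨hv', hv0⟩
  obtain ⟨l, rfl⟩ := (hτ.hasEigenvalue_iff hw μ).1
    (Module.End.hasEigenvalue_of_hasEigenvector hev)
  rw [Module.End.aeval_apply_of_hasEigenvector hev]
  by_cases hlj : l = j
  · subst hlj
    rw [spectralProj_apply_of_mem (Set.mem_singleton _) hv,
      Lagrange.eval_basis_self (v := fun l => -(τ l w : ℂ)) (s := Finset.univ) (i := l)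
        (hτ.eigenvalues_injective hw).injOn (Finset.mem_univ l), one_smul]
  · rw [spectralProj_apply_of_notMem (S := {-(τ j w : ℂ)}) (μ := -(τ l w : ℂ)) _ hv,
      Lagrange.eval_basis_of_ne (v := fun l => -(τ l w : ℂ)) (s := Finset.univ) (i := j) (j := l)
        (Ne.symm hlj) (Finset.mem_univ l), zero_smul]
    intro h
    exact hlj (hτ.eigenvalues_injective hw h)

/-- The projectors depend continuously on the frequency, by Lagrange's formula. -/
theorem continuousOn_spectralProj (hτ : S.StrictlyHyperbolic τ) (j : Fin N) {X : Type*}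
    [TopologicalSpace X] {s : Set X} {w : X → Euc (k + 1)} {v : X → CVec N}
    (hw : ContinuousOn w s) (hw0 : ∀ x ∈ s, w x ≠ 0) (hv : ContinuousOn v s) :
    ContinuousOn (fun x => spectralProj (S.symbEnd (w x)) {-(τ j (w x) : ℂ)} (v x)) s := by
  have hτc : ∀ l, ContinuousOn (fun x => -(τ l (w x) : ℂ)) s := fun l =>
    (Complex.continuous_ofReal.comp_continuousOn
      ((hτ.analytic l).continuousOn.comp hw fun x hx => hw0 x hx)).neg
  have key : ∀ F : Finset (Fin N), j ∉ F → ContinuousOn (fun x =>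
      Polynomial.aeval (S.symbEnd (w x))
        (∏ l ∈ F, Lagrange.basisDivisor (-(τ j (w x) : ℂ)) (-(τ l (w x) : ℂ))) (v x)) s := by
    intro F
    induction F using Finset.induction_on with
    | empty => intro _; simpa using hv
    | insert l F hl ih =>
      intro hj
      rw [Finset.mem_insert, not_or] at hj
      specialize ih hj.2
      have hstep : ∀ (f : Module.End ℂ (CVec N)) (a c : ℂ) (q : Polynomial ℂ) (u : CVec N),
          Polynomial.aeval f (Lagrange.basisDivisor a c * q) u =
            (a - c)⁻¹ • (f (Polynomial.aeval f q u) - c • Polynomial.aeval f q u) := by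
        intro f a c q u
        rw [map_mul, Module.End.mul_apply, Lagrange.basisDivisor, map_mul, Module.End.mul_apply,
          Polynomial.aeval_C, map_sub, Polynomial.aeval_X, Polynomial.aeval_C,
          LinearMap.sub_apply, Module.algebraMap_end_apply, Module.algebraMap_end_apply]
      simp only [Finset.prod_insert hl, hstep]
      have h1 : ContinuousOn (fun x => (-(τ j (w x) : ℂ) - -(τ l (w x) : ℂ))⁻¹) s := by
        refine ContinuousOn.inv₀ ((hτc j).sub (hτc l)) fun x hx h => ?_
        exact hj.1 (hτ.eigenvalues_injective (hw0 x hx) (sub_eq_zero.1 h))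
      exact h1.fun_smul ((S.continuous_symbEnd hw ih).sub ((hτc l).fun_smul ih))
  refine (key (Finset.univ.erase j) (by simp)).congr fun x hx => ?_
  simp only [hτ.spectralProj_eq_aeval (hw0 x hx) j, Lagrange.basis]

/-- The symbol acts on the range of a spectral projector as its eigenvalue. -/
theorem symbEnd_spectralProj (hτ : S.StrictlyHyperbolic τ) {w : Euc (k + 1)} (hw : w ≠ 0) (μ : ℂ)
    (v : CVec N) :
    S.symbEnd w (spectralProj (S.symbEnd w) {μ} v) = μ • spectralProj (S.symbEnd w) {μ} v := by
  have := spectralProj_singleton_mem (S.symbEnd w) μ v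
  rw [hτ.maxGenEigenspace_eq hw] at this
  exact Module.End.mem_eigenspace_iff.1 this

theorem spectralProj_symbEnd (hτ : S.StrictlyHyperbolic τ) {w : Euc (k + 1)} (hw : w ≠ 0)
    (μ : ℂ) (v : CVec N) :
    spectralProj (S.symbEnd w) {μ} (S.symbEnd w v) = μ • spectralProj (S.symbEnd w) {μ} v := by
  have : spectralProj (S.symbEnd w) {μ} ∘ₗ S.symbEnd w =
      μ • spectralProj (S.symbEnd w) {μ} := by
    refine end_ext_maxGenEigenspace (S.symbEnd w) fun ν v hv => ?_
    have hv' := hv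
    rw [hτ.maxGenEigenspace_eq hw, Module.End.mem_eigenspace_iff] at hv'
    rw [LinearMap.comp_apply, hv', map_smul, LinearMap.smul_apply]
    by_cases h : ν = μ
    · rw [h]
    · rw [spectralProj_apply_of_notMem (S := {μ}) h hv, smul_zero, smul_zero]
  exact LinearMap.congr_fun this v

/-- `π A(e) π = -(∂_e τ_j) π`: on the range of `π` the symbol of the system is that of the transport
at the group velocity `-∇τ_j`. -/
theorem spectralProj_symbEnd_spectralProj (hτ : S.StrictlyHyperbolic τ) {w : Euc (k + 1)}
    (hw : w ≠ 0) (j : Fin N) (e : Euc (k + 1)) (u : CVec N) :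
    spectralProj (S.symbEnd w) {-(τ j w : ℂ)}
      (S.symbEnd e (spectralProj (S.symbEnd w) {-(τ j w : ℂ)} u)) =
      -(fderiv ℝ (τ j) w e : ℂ) • spectralProj (S.symbEnd w) {-(τ j w : ℂ)} u := by
  set P := spectralProj (S.symbEnd w) {-(τ j w : ℂ)} with hP
  set p : ℝ → Euc (k + 1) := fun h => w + h • e with hp
  have hpc : Continuous p := by fun_prop
  have hp0 : p 0 = w := by simp [hp]
  -- `b h` is an eigenvector of the symbol at `w + h e`, and tends to `P u`
  set b : ℝ → CVec N := fun h => spectralProj (S.symbEnd (p h)) {-(τ j (p h) : ℂ)} (P u) with hb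
  have hopen : IsOpen {h : ℝ | p h ≠ 0} := isOpen_ne_fun hpc continuous_const
  have hbc : ContinuousAt b 0 :=
    (hτ.continuousOn_spectralProj j hpc.continuousOn (fun x hx => hx)
      continuousOn_const).continuousAt (hopen.mem_nhds (by simpa [hp] using hw))
  have hb0 : b 0 = P u := by
    simp only [hb, hp0, ← hP]
    exact spectralProj_idem _ _ _
  have hPc : Continuous P := LinearMap.continuous_of_finiteDimensional P
  have hEc : Continuous (S.symbEnd e) := LinearMap.continuous_of_finiteDimensional _
  have hlim1 : Tendsto (fun h => P (S.symbEnd e (b h))) (𝓝[≠] 0) (𝓝 (P (S.symbEnd e (P u)))) := by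
    have h1 : Tendsto b (𝓝[≠] 0) (𝓝 (P u)) := by
      rw [← hb0]; exact hbc.tendsto.mono_left nhdsWithin_le_nhds
    exact ((hPc.comp hEc).tendsto _).comp h1
  have hslope : Tendsto (fun h : ℝ => h⁻¹ • (τ j (p h) - τ j w)) (𝓝[≠] 0)
      (𝓝 (fderiv ℝ (τ j) w e)) := by
    have hd : HasFDerivAt (τ j) (fderiv ℝ (τ j) w) w :=
      ((hτ.analytic j) w hw).differentiableAt.hasFDerivAt
    have hd2 := (hd.hasLineDerivAt e).tendsto_slope_zero
    simpa [hp] using hd2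
  have hlim2 : Tendsto (fun h : ℝ => -((h⁻¹ • (τ j (p h) - τ j w) : ℝ) : ℂ) • P (b h)) (𝓝[≠] 0)
      (𝓝 (-(fderiv ℝ (τ j) w e : ℂ) • P u)) := by
    refine Tendsto.smul ((Complex.continuous_ofReal.tendsto _).comp hslope).neg ?_
    have h1 : Tendsto b (𝓝[≠] 0) (𝓝 (P u)) := by
      rw [← hb0]; exact hbc.tendsto.mono_left nhdsWithin_le_nhds
    have h2 := (hPc.tendsto _).comp h1
    rwa [hP, spectralProj_idem] at h2
  refine tendsto_nhds_unique hlim1 (hlim2.congr' ?_)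
  have hev : ∀ᶠ h in 𝓝[≠] (0 : ℝ), p h ≠ 0 :=
    nhdsWithin_le_nhds (hopen.mem_nhds (by simpa [hp] using hw))
  filter_upwards [hev, self_mem_nhdsWithin] with h h1 h2
  have e1 := hτ.symbEnd_spectralProj h1 (-(τ j (p h) : ℂ)) (P u)
  have e2 : S.symbEnd (p h) (b h) = S.symbEnd w (b h) + (h : ℂ) • S.symbEnd e (b h) := by
    rw [hp, symbEnd_add, symbEnd_smul]; rfl
  have e3 : P (S.symbEnd w (b h)) = -(τ j w : ℂ) • P (b h) := hτ.spectralProj_symbEnd hw _ _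
  have e4 : P (S.symbEnd (p h) (b h)) = -(τ j (p h) : ℂ) • P (b h) := by
    rw [← map_smul]; exact congrArg P e1
  rw [e2, map_add, map_smul, e3] at e4
  have hh : (h : ℂ) ≠ 0 := by exact_mod_cast h2
  have e5 : (h : ℂ) • P (S.symbEnd e (b h)) = -((τ j (p h) : ℂ) - τ j w) • P (b h) := by
    rw [← sub_eq_iff_eq_add'.2 e4.symm, ← sub_smul]
    congr 1
    ring
  have e6 : P (S.symbEnd e (b h)) = (h : ℂ)⁻¹ • ((h : ℂ) • P (S.symbEnd e (b h))) := by
    rw [smul_smul, inv_mul_cancel₀ hh, one_smul]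
  rw [e6, e5, smul_smul]
  congr 1
  push_cast [smul_eq_mul]
  ring

end BVP.StrictlyHyperbolic

end

noncomputable section

variable {k N M : ℕ}

namespace BVP

variable (S : BVP k N M)

/-! ### Characteristic frequencies and velocities -/

theorem symb_spat (b : Euc (k + 1)) (ξ : ℝ) :
    S.symb (spat b ξ) = ∑ i : Fin k, b i.succ • S.A i 0 + ξ • S.An 0 := by
  simp [symb, spat]

theorem proj_eq (b : Euc (k + 1)) (ξ : ℝ) :
    S.proj b ξ = spectralProj (S.symbEnd (spat b ξ)) {-(b 0 : ℂ)} := rfl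

theorem spat_neg (b : Euc (k + 1)) (ξ : ℝ) : spat (-b) (-ξ) = -spat b ξ := by
  ext i
  refine Fin.lastCases ?_ (fun i => ?_) i <;> simp [spat]

theorem proj_neg (b : Euc (k + 1)) (ξ : ℝ) : S.proj (-b) (-ξ) = S.proj b ξ := by
  rw [proj_eq, proj_eq, spat_neg, ← spectralProj_smul _ (c := -1) (by norm_num)]
  have h := S.symbEnd_smul (-1) (spat b ξ)
  rw [neg_one_smul] at h
  rw [h]
  simp

/-- The real numbers `ξ` for which `(b, ξ)` is characteristic, as the roots of a polynomial. -/
def charFreqs (b : Euc (k + 1)) : Finset ℝ :=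
  (-((S.An 0)⁻¹ * (b 0 • (1 : Matrix (Fin N) (Fin N) ℝ) +
    ∑ i : Fin k, b i.succ • S.A i 0))).charpoly.roots.toFinset

theorem card_charFreqs_le (b : Euc (k + 1)) : (S.charFreqs b).card ≤ N := by
  refine (Multiset.toFinset_card_le _).trans ((Polynomial.card_roots' _).trans ?_)
  rw [Matrix.charpoly_natDegree_eq_dim, Fintype.card_fin]

theorem mem_charFreqs (hchar : S.Noncharacteristic) (b : Euc (k + 1)) (ξ : ℝ) :
    ξ ∈ S.charFreqs b ↔ (S.L b ξ).det = 0 := by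
  have hA := hchar 0 S.zero_mem
  rw [charFreqs, Multiset.mem_toFinset, Polynomial.mem_roots (Matrix.charpoly_monic _).ne_zero,
    Polynomial.IsRoot.def, Matrix.eval_charpoly]
  have h : S.L b ξ = S.An 0 * (Matrix.scalar (Fin N) ξ - -((S.An 0)⁻¹ *
      (b 0 • (1 : Matrix (Fin N) (Fin N) ℝ) + ∑ i : Fin k, b i.succ • S.A i 0))) := by
    rw [sub_neg_eq_add, mul_add, Matrix.mul_nonsing_inv_cancel_left _ _ hA, Matrix.scalar_apply,
      ← Matrix.smul_one_eq_diagonal, Matrix.mul_smul, Matrix.mul_one, L, symb_spat]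
    abel
  rw [h, Matrix.det_mul, mul_eq_zero, or_iff_right hA.ne_zero]

theorem charFreqs_zero_subset (hchar : S.Noncharacteristic) (hN : 1 ≤ N) {ξ : ℝ}
    (h : ξ ∈ S.charFreqs 0) : ξ = 0 := by
  have hA := hchar 0 S.zero_mem
  rw [S.mem_charFreqs hchar, L, symb_spat] at h
  simp only [PiLp.zero_apply, zero_smul, Finset.sum_const_zero, zero_add, Matrix.det_smul,
    Fintype.card_fin, mul_eq_zero, hA.ne_zero, or_false] at h
  exact pow_eq_zero_iff (by omega) |>.1 h

theorem hasEigenvalue_symbEnd {w : Euc (k + 1)} {t : ℝ}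
    (h : (S.symbEnd w).HasEigenvalue (-(t : ℂ))) :
    (t • (1 : Matrix (Fin N) (Fin N) ℝ) + S.symb w).det = 0 := by
  rw [Module.End.hasEigenvalue_iff_isRoot_charpoly] at h
  have h1 : (S.symbEnd w).charpoly = ((S.symb w).map Complex.ofReal).charpoly := by
    rw [symbEnd, cAct, Matrix.toEuclideanLin, Matrix.toLpLin_eq_toLin, Matrix.charpoly_toLin]
  have h2 := Matrix.charpoly_map (S.symb w) Complex.ofRealHom
  rw [h1, show ((S.symb w).map Complex.ofReal).charpoly =
    (S.symb w).charpoly.map Complex.ofRealHom from h2, ← Complex.ofReal_neg,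
    show ((-t : ℝ) : ℂ) = Complex.ofRealHom (-t) from rfl, Polynomial.IsRoot.def,
    Polynomial.eval_map_apply, map_eq_zero, Matrix.eval_charpoly] at h
  have h3 : Matrix.scalar (Fin N) (-t) - S.symb w =
      -(t • (1 : Matrix (Fin N) (Fin N) ℝ) + S.symb w) := by
    rw [Matrix.scalar_apply, ← Matrix.smul_one_eq_diagonal]
    simp [sub_eq_add_neg, add_comm]
  rw [h3, Matrix.det_neg] at h
  simpa using h

theorem proj_eq_zero_of_notMem (hchar : S.Noncharacteristic) {b : Euc (k + 1)} {ξ : ℝ}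
    (h : ξ ∉ S.charFreqs b) : S.proj b ξ = 0 := by
  refine spectralProj_singleton_eq_zero fun hev => h ?_
  rw [S.mem_charFreqs hchar]
  exact S.hasEigenvalue_symbEnd hev

theorem zero_mem_charFreqs_zero (hchar : S.Noncharacteristic) (hN : 1 ≤ N) :
    (0 : ℝ) ∈ S.charFreqs 0 := by
  rw [S.mem_charFreqs hchar, L, symb_spat]
  have : Nonempty (Fin N) := ⟨⟨0, hN⟩⟩
  simp

theorem proj_zero (v : CVec N) : S.proj 0 0 v = v := by
  have h0 : S.symbEnd (spat 0 0) = 0 := by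
    have : spat (0 : Euc (k + 1)) 0 = 0 := by
      ext i
      refine Fin.lastCases ?_ (fun i => ?_) i <;> simp [spat]
    rw [this]
    simpa using S.symbEnd_smul 0 0
  rw [proj_eq, h0]
  refine spectralProj_apply_of_mem (Set.mem_singleton _) ?_
  rw [Module.End.mem_maxGenEigenspace]
  exact ⟨1, by simp⟩

theorem projTil_zero (hchar : S.Noncharacteristic) (v : CVec N) : S.projTil 0 0 v = v := by
  rw [projTil, LinearMap.comp_apply, LinearMap.comp_apply, proj_zero, ← cAct_mul,
    Matrix.nonsing_inv_mul _ (hchar 0 S.zero_mem), cAct_one]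

/-- `π̃` and `π A_d` have the same kernel. -/
theorem projTil_eq_zero (hchar : S.Noncharacteristic) {b : Euc (k + 1)} {ξ : ℝ} {v : CVec N}
    (h : S.projTil b ξ v = 0) : S.proj b ξ (cAct (S.An 0) v) = 0 := by
  have h2 := congrArg (cAct (S.An 0)) h
  rwa [projTil, LinearMap.comp_apply, LinearMap.comp_apply, ← cAct_mul,
    Matrix.mul_nonsing_inv _ (hchar 0 S.zero_mem), cAct_one, map_zero] at h2

theorem cAct_An_Atil (hchar : S.Noncharacteristic) (i : Fin k) (v : CVec N) :
    cAct (S.An 0) (cAct (S.Atil i.succ 0) v) = cAct (S.A i 0) v := by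
  rw [← cAct_mul, Atil, Fin.cases_succ, ← Matrix.mul_assoc,
    Matrix.mul_nonsing_inv _ (hchar 0 S.zero_mem), Matrix.one_mul]

theorem cAct_An_Atil_zero (hchar : S.Noncharacteristic) (v : CVec N) :
    cAct (S.An 0) (cAct (S.Atil 0 0) v) = v := by
  rw [← cAct_mul, Atil, Fin.cases_zero, Matrix.mul_nonsing_inv _ (hchar 0 S.zero_mem), cAct_one]

/-! ### The quadratic term -/

theorem exists_L1_bound : ∃ C : ℝ, 0 ≤ C ∧ ∀ (u : CVec N) (b : Euc (k + 1)) (w : CVec N),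
    ‖S.L1 u b w‖ ≤ C * ‖u‖ * ‖b‖ * ‖w‖ := by
  refine ⟨∑ i, ∑ c, ‖LinearMap.toContinuousLinearMap (cAct (S.dAtil i c))‖,
    by positivity, fun u b w => ?_⟩
  rw [L1, LinearMap.sum_apply, Finset.sum_mul, Finset.sum_mul, Finset.sum_mul]
  refine (norm_sum_le _ _).trans (Finset.sum_le_sum fun i _ => ?_)
  rw [LinearMap.sum_apply, Finset.sum_mul, Finset.sum_mul, Finset.sum_mul]
  refine (norm_sum_le _ _).trans (Finset.sum_le_sum fun c _ => ?_)
  rw [LinearMap.smul_apply, norm_smul, norm_mul, Complex.norm_real]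
  have h1 : ‖b i‖ ≤ ‖b‖ := PiLp.norm_apply_le b i
  have h2 : ‖u c‖ ≤ ‖u‖ := PiLp.norm_apply_le u c
  have h3 := (LinearMap.toContinuousLinearMap (cAct (S.dAtil i c))).le_opNorm w
  calc ‖b i‖ * ‖u c‖ * ‖cAct (S.dAtil i c) w‖
      ≤ ‖b‖ * ‖u‖ * (‖LinearMap.toContinuousLinearMap (cAct (S.dAtil i c))‖ * ‖w‖) := by
        gcongr
        exact h3
    _ = _ := by ring

theorem L1_add (u u' : CVec N) (b : Euc (k + 1)) : S.L1 (u + u') b = S.L1 u b + S.L1 u' b := by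
  simp only [L1, PiLp.add_apply, mul_add, add_smul, Finset.sum_add_distrib]

theorem L1_smul (r : ℂ) (u : CVec N) (b : Euc (k + 1)) : S.L1 (r • u) b = r • S.L1 u b := by
  simp only [L1, PiLp.smul_apply, smul_eq_mul, Finset.smul_sum, smul_smul]
  refine Finset.sum_congr rfl fun i _ => Finset.sum_congr rfl fun c _ => ?_
  congr 1
  ring

theorem L1_bfreq {m : ℕ} (u : CVec N) (ζ : Fin m → Euc (k + 1)) (n : Fin m → ℤ) :
    S.L1 u (bfreq ζ n) = ∑ j, (n j : ℂ) • S.L1 u (ζ j) := by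
  simp only [L1, bfreq, Finset.smul_sum, smul_smul]
  conv_rhs => rw [Finset.sum_comm]
  refine Finset.sum_congr rfl fun i _ => ?_
  conv_rhs => rw [Finset.sum_comm]
  refine Finset.sum_congr rfl fun c _ => ?_
  rw [← Finset.sum_smul]
  congr 1
  simp only [WithLp.ofLp_sum, Finset.sum_apply, PiLp.smul_apply, smul_eq_mul]
  push_cast
  rw [Finset.sum_mul]
  exact Finset.sum_congr rfl fun j _ => by ring

theorem L1_neg (u : CVec N) (b : Euc (k + 1)) : S.L1 u (-b) = -S.L1 u b := by
  simp [L1]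

/-- `L̃_1(·, b)·` as a continuous bilinear map. -/
def L1Bilin (b : Euc (k + 1)) : CVec N →L[ℂ] CVec N →L[ℂ] CVec N :=
  LinearMap.mkContinuous₂
    (LinearMap.mk₂ ℂ (fun u w => S.L1 u b w) (fun u u' w => by rw [L1_add]; rfl)
      (fun c u w => by rw [L1_smul]; rfl) (fun u w w' => map_add _ _ _)
      (fun c u w => map_smul _ _ _))
    (S.exists_L1_bound.choose * ‖b‖)
    (fun u w => by
      refine (S.exists_L1_bound.choose_spec.2 u b w).trans_eq ?_
      ring)

theorem L1Bilin_apply (b : Euc (k + 1)) (u w : CVec N) : S.L1Bilin b u w = S.L1 u b w := rfl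

end BVP

namespace BVP.StrictlyHyperbolic

variable {S : BVP k N M} {τ : Fin N → Euc (k + 1) → ℝ}

theorem spat_eq_zero {b : Euc (k + 1)} {ξ : ℝ} (h : spat b ξ = 0) (hb : b ≠ 0) : b 0 ≠ 0 := by
  intro h0
  apply hb
  ext i
  refine Fin.cases (by simpa using h0) (fun i => ?_) i
  have := congrArg (fun w : Euc (k + 1) => w i.castSucc) h
  simpa [spat] using this

theorem proj_eq_zero_of_spat {b : Euc (k + 1)} {ξ : ℝ} (h : spat b ξ = 0) (hb : b ≠ 0) :
    S.proj b ξ = 0 := by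
  refine spectralProj_singleton_eq_zero fun hev => ?_
  have := S.hasEigenvalue_symbEnd hev
  rw [h, S.symb_zero, add_zero, Matrix.det_smul, Matrix.det_one, mul_one] at this
  exact spat_eq_zero h hb (eq_zero_of_pow_eq_zero this)

/-- For `b ≠ 0`, either `(b, ξ)` is on one sheet of the characteristic variety, away from the origin,
or its projector vanishes. -/
theorem proj_eq_zero_or (hτ : S.StrictlyHyperbolic τ) {b : Euc (k + 1)} (hb : b ≠ 0) (ξ : ℝ) :
    S.proj b ξ = 0 ∨ (spat b ξ ≠ 0 ∧ ∃ j, b 0 = τ j (spat b ξ)) := by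
  by_cases hw : spat b ξ = 0
  · exact Or.inl (proj_eq_zero_of_spat hw hb)
  by_cases hev : (S.symbEnd (spat b ξ)).HasEigenvalue (-(b 0 : ℂ))
  · obtain ⟨j, hj⟩ := (hτ.hasEigenvalue_iff hw _).1 hev
    exact Or.inr ⟨hw, j, by exact_mod_cast neg_injective hj⟩
  · exact Or.inl (spectralProj_singleton_eq_zero hev)

/-- On the polarized vectors of a mode the spatial part of the system acts as a transport, at a speed
bounded by the group velocities. -/
theorem exists_velocity (hτ : S.StrictlyHyperbolic τ) {V : ℝ} (hV0 : 0 ≤ V)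
    (hV : BoundsGroupVelocities τ V) {b : Euc (k + 1)} (hb : b ≠ 0) (ξ : ℝ) :
    ∃ v : Fin (k + 1) → ℝ, (∀ i, |v i| ≤ V) ∧ ∀ i u,
      S.proj b ξ (S.symbEnd (EuclideanSpace.single i 1) (S.proj b ξ u)) =
        (v i : ℂ) • S.proj b ξ u := by
  rcases hτ.proj_eq_zero_or hb ξ with h | ⟨hw, j, hj⟩
  · exact ⟨0, by simpa using hV0, by simp [h]⟩
  · refine ⟨fun i => -fderiv ℝ (τ j) (spat b ξ) (EuclideanSpace.single i 1), fun i => ?_,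
      fun i u => ?_⟩
    · rw [abs_neg]
      have h1 := (fderiv ℝ (τ j) (spat b ξ)).le_opNorm (EuclideanSpace.single i 1)
      rw [PiLp.norm_single, norm_one, mul_one] at h1
      exact h1.trans (hV j _ hw)
    · rw [BVP.proj_eq, hj, hτ.spectralProj_symbEnd_spectralProj hw]
      push_cast
      rfl

/-- The projectors are uniformly bounded, by compactness of the sphere and homogeneity. -/
theorem exists_proj_bound (hτ : S.StrictlyHyperbolic τ) :
    ∃ C : ℝ, 0 ≤ C ∧ ∀ b ξ v, b ≠ 0 → ‖S.proj b ξ v‖ ≤ C * ‖v‖ := by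
  have hcomp : IsCompact (Metric.sphere (0 : Euc (k + 1)) 1) := isCompact_sphere _ _
  have h1 : ∀ j c, ∃ B : ℝ, ∀ w ∈ Metric.sphere (0 : Euc (k + 1)) 1,
      ‖spectralProj (S.symbEnd w) {-(τ j w : ℂ)} (EuclideanSpace.single c 1)‖ ≤ B := by
    intro j c
    refine hcomp.exists_bound_of_continuousOn (hτ.continuousOn_spectralProj j continuousOn_id
      (fun w hw => ?_) continuousOn_const)
    exact ne_zero_of_mem_unit_sphere ⟨w, hw⟩
  choose B hB using h1
  refine ⟨∑ j, ∑ c, |B j c|, by positivity, fun b ξ v hb => ?_⟩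
  rcases hτ.proj_eq_zero_or hb ξ with h | ⟨hw, j, hj⟩
  · rw [h, LinearMap.zero_apply, norm_zero]
    positivity
  have hn : ‖spat b ξ‖ ≠ 0 := norm_ne_zero_iff.2 hw
  set w := ‖spat b ξ‖⁻¹ • spat b ξ with hwdef
  have hws : w ∈ Metric.sphere (0 : Euc (k + 1)) 1 := by
    rw [mem_sphere_zero_iff_norm, hwdef, norm_smul, norm_inv, norm_norm, inv_mul_cancel₀ hn]
  have hw0 : w ≠ 0 := ne_zero_of_mem_unit_sphere ⟨w, hws⟩
  have hc : ((‖spat b ξ‖⁻¹ : ℝ) : ℂ) ≠ 0 := by exact_mod_cast inv_ne_zero hn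
  have hP : S.proj b ξ =
      spectralProj (S.symbEnd w) {((‖spat b ξ‖⁻¹ : ℝ) : ℂ) * -(b 0 : ℂ)} := by
    rw [hwdef, S.symbEnd_smul, spectralProj_smul _ hc, S.proj_eq]
  by_cases hev : (S.symbEnd w).HasEigenvalue (((‖spat b ξ‖⁻¹ : ℝ) : ℂ) * -(b 0 : ℂ))
  · obtain ⟨l, hl⟩ := (hτ.hasEigenvalue_iff hw0 _).1 hev
    rw [hP, hl]
    have hv : v = ∑ c, v c • (EuclideanSpace.single c (1 : ℂ) : CVec N) := by
      ext c; simp [Pi.single_apply]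
    calc ‖spectralProj (S.symbEnd w) {-(τ l w : ℂ)} v‖
        = ‖∑ c, v c • spectralProj (S.symbEnd w) {-(τ l w : ℂ)}
            (EuclideanSpace.single c (1 : ℂ))‖ := by
          conv_lhs => rw [hv]
          simp only [map_sum, map_smul]
      _ ≤ ∑ c, ‖v‖ * |B l c| := by
          refine (norm_sum_le _ _).trans (Finset.sum_le_sum fun c _ => ?_)
          rw [norm_smul]
          exact mul_le_mul (PiLp.norm_apply_le v c) ((hB l c w hws).trans (le_abs_self _))
            (norm_nonneg _) (norm_nonneg _)
      _ = (∑ c, |B l c|) * ‖v‖ := by rw [← Finset.mul_sum, mul_comm]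
      _ ≤ _ := by
          refine mul_le_mul_of_nonneg_right ?_ (norm_nonneg _)
          exact Finset.single_le_sum (f := fun j => ∑ c, |B j c|)
            (fun j _ => Finset.sum_nonneg fun c _ => abs_nonneg _) (Finset.mem_univ l)
  · rw [hP, spectralProj_singleton_eq_zero hev, LinearMap.zero_apply, norm_zero]
    positivity

/-- Two vectors polarized on the same line see the bilinear term symmetrically. -/
theorem L1_comm_of_polarized (hτ : S.StrictlyHyperbolic τ) {b : Euc (k + 1)} (hb : b ≠ 0) (ξ : ℝ)
    {u w : CVec N} (hu : S.proj b ξ u = u) (hw : S.proj b ξ w = w) (b' : Euc (k + 1)) :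
    S.L1 u b' w = S.L1 w b' u := by
  rcases hτ.proj_eq_zero_or hb ξ with h | ⟨hs, -⟩
  · rw [← hu, ← hw, h]; simp
  · have h1 := hτ.finrank_maxGenEigenspace_le_one hs (-(b 0 : ℂ))
    obtain ⟨e, he⟩ := finrank_le_one_iff.1 h1
    have hu' : u ∈ (S.symbEnd (spat b ξ)).maxGenEigenspace (-(b 0 : ℂ)) := by
      rw [← hu]; exact spectralProj_singleton_mem _ _ _
    have hw' : w ∈ (S.symbEnd (spat b ξ)).maxGenEigenspace (-(b 0 : ℂ)) := by
      rw [← hw]; exact spectralProj_singleton_mem _ _ _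
    obtain ⟨c, hc⟩ := he ⟨u, hu'⟩
    obtain ⟨d, hd⟩ := he ⟨w, hw'⟩
    have hc' : u = c • (e : CVec N) := (congrArg Subtype.val hc).symm
    have hd' : w = d • (e : CVec N) := (congrArg Subtype.val hd).symm
    rw [hc', hd', S.L1_smul, S.L1_smul, LinearMap.smul_apply, LinearMap.smul_apply, map_smul,
      map_smul, smul_comm]

/-- The spectral decomposition of `A_d(0)`: its eigenvalues are bounded by the group velocities. -/
theorem exists_An_decomposition (hτ : S.StrictlyHyperbolic τ) {V : ℝ}
    (hV : BoundsGroupVelocities τ V) :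
    ∃ (P : Fin N → Module.End ℂ (CVec N)) (l : Fin N → ℝ), (∀ j, |l j| ≤ V) ∧
      (∀ v, ∑ j, P j v = v) ∧ ∀ j v, P j (cAct (S.An 0) v) = (l j : ℂ) • P j v := by
  set e : Euc (k + 1) := EuclideanSpace.single (Fin.last k) 1 with he
  have he0 : e ≠ 0 := by
    intro h
    have := congrArg (fun w : Euc (k + 1) => ‖w‖) h
    simp [he] at this
  have hA : S.symbEnd e = cAct (S.An 0) := by rw [BVP.symbEnd, he, S.symb_single_last]
  refine ⟨fun j => spectralProj (S.symbEnd e) {-(τ j e : ℂ)}, fun j => -τ j e, fun j => ?_,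
    fun v => ?_, fun j v => ?_⟩
  · by_cases hP : spectralProj (S.symbEnd e) {-(τ j e : ℂ)} = 0
    · exfalso
      have hev : (S.symbEnd e).HasEigenvalue (-(τ j e : ℂ)) := (hτ.hasEigenvalue_iff he0 _).2 ⟨j, rfl⟩
      obtain ⟨v, hv⟩ := hev.exists_hasEigenvector
      have h1 : v ∈ (S.symbEnd e).maxGenEigenspace (-(τ j e : ℂ)) := by
        rw [hτ.maxGenEigenspace_eq he0]; exact hv.1
      have h2 := spectralProj_apply_of_mem (Set.mem_singleton _) h1
      rw [hP] at h2
      exact hv.2 h2.symm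
    · obtain ⟨v, hv⟩ : ∃ v, spectralProj (S.symbEnd e) {-(τ j e : ℂ)} v ≠ 0 := by
        by_contra! h
        exact hP (LinearMap.ext h)
      have h1 := hτ.spectralProj_symbEnd_spectralProj he0 j e v
      rw [hτ.spectralProj_symbEnd he0, spectralProj_idem] at h1
      have h2 := smul_left_injective ℂ hv h1
      have h3 : τ j e = fderiv ℝ (τ j) e e := by exact_mod_cast neg_injective h2
      rw [abs_neg, h3]
      have h4 := (fderiv ℝ (τ j) e).le_opNorm e
      have h5 : ‖e‖ = 1 := by simp [he]
      rw [h5, mul_one] at h4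
      exact h4.trans (hV j e he0)
  · have : (∑ j, spectralProj (S.symbEnd e) {-(τ j e : ℂ)}) = LinearMap.id := by
      refine end_ext_maxGenEigenspace (S.symbEnd e) fun μ v hv => ?_
      rw [LinearMap.sum_apply, LinearMap.id_apply]
      by_cases hv0 : v = 0
      · simp [hv0]
      have hv' := hv
      rw [hτ.maxGenEigenspace_eq he0] at hv'
      obtain ⟨l, rfl⟩ := (hτ.hasEigenvalue_iff he0 μ).1
        (Module.End.hasEigenvalue_of_hasEigenvector ⟨hv', hv0⟩)
      rw [Finset.sum_eq_single l]
      · exact spectralProj_apply_of_mem (Set.mem_singleton _) hv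
      · intro j _ hj
        refine spectralProj_apply_of_notMem (fun h => hj ?_) hv
        exact (hτ.eigenvalues_injective he0 h).symm
      · simp
    simpa using LinearMap.congr_fun this v
  · rw [← hA]
    push_cast
    exact hτ.spectralProj_symbEnd he0 _ _

theorem _root_.MultiphaseOptics.BoundsGroupVelocities.nonneg (hN : 1 ≤ N) {V : ℝ}
    (hV : BoundsGroupVelocities τ V) : 0 ≤ V := by
  have he0 : (EuclideanSpace.single (Fin.last k) 1 : Euc (k + 1)) ≠ 0 := by
    intro h
    have := congrArg (fun w : Euc (k + 1) => ‖w‖) h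
    simp at this
  exact (norm_nonneg _).trans (hV ⟨0, hN⟩ _ he0)

end BVP.StrictlyHyperbolic

end

noncomputable section

variable {k m N : ℕ}

/-! ### Fourier series on the product of a cube and the torus -/

/-- The cube of side `2πL` centred at the origin. -/
def cube (k : ℕ) (L : ℝ) : Set (Euc (k + 1)) :=
  {z | ∀ i, z i ∈ Set.Ioc (-(Real.pi * L)) (Real.pi * L)}

/-- The phase `κ·p` of a joint frequency `κ` in `(z', θ)`, for functions that are `2πL`-periodic in
`z'` and `2π`-periodic in `θ`. -/
def phase (L : ℝ) (κ : Fin (k + 1) ⊕ Fin m → ℤ) (p : Euc (k + 1) × Euc m) : ℝ :=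
  ∑ i, (κ (Sum.inl i) / L : ℝ) * p.1 i + ∑ j, (κ (Sum.inr j) : ℝ) * p.2 j

/-- The exponential `e^{iκ·p}`. -/
def emode (L : ℝ) (κ : Fin (k + 1) ⊕ Fin m → ℤ) (p : Euc (k + 1) × Euc m) : ℂ :=
  Complex.exp (Complex.I * phase L κ p)

theorem norm_exp_I_mul_ofReal (x : ℝ) : ‖Complex.exp (Complex.I * x)‖ = 1 := by
  rw [mul_comm, Complex.norm_exp_ofReal_mul_I]

theorem norm_emode (L : ℝ) (κ : Fin (k + 1) ⊕ Fin m → ℤ) (p : Euc (k + 1) × Euc m) :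
    ‖emode L κ p‖ = 1 := norm_exp_I_mul_ofReal _

theorem contDiff_phase (L : ℝ) (κ : Fin (k + 1) ⊕ Fin m → ℤ) {n : WithTop ℕ∞} :
    ContDiff ℝ n (phase (k := k) (m := m) L κ) := by
  unfold phase
  fun_prop

theorem continuous_emode (L : ℝ) (κ : Fin (k + 1) ⊕ Fin m → ℤ) :
    Continuous (emode (k := k) (m := m) L κ) := by
  have := (contDiff_phase (k := k) (m := m) L κ (n := 0)).continuous
  unfold emode
  fun_prop

theorem emode_add (L : ℝ) (κ κ' : Fin (k + 1) ⊕ Fin m → ℤ) (p : Euc (k + 1) × Euc m) :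
    emode L (κ + κ') p = emode L κ p * emode L κ' p := by
  rw [emode, emode, emode, ← Complex.exp_add, ← mul_add, ← Complex.ofReal_add]
  congr 3
  simp only [phase, Pi.add_apply, Int.cast_add, add_div, add_mul, Finset.sum_add_distrib]
  ring

theorem emode_neg_mul (L : ℝ) (κ κ' : Fin (k + 1) ⊕ Fin m → ℤ) (p : Euc (k + 1) × Euc m) :
    emode L (-κ) p * emode L κ' p = emode L (κ' - κ) p := by
  rw [← emode_add, neg_add_eq_sub]

/-- The parametrization of `ℝ^d × ℝ^m` in which the cube times the box becomes a unit box. -/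
def torusParam (k m : ℕ) (L : ℝ) (hL : L ≠ 0) :
    (Fin (k + 1) ⊕ Fin m → ℝ) ≃L[ℝ] Euc (k + 1) × Euc m :=
  LinearEquiv.toContinuousLinearEquiv
  { toFun := fun x => (WithLp.toLp 2 fun i => 2 * Real.pi * L * x (Sum.inl i),
      WithLp.toLp 2 fun j => 2 * Real.pi * x (Sum.inr j))
    map_add' := fun x y => by ext i <;> simp [mul_add]
    map_smul' := fun r x => by ext i <;> simp <;> ring
    invFun := fun p => Sum.elim (fun i => p.1 i / (2 * Real.pi * L)) (fun j => p.2 j / (2 * Real.pi))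
    left_inv := fun x => by
      ext e
      have := Real.pi_ne_zero
      cases e <;> simp <;> field_simp
    right_inv := fun p => by
      have := Real.pi_ne_zero
      ext i
      · simp; field_simp
      · simp; field_simp }

theorem measurableSet_box : MeasurableSet (box m) := by
  have : box m = ⋂ j, (fun θ : Euc m => θ j) ⁻¹' Set.Ioc 0 (2 * Real.pi) := by
    ext θ; simp [box]
  rw [this]
  refine MeasurableSet.iInter fun j => ?_
  exact (by fun_prop : Measurable fun θ : Euc m => θ j) measurableSet_Ioc

theorem measurableSet_cube (L : ℝ) : MeasurableSet (cube k L) := by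
  have : cube k L = ⋂ j, (fun z : Euc (k + 1) => z j) ⁻¹'
      Set.Ioc (-(Real.pi * L)) (Real.pi * L) := by
    ext θ; simp [cube]
  rw [this]
  refine MeasurableSet.iInter fun j => ?_
  exact (by fun_prop : Measurable fun θ : Euc (k + 1) => θ j) measurableSet_Ioc

/-- The corner of the unit box that parametrizes the cube times the box. -/
def corner : Fin (k + 1) ⊕ Fin m → ℝ := Sum.elim (fun _ => -(1 / 2)) (fun _ => 0)

theorem torusParam_mem_iff {L : ℝ} (hL : 0 < L) (x : Fin (k + 1) ⊕ Fin m → ℝ) :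
    torusParam k m L hL.ne' x ∈ cube k L ×ˢ box m ↔
      ∀ e, x e ∈ Set.Ioc (corner e) (corner e + 1) := by
  have hpi := Real.pi_pos
  have h2 : 0 < Real.pi * L := by positivity
  have e1 : ∀ i, (torusParam k m L hL.ne' x).1 i = (Real.pi * L) * (2 * x (Sum.inl i)) := by
    intro i; simp [torusParam]; ring
  have e2 : ∀ i, (torusParam k m L hL.ne' x).2 i = Real.pi * (2 * x (Sum.inr i)) := by
    intro i; simp [torusParam]; ring
  simp only [Set.mem_prod, cube, box, Set.mem_ofPred_eq, Sum.forall, corner, Sum.elim_inl,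
    Sum.elim_inr, Set.mem_Ioc, e1, e2]
  refine and_congr (forall_congr' fun i => and_congr ?_ ?_) (forall_congr' fun i => and_congr ?_ ?_)
  · rw [show -(Real.pi * L) = (Real.pi * L) * (-1) by ring, mul_lt_mul_iff_right₀ h2]
    constructor <;> intro h <;> linarith
  · rw [show (Real.pi * L * (2 * x (Sum.inl i)) ≤ Real.pi * L ↔
      Real.pi * L * (2 * x (Sum.inl i)) ≤ Real.pi * L * 1) by rw [mul_one],
      mul_le_mul_iff_right₀ h2]
    constructor <;> intro h <;> linarith
  · rw [show (0 < Real.pi * (2 * x (Sum.inr i)) ↔ Real.pi * 0 < Real.pi * (2 * x (Sum.inr i))) by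
      rw [mul_zero], mul_lt_mul_iff_right₀ hpi]
    constructor <;> intro h <;> linarith
  · rw [mul_comm 2 Real.pi, mul_le_mul_iff_right₀ hpi]
    constructor <;> intro h <;> linarith

instance : (volume : Measure (Euc (k + 1) × Euc m)).IsAddHaarMeasure := by
  rw [Measure.volume_eq_prod]; infer_instance

attribute [local instance] instMeasureSpaceUnitAddCircle

/-- The torus maps to the cube times the box, preserving the measure up to a constant and carrying
the trigonometric monomials to the exponentials `e^{iκ·p}`. -/
theorem exists_torus_map (k m : ℕ) {L : ℝ} (hL : 0 < L) :
    ∃ (T : UnitAddTorus (Fin (k + 1) ⊕ Fin m) → Euc (k + 1) × Euc m) (c : ℝ), 0 < c ∧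
      MeasurePreserving T volume (ENNReal.ofReal c⁻¹ • torusMeasure (cube k L) m) ∧
      ∀ κ y, UnitAddTorus.mFourier κ y = emode L κ (T y) := by
  set Ψ := torusParam k m L hL.ne' with hΨ
  set a : Fin (k + 1) ⊕ Fin m → ℝ := corner with ha
  set A : Set (Fin (k + 1) ⊕ Fin m → ℝ) := {x | ∀ i, x i ∈ Set.Ioc (a i) (a i + 1)} with hA
  have hAm : MeasurableSet A := MeasurableSet.univ_pi' fun i => measurableSet_Ioc
  have hmap : Measure.map Ψ (volume : Measure (Fin (k + 1) ⊕ Fin m → ℝ)) =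
      Measure.addHaarScalarFactor (Measure.map Ψ volume)
        (volume : Measure (Euc (k + 1) × Euc m)) • volume :=
    Measure.isAddLeftInvariant_eq_smul _ _
  set c₀ := Measure.addHaarScalarFactor (Measure.map Ψ volume)
        (volume : Measure (Euc (k + 1) × Euc m)) with hc₀
  have hc₀pos : 0 < c₀ := Measure.addHaarScalarFactor_pos_of_isAddHaarMeasure _ _
  refine ⟨fun y => Ψ (UnitAddTorus.measurableEquivPiIoc a y).1, (c₀ : ℝ)⁻¹, by positivity, ?_, ?_⟩
  · have h1 := UnitAddTorus.measurePreserving_equivPiIoc a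
    have h2 : MeasurePreserving (Subtype.val : A → _) (Measure.comap Subtype.val volume)
      (volume.restrict A) := measurePreserving_subtype_coe hAm
    have h3 : MeasurePreserving Ψ volume (c₀ • (volume : Measure (Euc (k + 1) × Euc m))) :=
      ⟨Ψ.continuous.measurable, hmap⟩
    have h4 := h3.restrict_preimage ((measurableSet_cube (k := k) L).prod (measurableSet_box (m := m)))
    have h5 : Ψ ⁻¹' (cube k L ×ˢ box m) = A := by
      ext x
      exact torusParam_mem_iff hL x
    rw [h5, Measure.restrict_smul] at h4
    have h6 := h4.comp (h2.comp h1)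
    have h7 : (ENNReal.ofReal ((c₀ : ℝ)⁻¹)⁻¹ • torusMeasure (cube k L) m) =
        c₀ • volume.restrict (cube k L ×ˢ box m) := by
      rw [inv_inv, ENNReal.ofReal_coe_nnreal]; rfl
    rw [h7]
    exact h6
  · intro κ y
    have hy : y = fun i => (((UnitAddTorus.measurableEquivPiIoc a y).1 i : ℝ) : UnitAddCircle) := by
      rw [← UnitAddTorus.coe_symm_measurableEquivPiIoc_apply a]
      simp only [MeasurableEquiv.symm_apply_apply]
    have key : ∀ x : Fin (k + 1) ⊕ Fin m → ℝ,
        UnitAddTorus.mFourier κ (fun i => (x i : UnitAddCircle)) = emode L κ (Ψ x) := by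
      intro x
      simp only [UnitAddTorus.mFourier, ContinuousMap.coe_mk, fourier_coe_apply]
      rw [← Complex.exp_sum, emode]
      congr 1
      have hpi := Real.pi_ne_zero
      simp only [phase, hΨ, torusParam, LinearEquiv.coe_toContinuousLinearEquiv',
        LinearEquiv.coe_mk, LinearMap.coe_mk, AddHom.coe_mk, Fintype.sum_sum_type]
      push_cast
      rw [mul_add, Finset.mul_sum, Finset.mul_sum]
      have hLc : (L : ℂ) ≠ 0 := by exact_mod_cast hL.ne'
      congr 1
      · refine Finset.sum_congr rfl fun i _ => ?_
        field_simp
      · refine Finset.sum_congr rfl fun i _ => ?_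
        ring
    exact (congrArg (UnitAddTorus.mFourier κ) hy).trans (key _)

instance (L : ℝ) : IsFiniteMeasure (torusMeasure (cube k L) m) := by
  constructor
  rw [torusMeasure, Measure.restrict_apply_univ, Measure.volume_eq_prod, Measure.prod_prod]
  refine ENNReal.mul_lt_top ?_ ?_
  · refine (Bornology.IsBounded.subset (Metric.isBounded_closedBall (x := (0 : Euc (k + 1)))
      (r := Real.sqrt (k + 1) * (Real.pi * L))) fun z hz => ?_).measure_lt_top
    rw [mem_closedBall_zero_iff, EuclideanSpace.norm_eq]
    have : ∀ i, ‖z i‖ ^ 2 ≤ (Real.pi * L) ^ 2 := fun i => by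
      rw [Real.norm_eq_abs, sq_abs]
      exact sq_le_sq' (hz i).1.le (hz i).2
    have h0 : 0 ≤ Real.pi * L := by have := hz 0; linarith [this.1, this.2]
    rw [Real.sqrt_le_iff]
    refine ⟨by positivity, (Finset.sum_le_sum fun i _ => this i).trans_eq ?_⟩
    rw [Finset.sum_const, Finset.card_univ, Fintype.card_fin, mul_pow (Real.sqrt _),
      Real.sq_sqrt (by positivity)]
    simp
  · refine (Bornology.IsBounded.subset (Metric.isBounded_closedBall (x := (0 : Euc m))
      (r := Real.sqrt m * (2 * Real.pi))) fun z hz => ?_).measure_lt_top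
    rw [mem_closedBall_zero_iff, EuclideanSpace.norm_eq]
    have : ∀ i, ‖z i‖ ^ 2 ≤ (2 * Real.pi) ^ 2 := fun i => by
      rw [Real.norm_eq_abs, sq_abs]
      exact sq_le_sq' (by linarith [(hz i).1, Real.pi_pos]) (hz i).2
    rw [Real.sqrt_le_iff]
    refine ⟨by positivity, (Finset.sum_le_sum fun i _ => this i).trans_eq ?_⟩
    rw [Finset.sum_const, Finset.card_univ, Fintype.card_fin, mul_pow (Real.sqrt _),
      Real.sq_sqrt (by positivity)]
    simp

/-- **Parseval's identity** and orthogonality of the exponentials on the cube times the box. -/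
theorem exists_parseval (k m : ℕ) {L : ℝ} (hL : 0 < L) :
    ∃ c : ℝ, 0 < c ∧
      (∀ κ, ∫ p, emode L κ p ∂(torusMeasure (cube k L) m) = if κ = 0 then (c : ℂ) else 0) ∧
      ∀ (N : ℕ) (F : Euc (k + 1) × Euc m → CVec N), MemLp F 2 (torusMeasure (cube k L) m) →
        HasSum (fun κ => ‖∫ p, emode L (-κ) p • F p ∂(torusMeasure (cube k L) m)‖ ^ 2)
          (c * ∫ p, ‖F p‖ ^ 2 ∂(torusMeasure (cube k L) m)) := by
  obtain ⟨T, c, hc, hT, hmode⟩ := exists_torus_map k m hL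
  have hint : ∀ {E : Type} [NormedAddCommGroup E] [NormedSpace ℝ E]
      (F : Euc (k + 1) × Euc m → E), AEStronglyMeasurable F (torusMeasure (cube k L) m) →
      ∫ y, F (T y) = c⁻¹ • ∫ p, F p ∂(torusMeasure (cube k L) m) := by
    intro E _ _ F hF
    have h1 := integral_map (μ := volume) (φ := T) (f := F) hT.measurable.aemeasurable
      (by rw [hT.map_eq]; exact hF.smul_measure _)
    rw [hT.map_eq, integral_smul_measure, ENNReal.toReal_ofReal (by positivity)] at h1
    exact h1.symm
  have hscalar : ∀ F : Euc (k + 1) × Euc m → ℂ, MemLp F 2 (torusMeasure (cube k L) m) →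
        HasSum (fun κ => ‖∫ p, emode L (-κ) p • F p ∂(torusMeasure (cube k L) m)‖ ^ 2)
          (c * ∫ p, ‖F p‖ ^ 2 ∂(torusMeasure (cube k L) m)) := by
    intro F hF
    have hG : MemLp (F ∘ T) 2 volume :=
      (hF.smul_measure ENNReal.ofReal_ne_top).comp_measurePreserving hT
    have h1 := UnitAddTorus.hasSum_sq_mFourierCoeff hG.toLp
    have h2 : ∀ κ, UnitAddTorus.mFourierCoeff hG.toLp κ =
        c⁻¹ • ∫ p, emode L (-κ) p • F p ∂(torusMeasure (cube k L) m) := by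
      intro κ
      rw [← hint (fun p => emode L (-κ) p • F p)
        ((continuous_emode L (-κ)).aestronglyMeasurable.smul hF.1), UnitAddTorus.mFourierCoeff]
      refine integral_congr_ae ?_
      filter_upwards [hG.coeFn_toLp] with y hy
      rw [hy, hmode]; rfl
    have h3 : ∫ y, ‖hG.toLp (F ∘ T) y‖ ^ 2 =
        c⁻¹ • ∫ p, ‖F p‖ ^ 2 ∂(torusMeasure (cube k L) m) := by
      rw [← hint (fun p => ‖F p‖ ^ 2) (hF.1.norm.pow 2)]
      refine integral_congr_ae ?_
      filter_upwards [hG.coeFn_toLp] with y hy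
      rw [hy]; rfl
    rw [h3] at h1
    simp only [h2] at h1
    have h4 := h1.mul_left (c ^ 2)
    have e1 : c ^ 2 * c⁻¹ • ∫ p, ‖F p‖ ^ 2 ∂(torusMeasure (cube k L) m) =
        c * ∫ p, ‖F p‖ ^ 2 ∂(torusMeasure (cube k L) m) := by
      rw [smul_eq_mul]; field_simp
    rw [e1] at h4
    refine h4.congr_fun fun κ => ?_
    rw [norm_smul, mul_pow, norm_inv, Real.norm_eq_abs, abs_of_pos hc]
    field_simp
  refine ⟨c, hc, fun κ => ?_, fun N F hF => ?_⟩
  · have h1 := hint (emode L κ) (continuous_emode L κ).aestronglyMeasurable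
    have h2 : ∫ y, emode L κ (T y) = if κ = 0 then (1 : ℂ) else 0 := by
      simp only [← hmode]
      have h3 := orthonormal_iff_ite.1 (UnitAddTorus.orthonormal_mFourier
        (d := Fin (k + 1) ⊕ Fin m)) 0 κ
      simp only [ContinuousMap.inner_toLp, ← UnitAddTorus.mFourier_neg,
        ← UnitAddTorus.mFourier_add, neg_zero, add_zero] at h3
      refine h3.trans ?_
      simp [eq_comm]
    rw [h2] at h1
    have h4 : ∫ p, emode L κ p ∂(torusMeasure (cube k L) m) =
        c • (c⁻¹ • ∫ p, emode L κ p ∂(torusMeasure (cube k L) m)) := by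
      rw [smul_smul, mul_inv_cancel₀ hc.ne', one_smul]
    rw [h4, ← h1]
    split_ifs <;> simp
  · have hFi : ∀ i, MemLp (fun p => F p i) 2 (torusMeasure (cube k L) m) := fun i =>
      hF.continuousLinearMap_comp (EuclideanSpace.proj (𝕜 := ℂ) i)
    have h1 := hasSum_sum (s := Finset.univ) fun i _ => hscalar _ (hFi i)
    have h2 : ∀ κ, ∀ i, (∫ p, emode L (-κ) p • F p ∂(torusMeasure (cube k L) m)) i =
        ∫ p, emode L (-κ) p • F p i ∂(torusMeasure (cube k L) m) := by
      intro κ i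
      refine ((EuclideanSpace.proj (𝕜 := ℂ) i).integral_comp_comm ?_).symm
      have hb : Integrable F (torusMeasure (cube k L) m) := hF.integrable (by norm_num)
      refine hb.norm.mono ((continuous_emode L (-κ)).aestronglyMeasurable.smul hF.1) ?_
      filter_upwards with p
      rw [norm_smul, norm_emode, one_mul, norm_norm]
    have h3 : ∫ p, ‖F p‖ ^ 2 ∂(torusMeasure (cube k L) m) =
        ∑ i, ∫ p, ‖F p i‖ ^ 2 ∂(torusMeasure (cube k L) m) := by
      rw [← integral_finsetSum]
      · simp only [EuclideanSpace.norm_sq_eq]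
      · intro i _
        exact (hFi i).integrable_norm_pow (by norm_num)
    rw [h3, Finset.mul_sum]
    refine h1.congr_fun fun κ => ?_
    rw [EuclideanSpace.norm_sq_eq]
    exact Finset.sum_congr rfl fun i _ => by rw [h2]

end

noncomputable section

variable {k m N n : ℕ} {D : Set (Euc (k + 1))} {L : ℝ}

/-! ### Localized Fourier coefficients -/

/-- `φ` is a smooth cutoff in `z'`, supported inside `D` and inside the cube of side `2πL`. -/
structure IsCutoff (D : Set (Euc (k + 1))) (L : ℝ) (φ : Euc (k + 1) → ℝ) : Prop where
  smooth : ContDiff ℝ ∞ φ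
  compact : HasCompactSupport φ
  support : tsupport φ ⊆ interior D ∩ cube k L

theorem IsCutoff.fderiv_apply {φ : Euc (k + 1) → ℝ} (hφ : IsCutoff D L φ) (v : Euc (k + 1)) :
    IsCutoff D L fun z => fderiv ℝ φ z v where
  smooth := (hφ.smooth.fderiv_right (m := ∞) (by norm_num)).clm_apply contDiff_const
  compact := hφ.compact.fderiv_apply ℝ v
  support := (tsupport_fderiv_apply_subset ℝ v).trans hφ.support

theorem IsCutoff.apply_eq_zero {φ : Euc (k + 1) → ℝ} (hφ : IsCutoff D L φ) {z : Euc (k + 1)}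
    (hz : z ∉ D ∩ cube k L) : φ z = 0 := by
  by_contra h
  have := hφ.support (subset_tsupport φ h)
  exact hz ⟨interior_subset this.1, this.2⟩

theorem torusMeasure_eq_prod (D : Set (Euc (k + 1))) (m : ℕ) :
    torusMeasure D m = (volume.restrict D).prod (volume.restrict (box m)) := by
  rw [torusMeasure, Measure.volume_eq_prod, Measure.prod_restrict]

instance : IsFiniteMeasure (volume.restrict (box m)) := by
  constructor
  rw [Measure.restrict_apply_univ]
  refine (Bornology.IsBounded.subset (Metric.isBounded_closedBall (x := (0 : Euc m))
      (r := Real.sqrt m * (2 * Real.pi))) fun z hz => ?_).measure_lt_top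
  rw [mem_closedBall_zero_iff, EuclideanSpace.norm_eq]
  have : ∀ i, ‖z i‖ ^ 2 ≤ (2 * Real.pi) ^ 2 := fun i => by
    rw [Real.norm_eq_abs, sq_abs]
    exact sq_le_sq' (by linarith [(hz i).1, Real.pi_pos]) (hz i).2
  rw [Real.sqrt_le_iff]
  refine ⟨by positivity, (Finset.sum_le_sum fun i _ => this i).trans_eq ?_⟩
  rw [Finset.sum_const, Finset.card_univ, Fintype.card_fin, mul_pow (Real.sqrt _),
    Real.sq_sqrt (by positivity)]
  simp

/-- Integrals over `D × 𝕋^m` and `D' × 𝕋^m` agree for functions supported over `D ∩ D'`. -/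
theorem integral_torusMeasure_congr {E : Type*} [NormedAddCommGroup E] [NormedSpace ℝ E]
    {D D' : Set (Euc (k + 1))} (hD : MeasurableSet D) (hD' : MeasurableSet D')
    {F : Euc (k + 1) × Euc m → E} (hF : ∀ p, p.1 ∉ D ∩ D' → F p = 0) :
    ∫ p, F p ∂(torusMeasure D m) = ∫ p, F p ∂(torusMeasure D' m) := by
  have h1 : ∫ p, F p ∂(torusMeasure D m) = ∫ p, F p ∂(torusMeasure (D ∩ D') m) := by
    refine setIntegral_eq_of_subset_of_forall_sdiff_eq_zero (hD.prod measurableSet_box)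
      (Set.prod_mono Set.inter_subset_left le_rfl) fun p hp => hF p fun h => hp.2 ⟨h, hp.1.2⟩
  have h2 : ∫ p, F p ∂(torusMeasure D' m) = ∫ p, F p ∂(torusMeasure (D ∩ D') m) := by
    refine setIntegral_eq_of_subset_of_forall_sdiff_eq_zero (hD'.prod measurableSet_box)
      (Set.prod_mono Set.inter_subset_right le_rfl) fun p hp => hF p fun h => hp.2 ⟨h, hp.1.2⟩
  rw [h1, h2]

theorem memLp_torusMeasure_congr {E : Type*} [NormedAddCommGroup E] {q : ℝ≥0∞}
    {D D' : Set (Euc (k + 1))} (hD : MeasurableSet D) (hD' : MeasurableSet D')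
    {F : Euc (k + 1) × Euc m → E} (hF : ∀ p, p.1 ∉ D ∩ D' → F p = 0)
    (h : MemLp F q (torusMeasure D m)) : MemLp F q (torusMeasure D' m) := by
  have e1 : (torusMeasure D m).restrict ((D ∩ D') ×ˢ Set.univ) = torusMeasure (D ∩ D') m := by
    rw [torusMeasure, Measure.restrict_restrict ((hD.inter hD').prod MeasurableSet.univ),
      Set.prod_inter_prod, Set.univ_inter, Set.inter_right_comm, Set.inter_self]; rfl
  have e2 : (torusMeasure D' m).restrict ((D ∩ D') ×ˢ Set.univ) = torusMeasure (D ∩ D') m := by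
    rw [torusMeasure, Measure.restrict_restrict ((hD.inter hD').prod MeasurableSet.univ),
      Set.prod_inter_prod, Set.univ_inter, Set.inter_assoc, Set.inter_self]; rfl
  have e3 : ((D ∩ D') ×ˢ (Set.univ : Set (Euc m))).indicator F = F := by
    refine Set.indicator_eq_self.2 fun p hp => ?_
    by_contra h
    exact hp (hF p fun h' => h ⟨h', trivial⟩)
  rw [← e3, memLp_indicator_iff_restrict ((hD.inter hD').prod MeasurableSet.univ), e1] at h
  rw [← e3, memLp_indicator_iff_restrict ((hD.inter hD').prod MeasurableSet.univ), e2]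
  exact h

/-- The Fourier coefficient of `φ u`, up to a constant factor. -/
def coef (L : ℝ) (φ : Euc (k + 1) → ℝ) (u : L2 D m n) (κ : Fin (k + 1) ⊕ Fin m → ℤ) : CVec n :=
  ∫ p, emode L (-κ) p • φ p.1 • u p ∂(torusMeasure D m)

theorem IsCutoff.memLp_smul {φ : Euc (k + 1) → ℝ} (hφ : IsCutoff D L φ) (u : L2 D m n) :
    MemLp (fun p => φ p.1 • u p) 2 (torusMeasure D m) := by
  obtain ⟨C, hC⟩ := hφ.smooth.continuous.bounded_above_of_compact_support hφ.compact
  refine ((Lp.memLp u).const_smul C).mono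
    ((hφ.smooth.continuous.comp continuous_fst).aestronglyMeasurable.smul
      (Lp.aestronglyMeasurable u)) ?_
  filter_upwards with p
  rw [norm_smul, Pi.smul_apply, norm_smul]
  exact mul_le_mul_of_nonneg_right ((hC _).trans (le_abs_self _)) (norm_nonneg _)

/-- A product of a cutoff, a bounded function and a function of `L²` is integrable. -/
theorem integrable_cutoff_smul {φ : Euc (k + 1) → ℝ} (hφ : Continuous φ)
    (hc : HasCompactSupport φ) (u : L2 D m n) :
    Integrable (fun p => φ p.1 • u p) (torusMeasure D m) := by
  have h1 : MemLp φ 2 (volume.restrict D) := hφ.memLp_of_hasCompactSupport hc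
  have h2 : MemLp (fun p : Euc (k + 1) × Euc m => φ p.1) 2 (torusMeasure D m) := by
    rw [torusMeasure_eq_prod]
    exact h1.comp_fst _
  have h3 := (Lp.memLp u).smul h2 (r := 1)
  exact memLp_one_iff_integrable.1 h3

theorem integrable_bdd_smul {E : Type*} [NormedAddCommGroup E] [NormedSpace ℂ E]
    {F : Euc (k + 1) × Euc m → E} {μ : Measure (Euc (k + 1) × Euc m)}
    (hF : Integrable F μ) (κ : Fin (k + 1) ⊕ Fin m → ℤ) :
    Integrable (fun p => emode L κ p • F p) μ :=
  hF.mono ((continuous_emode L κ).aestronglyMeasurable.smul hF.1)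
    (by filter_upwards with p; rw [norm_smul, norm_emode, one_mul])

theorem IsCutoff.coef_add {φ : Euc (k + 1) → ℝ} (hφ : IsCutoff D L φ) (u v : L2 D m n)
    (κ : Fin (k + 1) ⊕ Fin m → ℤ) : coef L φ (u + v) κ = coef L φ u κ + coef L φ v κ := by
  rw [coef, coef, coef, ← integral_add]
  · refine integral_congr_ae ?_
    filter_upwards [Lp.coeFn_add u v] with p hp
    rw [hp, Pi.add_apply, smul_add, smul_add]
  · exact integrable_bdd_smul (integrable_cutoff_smul hφ.smooth.continuous hφ.compact u) _
  · exact integrable_bdd_smul (integrable_cutoff_smul hφ.smooth.continuous hφ.compact v) _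

theorem coef_smul (φ : Euc (k + 1) → ℝ) (c : ℂ) (u : L2 D m n)
    (κ : Fin (k + 1) ⊕ Fin m → ℤ) : coef L φ (c • u) κ = c • coef L φ u κ := by
  rw [coef, coef, ← integral_smul]
  refine integral_congr_ae ?_
  filter_upwards [Lp.coeFn_smul c u] with p hp
  rw [hp, Pi.smul_apply, smul_comm (φ p.1) c, smul_comm (emode L (-κ) p) c]

theorem integral_sq_norm_eq (u : L2 D m n) :
    ∫ p, ‖u p‖ ^ 2 ∂(torusMeasure D m) = ‖u‖ ^ 2 := by
  have h := L2.integral_inner_eq_sq_eLpNorm (𝕜 := ℂ) u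
  have h1 : ∀ p, inner ℂ (u p) (u p) = ((‖u p‖ ^ 2 : ℝ) : ℂ) := fun p => by
    rw [inner_self_eq_norm_sq_to_K]; push_cast; rfl
  simp only [h1] at h
  rw [integral_complex_ofReal] at h
  have h2 := Complex.ofReal_injective h
  rw [h2, Lp.norm_def, ← ENNReal.toReal_pow, eLpNorm_eq_lintegral_rpow_enorm_toReal (by simp) (by simp)]
  rw [← ENNReal.rpow_natCast, ← ENNReal.rpow_mul]
  simp [enorm_eq_nnnorm]

/-- **Parseval's identity** for the localized coefficients. -/
theorem exists_hasSum_coef (k m : ℕ) (hL : 0 < L) : ∃ c : ℝ, 0 < c ∧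
    ∀ (D : Set (Euc (k + 1))), MeasurableSet D → ∀ (φ : Euc (k + 1) → ℝ), IsCutoff D L φ →
      ∀ (n : ℕ) (u : L2 D m n),
      HasSum (fun κ => ‖coef L φ u κ‖ ^ 2) (c * ∫ p, ‖φ p.1 • u p‖ ^ 2 ∂(torusMeasure D m)) := by
  obtain ⟨c, hc, -, h⟩ := exists_parseval k m hL
  refine ⟨c, hc, fun D hD φ hφ n u => ?_⟩
  have hz : ∀ p : Euc (k + 1) × Euc m, p.1 ∉ D ∩ cube k L → φ p.1 • u p = 0 := fun p hp => by
    rw [hφ.apply_eq_zero hp, zero_smul]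
  have h1 := h n (fun p => φ p.1 • u p) (memLp_torusMeasure_congr hD (measurableSet_cube L) hz
    (hφ.memLp_smul u))
  rw [integral_torusMeasure_congr (F := fun p => ‖φ p.1 • u p‖ ^ 2) hD (measurableSet_cube L)
    (fun p hp => by simp [hz p hp])]
  refine h1.congr_fun fun κ => ?_
  rw [coef, integral_torusMeasure_congr hD (measurableSet_cube L)
    (fun p hp => by rw [hz p hp, smul_zero])]

/-- **Bessel's inequality** for the localized coefficients. -/
theorem IsCutoff.exists_sum_sq_coef_le {φ : Euc (k + 1) → ℝ} (hφ : IsCutoff D L φ)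
    (hL : 0 < L) (hD : MeasurableSet D) (m : ℕ) : ∃ C : ℝ, 0 < C ∧ ∀ (n : ℕ) (u : L2 D m n)
      (F : Finset (Fin (k + 1) ⊕ Fin m → ℤ)), ∑ κ ∈ F, ‖coef L φ u κ‖ ^ 2 ≤ C * ‖u‖ ^ 2 := by
  obtain ⟨c, hc, h⟩ := exists_hasSum_coef k m hL
  obtain ⟨B, hB⟩ := hφ.smooth.continuous.bounded_above_of_compact_support hφ.compact
  have hB0 : 0 ≤ B := (norm_nonneg _).trans (hB 0)
  refine ⟨c * (B ^ 2 + 1), by positivity, fun n u F => ?_⟩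
  have h1 := h D hD φ hφ n u
  refine (sum_le_hasSum F (fun _ _ => by positivity) h1).trans ?_
  rw [mul_assoc]
  refine mul_le_mul_of_nonneg_left ?_ hc.le
  rw [← integral_sq_norm_eq, ← integral_const_mul]
  have hu := (Lp.memLp u).integrable_norm_pow (by norm_num)
  refine integral_mono ((hφ.memLp_smul u).integrable_norm_pow (by norm_num))
    (hu.const_mul _) fun p => ?_
  simp only [norm_smul, mul_pow]
  refine mul_le_mul_of_nonneg_right ?_ (by positivity)
  have := pow_le_pow_left₀ (norm_nonneg _) (hB p.1) 2
  linarith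

theorem IsCutoff.exists_norm_coef_le {φ : Euc (k + 1) → ℝ} (hφ : IsCutoff D L φ)
    (hL : 0 < L) (hD : MeasurableSet D) (m : ℕ) : ∃ C : ℝ, 0 < C ∧ ∀ (n : ℕ) (u : L2 D m n)
      (κ : Fin (k + 1) ⊕ Fin m → ℤ), ‖coef L φ u κ‖ ≤ C * ‖u‖ := by
  obtain ⟨C, hC, h⟩ := hφ.exists_sum_sq_coef_le hL hD m
  refine ⟨Real.sqrt C, by positivity, fun n u κ => ?_⟩
  have := h n u {κ}
  rw [Finset.sum_singleton] at this
  refine le_of_sq_le_sq (this.trans_eq ?_) (by positivity)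
  rw [mul_pow, Real.sq_sqrt hC.le]

/-- The localized Fourier coefficient, as a continuous linear map on `L²`. -/
def IsCutoff.coefCLM {φ : Euc (k + 1) → ℝ} (hφ : IsCutoff D L φ) (hL : 0 < L)
    (hD : MeasurableSet D) (m n : ℕ) (κ : Fin (k + 1) ⊕ Fin m → ℤ) : L2 D m n →L[ℂ] CVec n :=
  LinearMap.mkContinuous
    { toFun := fun u => coef L φ u κ
      map_add' := fun u v => hφ.coef_add u v κ
      map_smul' := fun c u => coef_smul φ c u κ }
    (hφ.exists_norm_coef_le hL hD m).choose
    fun u => (hφ.exists_norm_coef_le hL hD m).choose_spec.2 n u κ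

/-! ### Weak derivatives and Fourier coefficients -/

/-- The phase as a linear form. -/
def phaseCLM (L : ℝ) (κ : Fin (k + 1) ⊕ Fin m → ℤ) : Euc (k + 1) × Euc m →L[ℝ] ℝ :=
  LinearMap.toContinuousLinearMap
    { toFun := phase L κ
      map_add' := fun p q => by
        simp only [phase, Prod.fst_add, Prod.snd_add, PiLp.add_apply, mul_add,
          Finset.sum_add_distrib]
        ring
      map_smul' := fun c p => by
        simp only [phase, Prod.smul_fst, Prod.smul_snd, PiLp.smul_apply, smul_eq_mul,
          RingHom.id_apply, mul_add, Finset.mul_sum]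
        congr 1 <;> exact Finset.sum_congr rfl fun _ _ => by ring }

theorem phaseCLM_apply (L : ℝ) (κ : Fin (k + 1) ⊕ Fin m → ℤ) (p : Euc (k + 1) × Euc m) :
    phaseCLM L κ p = phase L κ p := rfl

/-- The frequency of `e^{iκ·p}` in the coordinate direction `e`. -/
def freq (L : ℝ) (κ : Fin (k + 1) ⊕ Fin m → ℤ) : Fin (k + 1) ⊕ Fin m → ℝ
  | Sum.inl i => κ (Sum.inl i) / L
  | Sum.inr j => κ (Sum.inr j)

theorem phase_dir (L : ℝ) (κ : Fin (k + 1) ⊕ Fin m → ℤ) (e : Fin (k + 1) ⊕ Fin m) :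
    phase L κ (dir e) = freq L κ e := by
  rcases e with i | j
  · simp [phase, dir, freq, PiLp.single_apply]
  · simp [phase, dir, freq, PiLp.single_apply]

theorem freq_neg (L : ℝ) (κ : Fin (k + 1) ⊕ Fin m → ℤ) (e : Fin (k + 1) ⊕ Fin m) :
    freq L (-κ) e = -freq L κ e := by
  rcases e with i | j <;> simp [freq, neg_div]

theorem phase_add_single (L : ℝ) (κ : Fin (k + 1) ⊕ Fin m → ℤ) (z : Euc (k + 1)) (θ : Euc m)
    (j : Fin m) : phase L κ (z, θ + EuclideanSpace.single j (2 * Real.pi)) =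
      phase L κ (z, θ) + κ (Sum.inr j) * (2 * Real.pi) := by
  simp [phase, mul_add, Finset.sum_add_distrib, PiLp.single_apply]
  ring

/-- The derivative of a cutoff in the coordinate direction `e`. -/
def cutoffDeriv (φ : Euc (k + 1) → ℝ) : Fin (k + 1) ⊕ Fin m → Euc (k + 1) → ℝ
  | Sum.inl i => fun z => fderiv ℝ φ z (EuclideanSpace.single i 1)
  | Sum.inr _ => fun _ => 0

theorem IsCutoff.zero : IsCutoff D L (fun _ => 0) where
  smooth := contDiff_const
  compact := HasCompactSupport.zero
  support := by simp [tsupport]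

theorem IsCutoff.deriv_dir {φ : Euc (k + 1) → ℝ} (hφ : IsCutoff D L φ)
    (e : Fin (k + 1) ⊕ Fin m) : IsCutoff D L (cutoffDeriv φ e) := by
  rcases e with i | j
  · exact hφ.fderiv_apply _
  · exact IsCutoff.zero

theorem fderiv_comp_fst_dir {φ : Euc (k + 1) → ℝ} (hφ : Differentiable ℝ φ)
    (e : Fin (k + 1) ⊕ Fin m) (p : Euc (k + 1) × Euc m) :
    fderiv ℝ (fun p : Euc (k + 1) × Euc m => φ p.1) p (dir e) = cutoffDeriv φ e p.1 := by
  have : HasFDerivAt (fun p : Euc (k + 1) × Euc m => φ p.1)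
      ((fderiv ℝ φ p.1).comp (ContinuousLinearMap.fst ℝ _ _)) p :=
    (hφ p.1).hasFDerivAt.comp p hasFDerivAt_fst
  rw [this.fderiv]
  rcases e with i | j <;> simp [dir, cutoffDeriv]

/-- The product of a cutoff with a `2π`-periodic smooth function of the phase is a test function. -/
theorem IsCutoff.isTest {φ : Euc (k + 1) → ℝ} (hφ : IsCutoff D L φ) {g : ℝ → ℝ}
    (hg : ContDiff ℝ ∞ g) (hper : ∀ (t : ℝ) (i : ℤ), g (t + i * (2 * Real.pi)) = g t)
    (κ : Fin (k + 1) ⊕ Fin m → ℤ) :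
    IsTest D fun p : Euc (k + 1) × Euc m => φ p.1 * g (phase L κ p) where
  smooth := (hφ.smooth.comp contDiff_fst).mul (hg.comp (contDiff_phase L κ))
  periodic z θ j := by simp only [phase_add_single, hper]
  support := ⟨tsupport φ, hφ.compact, fun z hz => (hφ.support hz).1, fun z θ hz => by
    simp only [image_eq_zero_of_notMem_tsupport hz, zero_mul]⟩

theorem IsCutoff.fderiv_mul_phase {φ : Euc (k + 1) → ℝ} (hφ : IsCutoff D L φ) {g g' : ℝ → ℝ}
    (hg : ∀ t, HasDerivAt g (g' t) t) (κ : Fin (k + 1) ⊕ Fin m → ℤ) (e : Fin (k + 1) ⊕ Fin m)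
    (p : Euc (k + 1) × Euc m) :
    fderiv ℝ (fun p : Euc (k + 1) × Euc m => φ p.1 * g (phase L κ p)) p (dir e) =
      cutoffDeriv φ e p.1 * g (phase L κ p) + φ p.1 * (freq L κ e * g' (phase L κ p)) := by
  have hd : Differentiable ℝ φ := hφ.smooth.differentiable (by norm_num)
  have h1 : HasFDerivAt (fun p : Euc (k + 1) × Euc m => g (phase L κ p))
      (g' (phase L κ p) • phaseCLM L κ) p :=
    (hg (phase L κ p)).comp_hasFDerivAt p (phaseCLM L κ).hasFDerivAt
  have h2 : DifferentiableAt ℝ (fun p : Euc (k + 1) × Euc m => φ p.1) p :=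
    (hd p.1).comp p differentiableAt_fst
  have h3 := h2.hasFDerivAt.mul h1
  have h4 : fderiv ℝ (fun p : Euc (k + 1) × Euc m => φ p.1 * g (phase L κ p)) p = _ := h3.fderiv
  rw [h4]
  simp only [_root_.add_apply, _root_.smul_apply, smul_eq_mul,
    fderiv_comp_fst_dir hd, phaseCLM_apply, phase_dir]
  ring

theorem emode_eq_cos_sin (κ : Fin (k + 1) ⊕ Fin m → ℤ) (p : Euc (k + 1) × Euc m) :
    emode L κ p = (Real.cos (phase L κ p) : ℂ) + Complex.I * (Real.sin (phase L κ p) : ℝ) := by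
  rw [emode, mul_comm, Complex.exp_mul_I]
  push_cast; ring

/-- Differentiation of localized Fourier coefficients. -/
theorem IsWeakDeriv.coef_eq {φ : Euc (k + 1) → ℝ} (hφ : IsCutoff D L φ)
    {e : Fin (k + 1) ⊕ Fin m} {u v : L2 D m n} (h : IsWeakDeriv e u v)
    (κ : Fin (k + 1) ⊕ Fin m → ℤ) :
    (Complex.I * freq L κ e) • coef L φ u κ =
      coef L φ v κ + coef L (cutoffDeriv φ e) u κ := by
  have hφ' : IsCutoff D L (cutoffDeriv φ e) := hφ.deriv_dir e
  have hc := h _ (hφ.isTest Real.contDiff_cos Real.cos_add_int_mul_two_pi (-κ))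
  have hs := h _ (hφ.isTest Real.contDiff_sin Real.sin_add_int_mul_two_pi (-κ))
  simp only [hφ.fderiv_mul_phase Real.hasDerivAt_cos] at hc
  simp only [hφ.fderiv_mul_phase Real.hasDerivAt_sin] at hs
  have bdd : ∀ {ψ : Euc (k + 1) → ℝ}, IsCutoff D L ψ → ∀ (w : L2 D m n) {g : ℝ → ℝ},
      Continuous g → (∀ t, |g t| ≤ 1) →
      Integrable (fun p => (g (phase L (-κ) p)) • ψ p.1 • w p) (torusMeasure D m) := by
    intro ψ hψ w g hg hb
    refine (integrable_cutoff_smul hψ.smooth.continuous hψ.compact w).mono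
      ((hg.comp (contDiff_phase L (-κ) (n := 0)).continuous).aestronglyMeasurable.smul
        (integrable_cutoff_smul hψ.smooth.continuous hψ.compact w).1) ?_
    filter_upwards with p
    rw [norm_smul, Real.norm_eq_abs]
    exact mul_le_of_le_one_left (norm_nonneg _) (hb _)
  have split : ∀ {ψ : Euc (k + 1) → ℝ}, IsCutoff D L ψ → ∀ w : L2 D m n, coef L ψ w κ =
      ∫ p, (Real.cos (phase L (-κ) p)) • ψ p.1 • w p ∂(torusMeasure D m) + Complex.I •
      ∫ p, (Real.sin (phase L (-κ) p)) • ψ p.1 • w p ∂(torusMeasure D m) := by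
    intro ψ hψ w
    have h2 : Integrable (fun p => Complex.I • (Real.sin (phase L (-κ) p)) • ψ p.1 • w p)
      (torusMeasure D m) := (bdd hψ w Real.continuous_sin Real.abs_sin_le_one).smul Complex.I
    rw [← integral_smul, ← integral_add (bdd hψ w Real.continuous_cos Real.abs_cos_le_one) h2,
      coef]
    refine integral_congr_ae (Eventually.of_forall fun p => ?_)
    simp only [emode_eq_cos_sin, add_smul, mul_smul]
    rfl
  have ic := fun {ψ} (hψ : IsCutoff D L ψ) (w : L2 D m n) =>
    bdd hψ w Real.continuous_cos Real.abs_cos_le_one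
  have is := fun {ψ} (hψ : IsCutoff D L ψ) (w : L2 D m n) =>
    bdd hψ w Real.continuous_sin Real.abs_sin_le_one
  have hc' : ∫ p, (Real.cos (phase L (-κ) p)) • cutoffDeriv φ e p.1 • u p
        ∂(torusMeasure D m) + freq L κ e •
      ∫ p, (Real.sin (phase L (-κ) p)) • φ p.1 • u p ∂(torusMeasure D m) =
      -∫ p, (Real.cos (phase L (-κ) p)) • φ p.1 • v p ∂(torusMeasure D m) := by
    have h2 : Integrable (fun p => freq L κ e • (Real.sin (phase L (-κ) p)) • φ p.1 • u p)
      (torusMeasure D m) := (is hφ u).smul (freq L κ e)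
    rw [← integral_smul, ← integral_add (ic hφ' u) h2]
    refine Eq.trans ?_ (hc.trans ?_)
    · refine integral_congr_ae (Eventually.of_forall fun p => ?_)
      simp only [freq_neg, smul_smul, ← add_smul]
      congr 1; ring
    · congr 1
      refine integral_congr_ae (Eventually.of_forall fun p => ?_)
      simp only [smul_smul]; congr 1; ring
  have hs' : ∫ p, (Real.sin (phase L (-κ) p)) • cutoffDeriv φ e p.1 • u p
        ∂(torusMeasure D m) - freq L κ e •
      ∫ p, (Real.cos (phase L (-κ) p)) • φ p.1 • u p ∂(torusMeasure D m) =
      -∫ p, (Real.sin (phase L (-κ) p)) • φ p.1 • v p ∂(torusMeasure D m) := by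
    have h2 : Integrable (fun p => freq L κ e • (Real.cos (phase L (-κ) p)) • φ p.1 • u p)
      (torusMeasure D m) := (ic hφ u).smul (freq L κ e)
    rw [← integral_smul, ← integral_sub (is hφ' u) h2]
    refine Eq.trans ?_ (hs.trans ?_)
    · refine integral_congr_ae (Eventually.of_forall fun p => ?_)
      simp only [freq_neg, smul_smul, ← sub_smul]
      congr 1; ring
    · congr 1
      refine integral_congr_ae (Eventually.of_forall fun p => ?_)
      simp only [smul_smul]; congr 1; ring
  rw [split hφ u, split hφ v, split hφ' u, ← neg_eq_iff_eq_neg.2 hc', ← neg_eq_iff_eq_neg.2 hs']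
  generalize (∫ p, (Real.cos (phase L (-κ) p)) • φ p.1 • u p ∂(torusMeasure D m)) = A
  generalize (∫ p, (Real.sin (phase L (-κ) p)) • φ p.1 • u p ∂(torusMeasure D m)) = B
  have hr : ∀ (r : ℝ) (w : CVec n), r • w = (r : ℂ) • w := fun r w => (Complex.coe_smul r w).symm
  simp only [hr]
  match_scalars
  all_goals ring_nf
  all_goals simp

end

noncomputable section

variable {k m N n : ℕ} {D : Set (Euc (k + 1))} {L : ℝ}

/-! ### Sobolev regularity and decay of Fourier coefficients -/

theorem sobolevENorm_le_succ (s : ℕ) (u : L2 D m n) :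
    sobolevENorm s u ≤ sobolevENorm (s + 1) u := by
  induction s generalizing u with
  | zero => simp only [sobolevENorm]; exact le_self_add
  | succ s ih =>
    rw [sobolevENorm, sobolevENorm]
    gcongr with e _ v _
    exact ih v

theorem enorm_le_sobolevENorm (s : ℕ) (u : L2 D m n) : ‖u‖ₑ ≤ sobolevENorm s u := by
  cases s with
  | zero => exact le_rfl
  | succ s => rw [sobolevENorm]; exact le_self_add

theorem norm_le_of_sobolevENorm_le {s : ℕ} {u : L2 D m n} {K : ℝ} (hK : 0 ≤ K)
    (h : sobolevENorm s u ≤ ENNReal.ofReal K) : ‖u‖ ≤ K := by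
  have := (enorm_le_sobolevENorm s u).trans h
  rwa [← ofReal_norm, ENNReal.ofReal_le_ofReal_iff hK] at this

theorem exists_isWeakDeriv_of_lt {s : ℕ} {u : L2 D m n} {K : ℝ≥0∞}
    (h : sobolevENorm (s + 1) u < K) (e : Fin (k + 1) ⊕ Fin m) :
    ∃ v, IsWeakDeriv e u v ∧ sobolevENorm s v < K := by
  rw [sobolevENorm] at h
  have h1 : (⨅ v : L2 D m n, ⨅ _ : IsWeakDeriv e u v, sobolevENorm s v) < K :=
    (Finset.single_le_sum (f := fun e => ⨅ v : L2 D m n, ⨅ _ : IsWeakDeriv e u v,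
      sobolevENorm s v) (fun _ _ => zero_le) (Finset.mem_univ e)).trans_lt
      (le_add_self.trans_lt h)
  obtain ⟨v, hv⟩ := iInf_lt_iff.1 h1
  obtain ⟨hw, hv⟩ := iInf_lt_iff.1 hv
  exact ⟨v, hw, hv⟩

/-- By induction on `s`: a factor `freq L κ e` is traded for a weak derivative in the direction `e`,
up to a term in which the derivative falls on the cutoff. -/
theorem IsCutoff.exists_sum_freq_pow_le (hL : 0 < L) (hD : MeasurableSet D)
    (e : Fin (k + 1) ⊕ Fin m) (s : ℕ) : ∀ {φ : Euc (k + 1) → ℝ}, IsCutoff D L φ →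
    ∃ C : ℝ, 0 < C ∧ ∀ (n : ℕ) (u : L2 D m n) (K : ℝ), sobolevENorm s u < ENNReal.ofReal K →
      ∀ F : Finset (Fin (k + 1) ⊕ Fin m → ℤ),
        ∑ κ ∈ F, (|freq L κ e| ^ s * ‖coef L φ u κ‖) ^ 2 ≤ C * K ^ 2 := by
  induction s with
  | zero =>
    intro φ hφ
    obtain ⟨C, hC, h⟩ := hφ.exists_sum_sq_coef_le hL hD m
    refine ⟨C, hC, fun n u K hK F => ?_⟩
    have hK0 : 0 ≤ K := (ENNReal.ofReal_pos.1 (zero_le.trans_lt hK)).le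
    simp only [pow_zero, one_mul]
    refine (h n u F).trans (mul_le_mul_of_nonneg_left ?_ hC.le)
    exact pow_le_pow_left₀ (norm_nonneg _) (norm_le_of_sobolevENorm_le hK0 hK.le) 2
  | succ s ih =>
    intro φ hφ
    obtain ⟨C, hC, h⟩ := ih hφ
    obtain ⟨C', hC', h'⟩ := ih (hφ.deriv_dir e)
    refine ⟨2 * (C + C'), by positivity, fun n u K hK F => ?_⟩
    obtain ⟨v, hv, hvK⟩ := exists_isWeakDeriv_of_lt hK e
    have h1 := h n v K hvK F
    have h2 := h' n u K ((sobolevENorm_le_succ s u).trans_lt hK) F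
    calc ∑ κ ∈ F, (|freq L κ e| ^ (s + 1) * ‖coef L φ u κ‖) ^ 2
        ≤ ∑ κ ∈ F, (2 * (|freq L κ e| ^ s * ‖coef L φ v κ‖) ^ 2 +
          2 * (|freq L κ e| ^ s * ‖coef L (cutoffDeriv φ e) u κ‖) ^ 2) := by
          refine Finset.sum_le_sum fun κ _ => ?_
          have e1 : |freq L κ e| * ‖coef L φ u κ‖ =
              ‖coef L φ v κ + coef L (cutoffDeriv φ e) u κ‖ := by
            rw [← hv.coef_eq hφ κ, norm_smul, norm_mul, Complex.norm_I, one_mul,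
              Complex.norm_real, Real.norm_eq_abs]
          rw [pow_succ |freq L κ e| s, mul_assoc, e1]
          have e2 := norm_add_le (coef L φ v κ) (coef L (cutoffDeriv φ e) u κ)
          have e3 := pow_le_pow_left₀ (norm_nonneg _) e2 2
          simp only [mul_pow _ ‖_‖]
          have e4 : 0 ≤ (|freq L κ e| ^ s) ^ 2 := by positivity
          nlinarith [sq_nonneg (‖coef L φ v κ‖ - ‖coef L (cutoffDeriv φ e) u κ‖),
            mul_nonneg e4 (sq_nonneg (‖coef L φ v κ‖ - ‖coef L (cutoffDeriv φ e) u κ‖)),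
            mul_le_mul_of_nonneg_left e3 e4]
      _ ≤ 2 * (C + C') * K ^ 2 := by
          rw [Finset.sum_add_distrib, ← Finset.mul_sum, ← Finset.mul_sum]
          linarith

/-- Sobolev regularity of order `s` controls the localized coefficients in a weighted `ℓ²` space. -/
theorem IsCutoff.exists_sum_weight_le {φ : Euc (k + 1) → ℝ} (hφ : IsCutoff D L φ) (hL : 1 ≤ L)
    (hD : MeasurableSet D) (m s : ℕ) :
    ∃ C : ℝ, 0 < C ∧ ∀ (n : ℕ) (u : L2 D m n) (K : ℝ), sobolevENorm s u < ENNReal.ofReal K →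
      ∀ F : Finset (Fin (k + 1) ⊕ Fin m → ℤ),
        ∑ κ ∈ F, ((1 + ‖κ‖) ^ s * ‖coef L φ u κ‖) ^ 2 ≤ C * K ^ 2 := by
  have hL0 : 0 < L := by linarith
  obtain ⟨C₀, hC₀, h₀⟩ := hφ.exists_sum_sq_coef_le hL0 hD m
  choose C hC h using fun e : Fin (k + 1) ⊕ Fin m =>
    IsCutoff.exists_sum_freq_pow_le hL0 hD e s hφ
  set Q : ℝ := ((Fintype.card (Fin (k + 1) ⊕ Fin m) : ℕ) : ℝ) with hQ
  have hCs : 0 ≤ ∑ e, C e := Finset.sum_nonneg fun e _ => (hC e).le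
  refine ⟨(2 ^ (s - 1)) ^ 2 * (2 * (C₀ + Q * (L ^ s) ^ 2 * ∑ e, C e)), by positivity,
    fun n u K hK F => ?_⟩
  have hK0 : 0 ≤ K := (ENNReal.ofReal_pos.1 (zero_le.trans_lt hK)).le
  have key : ∀ κ : Fin (k + 1) ⊕ Fin m → ℤ, ((1 + ‖κ‖) ^ s * ‖coef L φ u κ‖) ^ 2 ≤
      (2 ^ (s - 1)) ^ 2 * (2 * (‖coef L φ u κ‖ ^ 2 + Q * (L ^ s) ^ 2 *
        ∑ e, (|freq L κ e| ^ s * ‖coef L φ u κ‖) ^ 2)) := by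
    intro κ
    have e1 : (1 + ‖κ‖) ^ s ≤ 2 ^ (s - 1) * (1 + ‖κ‖ ^ s) := by
      simpa using add_pow_le (zero_le_one (α := ℝ)) (norm_nonneg κ) s
    have e2 : ‖κ‖ ^ s ≤ ∑ e, L ^ s * |freq L κ e| ^ s := by
      obtain ⟨e, he⟩ : ∃ e, ‖κ‖ = ‖κ e‖ := by
        obtain ⟨e, -, he⟩ := Finset.exists_mem_eq_sup Finset.univ
          ⟨Sum.inl 0, Finset.mem_univ _⟩ (fun e => ‖κ e‖₊)
        exact ⟨e, by rw [Pi.norm_def, he]; rfl⟩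
      have e3 : ‖κ‖ ≤ L * |freq L κ e| := by
        rw [he, Int.norm_eq_abs]
        rcases e with i | j
        · rw [freq, abs_div, abs_of_pos hL0]; field_simp; rfl
        · rw [freq]; exact le_mul_of_one_le_left (abs_nonneg _) hL
      refine (pow_le_pow_left₀ (norm_nonneg _) e3 s).trans ?_
      rw [mul_pow]
      exact Finset.single_le_sum (f := fun e => L ^ s * |freq L κ e| ^ s)
        (fun _ _ => by positivity) (Finset.mem_univ e)
    have e4 : (∑ e, L ^ s * |freq L κ e| ^ s) ^ 2 ≤
        Q * (L ^ s) ^ 2 * ∑ e, (|freq L κ e| ^ s) ^ 2 := by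
      refine (sq_sum_le_card_mul_sum_sq).trans_eq ?_
      rw [Finset.card_univ, ← hQ, mul_assoc, Finset.mul_sum _ _ ((L ^ s) ^ 2)]
      simp only [mul_pow]
    have e5 : ((1 + ‖κ‖) ^ s) ^ 2 ≤ (2 ^ (s - 1)) ^ 2 * (2 * (1 + Q * (L ^ s) ^ 2 *
        ∑ e, (|freq L κ e| ^ s) ^ 2)) := by
      refine (pow_le_pow_left₀ (by positivity) e1 2).trans ?_
      rw [mul_pow]
      refine mul_le_mul_of_nonneg_left ?_ (by positivity)
      have := pow_le_pow_left₀ (by positivity) e2 2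
      nlinarith [sq_nonneg (‖κ‖ ^ s - 1)]
    simp only [mul_pow _ ‖_‖]
    refine (mul_le_mul_of_nonneg_right e5 (by positivity)).trans_eq ?_
    rw [← Finset.sum_mul]
    ring
  refine (Finset.sum_le_sum fun κ _ => key κ).trans ?_
  rw [← Finset.mul_sum, ← Finset.mul_sum, Finset.sum_add_distrib, ← Finset.mul_sum,
    Finset.sum_comm]
  have b1 := (h₀ n u F).trans (mul_le_mul_of_nonneg_left (pow_le_pow_left₀ (norm_nonneg _)
    (norm_le_of_sobolevENorm_le hK0 hK.le) 2) hC₀.le)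
  have b2 : ∑ e, ∑ κ ∈ F, (|freq L κ e| ^ s * ‖coef L φ u κ‖) ^ 2 ≤ ∑ e, C e * K ^ 2 :=
    Finset.sum_le_sum fun e _ => h e n u K hK F
  rw [← Finset.sum_mul] at b2
  have b3 := mul_le_mul_of_nonneg_left b2 (a := Q * (L ^ s) ^ 2) (by positivity)
  refine (mul_le_mul_of_nonneg_left (mul_le_mul_of_nonneg_left (add_le_add b1 b3)
    (by norm_num : (0 : ℝ) ≤ 2)) (by positivity : (0 : ℝ) ≤ (2 ^ (s - 1)) ^ 2)).trans_eq ?_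
  ring

/-- The weights `(1 + |κ|)^{-p}` are summable for `p` larger than the dimension. -/
theorem summable_weight {ι : Type*} [Fintype ι] {p : ℕ} (hp : Fintype.card ι < p) :
    Summable fun κ : ι → ℤ => ((1 + ‖κ‖) ^ p)⁻¹ := by
  classical
  let b := Pi.basisFun ℝ ι
  let Λ := Submodule.span ℤ (Set.range b)
  have hmem : ∀ κ : ι → ℤ, (fun i => (κ i : ℝ)) ∈ Λ := fun κ => by
    rw [show (fun i => (κ i : ℝ)) = ∑ i, κ i • b i by
      ext j; simp [b, Pi.single_apply]]
    exact Submodule.sum_mem _ fun i _ => Submodule.smul_mem _ _ (Submodule.subset_span ⟨i, rfl⟩)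
  have hrank : Module.finrank ℤ Λ = Fintype.card ι := by
    rw [ZLattice.rank ℝ]; simp
  have h1 := ZLattice.summable_norm_pow_inv (L := Λ) p (by rw [hrank]; exact hp)
  have hinj : Function.Injective fun κ : ι → ℤ => (⟨_, hmem κ⟩ : Λ) := fun κ κ' h => by
    ext i
    have : (κ i : ℝ) = κ' i := congrFun (congrArg Subtype.val h) i
    exact_mod_cast this
  have h2 := h1.comp_injective hinj
  refine Summable.of_norm_bounded_eventually h2 ?_
  rw [Filter.eventually_cofinite]
  refine (Set.finite_singleton (0 : ι → ℤ)).subset fun κ hκ => ?_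
  by_contra hne
  refine hκ ?_
  have h3 : ‖(⟨_, hmem κ⟩ : Λ)‖ = ‖κ‖ := by
    rw [Submodule.coe_norm, Pi.norm_def, Pi.norm_def]
    congr 1
  have h4 : 0 < ‖κ‖ := norm_pos_iff.2 hne
  simp only [Function.comp_apply]
  rw [norm_inv, h3, Real.norm_of_nonneg (by positivity)]
  rw [inv_pow]
  exact inv_anti₀ (by positivity) (pow_le_pow_left₀ h4.le (by linarith) p)

/-- Cauchy–Schwarz: weighted `ℓ²` bounds give a weighted `ℓ¹` bound. -/
theorem exists_sum_weight_one_le (ι : Type*) [Fintype ι] {s : ℕ} (hs : Fintype.card ι + 2 < 2 * s) :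
    ∃ C : ℝ, 0 < C ∧ ∀ (c : (ι → ℤ) → ℝ) (K : ℝ), 0 ≤ K → (∀ κ, 0 ≤ c κ) →
      (∀ F : Finset (ι → ℤ), ∑ κ ∈ F, ((1 + ‖κ‖) ^ s * c κ) ^ 2 ≤ K ^ 2) →
      ∀ F : Finset (ι → ℤ), ∑ κ ∈ F, (1 + ‖κ‖) * c κ ≤ C * K := by
  have h1 := summable_weight (ι := ι) (p := 2 * s - 2) (by omega)
  set W := ∑' κ : ι → ℤ, ((1 + ‖κ‖) ^ (2 * s - 2))⁻¹ with hW
  have hW0 : 0 ≤ W := tsum_nonneg fun κ => by positivity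
  refine ⟨Real.sqrt W + 1, by positivity, fun c K hK hc h F => ?_⟩
  have h2 : ∀ κ : ι → ℤ, (1 + ‖κ‖) * c κ = ((1 + ‖κ‖) ^ (s - 1))⁻¹ * ((1 + ‖κ‖) ^ s * c κ) := by
    intro κ
    have : (1 + ‖κ‖) ^ s = (1 + ‖κ‖) ^ (s - 1) * (1 + ‖κ‖) := by
      rw [← pow_succ]; congr 1; omega
    rw [this]
    have : (1 + ‖κ‖) ^ (s - 1) ≠ 0 := by positivity
    field_simp
  simp only [h2]
  have h3 := Finset.sum_mul_sq_le_sq_mul_sq F (fun κ => ((1 + ‖κ‖) ^ (s - 1))⁻¹)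
    (fun κ => (1 + ‖κ‖) ^ s * c κ)
  have h4 : ∑ κ ∈ F, (((1 + ‖κ‖) ^ (s - 1))⁻¹) ^ 2 ≤ W := by
    refine (Finset.sum_le_sum fun κ _ => le_of_eq ?_).trans
      (h1.sum_le_tsum F fun κ _ => by positivity)
    rw [inv_pow, ← pow_mul]; congr 2; omega
  have h5 := h3.trans (mul_le_mul h4 (h F) (Finset.sum_nonneg fun _ _ => by positivity) hW0)
  refine le_of_sq_le_sq (h5.trans ?_) (by positivity)
  rw [mul_pow]
  refine mul_le_mul_of_nonneg_right ?_ (by positivity)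
  nlinarith [Real.sq_sqrt hW0, Real.sqrt_nonneg W]

end

noncomputable section

variable {k m N n : ℕ} {D : Set (Euc (k + 1))} {T L : ℝ}

/-! ### Representation by absolutely convergent Fourier series -/

/-- The volume of the cube times the box. -/
def torusVol (k m : ℕ) (L : ℝ) : ℝ := (torusMeasure (cube k L) m).real Set.univ

theorem integral_emode_zero (k m : ℕ) (L : ℝ) :
    ∫ p, emode L (0 : Fin (k + 1) ⊕ Fin m → ℤ) p ∂(torusMeasure (cube k L) m) =
      torusVol k m L := by
  have : ∀ p, emode L (0 : Fin (k + 1) ⊕ Fin m → ℤ) p = 1 := fun p => by simp [emode, phase]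
  simp only [this, integral_const, torusVol]
  simp

theorem torusVol_pos (k m : ℕ) (hL : 0 < L) : 0 < torusVol k m L := by
  obtain ⟨c, hc, h, -⟩ := exists_parseval k m hL
  have := h 0
  rw [if_pos rfl, integral_emode_zero] at this
  rw [Complex.ofReal_injective this]; exact hc

theorem integral_emode (k m : ℕ) (hL : 0 < L) (κ : Fin (k + 1) ⊕ Fin m → ℤ) :
    ∫ p, emode L κ p ∂(torusMeasure (cube k L) m) = if κ = 0 then (torusVol k m L : ℂ) else 0 := by
  obtain ⟨c, hc, h, -⟩ := exists_parseval k m hL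
  have := h 0
  rw [if_pos rfl, integral_emode_zero] at this
  rw [h, this]

/-- A square-integrable function whose Fourier coefficients vanish is zero. -/
theorem ae_eq_zero_of_fourier (hL : 0 < L) {F : Euc (k + 1) × Euc m → CVec N}
    (hF : MemLp F 2 (torusMeasure (cube k L) m))
    (h : ∀ κ, ∫ p, emode L (-κ) p • F p ∂(torusMeasure (cube k L) m) = 0) :
    ∀ᵐ p ∂(torusMeasure (cube k L) m), F p = 0 := by
  obtain ⟨c, hc, -, hP⟩ := exists_parseval k m hL
  have h1 := hP N F hF
  simp only [h, norm_zero, ne_eq, OfNat.ofNat_ne_zero, not_false_eq_true, zero_pow] at h1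
  have h2 : ∫ p, ‖F p‖ ^ 2 ∂(torusMeasure (cube k L) m) = 0 := by
    have := h1.unique hasSum_zero
    exact (mul_eq_zero.1 this).resolve_left hc.ne'
  rw [integral_eq_zero_iff_of_nonneg (fun _ => by positivity)
    (hF.integrable_norm_pow (by norm_num))] at h2
  filter_upwards [h2] with p hp
  simpa using hp

theorem ae_torusMeasure_iff (hD : MeasurableSet D) {P : Euc (k + 1) × Euc m → Prop} :
    (∀ᵐ p ∂(torusMeasure D m), P p) ↔ ∀ᵐ p, p ∈ D ×ˢ box m → P p := by
  rw [torusMeasure, ae_restrict_iff' (hD.prod measurableSet_box)]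

theorem ae_ae_of_ae_torusMeasure {P : Euc (k + 1) × Euc m → Prop}
    (h : ∀ᵐ p ∂(torusMeasure D m), P p) :
    ∀ᵐ z ∂(volume.restrict D), ∀ᵐ θ ∂(volume.restrict (box m)), P (z, θ) := by
  rw [torusMeasure_eq_prod] at h
  exact Measure.ae_ae_of_ae_prod h

/-- The sum of an absolutely convergent trigonometric series. -/
def fourierSum (L : ℝ) (C : (Fin (k + 1) ⊕ Fin m → ℤ) → CVec N) (p : Euc (k + 1) × Euc m) :
    CVec N :=
  (torusVol k m L)⁻¹ • ∑' κ, emode L κ p • C κ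

theorem continuous_fourierSum {C : (Fin (k + 1) ⊕ Fin m → ℤ) → CVec N}
    (hC : Summable fun κ => ‖C κ‖) : Continuous (fourierSum L C) := by
  have h : Continuous fun p : Euc (k + 1) × Euc m => ∑' κ, emode L κ p • C κ :=
    continuous_tsum (fun κ => (continuous_emode L κ).smul continuous_const) hC fun κ p => by
      rw [norm_smul, norm_emode, one_mul]
  unfold fourierSum
  exact h.const_smul (torusVol k m L)⁻¹

theorem norm_fourierSum_le (hL : 0 < L) {C : (Fin (k + 1) ⊕ Fin m → ℤ) → CVec N}
    (hC : Summable fun κ => ‖C κ‖) (p : Euc (k + 1) × Euc m) :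
    ‖fourierSum L C p‖ ≤ (torusVol k m L)⁻¹ * ∑' κ, ‖C κ‖ := by
  have h0 := torusVol_pos k m hL
  rw [fourierSum, norm_smul, Real.norm_of_nonneg (inv_nonneg.2 h0.le)]
  refine mul_le_mul_of_nonneg_left ?_ (inv_nonneg.2 h0.le)
  have : ∀ κ, ‖emode L κ p • C κ‖ = ‖C κ‖ := fun κ => by rw [norm_smul, norm_emode, one_mul]
  refine (norm_tsum_le_tsum_norm (by simpa only [this] using hC)).trans_eq ?_
  simp only [this]

theorem integral_emode_smul_fourierSum (hL : 0 < L) {C : (Fin (k + 1) ⊕ Fin m → ℤ) → CVec N}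
    (hC : Summable fun κ => ‖C κ‖) (κ : Fin (k + 1) ⊕ Fin m → ℤ) :
    ∫ p, emode L (-κ) p • fourierSum L C p ∂(torusMeasure (cube k L) m) = C κ := by
  have h0 := torusVol_pos k m hL
  have h1 : ∀ p, emode L (-κ) p • fourierSum L C p =
      (torusVol k m L)⁻¹ • ∑' κ', emode L (κ' - κ) p • C κ' := fun p => by
    rw [fourierSum, smul_comm (emode L (-κ) p), ← tsum_const_smul'']
    simp only [smul_smul, emode_neg_mul]
  have h2 := hasSum_integral_of_summable_integral_norm (μ := torusMeasure (cube k L) m)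
    (F := fun κ' p => emode L (κ' - κ) p • C κ')
    (fun κ' => by
      refine (integrable_const (C κ')).mono
        ((continuous_emode L _).aestronglyMeasurable.smul aestronglyMeasurable_const) ?_
      filter_upwards with p
      rw [norm_smul, norm_emode, one_mul])
    (by
      simp only [norm_smul, norm_emode, one_mul, integral_const, smul_eq_mul]
      exact hC.mul_left _)
  simp only [h1]
  rw [integral_smul, ← h2.tsum_eq]
  have h3 : ∀ κ', ∫ p, emode L (κ' - κ) p • C κ' ∂(torusMeasure (cube k L) m) =
      if κ' = κ then (torusVol k m L) • C κ else 0 := by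
    intro κ'
    rw [integral_smul_const, integral_emode k m hL]
    by_cases h : κ' = κ
    · subst h; simp
    · rw [if_neg (sub_ne_zero.2 h), if_neg h, zero_smul]
  simp only [h3, tsum_ite_eq]
  rw [smul_smul, inv_mul_cancel₀ h0.ne', one_smul]

/-- A localized function of `L²` whose Fourier coefficients are summable is the sum of its Fourier
series. -/
theorem IsCutoff.ae_eq_fourierSum {φ : Euc (k + 1) → ℝ} (hφ : IsCutoff D L φ) (hL : 0 < L)
    (hD : MeasurableSet D) (u : L2 D m n) (hs : Summable fun κ => ‖coef L φ u κ‖) :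
    ∀ᵐ p ∂(torusMeasure D m), p.1 ∈ cube k L → φ p.1 • u p = fourierSum L (coef L φ u) p := by
  have hz : ∀ p : Euc (k + 1) × Euc m, p.1 ∉ D ∩ cube k L → φ p.1 • u p = 0 := fun p hp => by
    rw [hφ.apply_eq_zero hp, zero_smul]
  have hm := memLp_torusMeasure_congr hD (measurableSet_cube L) hz (hφ.memLp_smul u)
  have hg : MemLp (fourierSum L (coef L φ u)) 2 (torusMeasure (cube k L) m) :=
    MemLp.of_bound (continuous_fourierSum hs).aestronglyMeasurable _
      (Eventually.of_forall (norm_fourierSum_le hL hs))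
  have h1 := ae_eq_zero_of_fourier hL (hm.sub hg) fun κ => by
    have e1 := integrable_bdd_smul (L := L) (hm.integrable (by norm_num)) (-κ)
    have e2 := integrable_bdd_smul (L := L) (hg.integrable (by norm_num)) (-κ)
    simp only [Pi.sub_apply, smul_sub]
    rw [integral_sub e1 e2, integral_emode_smul_fourierSum hL hs, coef,
      integral_torusMeasure_congr hD (measurableSet_cube L)
      (fun p hp => by rw [hz p hp, smul_zero]), sub_self]
  rw [ae_torusMeasure_iff (measurableSet_cube L)] at h1
  rw [ae_torusMeasure_iff hD]
  filter_upwards [h1] with p hp hpD hpc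
  have := hp ⟨hpc, hpD.2⟩
  rwa [Pi.sub_apply, sub_eq_zero] at this

/-! ### Partial Fourier coefficients -/

/-- The exponential `e^{iν·θ}`. -/
def tmode (ν : Fin m → ℤ) (θ : Euc m) : ℂ := Complex.exp (Complex.I * ∑ j, (ν j : ℂ) * θ j)

/-- The exponential `e^{iκ·z'/L}`. -/
def zmode (L : ℝ) (κ : Fin (k + 1) → ℤ) (z : Euc (k + 1)) : ℂ :=
  Complex.exp (Complex.I * (∑ i, (κ i / L : ℝ) * z i : ℝ))

theorem norm_zmode (L : ℝ) (κ : Fin (k + 1) → ℤ) (z : Euc (k + 1)) : ‖zmode L κ z‖ = 1 :=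
  norm_exp_I_mul_ofReal _

theorem norm_tmode (ν : Fin m → ℤ) (θ : Euc m) : ‖tmode ν θ‖ = 1 := by
  have : ∑ j, (ν j : ℂ) * θ j = ((∑ j, (ν j : ℝ) * θ j : ℝ) : ℂ) := by push_cast; rfl
  rw [tmode, this, norm_exp_I_mul_ofReal]

theorem continuous_zmode (L : ℝ) (κ : Fin (k + 1) → ℤ) : Continuous (zmode L κ) := by
  unfold zmode; fun_prop

theorem continuous_tmode (ν : Fin m → ℤ) : Continuous (tmode ν) := by
  unfold tmode; fun_prop

theorem emode_sumElim (L : ℝ) (κ : Fin (k + 1) → ℤ) (ν : Fin m → ℤ) (z : Euc (k + 1)) (θ : Euc m) :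
    emode L (Sum.elim κ ν) (z, θ) = zmode L κ z * tmode ν θ := by
  rw [emode, zmode, tmode, ← Complex.exp_add, ← mul_add]
  congr 2
  simp [phase]

theorem tmode_add (ν ν' : Fin m → ℤ) (θ : Euc m) : tmode (ν + ν') θ = tmode ν θ * tmode ν' θ := by
  rw [tmode, tmode, tmode, ← Complex.exp_add, ← mul_add]
  congr 2
  simp [add_mul, Finset.sum_add_distrib]

theorem tmode_zero (θ : Euc m) : tmode 0 θ = 1 := by simp [tmode]

theorem exp_neg_eq_tmode (ν : Fin m → ℤ) (θ : Euc m) :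
    Complex.exp (-Complex.I * ∑ j, (ν j : ℂ) * θ j) = tmode (-ν) θ := by
  rw [tmode]
  simp

theorem thetaCoef_eq (u : L2 D m n) (ν : Fin m → ℤ) (z : Euc (k + 1)) :
    thetaCoef u ν z = ((2 * Real.pi) ^ m)⁻¹ • ∫ θ in box m, tmode (-ν) θ • u (z, θ) := by
  rw [thetaCoef]
  simp only [exp_neg_eq_tmode]

theorem volume_real_box : (volume : Measure (Euc m)).real (box m) = (2 * Real.pi) ^ m := by
  have h := (EuclideanSpace.volume_preserving_symm_measurableEquiv_toLp (Fin m))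
  have e : box m = (MeasurableEquiv.toLp 2 (Fin m → ℝ)).symm ⁻¹'
      (Set.univ.pi fun _ => Set.Ioc 0 (2 * Real.pi)) := by
    ext θ; simp [box]
  rw [Measure.real, e, h.measure_preimage (MeasurableSet.univ_pi fun _ =>
    measurableSet_Ioc).nullMeasurableSet, volume_pi_pi]
  simp [Real.volume_Ioc, ENNReal.toReal_ofReal Real.pi_pos.le]

/-- Orthogonality of the exponentials on the torus. -/
theorem integral_tmode (ν : Fin m → ℤ) :
    ∫ θ in box m, tmode ν θ = if ν = 0 then (((2 * Real.pi) ^ m : ℝ) : ℂ) else 0 := by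
  split_ifs with h
  · subst h
    simp only [tmode_zero, setIntegral_const, volume_real_box]
    simp
  · have h1 := integral_emode 0 m one_pos (Sum.elim 0 ν)
    have h2 : (Sum.elim 0 ν : Fin (0 + 1) ⊕ Fin m → ℤ) ≠ 0 := fun h' => h (by
      ext j; simpa using congrFun h' (Sum.inr j))
    rw [if_neg h2, torusMeasure_eq_prod] at h1
    have h3 : ∀ p : Euc (0 + 1) × Euc m, emode 1 (Sum.elim 0 ν) p = zmode 1 0 p.1 * tmode ν p.2 :=
      fun p => emode_sumElim _ _ _ _ _
    simp only [h3] at h1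
    rw [integral_prod_mul] at h1
    refine (mul_eq_zero.1 h1).resolve_left ?_
    have h4 : ∀ z : Euc (0 + 1), zmode 1 0 z = 1 := fun z => by simp [zmode]
    simp only [h4, setIntegral_const]
    have h5 := torusVol_pos 0 m one_pos
    rw [torusVol, torusMeasure_eq_prod, Measure.real, ← Set.univ_prod_univ,
      Measure.prod_prod, ENNReal.toReal_mul, Measure.restrict_apply_univ] at h5
    have h6 := left_ne_zero_of_mul h5.ne'
    simpa [Measure.real] using h6

/-- The part of a trigonometric series of frequency `ν` in `θ`. -/
def fourierPart (m : ℕ) (L : ℝ) (C : (Fin (k + 1) → ℤ) → CVec N) (z : Euc (k + 1)) : CVec N :=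
  (torusVol k m L)⁻¹ • ∑' κ, zmode L κ z • C κ

theorem hasSum_sumElim {E : Type*} [NormedAddCommGroup E] [CompleteSpace E]
    {C : (Fin (k + 1) ⊕ Fin m → ℤ) → E} (hC : Summable fun κ => ‖C κ‖) :
    ∑' κ, C κ = ∑' ν : Fin m → ℤ, ∑' κ : Fin (k + 1) → ℤ, C (Sum.elim κ ν) := by
  let e : (Fin m → ℤ) × (Fin (k + 1) → ℤ) ≃ (Fin (k + 1) ⊕ Fin m → ℤ) :=
    (Equiv.prodComm _ _).trans (Equiv.sumArrowEquivProdArrow _ _ _).symm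
  rw [← e.tsum_eq]
  exact (e.summable_iff.2 hC.of_norm).tsum_prod

/-- Integrating a trigonometric series against `e^{-iν·θ}`. -/
theorem integral_tmode_smul_fourierSum {C : (Fin (k + 1) ⊕ Fin m → ℤ) → CVec N}
    (hC : Summable fun κ => ‖C κ‖) (ν : Fin m → ℤ) (z : Euc (k + 1)) :
    ((2 * Real.pi) ^ m)⁻¹ • ∫ θ in box m, tmode (-ν) θ • fourierSum L C (z, θ) =
      fourierPart m L (fun κ => C (Sum.elim κ ν)) z := by
  have h1 : ∀ θ, tmode (-ν) θ • fourierSum L C (z, θ) =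
      (torusVol k m L)⁻¹ • ∑' κ, (tmode (-ν) θ * emode L κ (z, θ)) • C κ := fun θ => by
    rw [fourierSum, smul_comm (tmode (-ν) θ), ← tsum_const_smul'']
    simp only [smul_smul]
  have h2 := hasSum_integral_of_summable_integral_norm (μ := volume.restrict (box m))
    (F := fun κ θ => (tmode (-ν) θ * emode L κ (z, θ)) • C κ)
    (fun κ => by
      have : Continuous fun θ => tmode (-ν) θ * emode L κ (z, θ) :=
        (continuous_tmode _).mul ((continuous_emode L κ).comp (by fun_prop))
      refine (integrable_const (C κ)).mono
        (this.aestronglyMeasurable.smul aestronglyMeasurable_const) ?_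
      filter_upwards with p
      rw [norm_smul, norm_mul, norm_tmode, norm_emode, one_mul, one_mul])
    (by
      simp only [norm_smul, norm_mul, norm_tmode, norm_emode, one_mul, integral_const, smul_eq_mul]
      exact hC.mul_left _)
  simp only [h1]
  rw [integral_smul, ← h2.tsum_eq, fourierPart, smul_comm]
  congr 1
  have h3 : ∀ (κ : Fin (k + 1) → ℤ) (ν' : Fin m → ℤ),
      ∫ θ in box m, (tmode (-ν) θ * emode L (Sum.elim κ ν') (z, θ)) • C (Sum.elim κ ν') =
      if ν' = ν then ((2 * Real.pi) ^ m) • zmode L κ z • C (Sum.elim κ ν) else 0 := by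
    intro κ ν'
    have : ∀ θ, tmode (-ν) θ * emode L (Sum.elim κ ν') (z, θ) =
        zmode L κ z * tmode (ν' - ν) θ := fun θ => by
      rw [emode_sumElim, sub_eq_add_neg, tmode_add]; ring
    simp only [this]
    rw [integral_smul_const, integral_const_mul, integral_tmode]
    by_cases h : ν' = ν
    · subst h
      rw [sub_self, if_pos rfl, if_pos rfl, mul_comm, mul_smul, Complex.coe_smul]
    · rw [if_neg (sub_ne_zero.2 h), if_neg h, mul_zero, zero_smul]
  have h4 : Summable fun κ : Fin (k + 1) ⊕ Fin m → ℤ =>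
      ‖∫ θ in box m, (tmode (-ν) θ * emode L κ (z, θ)) • C κ‖ := by
    refine (hC.mul_left ((2 * Real.pi) ^ m)).of_nonneg_of_le (fun _ => norm_nonneg _) fun κ => ?_
    refine (norm_integral_le_integral_norm _).trans_eq ?_
    simp only [norm_smul, norm_mul, norm_tmode, norm_emode, one_mul, setIntegral_const,
      volume_real_box, smul_eq_mul]
  rw [hasSum_sumElim h4]
  simp only [h3]
  rw [tsum_eq_single ν fun ν' h => by simp [h]]
  simp only [if_true]
  rw [tsum_const_smul'', smul_smul, inv_mul_cancel₀ (by have := Real.pi_pos; positivity), one_smul]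

/-- The Fourier coefficients in `θ` of a localized function. -/
theorem IsCutoff.ae_thetaCoef_eq {φ : Euc (k + 1) → ℝ} (hφ : IsCutoff D L φ) (hL : 0 < L)
    (hD : MeasurableSet D) (u : L2 D m n) (hs : Summable fun κ => ‖coef L φ u κ‖) :
    ∀ᵐ z ∂(volume.restrict D), z ∈ cube k L → ∀ ν, φ z • thetaCoef u ν z =
      fourierPart m L (fun κ => coef L φ u (Sum.elim κ ν)) z := by
  filter_upwards [ae_ae_of_ae_torusMeasure (hφ.ae_eq_fourierSum hL hD u hs)] with z hz hc ν
  rw [← integral_tmode_smul_fourierSum hs, thetaCoef_eq, smul_comm, ← integral_smul]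
  congr 1
  refine integral_congr_ae ?_
  filter_upwards [hz] with θ hθ
  rw [← hθ hc, smul_comm]

/-! ### Cutoffs and uniqueness of weak derivatives -/

theorem measurableSet_omegaT (T : ℝ) : MeasurableSet (omegaT k T) :=
  measurableSet_le (by fun_prop) measurable_const

theorem isOpen_lt_time (T : ℝ) : IsOpen {z : Euc (k + 1) | z 0 < T} :=
  isOpen_lt (by fun_prop) continuous_const

theorem lt_time_subset_interior (T : ℝ) : {z : Euc (k + 1) | z 0 < T} ⊆ interior (omegaT k T) :=
  interior_maximal (fun z (hz : z 0 < T) => (hz.le : z 0 ≤ T)) (isOpen_lt_time T)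

theorem IsCutoff.mem_cube {φ : Euc (k + 1) → ℝ} (hφ : IsCutoff D L φ) {z : Euc (k + 1)}
    (hz : φ z = 1) : z ∈ cube k L :=
  (hφ.support (subset_tsupport φ (by rw [Function.mem_support, hz]; exact one_ne_zero))).2

/-- Every compact set in the interior of `D` carries a cutoff. -/
theorem exists_isCutoff {K : Set (Euc (k + 1))} (hK : IsCompact K) (hKD : K ⊆ interior D) :
    ∃ L : ℝ, 1 ≤ L ∧ ∃ φ, IsCutoff D L φ ∧ ∀ z ∈ K, φ z = 1 := by
  obtain ⟨K', hK', hKK', hK'D⟩ := exists_compact_between hK isOpen_interior hKD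
  obtain ⟨R, hR⟩ := hK'.isBounded.exists_norm_le
  obtain ⟨f, hf0, hf1, -⟩ := exists_contMDiffMap_one_nhds_of_subset_interior (n := (⊤ : ℕ∞))
    (modelWithCornersSelf ℝ (Euc (k + 1))) hK.isClosed hKK'
  have hsupp : tsupport f ⊆ K' := by
    refine closure_minimal (fun z hz => ?_) hK'.isClosed
    by_contra h
    exact hz (hf1 z h)
  have hpi := Real.pi_gt_three
  refine ⟨|R| + 1, by linarith [abs_nonneg R], f, ⟨f.contMDiff.contDiff, ?_, ?_⟩, fun z hz => ?_⟩
  · exact hK'.of_isClosed_subset (isClosed_tsupport _) hsupp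
  · refine fun z hz => ⟨hK'D (hsupp hz), fun i => ?_⟩
    have h1 : |z i| ≤ R := by
      rw [← Real.norm_eq_abs]
      exact (PiLp.norm_apply_le z i).trans (hR z (hsupp hz))
    have h2 : R < Real.pi * (|R| + 1) := by nlinarith [abs_nonneg R, le_abs_self R]
    exact ⟨by linarith [neg_abs_le (z i)], by linarith [le_abs_self (z i)]⟩
  · exact (Filter.Eventually.self_of_nhdsSet hf0) z hz

theorem ae_apply_zero_ne (T : ℝ) : ∀ᵐ z : Euc (k + 1), z 0 ≠ T := by
  have h2 : ∀ᵐ x : Fin (k + 1) → ℝ, x 0 ≠ T := by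
    rw [ae_iff]
    simp only [not_not]
    exact Measure.pi_hyperplane (fun _ : Fin (k + 1) => (volume : Measure ℝ)) 0 T
  exact (EuclideanSpace.volume_preserving_symm_measurableEquiv_toLp
    (Fin (k + 1))).quasiMeasurePreserving.ae h2

theorem ae_time_lt (T : ℝ) : ∀ᵐ p ∂(torusMeasure (omegaT k T) m), p.1 0 < T := by
  rw [ae_torusMeasure_iff (measurableSet_omegaT T)]
  filter_upwards [Measure.quasiMeasurePreserving_fst.ae (ae_apply_zero_ne T)] with p hp hpD
  exact lt_of_le_of_ne hpD.1 hp

/-- The compact sets that exhaust the interior of `ω_T`. -/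
def exhaust (k : ℕ) (T : ℝ) (j : ℕ) : Set (Euc (k + 1)) :=
  Metric.closedBall 0 j ∩ {z | z 0 ≤ T - 1 / (j + 1)}

theorem isCompact_exhaust (j : ℕ) : IsCompact (exhaust k T j) :=
  (isCompact_closedBall _ _).inter_right (isClosed_le (by fun_prop) continuous_const)

theorem exhaust_subset (j : ℕ) : exhaust k T j ⊆ {z | z 0 < T} := fun z hz =>
  lt_of_le_of_lt hz.2 (sub_lt_self T (by positivity : (0 : ℝ) < 1 / (j + 1)))

theorem exists_mem_exhaust {z : Euc (k + 1)} (hz : z 0 < T) : ∃ j, z ∈ exhaust k T j := by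
  obtain ⟨j₁, hj₁⟩ := exists_nat_ge ‖z‖
  obtain ⟨j₂, hj₂⟩ := exists_nat_one_div_lt (sub_pos.2 hz)
  refine ⟨max j₁ j₂, ?_, ?_⟩
  · rw [mem_closedBall_zero_iff]
    exact hj₁.trans (by exact_mod_cast le_max_left _ _)
  · have : 1 / ((max j₁ j₂ : ℕ) + 1 : ℝ) ≤ 1 / ((j₂ : ℝ) + 1) := by
      refine one_div_le_one_div_of_le (by positivity) ?_
      have : (j₂ : ℝ) ≤ (max j₁ j₂ : ℕ) := by exact_mod_cast le_max_right _ _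
      linarith
    simp only [Set.mem_ofPred_eq]
    linarith

/-- A function of `L²(ω_T × 𝕋^m)` whose localized Fourier coefficients all vanish is zero. -/
theorem eq_zero_of_coef_eq_zero {T : ℝ} (w : L2 (omegaT k T) m n)
    (h : ∀ L : ℝ, 0 < L → ∀ φ, IsCutoff (omegaT k T) L φ → ∀ κ, coef L φ w κ = 0) : w = 0 := by
  have hloc : ∀ j : ℕ, ∀ᵐ p ∂(torusMeasure (omegaT k T) m), p.1 ∈ exhaust k T j → w p = 0 := by
    intro j
    obtain ⟨L, hL, φ, hφ, h1⟩ := exists_isCutoff (isCompact_exhaust j) (D := omegaT k T)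
      ((exhaust_subset j).trans (lt_time_subset_interior T))
    have hL0 : 0 < L := one_pos.trans_le hL
    have h0 := h L hL0 φ hφ
    filter_upwards [hφ.ae_eq_fourierSum hL0 (measurableSet_omegaT T) w
      (by simp [h0, summable_zero])] with p hp hj
    have := hp (hφ.mem_cube (h1 p.1 hj))
    rw [h1 p.1 hj, one_smul] at this
    simpa [fourierSum, h0] using this
  refine (Lp.eq_zero_iff_ae_eq_zero).2 ?_
  filter_upwards [ae_all_iff.2 hloc, ae_time_lt T] with p hp ht
  obtain ⟨j, hj⟩ := exists_mem_exhaust ht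
  exact hp j hj

/-- Weak derivatives on `ω_T × 𝕋^m` are unique. -/
theorem IsWeakDeriv.unique {T : ℝ} {e : Fin (k + 1) ⊕ Fin m} {u v v' : L2 (omegaT k T) m n}
    (h : IsWeakDeriv e u v) (h' : IsWeakDeriv e u v') : v = v' := by
  rw [← sub_eq_zero]
  refine eq_zero_of_coef_eq_zero _ fun L hL φ hφ κ => ?_
  have h1 := (h.coef_eq hφ κ).symm.trans (h'.coef_eq hφ κ)
  rw [add_left_inj] at h1
  have h2 := hφ.coef_add (v - v') v' κ
  rw [sub_add_cancel, h1] at h2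
  exact left_eq_add.1 (by rw [add_comm] at h2; exact h2)

end

noncomputable section

/-! ### Almost periodic functions on the half line -/

section AlmostPeriodic

variable {F : Type*} [NormedAddCommGroup F] [NormedSpace ℂ F]

/-- `W` is continuous and a uniform limit of trigonometric polynomials on the half line. -/
structure IsAlmostPeriodic (W : ℝ → F) : Prop where
  continuousOn : ContinuousOn W (Set.Ici 0)
  approx : ∀ ε : ℝ, 0 < ε → ∃ (s : Finset ℝ) (c : ℝ → F), ∀ ψ : ℝ, 0 ≤ ψ →
    ‖W ψ - ∑ ξ ∈ s, Complex.exp (Complex.I * (ψ * ξ : ℝ)) • c ξ‖ ≤ ε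

theorem norm_exp_neg_I (x : ℝ) : ‖Complex.exp (-Complex.I * x)‖ = 1 := by
  rw [show -Complex.I * x = Complex.I * ((-x : ℝ) : ℂ) by push_cast; ring, norm_exp_I_mul_ofReal]

theorem continuousOn_freq_smul {W : ℝ → F} (hW : ContinuousOn W (Set.Ici 0)) (ξ : ℝ) :
    ContinuousOn (fun ψ : ℝ => Complex.exp (-Complex.I * (ξ * ψ : ℝ)) • W ψ) (Set.Ici 0) :=
  (by fun_prop : Continuous fun ψ : ℝ => Complex.exp (-Complex.I * (ξ * ψ : ℝ))).continuousOn.smul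
    hW

theorem intervalIntegrable_freq_smul {W : ℝ → F} (hW : ContinuousOn W (Set.Ici 0)) (ξ : ℝ)
    {R : ℝ} (hR : 0 ≤ R) :
    IntervalIntegrable (fun ψ : ℝ => Complex.exp (-Complex.I * (ξ * ψ : ℝ)) • W ψ) volume 0 R :=
  ((continuousOn_freq_smul hW ξ).mono (by
    rw [Set.uIcc_of_le hR]; exact Set.Icc_subset_Ici_self)).intervalIntegrable

theorem norm_mean_le {G : ℝ → F} {K R : ℝ} (hR : 0 < R) (h : ∀ ψ, 0 ≤ ψ → ‖G ψ‖ ≤ K) :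
    ‖((R⁻¹ : ℝ) : ℂ) • ∫ ψ in (0 : ℝ)..R, G ψ‖ ≤ K := by
  rw [norm_smul, Complex.norm_real, norm_inv, Real.norm_of_nonneg hR.le]
  have := intervalIntegral.norm_integral_le_of_norm_le_const (a := 0) (b := R) (f := G) (C := K)
    (fun ψ hψ => h ψ (by rw [Set.uIoc_of_le hR.le] at hψ; exact hψ.1.le))
  rw [sub_zero, abs_of_pos hR] at this
  rwa [inv_mul_le_iff₀ hR, mul_comm]

/-- The mean value of a pure oscillation. -/
theorem tendsto_mean_exp (l : ℝ) :
    Tendsto (fun R : ℝ => ((R⁻¹ : ℝ) : ℂ) * ∫ ψ in (0 : ℝ)..R, Complex.exp (Complex.I * (l * ψ : ℝ)))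
      atTop (𝓝 (if l = 0 then 1 else 0)) := by
  split_ifs with h
  · subst h
    refine tendsto_const_nhds.congr' ?_
    filter_upwards [eventually_gt_atTop 0] with R hR
    simp [hR.ne']
  · have hc : Complex.I * l ≠ 0 := mul_ne_zero Complex.I_ne_zero (by exact_mod_cast h)
    have h1 : ∀ R : ℝ, ∫ ψ in (0 : ℝ)..R, Complex.exp (Complex.I * (l * ψ : ℝ)) =
        (Complex.exp (Complex.I * (l * R : ℝ)) - 1) / (Complex.I * l) := by
      intro R
      have := integral_exp_mul_complex (a := 0) (b := R) hc
      simp only [Complex.ofReal_zero, mul_zero, Complex.exp_zero] at this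
      push_cast
      simp only [← mul_assoc]
      exact this
    simp only [h1]
    refine squeeze_zero_norm (a := fun R : ℝ => |R⁻¹| * (2 / ‖Complex.I * l‖)) (fun R => ?_) ?_
    · rw [norm_mul, norm_div, Complex.norm_real, Real.norm_eq_abs]
      gcongr
      refine (norm_sub_le _ _).trans ?_
      rw [norm_exp_I_mul_ofReal, norm_one]; norm_num
    · have := (tendsto_inv_atTop_zero (𝕜 := ℝ)).abs.mul_const (2 / ‖Complex.I * l‖)
      simpa using this

theorem IsFreqPart.unique {W : ℝ → F} {ξ : ℝ} {a b : F} (ha : IsFreqPart W ξ a)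
    (hb : IsFreqPart W ξ b) : a = b := tendsto_nhds_unique ha hb

theorem IsFreqPart.congr {W W' : ℝ → F} {ξ : ℝ} {a : F} (ha : IsFreqPart W ξ a)
    (h : ∀ ψ, 0 ≤ ψ → W ψ = W' ψ) : IsFreqPart W' ξ a := by
  refine Tendsto.congr' ?_ ha
  filter_upwards [eventually_ge_atTop 0] with R hR
  congr 1
  refine intervalIntegral.integral_congr fun ψ hψ => ?_
  rw [Set.uIcc_of_le hR] at hψ
  simp only [h ψ hψ.1]

theorem IsFreqPart.norm_le {W : ℝ → F} {ξ : ℝ} {a : F} (ha : IsFreqPart W ξ a) {K : ℝ}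
    (h : ∀ ψ, 0 ≤ ψ → ‖W ψ‖ ≤ K) : ‖a‖ ≤ K := by
  refine le_of_tendsto ha.norm ?_
  filter_upwards [eventually_gt_atTop 0] with R hR
  exact norm_mean_le hR fun ψ hψ => by rw [norm_smul, norm_exp_neg_I, one_mul]; exact h ψ hψ

theorem IsFreqPart.sub {W W' : ℝ → F} {ξ : ℝ} {a b : F} (ha : IsFreqPart W ξ a)
    (hb : IsFreqPart W' ξ b) (hW : ContinuousOn W (Set.Ici 0))
    (hW' : ContinuousOn W' (Set.Ici 0)) : IsFreqPart (fun ψ => W ψ - W' ψ) ξ (a - b) := by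
  refine (Tendsto.sub ha hb).congr' ?_
  filter_upwards [eventually_ge_atTop 0] with R hR
  rw [← smul_sub, ← intervalIntegral.integral_sub (intervalIntegrable_freq_smul hW ξ hR)
    (intervalIntegrable_freq_smul hW' ξ hR)]
  simp only [smul_sub]

theorem IsFreqPart.clm {F' : Type*} [NormedAddCommGroup F'] [NormedSpace ℂ F'] [CompleteSpace F]
    [CompleteSpace F'] {W : ℝ → F} {ξ : ℝ} {a : F} (ha : IsFreqPart W ξ a)
    (hW : ContinuousOn W (Set.Ici 0)) (l : F →L[ℂ] F') :
    IsFreqPart (fun ψ => l (W ψ)) ξ (l a) := by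
  refine ((l.continuous.tendsto a).comp ha).congr' ?_
  filter_upwards [eventually_ge_atTop 0] with R hR
  rw [Function.comp_apply, l.map_smul,
    ← l.intervalIntegral_comp_comm (intervalIntegrable_freq_smul hW ξ hR)]
  simp only [l.map_smul]

/-- A function that tends to zero has no oscillating component. -/
theorem IsFreqPart.of_tendsto_zero {W : ℝ → F} (hW : ContinuousOn W (Set.Ici 0))
    (h : Tendsto W atTop (𝓝 0)) (ξ : ℝ) : IsFreqPart W ξ 0 := by
  rw [IsFreqPart, Metric.tendsto_atTop]
  intro ε hε
  obtain ⟨A, hA⟩ := Metric.tendsto_atTop.1 h (ε / 2) (by positivity)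
  set A' := max A 0 with hA'
  have hA0 : 0 ≤ A' := le_max_right _ _
  set Q := ‖∫ ψ in (0 : ℝ)..A', Complex.exp (-Complex.I * (ξ * ψ : ℝ)) • W ψ‖ with hQ
  refine ⟨max (A' + 1) (4 * Q / ε), fun R hR => ?_⟩
  have hRA : A' + 1 ≤ R := (le_max_left _ _).trans hR
  have hRQ : 4 * Q / ε ≤ R := (le_max_right _ _).trans hR
  have hR0 : 0 < R := by linarith
  have hi := intervalIntegrable_freq_smul hW ξ hA0
  have hi2 : IntervalIntegrable (fun ψ : ℝ => Complex.exp (-Complex.I * (ξ * ψ : ℝ)) • W ψ)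
      volume A' R := ((continuousOn_freq_smul hW ξ).mono (by
    rw [Set.uIcc_of_le (by linarith)]; exact fun x hx => hA0.trans hx.1)).intervalIntegrable
  have h2 := intervalIntegral.norm_integral_le_of_norm_le_const (a := A') (b := R)
    (f := fun ψ : ℝ => Complex.exp (-Complex.I * (ξ * ψ : ℝ)) • W ψ) (C := ε / 2)
    (fun ψ hψ => by
      rw [Set.uIoc_of_le (by linarith)] at hψ
      have := hA ψ ((le_max_left _ _).trans hψ.1.le)
      rw [dist_zero_right] at this
      rw [norm_smul, norm_exp_neg_I, one_mul]; exact this.le)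
  rw [dist_zero_right, ← intervalIntegral.integral_add_adjacent_intervals hi hi2, norm_smul,
    Complex.norm_real, norm_inv, Real.norm_of_nonneg hR0.le, inv_mul_lt_iff₀ hR0]
  refine (norm_add_le _ _).trans_lt ?_
  rw [abs_of_pos (by linarith : 0 < R - A')] at h2
  rw [div_le_iff₀ hε] at hRQ
  nlinarith

/-- The Fourier components of an absolutely convergent trigonometric series. -/
theorem isFreqPart_tsum [CompleteSpace F] {ι : Type*} [Countable ι] (r : ι → ℝ) {C : ι → F}
    (hC : Summable fun j => ‖C j‖) (ξ : ℝ) :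
    IsFreqPart (fun ψ => ∑' j, Complex.exp (Complex.I * (r j * ψ : ℝ)) • C j) ξ
      (∑' j, if r j = ξ then C j else 0) := by
  have e1 : ∀ (ψ : ℝ) (j : ι), Complex.exp (-Complex.I * (ξ * ψ : ℝ)) •
      Complex.exp (Complex.I * (r j * ψ : ℝ)) • C j =
      Complex.exp (Complex.I * ((r j - ξ) * ψ : ℝ)) • C j := fun ψ j => by
    rw [smul_smul, ← Complex.exp_add]
    congr 2
    push_cast; ring
  have hn : ∀ (ψ : ℝ) (j : ι), ‖Complex.exp (Complex.I * ((r j - ξ) * ψ : ℝ)) • C j‖ = ‖C j‖ :=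
    fun ψ j => by rw [norm_smul, norm_exp_I_mul_ofReal, one_mul]
  have e2 : ∀ R : ℝ, 0 < R → ((R⁻¹ : ℝ) : ℂ) • ∫ ψ in (0 : ℝ)..R,
      Complex.exp (-Complex.I * (ξ * ψ : ℝ)) •
        ∑' j, Complex.exp (Complex.I * (r j * ψ : ℝ)) • C j =
      ∑' j, (((R⁻¹ : ℝ) : ℂ) * ∫ ψ in (0 : ℝ)..R,
        Complex.exp (Complex.I * ((r j - ξ) * ψ : ℝ))) • C j := by
    intro R hR
    have h := intervalIntegral.hasSum_integral_of_dominated_convergence (μ := volume)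
      (a := 0) (b := R) (F := fun j ψ => Complex.exp (Complex.I * ((r j - ξ) * ψ : ℝ)) • C j)
      (f := fun ψ => ∑' j, Complex.exp (Complex.I * ((r j - ξ) * ψ : ℝ)) • C j)
      (fun j _ => ‖C j‖) (fun j => by
        have : Continuous fun ψ : ℝ => Complex.exp (Complex.I * ((r j - ξ) * ψ : ℝ)) • C j := by
          fun_prop
        exact this.aestronglyMeasurable)
      (fun j => Eventually.of_forall fun ψ _ => (hn ψ j).le)
      (Eventually.of_forall fun ψ _ => hC) (by simp)
      (Eventually.of_forall fun ψ _ => (Summable.of_norm (by simpa only [hn] using hC)).hasSum)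
    have h2 : ∀ ψ : ℝ, Complex.exp (-Complex.I * (ξ * ψ : ℝ)) •
        ∑' j, Complex.exp (Complex.I * (r j * ψ : ℝ)) • C j =
        ∑' j, Complex.exp (Complex.I * ((r j - ξ) * ψ : ℝ)) • C j := fun ψ => by
      rw [← tsum_const_smul'']
      simp only [e1]
    simp only [h2]
    rw [← h.tsum_eq, ← tsum_const_smul'']
    refine tsum_congr fun j => ?_
    rw [intervalIntegral.integral_smul_const, smul_smul]
  rw [IsFreqPart]
  have h3 : Tendsto (fun R : ℝ => ∑' j, (((R⁻¹ : ℝ) : ℂ) * ∫ ψ in (0 : ℝ)..R,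
        Complex.exp (Complex.I * ((r j - ξ) * ψ : ℝ))) • C j) atTop
      (𝓝 (∑' j, if r j = ξ then C j else 0)) := by
    refine tendsto_tsum_of_dominated_convergence hC (fun j => ?_) ?_
    · have := (tendsto_mean_exp (r j - ξ)).smul_const (C j)
      simpa only [sub_eq_zero, ite_smul, one_smul, zero_smul] using this
    · filter_upwards [eventually_gt_atTop 0] with R hR j
      rw [norm_smul]
      refine mul_le_of_le_one_left (norm_nonneg _) ?_
      rw [← smul_eq_mul]
      exact norm_mean_le hR fun ψ _ => (norm_exp_I_mul_ofReal _).le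
  refine h3.congr' ?_
  filter_upwards [eventually_gt_atTop 0] with R hR
  exact (e2 R hR).symm

/-- The Fourier components of a trigonometric polynomial. -/
theorem isFreqPart_sum [CompleteSpace F] (s : Finset ℝ) (c : ℝ → F) (ξ : ℝ) :
    IsFreqPart (fun ψ : ℝ => ∑ η ∈ s, Complex.exp (Complex.I * (ψ * η : ℝ)) • c η) ξ
      (if ξ ∈ s then c ξ else 0) := by
  have h := isFreqPart_tsum (ι := s) (fun η => (η : ℝ)) (C := fun η => c η)
    (hasSum_fintype _).summable ξ
  simp only [tsum_fintype] at h
  rw [Finset.sum_coe_sort s (fun η => if η = ξ then c η else 0), Finset.sum_ite_eq'] at h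
  refine h.congr fun ψ _ => ?_
  rw [Finset.sum_coe_sort s fun η => Complex.exp (Complex.I * (η * ψ : ℝ)) • c η]
  simp only [mul_comm]

theorem continuous_trigPoly (s : Finset ℝ) (c : ℝ → F) :
    Continuous fun ψ : ℝ => ∑ η ∈ s, Complex.exp (Complex.I * (ψ * η : ℝ)) • c η := by
  fun_prop

/-- All the Fourier components of an almost periodic function exist. -/
theorem IsAlmostPeriodic.exists_isFreqPart [CompleteSpace F] {W : ℝ → F}
    (hW : IsAlmostPeriodic W) (ξ : ℝ) : ∃ a, IsFreqPart W ξ a := by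
  refine cauchySeq_tendsto_of_complete (Metric.cauchySeq_iff.2 fun ε hε => ?_)
  obtain ⟨s, c, h⟩ := hW.approx (ε / 4) (by positivity)
  obtain ⟨A, hA⟩ := Metric.cauchySeq_iff.1 (isFreqPart_sum s c ξ).cauchySeq (ε / 4) (by positivity)
  have key : ∀ R, max A 1 ≤ R → dist (((R⁻¹ : ℝ) : ℂ) •
      ∫ ψ in (0 : ℝ)..R, Complex.exp (-Complex.I * (ξ * ψ : ℝ)) • W ψ) (((R⁻¹ : ℝ) : ℂ) •
      ∫ ψ in (0 : ℝ)..R, Complex.exp (-Complex.I * (ξ * ψ : ℝ)) •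
        ∑ η ∈ s, Complex.exp (Complex.I * (ψ * η : ℝ)) • c η) ≤ ε / 4 := by
    intro R hR
    have hR0 : 0 < R := by linarith [le_max_right A 1]
    rw [dist_eq_norm, ← smul_sub, ← intervalIntegral.integral_sub
      (intervalIntegrable_freq_smul hW.continuousOn ξ hR0.le)
      (intervalIntegrable_freq_smul (continuous_trigPoly s c).continuousOn ξ hR0.le)]
    simp only [← smul_sub]
    exact norm_mean_le hR0 fun ψ hψ => by
      rw [norm_smul, norm_exp_neg_I, one_mul]; exact h ψ hψ
  refine ⟨max A 1, fun R hR R' hR' => ?_⟩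
  have h1 := key R hR
  have h2 := key R' hR'
  have h3 := hA R ((le_max_left _ _).trans hR) R' ((le_max_left _ _).trans hR')
  rw [dist_comm] at h2
  refine (dist_triangle4 _ _ _ _).trans_lt (lt_of_le_of_lt (add_le_add (add_le_add h1 h3.le) h2) ?_)
  linarith

theorem IsAlmostPeriodic.exists_bound {W : ℝ → F} (hW : IsAlmostPeriodic W) :
    ∃ B, 0 ≤ B ∧ ∀ ψ, 0 ≤ ψ → ‖W ψ‖ ≤ B := by
  obtain ⟨s, c, h⟩ := hW.approx 1 one_pos
  refine ⟨1 + ∑ η ∈ s, ‖c η‖, by positivity, fun ψ hψ => ?_⟩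
  have h1 := norm_le_norm_sub_add (W ψ) (∑ η ∈ s, Complex.exp (Complex.I * (ψ * η : ℝ)) • c η)
  refine h1.trans (add_le_add (h ψ hψ) ((norm_sum_le _ _).trans_eq ?_))
  exact Finset.sum_congr rfl fun η _ => by rw [norm_smul, norm_exp_I_mul_ofReal, one_mul]

theorem IsAlmostPeriodic.clm {F' : Type*} [NormedAddCommGroup F'] [NormedSpace ℂ F'] {W : ℝ → F}
    (hW : IsAlmostPeriodic W) (l : F →L[ℂ] F') : IsAlmostPeriodic fun ψ => l (W ψ) where
  continuousOn := l.continuous.comp_continuousOn hW.continuousOn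
  approx ε hε := by
    obtain ⟨s, c, h⟩ := hW.approx (ε / (‖l‖ + 1)) (by positivity)
    refine ⟨s, fun ξ => l (c ξ), fun ψ hψ => ?_⟩
    have h1 := l.le_opNorm (W ψ - ∑ ξ ∈ s, Complex.exp (Complex.I * (ψ * ξ : ℝ)) • c ξ)
    rw [map_sub, map_sum] at h1
    simp only [l.map_smul] at h1
    refine h1.trans ((mul_le_mul_of_nonneg_left (h ψ hψ) (norm_nonneg l)).trans ?_)
    rw [mul_div_assoc', div_le_iff₀ (by positivity)]
    nlinarith [norm_nonneg l]

/-- Finite sums of squares of Fourier components (each one at its own frequency). -/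
theorem sum_sq_isFreqPart_le [CompleteSpace F] {ι : Type*} (s : Finset ι) {W : ι → ℝ → F} {ξ : ι → ℝ}
    {a : ι → F} (hW : ∀ i, ContinuousOn (W i) (Set.Ici 0)) (ha : ∀ i, IsFreqPart (W i) (ξ i) (a i))
    {B : ℝ} (hB : 0 ≤ B) (h : ∀ ψ, 0 ≤ ψ → ∑ i ∈ s, ‖W i ψ‖ ^ 2 ≤ B ^ 2) :
    ∑ i ∈ s, ‖a i‖ ^ 2 ≤ B ^ 2 := by
  let V : ℝ → PiLp 2 (fun _ : s => F) := fun ψ =>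
    WithLp.toLp 2 fun i => Complex.exp (-Complex.I * (ξ i * ψ : ℝ)) • W i ψ
  have hV : ContinuousOn V (Set.Ici 0) := by
    refine (PiLp.continuous_toLp 2 _).comp_continuousOn ?_
    exact continuousOn_pi.2 fun i => continuousOn_freq_smul (hW i) (ξ i)
  have hVB : ∀ ψ, 0 ≤ ψ → ‖V ψ‖ ≤ B := fun ψ hψ => by
    refine le_of_sq_le_sq ?_ hB
    rw [PiLp.norm_sq_eq_of_L2]
    refine le_of_eq_of_le ?_ (h ψ hψ)
    rw [← Finset.sum_coe_sort s]
    refine Finset.sum_congr rfl fun i _ => ?_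
    simp only [V, norm_smul, norm_exp_neg_I, one_mul]
  have hlim : Tendsto (fun R : ℝ => ((R⁻¹ : ℝ) : ℂ) • ∫ ψ in (0 : ℝ)..R, V ψ) atTop
      (𝓝 (WithLp.toLp 2 fun i : s => a i)) := by
    have h1 : Tendsto (fun R : ℝ => fun i : s => ((R⁻¹ : ℝ) : ℂ) •
        ∫ ψ in (0 : ℝ)..R, Complex.exp (-Complex.I * (ξ i * ψ : ℝ)) • W i ψ) atTop
        (𝓝 fun i : s => a i) := tendsto_pi_nhds.2 fun i => ha i
    refine (((PiLp.continuous_toLp 2 fun _ : s => F).tendsto _).comp h1).congr' ?_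
    filter_upwards [eventually_ge_atTop 0] with R hR
    ext i
    have hi : IntervalIntegrable V volume 0 R := (hV.mono (by
      rw [Set.uIcc_of_le hR]; exact Set.Icc_subset_Ici_self)).intervalIntegrable
    have h2 := (PiLp.proj (𝕜 := ℂ) 2 (fun _ : s => F) i).intervalIntegral_comp_comm hi
    simp only [Function.comp_apply, PiLp.smul_apply]
    congr 1
  have h3 : ‖(WithLp.toLp 2 fun i : s => a i : PiLp 2 fun _ : s => F)‖ ≤ B := by
    refine le_of_tendsto hlim.norm ?_
    filter_upwards [eventually_gt_atTop 0] with R hR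
    exact norm_mean_le hR hVB
  have h4 := pow_le_pow_left₀ (norm_nonneg _) h3 2
  rw [PiLp.norm_sq_eq_of_L2] at h4
  rw [← Finset.sum_coe_sort s]
  exact h4

end AlmostPeriodic

end

noncomputable section

/-! ### Uniqueness of almost periodic functions -/

/-- If all Fourier components vanish, then so does the quadratic mean. -/
theorem IsAlmostPeriodic.eventually_mean_sq_le {W : ℝ → ℂ} (hW : IsAlmostPeriodic W)
    (h0 : ∀ ξ, IsFreqPart W ξ 0) {δ : ℝ} (hδ : 0 < δ) :
    ∀ᶠ R : ℝ in atTop, ∫ ψ in (0 : ℝ)..R, ‖W ψ‖ ^ 2 ≤ δ * R := by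
  obtain ⟨B, hB, hWB⟩ := hW.exists_bound
  obtain ⟨s, c, hP⟩ := hW.approx (δ / (2 * (B + 1))) (by positivity)
  have h1 : Tendsto (fun R : ℝ => ∑ η ∈ s, (starRingEnd ℂ) (c η) * (((R⁻¹ : ℝ) : ℂ) •
      ∫ ψ in (0 : ℝ)..R, Complex.exp (-Complex.I * (η * ψ : ℝ)) • W ψ)) atTop (𝓝 0) := by
    have := tendsto_finsetSum s fun η _ => (h0 η).const_mul ((starRingEnd ℂ) (c η))
    simpa using this
  have h2 := (Metric.tendsto_atTop.1 h1) (δ / 2) (by positivity)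
  obtain ⟨A, hA⟩ := h2
  filter_upwards [eventually_ge_atTop A, eventually_gt_atTop 0] with R hRA hR
  set P : ℝ → ℂ := fun ψ => ∑ η ∈ s, Complex.exp (Complex.I * (ψ * η : ℝ)) • c η with hPdef
  have hPc : Continuous P := continuous_trigPoly s c
  have hWc : ContinuousOn W (Set.uIcc 0 R) := hW.continuousOn.mono (by
    rw [Set.uIcc_of_le hR.le]; exact Set.Icc_subset_Ici_self)
  have hconj : ∀ ψ, (starRingEnd ℂ) (P ψ) * W ψ =
      ∑ η ∈ s, (starRingEnd ℂ) (c η) * (Complex.exp (-Complex.I * (η * ψ : ℝ)) • W ψ) := by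
    intro ψ
    simp only [hPdef, map_sum, smul_eq_mul, map_mul, Finset.sum_mul, ← Complex.exp_conj,
      Complex.conj_I, Complex.conj_ofReal]
    refine Finset.sum_congr rfl fun η _ => ?_
    rw [mul_comm η ψ]; ring
  have i1 : IntervalIntegrable (fun ψ => (starRingEnd ℂ) (W ψ - P ψ) * W ψ) volume 0 R :=
    ((Complex.continuous_conj.comp_continuousOn (hWc.sub hPc.continuousOn)).mul
      hWc).intervalIntegrable
  have i2 : IntervalIntegrable (fun ψ => (starRingEnd ℂ) (P ψ) * W ψ) volume 0 R :=
    ((Complex.continuous_conj.comp_continuousOn hPc.continuousOn).mul hWc).intervalIntegrable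
  have e1 : ((∫ ψ in (0 : ℝ)..R, ‖W ψ‖ ^ 2 : ℝ) : ℂ) =
      (∫ ψ in (0 : ℝ)..R, (starRingEnd ℂ) (W ψ - P ψ) * W ψ) +
      ∫ ψ in (0 : ℝ)..R, (starRingEnd ℂ) (P ψ) * W ψ := by
    rw [← intervalIntegral.integral_add i1 i2, ← intervalIntegral.integral_ofReal]
    refine intervalIntegral.integral_congr fun ψ _ => ?_
    simp only [map_sub]
    rw [sub_mul, sub_add_cancel, Complex.conj_mul']
    push_cast; rfl
  have e2 : ‖∫ ψ in (0 : ℝ)..R, (starRingEnd ℂ) (W ψ - P ψ) * W ψ‖ ≤ δ / 2 * R := by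
    have := intervalIntegral.norm_integral_le_of_norm_le_const (a := 0) (b := R)
      (f := fun ψ => (starRingEnd ℂ) (W ψ - P ψ) * W ψ) (C := δ / 2) fun ψ hψ => by
        rw [Set.uIoc_of_le hR.le] at hψ
        rw [norm_mul, RCLike.norm_conj]
        refine (mul_le_mul (hP ψ hψ.1.le) (hWB ψ hψ.1.le) (norm_nonneg _) (by positivity)).trans ?_
        rw [div_mul_eq_mul_div, div_le_div_iff₀ (by positivity) (by norm_num)]
        nlinarith
    rwa [sub_zero, abs_of_pos hR] at this
  have e3 : ‖∫ ψ in (0 : ℝ)..R, (starRingEnd ℂ) (P ψ) * W ψ‖ ≤ δ / 2 * R := by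
    have h4 := (hA R hRA).le
    rw [dist_zero_right] at h4
    have h5 : ∑ η ∈ s, (starRingEnd ℂ) (c η) * (((R⁻¹ : ℝ) : ℂ) •
        ∫ ψ in (0 : ℝ)..R, Complex.exp (-Complex.I * (η * ψ : ℝ)) • W ψ) =
        ((R⁻¹ : ℝ) : ℂ) • ∫ ψ in (0 : ℝ)..R, (starRingEnd ℂ) (P ψ) * W ψ := by
      simp only [hconj]
      rw [intervalIntegral.integral_finsetSum fun η _ =>
        (intervalIntegrable_freq_smul hW.continuousOn η hR.le).const_mul _, Finset.smul_sum]
      refine Finset.sum_congr rfl fun η _ => ?_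
      rw [intervalIntegral.integral_const_mul]
      simp only [smul_eq_mul]; ring
    rw [h5, norm_smul, Complex.norm_real, norm_inv, Real.norm_of_nonneg hR.le,
      inv_mul_le_iff₀ hR, mul_comm] at h4
    exact h4
  have e4 : ‖((∫ ψ in (0 : ℝ)..R, ‖W ψ‖ ^ 2 : ℝ) : ℂ)‖ ≤ δ / 2 * R + δ / 2 * R := by
    rw [e1]; exact (norm_add_le _ _).trans (add_le_add e2 e3)
  rw [Complex.norm_real] at e4
  linarith [le_abs_self (∫ ψ in (0 : ℝ)..R, ‖W ψ‖ ^ 2), Real.norm_eq_abs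
    (∫ ψ in (0 : ℝ)..R, ‖W ψ‖ ^ 2)]

/-- Finitely many oscillations return simultaneously close to their values, from every time. -/
theorem exists_almost_periods (s : Finset ℝ) {ε : ℝ} (hε : 0 < ε) :
    ∃ Q : Finset ℝ, (∀ r ∈ Q, 0 ≤ r) ∧ ∀ t : ℝ, 0 ≤ t → ∃ r ∈ Q, ∀ η ∈ s,
      ‖Complex.exp (Complex.I * (t * η : ℝ)) - Complex.exp (Complex.I * (r * η : ℝ))‖ ≤ ε := by
  classical
  let g : ℝ → (s → ℂ) := fun t η => Complex.exp (Complex.I * (t * η : ℝ))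
  have hb : Bornology.IsBounded (g '' Set.Ici 0) := by
    refine (Metric.isBounded_closedBall (x := (0 : s → ℂ)) (r := 1)).subset ?_
    rintro _ ⟨t, -, rfl⟩
    rw [mem_closedBall_zero_iff, pi_norm_le_iff_of_nonneg zero_le_one]
    exact fun η => (norm_exp_I_mul_ofReal _).le
  have htb := hb.isCompact_closure.totallyBounded.subset subset_closure
  obtain ⟨Y, hY, hYf, hcov⟩ := Metric.finite_approx_of_totallyBounded htb ε hε
  choose! r hr hgr using fun y (hy : y ∈ Y) => hY hy
  refine ⟨hYf.toFinset.image r, fun x hx => ?_, fun t ht => ?_⟩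
  · obtain ⟨y, hy, rfl⟩ := Finset.mem_image.1 hx
    exact hr y (hYf.mem_toFinset.1 hy)
  · obtain ⟨y, hy, hyt⟩ := Set.mem_iUnion₂.1 (hcov ⟨t, ht, rfl⟩)
    refine ⟨r y, Finset.mem_image_of_mem r (hYf.mem_toFinset.2 hy), fun η hη => ?_⟩
    rw [Metric.mem_ball, ← hgr y hy, dist_pi_lt_iff hε] at hyt
    have := (hyt ⟨η, hη⟩).le
    rwa [dist_eq_norm] at this

/-- **Uniqueness theorem**: a scalar almost periodic function without Fourier components is
zero. Otherwise it would stay away from zero on a set of times of positive density. -/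
theorem IsAlmostPeriodic.eq_zero_of_scalar {W : ℝ → ℂ} (hW : IsAlmostPeriodic W)
    (h0 : ∀ ξ, IsFreqPart W ξ 0) {ψ₀ : ℝ} (hψ₀ : 0 ≤ ψ₀) : W ψ₀ = 0 := by
  by_contra hne
  set δ := ‖W ψ₀‖ / 4 with hδ
  have hδ0 : 0 < δ := by positivity
  obtain ⟨s, c, hP⟩ := hW.approx δ hδ0
  obtain ⟨Q, hQ0, hQ⟩ := exists_almost_periods s (ε := δ / (∑ η ∈ s, ‖c η‖ + 1)) (by positivity)
  obtain ⟨A, hA⟩ : ∃ A : ℝ, ∀ r ∈ Q, r ≤ A := Q.bddAbove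
  set A' := max A 0 with hA'
  have hA'0 : 0 ≤ A' := le_max_right _ _
  have hAA' : ∀ r ∈ Q, r ≤ A' := fun r hr => (hA r hr).trans (le_max_left _ _)
  -- every large time is, up to one of the finitely many shifts `r ∈ Q`, an almost period
  have key : ∀ t, A' ≤ t → ∃ r ∈ Q, δ ≤ ‖W (ψ₀ + t - r)‖ := by
    intro t ht
    obtain ⟨r, hr, hη⟩ := hQ t (hA'0.trans ht)
    refine ⟨r, hr, ?_⟩
    have htr : 0 ≤ t - r := by linarith [hAA' r hr]
    have e1 := hP ψ₀ hψ₀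
    have e2 := hP (ψ₀ + t - r) (by linarith)
    have e3 : ‖(∑ ξ ∈ s, Complex.exp (Complex.I * ((ψ₀ + t - r) * ξ : ℝ)) • c ξ) -
        ∑ ξ ∈ s, Complex.exp (Complex.I * (ψ₀ * ξ : ℝ)) • c ξ‖ ≤ δ := by
      rw [← Finset.sum_sub_distrib]
      refine (norm_sum_le _ _).trans ?_
      have : ∀ ξ ∈ s, ‖Complex.exp (Complex.I * ((ψ₀ + t - r) * ξ : ℝ)) • c ξ -
          Complex.exp (Complex.I * (ψ₀ * ξ : ℝ)) • c ξ‖ ≤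
          δ / (∑ η ∈ s, ‖c η‖ + 1) * ‖c ξ‖ := by
        intro ξ hξ
        rw [← sub_smul, norm_smul]
        refine mul_le_mul_of_nonneg_right ?_ (norm_nonneg _)
        refine le_trans (le_of_eq ?_) (hη ξ hξ)
        have e : ∀ x : ℝ, Complex.exp (Complex.I * ((ψ₀ - r) * ξ : ℝ)) *
            Complex.exp (Complex.I * (x * ξ : ℝ)) =
            Complex.exp (Complex.I * ((ψ₀ + x - r) * ξ : ℝ)) := fun x => by
          rw [← Complex.exp_add]; congr 1; push_cast; ring
        have e5 := e r
        rw [add_sub_cancel_right] at e5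
        rw [← e t, ← e5, ← mul_sub, norm_mul, norm_exp_I_mul_ofReal, one_mul]
      refine (Finset.sum_le_sum this).trans ?_
      rw [← Finset.mul_sum, div_mul_eq_mul_div, div_le_iff₀ (by positivity)]
      nlinarith
    have e4 : W ψ₀ = W (ψ₀ + t - r) - ((W (ψ₀ + t - r) -
        ∑ ξ ∈ s, Complex.exp (Complex.I * ((ψ₀ + t - r) * ξ : ℝ)) • c ξ) +
        ((∑ ξ ∈ s, Complex.exp (Complex.I * ((ψ₀ + t - r) * ξ : ℝ)) • c ξ) -
        ∑ ξ ∈ s, Complex.exp (Complex.I * (ψ₀ * ξ : ℝ)) • c ξ) -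
        (W ψ₀ - ∑ ξ ∈ s, Complex.exp (Complex.I * (ψ₀ * ξ : ℝ)) • c ξ)) := by ring
    have e5 : ‖W ψ₀‖ ≤ ‖W (ψ₀ + t - r)‖ + ((δ + δ) + δ) := by
      rw [e4]
      exact (norm_sub_le _ _).trans (add_le_add le_rfl ((norm_sub_le _ _).trans
        (add_le_add ((norm_add_le _ _).trans (add_le_add e2 e3)) e1)))
    have : ‖W ψ₀‖ = 4 * δ := by rw [hδ]; ring
    linarith
  set q : ℝ := (Q.card : ℝ) + 1 with hq
  have hq0 : 0 < q := by positivity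
  have hmean := hW.eventually_mean_sq_le h0 (δ := δ ^ 2 / (2 * q)) (by positivity)
  obtain ⟨R₀, hR₀⟩ := eventually_atTop.1 hmean
  set R := max R₀ (max A' (2 * A' + ψ₀ + 1)) with hR
  have hRA : A' ≤ R := (le_max_left _ _).trans (le_max_right _ _)
  have hRb : 2 * A' + ψ₀ + 1 ≤ R := (le_max_right _ _).trans (le_max_right _ _)
  have hcont : ContinuousOn (fun ψ => ‖W ψ‖ ^ 2) (Set.Ici 0) := hW.continuousOn.norm.pow 2
  have hI := hR₀ (ψ₀ + R) (by linarith [le_max_left R₀ (max A' (2 * A' + ψ₀ + 1))])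
  have hint : ∀ a b : ℝ, 0 ≤ a → a ≤ b →
      IntervalIntegrable (fun ψ => ‖W ψ‖ ^ 2) volume a b := fun a b ha hab =>
    (hcont.mono (by rw [Set.uIcc_of_le hab]; exact fun x hx => ha.trans hx.1)).intervalIntegrable
  have hsh : ∀ r ∈ Q, IntervalIntegrable (fun t => ‖W (ψ₀ + t - r)‖ ^ 2) volume A' R ∧
      ∫ t in A'..R, ‖W (ψ₀ + t - r)‖ ^ 2 ≤ δ ^ 2 / (2 * q) * (ψ₀ + R) := by
    intro r hr
    have hra := hAA' r hr
    have hr0 := hQ0 r hr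
    have e : ∀ t, ψ₀ + t - r = t + (ψ₀ - r) := fun t => by ring
    simp only [e]
    have i1 := hint (A' + (ψ₀ - r)) (R + (ψ₀ - r)) (by linarith) (by linarith)
    refine ⟨by simpa using i1.comp_add_right (ψ₀ - r), ?_⟩
    rw [intervalIntegral.integral_comp_add_right (fun t => ‖W t‖ ^ 2)]
    refine le_trans ?_ hI
    refine intervalIntegral.integral_mono_interval (by linarith) (by linarith) (by linarith)
      (Eventually.of_forall fun _ => by positivity) (hint 0 _ le_rfl (by linarith))
  -- so the translates of `‖W‖²` by `Q` have a mean bounded below, whereas the mean of `‖W‖²` is `0`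
  have hlow : δ ^ 2 * (R - A') ≤ ∫ t in A'..R, ∑ r ∈ Q, ‖W (ψ₀ + t - r)‖ ^ 2 := by
    have : ∫ _ in A'..R, δ ^ 2 = δ ^ 2 * (R - A') := by
      rw [intervalIntegral.integral_const, smul_eq_mul, mul_comm]
    rw [← this]
    refine intervalIntegral.integral_mono_on hRA intervalIntegrable_const
      (by simpa only [Finset.sum_fn] using IntervalIntegrable.sum Q fun r hr => (hsh r hr).1) fun t ht => ?_
    obtain ⟨r, hr, hd⟩ := key t ht.1
    refine (pow_le_pow_left₀ hδ0.le hd 2).trans ?_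
    exact Finset.single_le_sum (f := fun r => ‖W (ψ₀ + t - r)‖ ^ 2) (fun _ _ => by positivity) hr
  rw [intervalIntegral.integral_finsetSum fun r hr => (hsh r hr).1] at hlow
  have hup := Finset.sum_le_sum fun r hr => (hsh r hr).2
  rw [Finset.sum_const, nsmul_eq_mul] at hup
  have h1 : (Q.card : ℝ) * (δ ^ 2 / (2 * q) * (ψ₀ + R)) ≤ δ ^ 2 / 2 * (ψ₀ + R) := by
    have : (Q.card : ℝ) * (δ ^ 2 / (2 * q)) ≤ δ ^ 2 / 2 := by
      rw [mul_div_assoc', div_le_div_iff₀ (by positivity) (by norm_num)]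
      nlinarith [sq_nonneg δ]
    nlinarith [mul_le_mul_of_nonneg_right this (show 0 ≤ ψ₀ + R by linarith)]
  have h2 : δ ^ 2 * (R - A') ≤ δ ^ 2 * ((ψ₀ + R) / 2) := by linarith
  have h3 := le_of_mul_le_mul_left h2 (by positivity)
  linarith

/-- A finite-dimensional almost periodic function is determined by its Fourier components. -/
theorem IsAlmostPeriodic.eq_zero {n : ℕ} {W : ℝ → CVec n} (hW : IsAlmostPeriodic W)
    (h0 : ∀ ξ, IsFreqPart W ξ 0) {ψ : ℝ} (hψ : 0 ≤ ψ) : W ψ = 0 := by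
  ext i
  refine (hW.clm (EuclideanSpace.proj (𝕜 := ℂ) i)).eq_zero_of_scalar (fun ξ => ?_) hψ
  have := (h0 ξ).clm hW.continuousOn (EuclideanSpace.proj (𝕜 := ℂ) i)
  rwa [map_zero] at this

/-- An almost periodic function with finite spectrum is a trigonometric polynomial. -/
theorem IsAlmostPeriodic.eq_sum {n : ℕ} {W : ℝ → CVec n} (hW : IsAlmostPeriodic W)
    (s : Finset ℝ) (a : ℝ → CVec n) (ha : ∀ ξ, IsFreqPart W ξ (a ξ)) (hs : ∀ ξ, ξ ∉ s → a ξ = 0)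
    {ψ : ℝ} (hψ : 0 ≤ ψ) : W ψ = ∑ ξ ∈ s, Complex.exp (Complex.I * (ψ * ξ : ℝ)) • a ξ := by
  classical
  have hP := continuous_trigPoly s a
  have hAP : IsAlmostPeriodic fun ψ : ℝ =>
      W ψ - ∑ ξ ∈ s, Complex.exp (Complex.I * (ψ * ξ : ℝ)) • a ξ := by
    refine ⟨hW.continuousOn.sub hP.continuousOn, fun ε hε => ?_⟩
    obtain ⟨s', c, h⟩ := hW.approx ε hε
    refine ⟨s ∪ s', fun ξ => (if ξ ∈ s' then c ξ else 0) - if ξ ∈ s then a ξ else 0,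
      fun ψ hψ => le_of_eq_of_le ?_ (h ψ hψ)⟩
    congr 1
    simp only [smul_sub, Finset.sum_sub_distrib, smul_ite, smul_zero, Finset.sum_ite_mem,
      Finset.union_inter_cancel_left, Finset.union_inter_cancel_right]
    abel
  refine sub_eq_zero.1 (hAP.eq_zero (fun ξ => ?_) hψ)
  have h1 := (ha ξ).sub (isFreqPart_sum s a ξ) hW.continuousOn hP.continuousOn
  have h2 : a ξ - (if ξ ∈ s then a ξ else 0) = 0 := by
    split_ifs with h
    · exact sub_self _
    · rw [hs ξ h, sub_zero]
  rwa [h2] at h1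

end

noncomputable section

/-! ### Transport equations -/

section Transport

variable {E : Type*} [NormedAddCommGroup E] [NormedSpace ℝ E]

/-- The integral of `χ` along the segments `[z, z + Se]`. -/
def lineIntegral (e : E) (S : ℝ) (χ : E → ℝ) (z : E) : ℝ := ∫ r in (0 : ℝ)..S, χ (z + r • e)

theorem contDiff_lineIntegral [FiniteDimensional ℝ E] (e : E) {S : ℝ} (hS : 0 ≤ S)
    (l : E →L[ℝ] ℝ) (hl : l e = 1) {χ : E → ℝ} (hχ : ContDiff ℝ ∞ χ) (hc : HasCompactSupport χ) :
    ContDiff ℝ ∞ (lineIntegral e S χ) := by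
  obtain ⟨A, hA⟩ : ∃ A : ℝ, ∀ z, χ z ≠ 0 → |l z| ≤ A := by
    obtain ⟨A, hA⟩ := (hc.image l.continuous).isBounded.exists_norm_le
    exact ⟨A, fun z hz => hA _ ⟨z, subset_tsupport _ hz, rfl⟩⟩
  have key : ∀ R : ℝ, ContDiffOn ℝ ∞ (lineIntegral e S χ) {z | |l z| < R} := by
    intro R
    have h := contDiffOn_convolution_right_with_param_comp (𝕜 := ℝ) (μ := volume) (n := (⊤ : ℕ∞))
      (ContinuousLinearMap.mul ℝ ℝ) (s := {z : E | |l z| < R}) (v := fun _ => (0 : ℝ))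
      contDiffOn_const (f := (Set.Ioc 0 S).indicator fun _ => (1 : ℝ))
      (g := fun z x => χ (z - x • e)) (k := Set.Icc (-(A + R)) (A + R))
      (isOpen_lt (by fun_prop) continuous_const) isCompact_Icc
      (fun z x hz hx => by
        by_contra hne
        have h1 := hA _ hne
        rw [map_sub, map_smul, hl, smul_eq_mul, mul_one] at h1
        have hz' : |l z| < R := hz
        refine hx ⟨?_, ?_⟩ <;> linarith [abs_le.1 h1, abs_lt.1 hz'])
      ((integrable_indicator_iff measurableSet_Ioc).2 (by simp)).locallyIntegrable
      (by
        have : ContDiff ℝ ∞ fun q : E × ℝ => χ (q.1 - q.2 • e) := hχ.comp (by fun_prop)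
        exact this.contDiffOn)
    refine h.congr fun z _ => ?_
    rw [lineIntegral, intervalIntegral.integral_of_le hS, ← integral_indicator measurableSet_Ioc,
      convolution]
    refine integral_congr_ae (Eventually.of_forall fun r => ?_)
    by_cases hr : r ∈ Set.Ioc 0 S
    · simp [Set.indicator_of_mem hr]
    · simp [Set.indicator_of_notMem hr]
  rw [contDiff_iff_contDiffAt]
  intro z
  exact (key (|l z| + 1)).contDiffAt ((isOpen_lt (by fun_prop) continuous_const).mem_nhds
    (show |l z| < |l z| + 1 by linarith))

theorem fderiv_lineIntegral (e : E) (S : ℝ) {χ : E → ℝ} (hχ : Continuous χ) {z : E}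
    (hd : DifferentiableAt ℝ (lineIntegral e S χ) z) :
    fderiv ℝ (lineIntegral e S χ) z e = χ (z + S • e) - χ z := by
  have h1 : HasDerivAt (fun h : ℝ => lineIntegral e S χ (z + h • e))
      (fderiv ℝ (lineIntegral e S χ) z e) 0 := by
    have h2 : HasDerivAt (fun h : ℝ => z + h • e) e 0 := by
      simpa using ((hasDerivAt_id (0 : ℝ)).smul_const e).const_add z
    have h3 : HasFDerivAt (lineIntegral e S χ) (fderiv ℝ (lineIntegral e S χ) z)
      (z + (0 : ℝ) • e) := by simpa using hd.hasFDerivAt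
    exact h3.comp_hasDerivAt (0 : ℝ) h2
  set q : ℝ → ℝ := fun r => χ (z + r • e) with hq
  have hqc : Continuous q := hχ.comp (by fun_prop)
  have h4 : ∀ h : ℝ, lineIntegral e S χ (z + h • e) = (∫ r in (0 : ℝ)..(h + S), q r) -
      ∫ r in (0 : ℝ)..h, q r := by
    intro h
    rw [intervalIntegral.integral_interval_sub_left (hqc.intervalIntegrable _ _)
      (hqc.intervalIntegrable _ _), lineIntegral]
    have := intervalIntegral.integral_comp_add_left (a := 0) (b := S) q h
    rw [add_zero] at this
    rw [← this]
    simp only [hq, add_smul, add_assoc]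
  have h5 : ∀ x : ℝ, HasDerivAt (fun u : ℝ => ∫ r in (0 : ℝ)..u, q r) (q x) x := fun x =>
    intervalIntegral.integral_hasDerivAt_right (hqc.intervalIntegrable _ _)
      (hqc.stronglyMeasurableAtFilter _ _) hqc.continuousAt
  have h6 : HasDerivAt (fun h : ℝ => (∫ r in (0 : ℝ)..(h + S), q r) - ∫ r in (0 : ℝ)..h, q r)
      (q (0 + S) - q 0) 0 := by
    have := (h5 (0 + S)).comp_add_const 0 S
    exact this.sub (h5 0)
  simp only [h4] at h1
  rw [h1.unique h6]
  simp [hq]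

variable [FiniteDimensional ℝ E] [MeasurableSpace E] [BorelSpace E]
  {F : Type*} [NormedAddCommGroup F] [NormedSpace ℝ F] [CompleteSpace F]

theorem measurePreserving_shear (μ : Measure E) [μ.IsAddHaarMeasure] (e : E) (ν : Measure ℝ)
    [SFinite ν] : MeasurePreserving (fun p : ℝ × E => (p.1, p.2 - p.1 • e)) (ν.prod μ) (ν.prod μ) :=
  (MeasurePreserving.id ν).skew_product (g := fun r z => z - r • e) (by fun_prop)
    (Eventually.of_forall fun r => (measurePreserving_sub_right μ (r • e)).map_eq)

theorem integrable_shear {F : Type*} [NormedAddCommGroup F] {μ : Measure E} [μ.IsAddHaarMeasure] (e : E) (S : ℝ) {g : E → F}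
    (hg : Integrable g μ) :
    Integrable (fun p : ℝ × E => g (p.2 - p.1 • e)) ((volume.restrict (Set.Ioc 0 S)).prod μ) :=
  ((measurePreserving_shear μ e (volume.restrict (Set.Ioc 0 S))).integrable_comp
    (hg.comp_snd (volume.restrict (Set.Ioc 0 S))).1).2 (hg.comp_snd _)

/-- The adjoint of integration along segments. -/
theorem integral_lineIntegral_smul {μ : Measure E} [μ.IsAddHaarMeasure] (e : E) {S : ℝ}
    (hS : 0 ≤ S) {χ : E → ℝ} (hχ : Continuous χ) (hc : HasCompactSupport χ) {g : E → F}
    (hg : Integrable g μ) :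
    ∫ z, lineIntegral e S χ z • g z ∂μ =
      ∫ z, χ z • (∫ r in Set.Ioc 0 S, g (z - r • e)) ∂μ := by
  obtain ⟨B, hB⟩ := hχ.bounded_above_of_compact_support hc
  have i1 : Integrable (fun p : ℝ × E => χ p.2 • g (p.2 - p.1 • e))
      ((volume.restrict (Set.Ioc 0 S)).prod μ) :=
    (integrable_shear e S hg).bdd_smul B
      ((hχ.comp continuous_snd).aestronglyMeasurable) (Eventually.of_forall fun p => hB p.2)
  have i2 : Integrable (fun p : ℝ × E => χ (p.2 + p.1 • e) • g p.2)
      ((volume.restrict (Set.Ioc 0 S)).prod μ) :=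
    (hg.comp_snd (volume.restrict (Set.Ioc 0 S))).bdd_smul B
      ((hχ.comp (by fun_prop : Continuous fun p : ℝ × E => p.2 + p.1 • e)).aestronglyMeasurable)
      (Eventually.of_forall fun p => hB _)
  have h1 : ∫ p, χ (p.2 + p.1 • e) • g p.2 ∂((volume.restrict (Set.Ioc 0 S)).prod μ) =
      ∫ p, χ p.2 • g (p.2 - p.1 • e) ∂((volume.restrict (Set.Ioc 0 S)).prod μ) := by
    have hT := measurePreserving_shear μ e (volume.restrict (Set.Ioc 0 S))
    have h2 := integral_map (μ := (volume.restrict (Set.Ioc 0 S)).prod μ)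
      (φ := fun p : ℝ × E => (p.1, p.2 - p.1 • e))
      (f := fun p : ℝ × E => χ (p.2 + p.1 • e) • g p.2) hT.measurable.aemeasurable
      (by rw [hT.map_eq]; exact i2.1)
    rw [hT.map_eq] at h2
    rw [h2]
    simp only [sub_add_cancel]
  rw [integral_prod_symm _ i1, integral_prod_symm _ i2] at h1
  simp only [integral_smul] at h1
  rw [← h1]
  refine integral_congr_ae (Eventually.of_forall fun z => ?_)
  simp only [lineIntegral, intervalIntegral.integral_of_le hS, integral_smul_const]

/-- Solutions of a transport equation with zero past are given by integration along the
characteristics. -/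
theorem transport_formula {μ : Measure E} [μ.IsAddHaarMeasure] {l : E →L[ℝ] ℝ} {e : E}
    (hl : l e = 1) {C : Set E} (hC : IsOpen C) {δ A : ℝ} (hδ : 0 < δ) (hA : 0 ≤ A)
    (hCl : ∀ z ∈ C, -δ < l z ∧ l z < A)
    (hback : ∀ z ∈ C, ∀ r : ℝ, 0 ≤ r → -δ < l (z - r • e) → z - r • e ∈ C)
    {f h : E → F} (hf : IntegrableOn f C μ) (hh : IntegrableOn h C μ)
    (hf0 : ∀ᵐ z ∂μ, z ∈ C → l z < 0 → f z = 0)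
    (heq : ∀ χ : E → ℝ, ContDiff ℝ ∞ χ → HasCompactSupport χ → tsupport χ ⊆ C →
      ∫ z, fderiv ℝ χ z e • f z ∂μ = -∫ z, χ z • h z ∂μ) :
    ∃ g : E → F, Integrable g μ ∧ (∀ z, ‖g z‖ₑ ≤ C.indicator (fun z => ‖h z‖ₑ) z) ∧
      ∀ᵐ z ∂μ, z ∈ C → f z = ∫ r in Set.Ioc 0 (A + δ), g (z - r • e) := by
  set S := A + δ with hS
  have hS0 : 0 ≤ S := by linarith
  set β : ℝ → ℝ := fun x => Real.smoothTransition (3 * x / δ + 2) with hβ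
  have hβs : ContDiff ℝ ∞ β := Real.smoothTransition.contDiff.comp (by fun_prop)
  have hβ0 : ∀ x, x ≤ -(2 * δ / 3) → β x = 0 := fun x hx =>
    Real.smoothTransition.zero_of_nonpos (by
      have : 3 * x / δ ≤ -2 := by rw [div_le_iff₀ hδ]; linarith
      linarith)
  have hβ1 : ∀ x, -(δ / 3) ≤ x → β x = 1 := fun x hx =>
    Real.smoothTransition.one_of_one_le (by
      have : -1 ≤ 3 * x / δ := by rw [le_div_iff₀ hδ]; linarith
      linarith)
  have hβabs : ∀ x, |β x| ≤ 1 := fun x =>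
    abs_le.2 ⟨by linarith [Real.smoothTransition.nonneg (3 * x / δ + 2)],
      Real.smoothTransition.le_one _⟩
  set g : E → F := C.indicator fun z => β (l z) • h z with hg
  have hgle : ∀ z, ‖g z‖ₑ ≤ C.indicator (fun z => ‖h z‖ₑ) z := by
    intro z
    by_cases hz : z ∈ C
    · rw [hg, Set.indicator_of_mem hz, Set.indicator_of_mem hz, enorm_smul]
      refine mul_le_of_le_one_left zero_le ?_
      rw [Real.enorm_eq_ofReal_abs, ENNReal.ofReal_le_one]
      exact hβabs _
    · rw [hg, Set.indicator_of_notMem hz, Set.indicator_of_notMem hz, enorm_zero]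
  have hgi : Integrable g μ := by
    rw [hg, integrable_indicator_iff hC.measurableSet]
    exact Integrable.bdd_smul hh 1
      ((hβs.continuous.comp l.continuous).aestronglyMeasurable)
      (Eventually.of_forall fun z => hβabs _)
  refine ⟨g, hgi, hgle, ?_⟩
  have hHi : Integrable (fun z => ∫ r in Set.Ioc 0 S, g (z - r • e)) μ :=
    (integrable_shear e S hgi).integral_prod_right
  have hfin := hC.ae_eq_zero_of_integral_contDiff_smul_eq_zero (μ := μ)
    (f := fun z => f z - ∫ r in Set.Ioc 0 S, g (z - r • e))
    ((hf.sub hHi.integrableOn).locallyIntegrableOn) ?_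
  · filter_upwards [hfin] with z hz hzC
    exact sub_eq_zero.1 (hz hzC)
  intro χ hχ hc hsupp
  -- The test function is a cutoff for negative times of the primitive of `χ` along `e`.
  set Ψ : E → ℝ := fun z => β (l z) * lineIntegral e S χ z with hΨ
  have hprim := contDiff_lineIntegral e hS0 l hl hχ hc
  have hΨs : ContDiff ℝ ∞ Ψ := (hβs.comp l.contDiff).mul hprim
  set Kc : Set E := {z | -(2 * δ / 3) ≤ l z} ∩
    (fun p : E × ℝ => p.1 - p.2 • e) '' (tsupport χ ×ˢ Set.Icc 0 S) with hKc
  have hKcc : IsCompact Kc := by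
    refine IsCompact.inter_left ?_ (isClosed_le continuous_const l.continuous)
    exact (hc.isCompact.prod isCompact_Icc).image (by fun_prop)
  have hKC : Kc ⊆ C := by
    rintro _ ⟨hz, ⟨w, r⟩, ⟨hw, hr⟩, rfl⟩
    have hz' : -(2 * δ / 3) ≤ l (w - r • e) := hz
    exact hback w (hsupp hw) r hr.1 (by linarith)
  have hΨsupp : tsupport Ψ ⊆ Kc := by
    refine closure_minimal (fun z hz => ?_) hKcc.isClosed
    have hz' : β (l z) * lineIntegral e S χ z ≠ 0 := hz
    refine ⟨?_, ?_⟩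
    · by_contra hlt
      exact left_ne_zero_of_mul hz' (hβ0 _ (not_le.1 hlt).le)
    · by_contra hno
      refine right_ne_zero_of_mul hz' ?_
      rw [lineIntegral, intervalIntegral.integral_of_le hS0]
      refine setIntegral_eq_zero_of_forall_eq_zero fun r hr => ?_
      by_contra hne
      exact hno ⟨(z + r • e, r), ⟨subset_tsupport _ hne, hr.1.le, hr.2⟩, by simp⟩
  have hΨc : HasCompactSupport Ψ := hKcc.of_isClosed_subset (isClosed_tsupport _) hΨsupp
  have hweak := heq Ψ hΨs hΨc (hΨsupp.trans hKC)
  have hL : ∫ z, fderiv ℝ Ψ z e • f z ∂μ = -∫ z, χ z • f z ∂μ := by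
    rw [← integral_neg]
    refine integral_congr_ae ?_
    filter_upwards [hf0] with z hz
    by_cases hzC : z ∈ C
    · by_cases hlz : l z < 0
      · rw [hz hzC hlz, smul_zero, smul_zero, neg_zero]
      · have hloc : Ψ =ᶠ[𝓝 z] lineIntegral e S χ := by
          have : {w : E | -(δ / 3) < l w} ∈ 𝓝 z :=
            (isOpen_lt continuous_const l.continuous).mem_nhds
              (show -(δ / 3) < l z by linarith)
          filter_upwards [this] with w hw
          rw [hΨ]
          simp only
          rw [hβ1 _ (le_of_lt hw), one_mul]
        have h0 : χ (z + S • e) = 0 := by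
          by_contra hne
          have := (hCl _ (hsupp (subset_tsupport _ hne))).2
          rw [map_add, map_smul, hl, smul_eq_mul, mul_one] at this
          linarith
        rw [hloc.fderiv_eq, fderiv_lineIntegral e S hχ.continuous
          ((hprim.differentiable (by norm_num)) z), h0, zero_sub, neg_smul]
    · have h1 : fderiv ℝ Ψ z = 0 := by
        by_contra hne
        exact hzC (hKC (hΨsupp (support_fderiv_subset ℝ hne)))
      have h2 : χ z = 0 := by
        by_contra hne
        exact hzC (hsupp (subset_tsupport _ hne))
      rw [h1, h2]; simp
  have hR : ∫ z, Ψ z • h z ∂μ = ∫ z, χ z • (∫ r in Set.Ioc 0 S, g (z - r • e)) ∂μ := by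
    rw [← integral_lineIntegral_smul e hS0 hχ.continuous hc hgi]
    refine integral_congr_ae (Eventually.of_forall fun z => ?_)
    by_cases hzC : z ∈ C
    · simp only [hg, Set.indicator_of_mem hzC, hΨ, smul_smul]
      rw [mul_comm]
    · have : Ψ z = 0 := by
        by_contra hne
        exact hzC (hKC (hΨsupp (subset_tsupport _ hne)))
      simp only [hg, Set.indicator_of_notMem hzC, this, smul_zero, zero_smul]
  rw [hL, hR, neg_inj] at hweak
  obtain ⟨B, hB⟩ := hχ.continuous.bounded_above_of_compact_support hc
  have i1 : Integrable (fun z => χ z • f z) μ := by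
    have h1 : IntegrableOn (fun z => χ z • f z) C μ :=
      Integrable.bdd_smul hf B hχ.continuous.aestronglyMeasurable (Eventually.of_forall hB)
    refine (integrableOn_iff_integrable_of_support_subset fun z hz => ?_).1 h1
    exact hsupp (subset_tsupport _ fun h0 => hz (by simp [h0]))
  have i2 : Integrable (fun z => χ z • (∫ r in Set.Ioc 0 S, g (z - r • e))) μ :=
    hHi.bdd_smul B hχ.continuous.aestronglyMeasurable (Eventually.of_forall hB)
  simp only [smul_sub]
  rw [integral_sub i1 i2, hweak, sub_self]

/-- **Weighted `L¹` estimate** for transport equations with zero past. -/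
theorem transport_estimate {μ : Measure E} [μ.IsAddHaarMeasure] {l : E →L[ℝ] ℝ} {e : E}
    (hl : l e = 1) {C : Set E} (hC : IsOpen C) {δ A : ℝ} (hδ : 0 < δ) (hA : 0 ≤ A)
    (hCl : ∀ z ∈ C, -δ < l z ∧ l z < A)
    (hback : ∀ z ∈ C, ∀ r : ℝ, 0 ≤ r → -δ < l (z - r • e) → z - r • e ∈ C)
    {f h : E → F} (hf : IntegrableOn f C μ) (hh : IntegrableOn h C μ)
    (hf0 : ∀ᵐ z ∂μ, z ∈ C → l z < 0 → f z = 0)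
    (heq : ∀ χ : E → ℝ, ContDiff ℝ ∞ χ → HasCompactSupport χ → tsupport χ ⊆ C →
      ∫ z, fderiv ℝ χ z e • f z ∂μ = -∫ z, χ z • h z ∂μ) {γ : ℝ} (hγ : 0 < γ) :
    ENNReal.ofReal γ * ∫⁻ z in C, ENNReal.ofReal (Real.exp (-γ * l z)) * ‖f z‖ₑ ∂μ ≤
      ∫⁻ z in C, ENNReal.ofReal (Real.exp (-γ * l z)) * ‖h z‖ₑ ∂μ := by
  obtain ⟨g, hgi, hgle, hfg⟩ := transport_formula hl hC hδ hA hCl hback hf hh hf0 heq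
  set S := A + δ with hS
  set w : E → ℝ≥0∞ := fun z => ENNReal.ofReal (Real.exp (-γ * l z)) with hw
  have hwm : Measurable w := by
    have : Continuous fun z => Real.exp (-γ * l z) := by fun_prop
    exact this.measurable.ennreal_ofReal
  have hsh : ∀ (z : E) (r : ℝ), w (z + r • e) = w z * ENNReal.ofReal (Real.exp (-γ * r)) := by
    intro z r
    simp only [hw]
    rw [← ENNReal.ofReal_mul (Real.exp_nonneg _), ← Real.exp_add, map_add, map_smul, hl,
      smul_eq_mul, mul_one, mul_add]
  have hexp : ENNReal.ofReal γ * ∫⁻ r in Set.Ioc 0 S, ENNReal.ofReal (Real.exp (-γ * r)) ≤ 1 := by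
    have h1 : ∫⁻ r in Set.Ioc 0 S, ENNReal.ofReal (Real.exp (-γ * r)) ≤
        ∫⁻ r in Set.Ioi 0, ENNReal.ofReal (Real.exp (-γ * r)) :=
      lintegral_mono_set Set.Ioc_subset_Ioi_self
    have hneg : -γ < 0 := by linarith
    rw [← ofReal_integral_eq_lintegral_ofReal (integrableOn_exp_mul_Ioi hneg 0)
      (Eventually.of_forall fun _ => Real.exp_nonneg _), integral_exp_mul_Ioi hneg] at h1
    refine (mul_le_mul_right h1 _).trans ?_
    rw [← ENNReal.ofReal_mul hγ.le, ENNReal.ofReal_le_one]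
    simp [hγ.ne']
  have h1 : ∫⁻ z in C, w z * ‖f z‖ₑ ∂μ ≤
      ∫⁻ z, (∫⁻ r in Set.Ioc 0 S, w z * ‖g (z - r • e)‖ₑ) ∂μ := by
    refine le_trans ?_ (setLIntegral_le_lintegral C _)
    refine lintegral_mono_ae ?_
    rw [ae_restrict_iff' hC.measurableSet]
    filter_upwards [hfg] with z hz hzC
    rw [hz hzC, lintegral_const_mul' _ _ ENNReal.ofReal_ne_top]
    exact mul_le_mul_right (enorm_integral_le_lintegral_enorm _) _
  have hm : AEMeasurable (fun p : ℝ × E => w p.2 * ‖g (p.2 - p.1 • e)‖ₑ)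
      ((volume.restrict (Set.Ioc 0 S)).prod μ) :=
    (hwm.comp measurable_snd).aemeasurable.mul (integrable_shear e S hgi).1.enorm
  have h2 : ∫⁻ z, (∫⁻ r in Set.Ioc 0 S, w z * ‖g (z - r • e)‖ₑ) ∂μ =
      (∫⁻ r in Set.Ioc 0 S, ENNReal.ofReal (Real.exp (-γ * r))) * ∫⁻ z, w z * ‖g z‖ₑ ∂μ := by
    rw [← lintegral_prod_symm _ hm, lintegral_prod _ hm]
    have h3 : ∀ r : ℝ, ∫⁻ z, w z * ‖g (z - r • e)‖ₑ ∂μ =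
        ENNReal.ofReal (Real.exp (-γ * r)) * ∫⁻ z, w z * ‖g z‖ₑ ∂μ := by
      intro r
      have h4 := lintegral_sub_right_eq_self (μ := μ)
        (fun z => w (z + r • e) * ‖g z‖ₑ) (r • e)
      simp only [sub_add_cancel] at h4
      rw [h4, ← lintegral_const_mul' _ _ ENNReal.ofReal_ne_top]
      refine lintegral_congr fun z => ?_
      rw [hsh]; ring
    simp only [h3]
    have : Continuous fun r : ℝ => Real.exp (-γ * r) := by fun_prop
    rw [lintegral_mul_const _ this.measurable.ennreal_ofReal]
  have h5 : ∫⁻ z, w z * ‖g z‖ₑ ∂μ ≤ ∫⁻ z in C, w z * ‖h z‖ₑ ∂μ := by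
    rw [← lintegral_indicator hC.measurableSet]
    refine lintegral_mono fun z => ?_
    refine (mul_le_mul_right (hgle z) _).trans ?_
    by_cases hz : z ∈ C
    · simp [Set.indicator_of_mem hz]
    · simp [Set.indicator_of_notMem hz]
  calc ENNReal.ofReal γ * ∫⁻ z in C, w z * ‖f z‖ₑ ∂μ
      ≤ ENNReal.ofReal γ * ((∫⁻ r in Set.Ioc 0 S, ENNReal.ofReal (Real.exp (-γ * r))) *
        ∫⁻ z, w z * ‖g z‖ₑ ∂μ) := by rw [← h2]; exact mul_le_mul_right h1 _
    _ ≤ 1 * ∫⁻ z, w z * ‖g z‖ₑ ∂μ := by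
        rw [← mul_assoc]; exact mul_le_mul_left hexp _
    _ ≤ _ := by rw [one_mul]; exact h5

end Transport

end

noncomputable section

variable {k m N n : ℕ} {T : ℝ} {s : ℕ}

/-! ### Regularity of profiles -/

theorem tendsto_of_sobolevENorm {ι : Type*} {D : Set (Euc (k + 1))} {f : Filter ι}
    {u : ι → L2 D m n} {a : L2 D m n}
    (h : Tendsto (fun i => sobolevENorm s (u i - a)) f (𝓝 0)) : Tendsto u f (𝓝 a) := by
  rw [tendsto_iff_edist_tendsto_0]
  refine tendsto_of_tendsto_of_tendsto_of_le_of_le tendsto_const_nhds h (fun _ => zero_le)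
    fun i => ?_
  rw [edist_eq_enorm_sub]
  exact enorm_le_sobolevENorm s _

theorem MemE.continuousOn {U : Profile k m N T} (hU : MemE s U) :
    ContinuousOn (fun q : ℝ × ℝ => U q.1 q.2) (Set.Ici 0 ×ˢ Set.Ici 0) := by
  rintro ⟨x, ψ⟩ ⟨hx, hψ⟩
  exact tendsto_of_sobolevENorm (hU.continuous x ψ hx hψ)

theorem IsWeakDeriv.eq_add {e : Fin (k + 1) ⊕ Fin m} {u w Du Dw D : L2 (omegaT k T) m n}
    (hu : IsWeakDeriv e u Du) (hw : IsWeakDeriv e w Dw) (h : IsWeakDeriv e (u + w) D) :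
    D = Du + Dw := by
  rw [← sub_eq_zero]
  refine eq_zero_of_coef_eq_zero _ fun L hL φ hφ κ => ?_
  have h1 := h.coef_eq hφ κ
  rw [hφ.coef_add, (hφ.deriv_dir e).coef_add, smul_add, hu.coef_eq hφ κ, hw.coef_eq hφ κ] at h1
  have h2 := hφ.coef_add (D - (Du + Dw)) (Du + Dw) κ
  rw [sub_add_cancel, hφ.coef_add Du Dw] at h2
  have h3 : coef L φ D κ = coef L φ Du κ + coef L φ Dw κ := by
    refine add_right_cancel (b := coef L (cutoffDeriv φ e) u κ + coef L (cutoffDeriv φ e) w κ) ?_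
    rw [← h1]; abel
  rw [h3] at h2
  exact right_eq_add.1 h2

theorem exists_isWeakDeriv_enorm_lt {u : L2 (omegaT k T) m n} {K : ℝ≥0∞} (hs : 1 ≤ s)
    (h : sobolevENorm s u < K) (e : Fin (k + 1) ⊕ Fin m) :
    ∃ v, IsWeakDeriv e u v ∧ ‖v‖ₑ < K := by
  obtain ⟨s, rfl⟩ := Nat.exists_eq_add_of_le' hs
  obtain ⟨v, hv, hK⟩ := exists_isWeakDeriv_of_lt h e
  exact ⟨v, hv, (enorm_le_sobolevENorm s v).trans_lt hK⟩

theorem IsWeakDeriv.enorm_le {u v : L2 (omegaT k T) m n} {e : Fin (k + 1) ⊕ Fin m}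
    (h : IsWeakDeriv e u v) (hs : 1 ≤ s) : ‖v‖ₑ ≤ sobolevENorm s u := by
  refine le_of_forall_gt fun K hK => ?_
  obtain ⟨w, hw, hwK⟩ := exists_isWeakDeriv_enorm_lt hs hK e
  rwa [h.unique hw]

theorem IsWeakDeriv.enorm_sub_le {u u' v v' : L2 (omegaT k T) m n} {e : Fin (k + 1) ⊕ Fin m}
    (h : IsWeakDeriv e u v) (h' : IsWeakDeriv e u' v') (hs : 1 ≤ s) :
    ‖v - v'‖ₑ ≤ sobolevENorm s (u - u') := by
  refine le_of_forall_gt fun K hK => ?_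
  obtain ⟨w, hw, hwK⟩ := exists_isWeakDeriv_enorm_lt hs hK e
  have := h'.eq_add hw (D := v) (by rwa [add_sub_cancel])
  rwa [this, add_sub_cancel_left]

/-- Weak derivatives of profiles are continuous with values in `L²`. -/
theorem MemE.continuousOn_deriv {U DU : Profile k m N T} (hU : MemE s U) (hs : 1 ≤ s)
    {e : Fin (k + 1) ⊕ Fin m}
    (h : ∀ x ψ, 0 ≤ x → 0 ≤ ψ → IsWeakDeriv e (U x ψ) (DU x ψ)) :
    ContinuousOn (fun q : ℝ × ℝ => DU q.1 q.2) (Set.Ici 0 ×ˢ Set.Ici 0) := by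
  rintro ⟨x, ψ⟩ ⟨hx, hψ⟩
  refine tendsto_iff_edist_tendsto_0.2 ?_
  refine tendsto_of_tendsto_of_tendsto_of_le_of_le' tendsto_const_nhds
    (hU.continuous x ψ hx hψ) (Eventually.of_forall fun _ => zero_le) ?_
  filter_upwards [self_mem_nhdsWithin] with q hq
  rw [edist_eq_enorm_sub]
  exact (h q.1 q.2 hq.1 hq.2).enorm_sub_le (h x ψ hx hψ) hs

theorem MemE.exists_deriv {U : Profile k m N T} (hU : MemE s U) (hs : 1 ≤ s)
    (e : Fin (k + 1) ⊕ Fin m) :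
    ∃ DU : Profile k m N T, ∀ x ψ, 0 ≤ x → 0 ≤ ψ → IsWeakDeriv e (U x ψ) (DU x ψ) := by
  obtain ⟨C, hC⟩ := hU.bounded
  have : ∀ x ψ, ∃ v, 0 ≤ x → 0 ≤ ψ → IsWeakDeriv e (U x ψ) v := fun x ψ => by
    by_cases h : 0 ≤ x ∧ 0 ≤ ψ
    · obtain ⟨v, hv, -⟩ := exists_isWeakDeriv_enorm_lt hs
        ((hC x ψ h.1 h.2).trans_lt ENNReal.coe_lt_top) e
      exact ⟨v, fun _ _ => hv⟩
    · exact ⟨0, fun h1 h2 => absurd ⟨h1, h2⟩ h⟩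
  choose DU hDU using this
  exact ⟨DU, hDU⟩

theorem MemE.exists_bound {U : Profile k m N T} (hU : MemE s U) :
    ∃ K : ℝ, 0 < K ∧ ∀ x ψ, 0 ≤ x → 0 ≤ ψ → sobolevENorm s (U x ψ) < ENNReal.ofReal K := by
  obtain ⟨C, hC⟩ := hU.bounded
  refine ⟨C + 1, by positivity, fun x ψ hx hψ => (hC x ψ hx hψ).trans_lt ?_⟩
  rw [← ENNReal.ofReal_coe_nnreal]
  exact ENNReal.ofReal_lt_ofReal_iff'.2 ⟨by linarith, by positivity⟩

theorem MemOsc.isAlmostPeriodic {U : Profile k m N T} (hU : MemOsc s U) {x : ℝ} (hx : 0 ≤ x) :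
    IsAlmostPeriodic (U x) where
  continuousOn := by
    have h : ContinuousOn (fun ψ : ℝ => (x, ψ)) (Set.Ici 0) := by fun_prop
    exact hU.1.continuousOn.comp h fun ψ hψ => ⟨hx, hψ⟩
  approx ε hε := by
    obtain ⟨P, ⟨F, c, -, hP⟩, h⟩ := hU.2 ε.toNNReal (Real.toNNReal_pos.2 hε)
    refine ⟨F, fun ξ => c ξ x, fun ψ hψ => ?_⟩
    rw [← hP x ψ hx hψ]
    exact norm_le_of_sobolevENorm_le hε.le (h x ψ hx hψ)

/-- The Fourier component of `W` at frequency `ξ`, or `0` if it does not exist. -/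
def freqPart {F : Type*} [NormedAddCommGroup F] [NormedSpace ℂ F] (W : ℝ → F) (ξ : ℝ) : F :=
  open Classical in if h : ∃ a, IsFreqPart W ξ a then h.choose else 0

theorem IsAlmostPeriodic.isFreqPart_freqPart {F : Type*} [NormedAddCommGroup F] [NormedSpace ℂ F]
    [CompleteSpace F] {W : ℝ → F} (hW : IsAlmostPeriodic W) (ξ : ℝ) :
    IsFreqPart W ξ (freqPart W ξ) := by
  have h := hW.exists_isFreqPart ξ
  rw [freqPart, dif_pos h]
  exact h.choose_spec

/-- The Fourier components of an oscillating profile are continuous up to the boundary. -/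
theorem MemOsc.continuousOn_freqPart {U : Profile k m N T} (hU : MemOsc s U) (ξ : ℝ) :
    ContinuousOn (fun x => freqPart (U x) ξ) (Set.Ici 0) := by
  refine continuousOn_of_uniform_approx_of_continuousOn fun u hu => ?_
  obtain ⟨ε, hε, hεu⟩ := Metric.mem_uniformity_dist.1 hu
  obtain ⟨P, ⟨F, c, hc, hP⟩, h⟩ := hU.2 (ε / 2).toNNReal (Real.toNNReal_pos.2 (by positivity))
  refine ⟨fun x => if ξ ∈ F then c ξ x else 0, ?_, fun x hx => hεu ?_⟩
  · split_ifs with hξ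
    · have h1 : ContinuousOn (fun x : ℝ => (x, (0 : ℝ))) (Set.Ici 0) := by fun_prop
      exact (hc ξ hξ).continuousOn.comp h1 fun x hx => ⟨hx, Set.self_mem_Ici⟩
    · exact continuousOn_const
  · have hx' : 0 ≤ x := hx
    have h1 := (hU.isAlmostPeriodic hx').isFreqPart_freqPart ξ
    have h2 := h1.sub (isFreqPart_sum F (fun ξ => c ξ x) ξ)
      (hU.isAlmostPeriodic hx').continuousOn (continuous_trigPoly F _).continuousOn
    have h3 := h2.norm_le (K := ε / 2) fun ψ hψ => by
      rw [← hP x ψ hx' hψ]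
      exact norm_le_of_sobolevENorm_le (by positivity) (h x ψ hx' hψ)
    rw [dist_eq_norm]
    linarith

/-! ### Fourier components of localized profiles -/

variable {L : ℝ} {φ : Euc (k + 1) → ℝ}

/-- The Fourier coefficient at `κ` of the localization of the oscillating component `ξ` of `U x`.
The argument `x` is truncated at `0`, to have a continuous function on `ℝ`. -/
def oscCoef (L : ℝ) (φ : Euc (k + 1) → ℝ) (U : Profile k m N T) (x ξ : ℝ)
    (κ : Fin (k + 1) ⊕ Fin m → ℤ) : CVec N :=
  coef L φ (freqPart (U (max x 0)) ξ) κ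

theorem MemOsc.continuous_oscCoef {U : Profile k m N T} (hU : MemOsc s U)
    (hφ : IsCutoff (omegaT k T) L φ) (hL : 0 < L) (ξ : ℝ) (κ : Fin (k + 1) ⊕ Fin m → ℤ) :
    Continuous fun x => oscCoef L φ U x ξ κ := by
  have h1 : Continuous fun x => freqPart (U (max x 0)) ξ :=
    (hU.continuousOn_freqPart ξ).comp_continuous (by fun_prop) fun x => le_max_right x 0
  exact (hφ.coefCLM hL (measurableSet_omegaT T) m N κ).continuous.comp h1

theorem MemOsc.isFreqPart_coef {U : Profile k m N T} (hU : MemOsc s U)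
    (hφ : IsCutoff (omegaT k T) L φ) (hL : 0 < L) (x ξ : ℝ) (κ : Fin (k + 1) ⊕ Fin m → ℤ) :
    IsFreqPart (fun ψ => coef L φ (U (max x 0) ψ) κ) ξ (oscCoef L φ U x ξ κ) :=
  ((hU.isAlmostPeriodic (le_max_right x 0)).isFreqPart_freqPart ξ).clm
    (hU.isAlmostPeriodic (le_max_right x 0)).continuousOn
    (hφ.coefCLM hL (measurableSet_omegaT T) m N κ)

/-- Localized Fourier coefficients are obtained by integrating the partial Fourier coefficients. -/
theorem IsCutoff.coef_eq_integral_thetaCoef {D : Set (Euc (k + 1))} (hφ : IsCutoff D L φ)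
    (u : L2 D m n) (κ : Fin (k + 1) → ℤ) (ν : Fin m → ℤ) :
    coef L φ u (Sum.elim κ ν) = ((2 * Real.pi) ^ m : ℝ) •
      ∫ z in D, zmode L (-κ) z • φ z • thetaCoef u ν z ∧
    Integrable (fun z => zmode L (-κ) z • φ z • thetaCoef u ν z) (volume.restrict D) := by
  have hpi : ((2 * Real.pi) ^ m : ℝ) ≠ 0 := by have := Real.pi_pos; positivity
  have hi := integrable_bdd_smul (L := L) (integrable_cutoff_smul hφ.smooth.continuous hφ.compact u)
    (-(Sum.elim κ ν))
  have e1 : ∀ z : Euc (k + 1), ∫ θ in box m, emode L (-(Sum.elim κ ν)) (z, θ) • φ z • u (z, θ) =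
      ((2 * Real.pi) ^ m : ℝ) • zmode L (-κ) z • φ z • thetaCoef u ν z := by
    intro z
    rw [thetaCoef_eq, smul_comm (φ z), smul_comm (zmode L (-κ) z), smul_smul,
      mul_inv_cancel₀ hpi, one_smul, ← integral_smul, ← integral_smul]
    refine integral_congr_ae (Eventually.of_forall fun θ => ?_)
    have : -(Sum.elim κ ν) = Sum.elim (-κ) (-ν) := by
      ext e; rcases e with i | j <;> rfl
    simp only [this, emode_sumElim, mul_smul, smul_comm (tmode (-ν) θ) (φ z)]
  have hi' : Integrable (fun p : Euc (k + 1) × Euc m =>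
      emode L (-(Sum.elim κ ν)) p • φ p.1 • u p)
      ((volume.restrict D).prod (volume.restrict (box m))) := by
    rw [← torusMeasure_eq_prod]; exact hi
  have h2 := hi'.integral_prod_left
  simp only [e1] at h2
  refine ⟨?_, ?_⟩
  · have h3 := integral_prod _ hi'
    simp only [e1] at h3
    rw [integral_smul] at h3
    rw [← h3, coef, ← torusMeasure_eq_prod]
  · have := h2.smul ((2 * Real.pi) ^ m)⁻¹
    refine this.congr (Eventually.of_forall fun z => ?_)
    simp only [Pi.smul_apply, smul_smul, inv_mul_cancel₀ hpi, one_smul]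

end

noncomputable section

variable {k m N M n : ℕ} {T : ℝ} {s : ℕ} {L : ℝ} {φ : Euc (k + 1) → ℝ}

theorem exists_eq_sumElim (κ : Fin (k + 1) ⊕ Fin m → ℤ) :
    ∃ (κ' : Fin (k + 1) → ℤ) (ν : Fin m → ℤ), κ = Sum.elim κ' ν :=
  ⟨κ ∘ Sum.inl, κ ∘ Sum.inr, (Sum.elim_comp_inl_inr κ).symm⟩

theorem norm_le_norm_sumElim (κ : Fin (k + 1) → ℤ) (ν : Fin m → ℤ) :
    ‖ν‖ ≤ ‖(Sum.elim κ ν : Fin (k + 1) ⊕ Fin m → ℤ)‖ :=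
  (pi_norm_le_iff_of_nonneg (norm_nonneg _)).2 fun j =>
    norm_le_pi_norm (Sum.elim κ ν : Fin (k + 1) ⊕ Fin m → ℤ) (Sum.inr j)

section Spectrum

variable {S : BVP k N M} {ζ : Fin m → Euc (k + 1)} {U Uev : Profile k m N T}

/-- The localized coefficients inherit the polarization of the profile. -/
theorem MemOsc.proj_oscCoef (hU : MemOsc s U) (hpol : IsProjE S ζ U Uev U Uev)
    (hφ : IsCutoff (omegaT k T) L φ) (x ξ : ℝ) (κ : Fin (k + 1) → ℤ) (ν : Fin m → ℤ) :
    S.proj (bfreq ζ ν) ξ (oscCoef L φ U x ξ (Sum.elim κ ν)) =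
      oscCoef L φ U x ξ (Sum.elim κ ν) := by
  have h := (hU.isAlmostPeriodic (le_max_right x 0)).isFreqPart_freqPart ξ
  have hp := hpol.osc (max x 0) ξ _ _ (le_max_right x 0) h h ν
  obtain ⟨h1, h2⟩ := hφ.coef_eq_integral_thetaCoef (freqPart (U (max x 0)) ξ) κ ν
  rw [oscCoef, h1, ← Complex.coe_smul, map_smul]
  congr 1
  set P := LinearMap.toContinuousLinearMap (S.proj (bfreq ζ ν) ξ) with hP
  have h3 := P.integral_comp_comm h2
  change P _ = _
  rw [← h3]
  refine integral_congr_ae ?_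
  filter_upwards [hp] with z hz
  rw [P.map_smul, ← Complex.coe_smul, P.map_smul]
  congr 2
  exact hz.symm

theorem MemOsc.oscCoef_eq_zero (hchar : S.Noncharacteristic) (hU : MemOsc s U)
    (hpol : IsProjE S ζ U Uev U Uev) (hφ : IsCutoff (omegaT k T) L φ) (x : ℝ) {ξ : ℝ}
    (κ : Fin (k + 1) → ℤ) {ν : Fin m → ℤ} (hξ : ξ ∉ S.charFreqs (bfreq ζ ν)) :
    oscCoef L φ U x ξ (Sum.elim κ ν) = 0 := by
  rw [← hU.proj_oscCoef hpol hφ, S.proj_eq_zero_of_notMem hchar hξ, LinearMap.zero_apply]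

/-- The localized coefficients are trigonometric polynomials in `ψ_d`. -/
theorem MemOsc.coef_eq_sum (hchar : S.Noncharacteristic) (hU : MemOsc s U)
    (hpol : IsProjE S ζ U Uev U Uev) (hφ : IsCutoff (omegaT k T) L φ) (hL : 0 < L) {x ψ : ℝ}
    (hx : 0 ≤ x) (hψ : 0 ≤ ψ) (κ : Fin (k + 1) → ℤ) (ν : Fin m → ℤ) :
    coef L φ (U x ψ) (Sum.elim κ ν) = ∑ ξ ∈ S.charFreqs (bfreq ζ ν),
      Complex.exp (Complex.I * (ψ * ξ : ℝ)) • oscCoef L φ U x ξ (Sum.elim κ ν) := by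
  have h1 : IsAlmostPeriodic fun ψ => coef L φ (U x ψ) (Sum.elim κ ν) :=
    (hU.isAlmostPeriodic hx).clm (hφ.coefCLM hL (measurableSet_omegaT T) m N _)
  refine h1.eq_sum _ _ (fun ξ => ?_) (fun ξ hξ => hU.oscCoef_eq_zero hchar hpol hφ x κ hξ) hψ
  have := hU.isFreqPart_coef hφ hL x ξ (Sum.elim κ ν)
  rwa [max_eq_left hx] at this

/-- Weighted summability of the localized coefficients, uniform in `x_d`. -/
theorem MemOsc.exists_sum_oscCoef_le (ζ : Fin m → Euc (k + 1)) (hU : MemOsc s U) (S : BVP k N M)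
    (hφ : IsCutoff (omegaT k T) L φ) (hL : 1 ≤ L) (hs : k + 1 + m + 2 < 2 * s) :
    ∃ K : ℝ, 0 < K ∧ ∀ (x : ℝ) (F : Finset (Fin (k + 1) ⊕ Fin m → ℤ)),
      ∑ κ ∈ F, (1 + ‖κ‖) * ∑ ξ ∈ S.charFreqs (bfreq ζ (κ ∘ Sum.inr)), ‖oscCoef L φ U x ξ κ‖ ≤ K := by
  have hL0 : 0 < L := by linarith
  obtain ⟨K₀, hK₀, hUK⟩ := hU.1.exists_bound
  obtain ⟨C, hC, hCb⟩ := hφ.exists_sum_weight_le hL (measurableSet_omegaT T) m s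
  obtain ⟨C', hC', hC'b⟩ := exists_sum_weight_one_le (Fin (k + 1) ⊕ Fin m) (s := s) (by simpa using hs)
  set B : ℝ := Real.sqrt (N * C) * K₀ with hB
  have hB0 : 0 ≤ B := by positivity
  refine ⟨C' * (Real.sqrt N * B) + 1, by positivity, fun x F => ?_⟩
  refine (hC'b (fun κ => ∑ ξ ∈ S.charFreqs (bfreq ζ (κ ∘ Sum.inr)), ‖oscCoef L φ U x ξ κ‖)
    (Real.sqrt N * B) (by positivity) (fun κ => Finset.sum_nonneg fun _ _ => norm_nonneg _)
    (fun F => ?_) F).trans (by linarith)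
  have hx := le_max_right x 0
  have h1 := sum_sq_isFreqPart_le (F.sigma fun κ => S.charFreqs (bfreq ζ (κ ∘ Sum.inr)))
    (W := fun i ψ => ((1 + ‖i.1‖ : ℝ) : ℂ) ^ s • coef L φ (U (max x 0) ψ) i.1)
    (ξ := fun i => i.2) (a := fun i => ((1 + ‖i.1‖ : ℝ) : ℂ) ^ s • oscCoef L φ U x i.2 i.1)
    (fun i => by
      have hc : ContinuousOn (fun ψ => coef L φ (U (max x 0) ψ) i.1) (Set.Ici 0) :=
        (hφ.coefCLM hL0 (measurableSet_omegaT T) m N i.1).continuous.comp_continuousOn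
          (hU.isAlmostPeriodic hx).continuousOn
      exact hc.const_smul (((1 + ‖i.1‖ : ℝ) : ℂ) ^ s))
    (fun i => by
      have h2 := hU.isFreqPart_coef hφ hL0 x i.2 i.1
      have hc : ContinuousOn (fun ψ => coef L φ (U (max x 0) ψ) i.1) (Set.Ici 0) :=
        (hφ.coefCLM hL0 (measurableSet_omegaT T) m N i.1).continuous.comp_continuousOn
          (hU.isAlmostPeriodic hx).continuousOn
      exact h2.clm hc ((((1 + ‖i.1‖ : ℝ) : ℂ) ^ s) • ContinuousLinearMap.id ℂ (CVec N)))
    (B := B) hB0 (fun ψ hψ => by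
      rw [Finset.sum_sigma]
      have h3 := hCb N (U (max x 0) ψ) K₀ (hUK _ _ hx hψ) F
      have e : ∀ κ : Fin (k + 1) ⊕ Fin m → ℤ, ∑ _ξ ∈ S.charFreqs (bfreq ζ (κ ∘ Sum.inr)),
          ‖((1 + ‖κ‖ : ℝ) : ℂ) ^ s • coef L φ (U (max x 0) ψ) κ‖ ^ 2 ≤
          N * ((1 + ‖κ‖) ^ s * ‖coef L φ (U (max x 0) ψ) κ‖) ^ 2 := by
        intro κ
        rw [Finset.sum_const, nsmul_eq_mul, norm_smul, norm_pow, Complex.norm_real,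
          Real.norm_of_nonneg (by positivity)]
        gcongr
        exact S.card_charFreqs_le _
      refine (Finset.sum_le_sum fun κ _ => e κ).trans ?_
      rw [← Finset.mul_sum, hB, mul_pow, Real.sq_sqrt (by positivity), mul_assoc]
      exact mul_le_mul_of_nonneg_left h3 (by positivity))
  rw [Finset.sum_sigma] at h1
  calc ∑ κ ∈ F, ((1 + ‖κ‖) ^ s * ∑ ξ ∈ S.charFreqs (bfreq ζ (κ ∘ Sum.inr)),
        ‖oscCoef L φ U x ξ κ‖) ^ 2
      ≤ ∑ κ ∈ F, N * ∑ ξ ∈ S.charFreqs (bfreq ζ (κ ∘ Sum.inr)),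
        ‖((1 + ‖κ‖ : ℝ) : ℂ) ^ s • oscCoef L φ U x ξ κ‖ ^ 2 := by
        refine Finset.sum_le_sum fun κ _ => ?_
        rw [Finset.mul_sum]
        refine (sq_sum_le_card_mul_sum_sq).trans ?_
        simp only [norm_smul, norm_pow, Complex.norm_real,
          Real.norm_of_nonneg (show 0 ≤ 1 + ‖κ‖ by positivity)]
        gcongr
        exact S.card_charFreqs_le _
    _ ≤ (Real.sqrt N * B) ^ 2 := by
        rw [← Finset.mul_sum, mul_pow, Real.sq_sqrt (by positivity)]
        exact mul_le_mul_of_nonneg_left h1 (by positivity)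

end Spectrum

/-! ### Amplitudes of the modes -/

/-- The modes `(n, ξ)` that a polarized profile may carry: `(n·ζ, ξ)` is characteristic. -/
abbrev Mode (S : BVP k N M) (ζ : Fin m → Euc (k + 1)) :=
  Σ ν : Fin m → ℤ, S.charFreqs (bfreq ζ ν)

variable {S : BVP k N M} {ζ : Fin m → Euc (k + 1)} {U Uev : Profile k m N T}

/-- The amplitude at `(z', x_d)` of the mode `(ν, ξ)` of the localization of `U`. -/
def modeAmp (L : ℝ) (φ : Euc (k + 1) → ℝ) (U : Profile k m N T) (ν : Fin m → ℤ) (ξ : ℝ)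
    (q : Euc (k + 1) × ℝ) : CVec N :=
  fourierPart m L (fun κ => oscCoef L φ U q.2 ξ (Sum.elim κ ν)) q.1

/-- The sums of the absolute values of the Fourier coefficients of the modes. -/
structure ModeBound (S : BVP k N M) (ζ : Fin m → Euc (k + 1)) (L : ℝ) (φ : Euc (k + 1) → ℝ)
    (U : Profile k m N T) (K : ℝ) : Prop where
  pos : 0 < K
  sum_le : ∀ (x : ℝ) (G : Finset (Mode S ζ × (Fin (k + 1) → ℤ))),
    ∑ g ∈ G, (1 + ‖g.1.1‖) * ‖oscCoef L φ U x g.1.2 (Sum.elim g.2 g.1.1)‖ ≤ K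

/-- The weighted sum of the localized coefficients of all the modes is bounded, uniformly in `x_d`. -/
theorem MemOsc.exists_modeBound (ζ : Fin m → Euc (k + 1)) (hU : MemOsc s U) (S : BVP k N M)
    (hφ : IsCutoff (omegaT k T) L φ) (hL : 1 ≤ L) (hs : k + 1 + m + 2 < 2 * s) :
    ∃ K, ModeBound S ζ L φ U K := by
  classical
  obtain ⟨K, hK, h⟩ := hU.exists_sum_oscCoef_le ζ S hφ hL hs
  refine ⟨K, hK, fun x G => ?_⟩
  set r : Mode S ζ × (Fin (k + 1) → ℤ) → (Fin (k + 1) ⊕ Fin m → ℤ) := fun g =>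
    Sum.elim g.2 g.1.1 with hr
  refine le_trans ?_ (h x (G.image r))
  rw [← Finset.sum_fiberwise_of_maps_to (g := r) fun g hg => Finset.mem_image_of_mem r hg]
  refine Finset.sum_le_sum fun κ _ => ?_
  rw [Finset.mul_sum]
  have hinj : Set.InjOn (fun g : Mode S ζ × (Fin (k + 1) → ℤ) => (g.1.2 : ℝ))
      (G.filter fun g => r g = κ) := by
    rintro ⟨⟨ν, ξ⟩, κ'⟩ h1 ⟨⟨ν', ξ'⟩, κ''⟩ h2 h3
    have e := ((Finset.mem_filter.1 h1).2).trans (Finset.mem_filter.1 h2).2.symm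
    obtain rfl : ν = ν' := funext fun j => congrFun e (Sum.inr j)
    obtain rfl : κ' = κ'' := funext fun j => congrFun e (Sum.inl j)
    have : ξ = ξ' := Subtype.ext h3
    rw [this]
  refine le_trans (Finset.sum_le_sum (g := fun g => (1 + ‖κ‖) * ‖oscCoef L φ U x g.1.2 κ‖)
    fun g hg => ?_) ?_
  · obtain ⟨-, rfl⟩ := Finset.mem_filter.1 hg
    exact mul_le_mul_of_nonneg_right (by linarith [norm_le_norm_sumElim g.2 g.1.1])
      (norm_nonneg _)
  · rw [← Finset.sum_image (f := fun ξ => (1 + ‖κ‖) * ‖oscCoef L φ U x ξ κ‖) hinj]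
    refine Finset.sum_le_sum_of_subset_of_nonneg ?_ fun _ _ _ => by positivity
    intro ξ hξ
    obtain ⟨g, hg, rfl⟩ := Finset.mem_image.1 hξ
    obtain ⟨-, rfl⟩ := Finset.mem_filter.1 hg
    exact g.1.2.2

namespace ModeBound

variable {K : ℝ} (hK : ModeBound S ζ L φ U K)

theorem summable (hK : ModeBound S ζ L φ U K) (x : ℝ) :
    Summable fun g : Mode S ζ × (Fin (k + 1) → ℤ) =>
      (1 + ‖g.1.1‖) * ‖oscCoef L φ U x g.1.2 (Sum.elim g.2 g.1.1)‖ :=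
  summable_of_sum_le (fun _ => by positivity) (hK.sum_le x)

theorem summable_coef (hK : ModeBound S ζ L φ U K) (x : ℝ) (α : Mode S ζ) :
    Summable fun κ : Fin (k + 1) → ℤ => ‖oscCoef L φ U x α.2 (Sum.elim κ α.1)‖ := by
  refine ((hK.summable x).comp_injective (Prod.mk_right_injective α)).of_nonneg_of_le
    (fun _ => norm_nonneg _) fun κ => ?_
  exact le_mul_of_one_le_left (norm_nonneg _) (by simp)

theorem norm_modeAmp_le (hK : ModeBound S ζ L φ U K) (hL : 0 < L) (q : Euc (k + 1) × ℝ)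
    (α : Mode S ζ) : ‖modeAmp L φ U α.1 α.2 q‖ ≤ (torusVol k m L)⁻¹ *
      ∑' κ : Fin (k + 1) → ℤ, ‖oscCoef L φ U q.2 α.2 (Sum.elim κ α.1)‖ := by
  have h0 := torusVol_pos k m hL
  rw [modeAmp, fourierPart, norm_smul, Real.norm_of_nonneg (inv_nonneg.2 h0.le)]
  refine mul_le_mul_of_nonneg_left ?_ (inv_nonneg.2 h0.le)
  have : ∀ κ : Fin (k + 1) → ℤ, ‖zmode L κ q.1 • oscCoef L φ U q.2 α.2 (Sum.elim κ α.1)‖ =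
      ‖oscCoef L φ U q.2 α.2 (Sum.elim κ α.1)‖ := fun κ => by
    rw [norm_smul, norm_zmode, one_mul]
  refine (norm_tsum_le_tsum_norm (by simpa only [this] using hK.summable_coef q.2 α)).trans_eq ?_
  simp only [this]

/-- The amplitudes of the modes are summable, with a weight, uniformly. -/
theorem summable_modeAmp (hK : ModeBound S ζ L φ U K) (hL : 0 < L) (q : Euc (k + 1) × ℝ) :
    (Summable fun α : Mode S ζ => (1 + ‖α.1‖) * ‖modeAmp L φ U α.1 α.2 q‖) ∧
    ∑' α : Mode S ζ, (1 + ‖α.1‖) * ‖modeAmp L φ U α.1 α.2 q‖ ≤ (torusVol k m L)⁻¹ * K := by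
  have h0 := torusVol_pos k m hL
  have h1 := (hK.summable q.2).prod
  have h2 : ∑' α : Mode S ζ, ∑' κ : Fin (k + 1) → ℤ,
      (1 + ‖α.1‖) * ‖oscCoef L φ U q.2 α.2 (Sum.elim κ α.1)‖ ≤ K := by
    rw [← (hK.summable q.2).tsum_prod]
    exact (hK.summable q.2).tsum_le_of_sum_le (hK.sum_le q.2)
  have h3 : ∀ α : Mode S ζ, (1 + ‖α.1‖) * ‖modeAmp L φ U α.1 α.2 q‖ ≤ (torusVol k m L)⁻¹ *
      ∑' κ : Fin (k + 1) → ℤ, (1 + ‖α.1‖) * ‖oscCoef L φ U q.2 α.2 (Sum.elim κ α.1)‖ := by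
    intro α
    rw [tsum_mul_left, mul_left_comm]
    exact mul_le_mul_of_nonneg_left (hK.norm_modeAmp_le hL q α) (by positivity)
  have h4 : Summable fun α : Mode S ζ => (1 + ‖α.1‖) * ‖modeAmp L φ U α.1 α.2 q‖ :=
    (h1.mul_left _).of_nonneg_of_le (fun _ => by positivity) h3
  refine ⟨h4, (h4.tsum_le_tsum h3 (h1.mul_left _)).trans ?_⟩
  rw [tsum_mul_left]
  exact mul_le_mul_of_nonneg_left h2 (inv_nonneg.2 h0.le)

theorem measurable_modeAmp (hK : ModeBound S ζ L φ U K) (hU : MemOsc s U)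
    (hφ : IsCutoff (omegaT k T) L φ) (hL : 0 < L) (α : Mode S ζ) :
    StronglyMeasurable (modeAmp L φ U α.1 α.2) := by
  have h : ∀ κ : Fin (k + 1) → ℤ, Continuous fun q : Euc (k + 1) × ℝ =>
      zmode L κ q.1 • oscCoef L φ U q.2 α.2 (Sum.elim κ α.1) := fun κ =>
    ((continuous_zmode L κ).comp continuous_fst).smul
      ((hU.continuous_oscCoef hφ hL _ _).comp continuous_snd)
  have h2 : ∀ q : Euc (k + 1) × ℝ, HasSum
      (fun κ : Fin (k + 1) → ℤ => zmode L κ q.1 • oscCoef L φ U q.2 α.2 (Sum.elim κ α.1))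
      (∑' κ : Fin (k + 1) → ℤ, zmode L κ q.1 • oscCoef L φ U q.2 α.2 (Sum.elim κ α.1)) :=
    fun q => (Summable.of_norm (by
      simpa only [norm_smul, norm_zmode, one_mul] using hK.summable_coef q.2 α)).hasSum
  have h3 : StronglyMeasurable fun q : Euc (k + 1) × ℝ =>
      ∑' κ : Fin (k + 1) → ℤ, zmode L κ q.1 • oscCoef L φ U q.2 α.2 (Sum.elim κ α.1) :=
    stronglyMeasurable_of_tendsto atTop
      (fun F => (continuous_finsetSum F fun κ _ => h κ).stronglyMeasurable)
      (tendsto_pi_nhds.2 fun q => h2 q)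
  show StronglyMeasurable fun q : Euc (k + 1) × ℝ => (torusVol k m L)⁻¹ •
    ∑' κ : Fin (k + 1) → ℤ, zmode L κ q.1 • oscCoef L φ U q.2 α.2 (Sum.elim κ α.1)
  exact h3.const_smul (torusVol k m L)⁻¹

theorem proj_modeAmp (hK : ModeBound S ζ L φ U K) (hU : MemOsc s U)
    (hpol : IsProjE S ζ U Uev U Uev) (hφ : IsCutoff (omegaT k T) L φ) (q : Euc (k + 1) × ℝ)
    (α : Mode S ζ) :
    S.proj (bfreq ζ α.1) α.2 (modeAmp L φ U α.1 α.2 q) = modeAmp L φ U α.1 α.2 q := by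
  set P := LinearMap.toContinuousLinearMap (S.proj (bfreq ζ α.1) α.2) with hP
  change P _ = _
  have h2 : Summable fun κ : Fin (k + 1) → ℤ =>
      zmode L κ q.1 • oscCoef L φ U q.2 α.2 (Sum.elim κ α.1) := Summable.of_norm (by
      simpa only [norm_smul, norm_zmode, one_mul] using hK.summable_coef q.2 α)
  rw [modeAmp, fourierPart, ← Complex.coe_smul, P.map_smul, P.map_tsum h2]
  congr 1
  refine tsum_congr fun κ => ?_
  rw [P.map_smul]
  congr 1
  exact hU.proj_oscCoef hpol hφ _ _ _ _

end ModeBound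

end

noncomputable section

variable {k m N M n : ℕ} {T : ℝ} {s : ℕ} {L : ℝ} {φ : Euc (k + 1) → ℝ}
variable {S : BVP k N M} {ζ : Fin m → Euc (k + 1)} {U Uev : Profile k m N T} {K : ℝ}

/-! ### The mode expansion of a localized profile -/

/-- Joint frequencies `(κ, ν)`, together with a characteristic root `ξ` over `ν`. -/
def modeEquiv (S : BVP k N M) (ζ : Fin m → Euc (k + 1)) :
    (Σ κ : Fin (k + 1) ⊕ Fin m → ℤ, S.charFreqs (bfreq ζ (κ ∘ Sum.inr))) ≃
      Mode S ζ × (Fin (k + 1) → ℤ) where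
  toFun g := (⟨g.1 ∘ Sum.inr, g.2⟩, g.1 ∘ Sum.inl)
  invFun g := ⟨Sum.elim g.2 g.1.1, g.1.2⟩
  left_inv := by
    rintro ⟨κ, ξ⟩
    obtain ⟨κ', ν, rfl⟩ := exists_eq_sumElim κ
    rfl
  right_inv := by
    rintro ⟨⟨ν, ξ⟩, κ⟩
    rfl

namespace ModeBound

/-- A localized function whose coefficients are, up to a factor `w ν`, those of the profile is the
sum of the corresponding series of modes. -/
theorem ae_eq_tsum (hK : ModeBound S ζ L φ U K) (hL : 0 < L) (hφ : IsCutoff (omegaT k T) L φ)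
    (u : L2 (omegaT k T) m N) {w : (Fin m → ℤ) → ℂ} (hw : ∀ ν, ‖w ν‖ ≤ 1 + ‖ν‖) {x ψ : ℝ}
    (hu : ∀ κ ν, coef L φ u (Sum.elim κ ν) = w ν • ∑ ξ ∈ S.charFreqs (bfreq ζ ν),
      Complex.exp (Complex.I * (ψ * ξ : ℝ)) • oscCoef L φ U x ξ (Sum.elim κ ν)) :
    ∀ᵐ p ∂(torusMeasure (omegaT k T) m), p.1 ∈ cube k L → φ p.1 • u p =
      ∑' α : Mode S ζ, w α.1 • Complex.exp (Complex.I * (α.2 * ψ : ℝ)) • tmode α.1 p.2 •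
        modeAmp L φ U α.1 α.2 (p.1, x) := by
  set a : Mode S ζ × (Fin (k + 1) → ℤ) → CVec N := fun g =>
    w g.1.1 • Complex.exp (Complex.I * (g.1.2 * ψ : ℝ)) •
      oscCoef L φ U x g.1.2 (Sum.elim g.2 g.1.1) with ha
  have hexp : ∀ t : ℝ, ‖Complex.exp (Complex.I * t)‖ = 1 := norm_exp_I_mul_ofReal
  have hsum : Summable fun g => ‖a g‖ := by
    refine (hK.summable x).of_nonneg_of_le (fun _ => norm_nonneg _) fun g => ?_
    rw [ha]
    simp only
    rw [norm_smul, norm_smul, hexp, one_mul]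
    exact mul_le_mul_of_nonneg_right (hw _) (norm_nonneg _)
  have hcoef : ∀ κ : Fin (k + 1) ⊕ Fin m → ℤ, coef L φ u κ =
      ∑' ξ : S.charFreqs (bfreq ζ (κ ∘ Sum.inr)), a (modeEquiv S ζ ⟨κ, ξ⟩) := by
    intro κ
    obtain ⟨κ', ν, rfl⟩ := exists_eq_sumElim κ
    rw [hu, tsum_fintype, Finset.smul_sum, ← Finset.sum_coe_sort]
    refine Finset.sum_congr rfl fun ξ _ => ?_
    simp only [ha, modeEquiv, Equiv.coe_fn_mk, mul_comm ψ]
    rfl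
  have hsum' : Summable fun g => ‖a (modeEquiv S ζ g)‖ :=
    (modeEquiv S ζ).summable_iff.2 hsum
  have hs : Summable fun κ => ‖coef L φ u κ‖ := by
    refine hsum'.sigma.of_nonneg_of_le (fun _ => norm_nonneg _) fun κ => ?_
    rw [hcoef, tsum_fintype, tsum_fintype]
    exact norm_sum_le _ _
  filter_upwards [hφ.ae_eq_fourierSum hL (measurableSet_omegaT T) u hs] with p hp hc
  rw [hp hc, fourierSum]
  have e1 : ∀ κ, emode L κ p • coef L φ u κ = ∑' ξ : S.charFreqs (bfreq ζ (κ ∘ Sum.inr)),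
      (fun g : Mode S ζ × (Fin (k + 1) → ℤ) => emode L (Sum.elim g.2 g.1.1) p • a g)
        (modeEquiv S ζ ⟨κ, ξ⟩) := by
    intro κ
    rw [hcoef, ← tsum_const_smul'']
    refine tsum_congr fun ξ => ?_
    simp only [modeEquiv, Equiv.coe_fn_mk, Sum.elim_comp_inl_inr]
  have hsum2 : Summable fun g : Mode S ζ × (Fin (k + 1) → ℤ) =>
      emode L (Sum.elim g.2 g.1.1) p • a g := by
    refine Summable.of_norm ?_
    simpa only [norm_smul, norm_emode, one_mul] using hsum
  simp only [e1]
  rw [← ((modeEquiv S ζ).summable_iff.2 hsum2).tsum_sigma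
      (f := fun g => (fun g : Mode S ζ × (Fin (k + 1) → ℤ) =>
        emode L (Sum.elim g.2 g.1.1) p • a g) (modeEquiv S ζ g)),
    (modeEquiv S ζ).tsum_eq (fun g : Mode S ζ × (Fin (k + 1) → ℤ) =>
      emode L (Sum.elim g.2 g.1.1) p • a g), hsum2.tsum_prod, ← tsum_const_smul'']
  refine tsum_congr fun α => ?_
  obtain ⟨z, θ⟩ := p
  rw [modeAmp, fourierPart]
  simp only [← tsum_const_smul'']
  refine tsum_congr fun κ => ?_
  simp only [ha, emode_sumElim]
  rw [smul_comm (tmode α.1 θ), smul_comm (Complex.exp _) (torusVol k m L)⁻¹,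
    smul_comm (w α.1) (torusVol k m L)⁻¹]
  simp only [smul_smul]
  congr 2
  ring

theorem ae_osc_eq (hK : ModeBound S ζ L φ U K) (hL : 0 < L) (hφ : IsCutoff (omegaT k T) L φ)
    (hchar : S.Noncharacteristic) (hU : MemOsc s U) (hpol : IsProjE S ζ U Uev U Uev) {x ψ : ℝ}
    (hx : 0 ≤ x) (hψ : 0 ≤ ψ) :
    ∀ᵐ p ∂(torusMeasure (omegaT k T) m), p.1 ∈ cube k L → φ p.1 • U x ψ p =
      ∑' α : Mode S ζ, Complex.exp (Complex.I * (α.2 * ψ : ℝ)) • tmode α.1 p.2 •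
        modeAmp L φ U α.1 α.2 (p.1, x) := by
  have := hK.ae_eq_tsum hL hφ (U x ψ) (w := fun _ => 1) (ψ := ψ) (x := x) (fun ν => by simp)
    fun κ ν => by rw [one_smul, hU.coef_eq_sum hchar hpol hφ hL hx hψ]
  simpa only [one_smul] using this

theorem ae_deriv_eq (hK : ModeBound S ζ L φ U K) (hL : 0 < L) (hφ : IsCutoff (omegaT k T) L φ)
    (hchar : S.Noncharacteristic) (hU : MemOsc s U) (hpol : IsProjE S ζ U Uev U Uev) {x ψ : ℝ}
    (hx : 0 ≤ x) (hψ : 0 ≤ ψ) {j : Fin m} {v : L2 (omegaT k T) m N}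
    (hv : IsWeakDeriv (Sum.inr j) (U x ψ) v) :
    ∀ᵐ p ∂(torusMeasure (omegaT k T) m), p.1 ∈ cube k L → φ p.1 • v p =
      ∑' α : Mode S ζ, (Complex.I * α.1 j) • Complex.exp (Complex.I * (α.2 * ψ : ℝ)) •
        tmode α.1 p.2 • modeAmp L φ U α.1 α.2 (p.1, x) := by
  refine hK.ae_eq_tsum hL hφ v (w := fun ν => Complex.I * ν j) (fun ν => ?_) fun κ ν => ?_
  · rw [norm_mul, Complex.norm_I, one_mul, Complex.norm_intCast, ← Int.norm_eq_abs]
    linarith [norm_le_pi_norm ν j]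
  · have h := hv.coef_eq hφ (Sum.elim κ ν)
    have h0 : coef L (cutoffDeriv φ (Sum.inr j : Fin (k + 1) ⊕ Fin m)) (U x ψ) (Sum.elim κ ν) = 0 := by
      simp [coef, cutoffDeriv]
    rw [h0, add_zero] at h
    rw [← h, hU.coef_eq_sum hchar hpol hφ hL hx hψ]
    simp [freq]

/-- On the localized region, the amplitudes are the Fourier coefficients of the profile. -/
theorem ae_thetaCoef_eq (hK : ModeBound S ζ L φ U K) (hL : 0 < L)
    (hφ : IsCutoff (omegaT k T) L φ) (hchar : S.Noncharacteristic) (hU : MemOsc s U)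
    (hpol : IsProjE S ζ U Uev U Uev) {x : ℝ} (hx : 0 ≤ x) (ξ : ℝ) :
    ∀ᵐ z ∂(volume.restrict (omegaT k T)), z ∈ cube k L → ∀ ν,
      φ z • thetaCoef (freqPart (U x) ξ) ν z = modeAmp L φ U ν ξ (z, x) := by
  have h1 : Summable fun κ => ‖coef L φ (freqPart (U x) ξ) κ‖ := by
    have h2 := ((modeEquiv S ζ).summable_iff.2 (hK.summable x)).sigma
    refine h2.of_nonneg_of_le (fun _ => norm_nonneg _) fun κ => ?_
    obtain ⟨κ', ν, rfl⟩ := exists_eq_sumElim κ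
    have e : coef L φ (freqPart (U x) ξ) (Sum.elim κ' ν) = oscCoef L φ U x ξ (Sum.elim κ' ν) := by
      rw [oscCoef, max_eq_left hx]
    rw [tsum_fintype, e]
    by_cases hξ : ξ ∈ S.charFreqs (bfreq ζ ν)
    · refine le_trans ?_ (Finset.single_le_sum (fun i _ => ?_) (Finset.mem_univ
        (⟨ξ, hξ⟩ : S.charFreqs (bfreq ζ (Sum.elim κ' ν ∘ Sum.inr)))))
      · simp only [Function.comp_apply, modeEquiv, Equiv.coe_fn_mk]
        exact le_mul_of_one_le_left (norm_nonneg _) (by simp)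
      · simp only [Function.comp_apply]
        positivity
    · rw [hU.oscCoef_eq_zero hchar hpol hφ x κ' hξ, norm_zero]
      refine Finset.sum_nonneg fun i _ => ?_
      simp only [Function.comp_apply]
      positivity
  filter_upwards [hφ.ae_thetaCoef_eq hL (measurableSet_omegaT T) (freqPart (U x) ξ) h1]
    with z hz hc ν
  rw [hz hc ν, modeAmp]
  simp only [oscCoef, max_eq_left hx]

end ModeBound

/-- Oscillating components vanish in the past. -/
theorem MemOsc.freqPart_eq_zero (hU : MemOsc s U) {x : ℝ} (hx : 0 ≤ x) (ξ : ℝ) :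
    ∀ᵐ p ∂(torusMeasure (omegaT k T) m), p.1 0 < 0 → freqPart (U x) ξ p = 0 := by
  set A : Set (Euc (k + 1) × Euc m) := {p | p.1 0 < 0} with hA
  have hAm : MeasurableSet A := measurableSet_lt (by fun_prop) measurable_const
  have h1 := (hU.isAlmostPeriodic hx).isFreqPart_freqPart ξ
  have h2 := h1.clm (hU.isAlmostPeriodic hx).continuousOn
    (LpToLpRestrictCLM (Euc (k + 1) × Euc m) (CVec N) ℂ (torusMeasure (omegaT k T) m) 2 A)
  have h3 : ∀ ψ, 0 ≤ ψ → LpToLpRestrictCLM (Euc (k + 1) × Euc m) (CVec N) ℂ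
      (torusMeasure (omegaT k T) m) 2 A (U x ψ) = 0 := by
    intro ψ hψ
    refine (Lp.eq_zero_iff_ae_eq_zero).2 ?_
    filter_upwards [LpToLpRestrictCLM_coeFn ℂ A (U x ψ),
      (ae_restrict_iff' hAm).2 (hU.1.zero x ψ hx hψ)] with p hp h0
    rw [hp, h0]; rfl
  have h4 := h2.norm_le (K := 0) fun ψ hψ => by rw [h3 ψ hψ, norm_zero]
  have h5 := (Lp.eq_zero_iff_ae_eq_zero).1 (norm_le_zero_iff.1 h4)
  refine (ae_restrict_iff' hAm).1 ?_
  filter_upwards [h5, LpToLpRestrictCLM_coeFn ℂ A (freqPart (U x) ξ)] with p hp hp'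
  rw [← hp', hp]; rfl

theorem MemOsc.thetaCoef_freqPart_eq_zero (hU : MemOsc s U) {x : ℝ} (hx : 0 ≤ x) (ξ : ℝ)
    (ν : Fin m → ℤ) :
    ∀ᵐ z ∂(volume.restrict (omegaT k T)), z 0 < 0 → thetaCoef (freqPart (U x) ξ) ν z = 0 := by
  filter_upwards [ae_ae_of_ae_torusMeasure (hU.freqPart_eq_zero hx ξ)] with z hz h0
  rw [thetaCoef_eq, integral_eq_zero_of_ae, smul_zero]
  filter_upwards [hz] with θ hθ
  rw [hθ h0, smul_zero]; rfl

/-- The amplitudes of the modes vanish in the past. -/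
theorem ModeBound.ae_modeAmp_eq_zero (hK : ModeBound S ζ L φ U K) (hL : 0 < L)
    (hφ : IsCutoff (omegaT k T) L φ) (hchar : S.Noncharacteristic) (hU : MemOsc s U)
    (hpol : IsProjE S ζ U Uev U Uev) (α : Mode S ζ) :
    ∀ᵐ q : Euc (k + 1) × ℝ, q.1 ∈ omegaT k T ∩ cube k L → 0 ≤ q.2 → q.1 0 < 0 →
      modeAmp L φ U α.1 α.2 q = 0 := by
  have hm : MeasurableSet {q : Euc (k + 1) × ℝ | q.1 ∈ omegaT k T ∩ cube k L → 0 ≤ q.2 →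
      q.1 0 < 0 → modeAmp L φ U α.1 α.2 q = 0} := by
    have h1 : MeasurableSet {q : Euc (k + 1) × ℝ | q.1 ∈ omegaT k T ∩ cube k L} :=
      measurable_fst ((measurableSet_omegaT T).inter (measurableSet_cube L))
    have h2 : MeasurableSet {q : Euc (k + 1) × ℝ | 0 ≤ q.2} :=
      measurableSet_le measurable_const measurable_snd
    have h3 : MeasurableSet {q : Euc (k + 1) × ℝ | q.1 0 < 0} :=
      measurableSet_lt (by fun_prop) measurable_const
    have h4 : MeasurableSet {q : Euc (k + 1) × ℝ | modeAmp L φ U α.1 α.2 q = 0} :=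
      (hK.measurable_modeAmp hU hφ hL α).measurable (measurableSet_singleton 0)
    exact h1.imp (h2.imp (h3.imp h4))
  rw [Measure.volume_eq_prod]
  refine (Measure.ae_prod_iff_ae_ae hm).2 (Measure.ae_ae_comm ?_ |>.2 ?_)
  · exact hm
  refine Eventually.of_forall fun x => ?_
  by_cases hx : 0 ≤ x
  · have h1 := hK.ae_thetaCoef_eq hL hφ hchar hU hpol hx α.2
    have h2 := hU.thetaCoef_freqPart_eq_zero hx α.2 α.1
    rw [ae_restrict_iff' (measurableSet_omegaT T)] at h1 h2
    filter_upwards [h1, h2] with z h1 h2 hz _ h0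
    rw [← h1 hz.1 hz.2, h2 hz.1 h0, smul_zero]
  · filter_upwards with z _ h
    exact absurd h hx

end

noncomputable section

variable {k m N M n : ℕ} {T : ℝ}

/-! ### Integration of trigonometric series -/

theorem stronglyMeasurable_tsum {ι α E : Type*} [Countable ι] [MeasurableSpace α]
    [NormedAddCommGroup E] {f : ι → α → E} (hf : ∀ i, StronglyMeasurable (f i))
    (hs : ∀ a, Summable fun i => f i a) : StronglyMeasurable fun a => ∑' i, f i a :=
  stronglyMeasurable_of_tendsto atTop
    (fun F : Finset ι => Finset.stronglyMeasurable_fun_sum F fun i _ => hf i)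
    (tendsto_pi_nhds.2 fun a => (hs a).hasSum)

instance (D : Set (Euc (k + 1))) : SFinite (torusMeasure D m) := by
  unfold torusMeasure; infer_instance

theorem tsum_enorm_le {ι α E : Type*} [NormedAddCommGroup E] {f : ι → α → E} {A : Set α} {B : ℝ}
    (hs : ∀ a, Summable fun i => ‖f i a‖) (hB : ∀ a, ∑' i, ‖f i a‖ ≤ B)
    (h0 : ∀ i, ∀ a ∉ A, f i a = 0) (a : α) :
    ∑' i, ‖f i a‖ₑ ≤ A.indicator (fun _ => ENNReal.ofReal B) a := by
  by_cases ha : a ∈ A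
  · rw [Set.indicator_of_mem ha]
    simp only [← ofReal_norm]
    rw [← ENNReal.ofReal_tsum_of_nonneg (fun _ => norm_nonneg _) (hs a)]
    exact ENNReal.ofReal_le_ofReal (hB a)
  · simp [h0 _ a ha, ha]

section Series

variable {ι α E : Type*} [Countable ι] [MeasurableSpace α] [NormedAddCommGroup E]
  {μ : Measure α} {f : ι → α → E} {A : Set α} {B : ℝ}

theorem tsum_lintegral_enorm_ne_top (hf : ∀ i, StronglyMeasurable (f i)) (hA : MeasurableSet A)
    (hμ : μ A ≠ ⊤) (hs : ∀ a, Summable fun i => ‖f i a‖) (hB : ∀ a, ∑' i, ‖f i a‖ ≤ B)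
    (h0 : ∀ i, ∀ a ∉ A, f i a = 0) : ∑' i, ∫⁻ a, ‖f i a‖ₑ ∂μ ≠ ⊤ := by
  rw [← lintegral_tsum fun i => (hf i).enorm.aemeasurable]
  refine ne_top_of_le_ne_top ?_ (lintegral_mono fun a => tsum_enorm_le hs hB h0 a)
  rw [lintegral_indicator_const hA]
  exact ENNReal.mul_ne_top ENNReal.ofReal_ne_top hμ

/-- Termwise integration of a series which is normally convergent and supported in a set of finite
measure. -/
theorem integral_tsum_of_bound [NormedSpace ℝ E] [CompleteSpace E]
    (hf : ∀ i, StronglyMeasurable (f i)) (hA : MeasurableSet A)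
    (hμ : μ A ≠ ⊤) (hs : ∀ a, Summable fun i => ‖f i a‖) (hB : ∀ a, ∑' i, ‖f i a‖ ≤ B)
    (h0 : ∀ i, ∀ a ∉ A, f i a = 0) :
    (∀ i, Integrable (f i) μ) ∧ (Summable fun i => ‖∫ a, f i a ∂μ‖) ∧
      Integrable (fun a => ∑' i, f i a) μ ∧ ∫ a, ∑' i, f i a ∂μ = ∑' i, ∫ a, f i a ∂μ := by
  have h1 := tsum_lintegral_enorm_ne_top hf hA hμ hs hB h0
  have h2 : ∀ i, Integrable (f i) μ := fun i =>
    ⟨(hf i).aestronglyMeasurable, lt_top_iff_ne_top.2 (ENNReal.ne_top_of_tsum_ne_top h1 i)⟩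
  refine ⟨h2, ?_, ?_, integral_tsum (fun i => (hf i).aestronglyMeasurable) h1⟩
  · refine (ENNReal.summable_toReal h1).of_nonneg_of_le (fun _ => norm_nonneg _) fun i => ?_
    rw [← integral_norm_eq_lintegral_enorm (hf i).aestronglyMeasurable]
    exact norm_integral_le_integral_norm _
  · refine ⟨(stronglyMeasurable_tsum hf fun a => (hs a).of_norm).aestronglyMeasurable, ?_⟩
    refine lt_of_le_of_lt (lintegral_mono fun a => ?_)
      ((lintegral_tsum fun i => (hf i).enorm.aemeasurable).trans_lt h1.lt_top)
    exact enorm_tsum_le_tsum_enorm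

end Series

/-- The Fourier component of frequency `(ν, ξ)` of a trigonometric series in `(θ, ψ)`, integrated
in `(z', x_d)`. -/
theorem isFreqPart_integral_series {ι : Type*} [Countable ι] {D : Set (Euc (k + 1))}
    {c : ι → Euc (k + 1) × ℝ → CVec N} (hc : ∀ i, StronglyMeasurable (c i)) {R B : ℝ}
    (hs : ∀ q, Summable fun i => ‖c i q‖) (hB : ∀ q, ∑' i, ‖c i q‖ ≤ B)
    (h0 : ∀ i, ∀ q ∉ Metric.closedBall (0 : Euc (k + 1) × ℝ) R, c i q = 0)
    (n : ι → Fin m → ℤ) (r : ι → ℝ) (ν : Fin m → ℤ) (ξ : ℝ) :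
    let W : ℝ → CVec N := fun ψ => ∫ x in Set.Ioi (0 : ℝ), ∫ p, tmode (-ν) p.2 •
      ∑' i, Complex.exp (Complex.I * (r i * ψ : ℝ)) • tmode (n i) p.2 • c i (p.1, x)
      ∂(torusMeasure D m)
    Continuous W ∧ IsFreqPart W ξ (((2 * Real.pi) ^ m : ℝ) •
      ∫ q in D ×ˢ Set.Ioi (0 : ℝ), ∑' i, if n i = ν ∧ r i = ξ then c i q else 0) := by
  classical
  intro W
  set ρ : Measure (ℝ × Euc (k + 1) × Euc m) :=
    (volume.restrict (Set.Ioi (0 : ℝ))).prod (torusMeasure D m) with hρ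
  set A : Set (ℝ × Euc (k + 1) × Euc m) :=
    Metric.closedBall (0 : ℝ) R ×ˢ (Metric.closedBall (0 : Euc (k + 1)) R ×ˢ Set.univ) with hA
  have hAm : MeasurableSet A := Metric.isClosed_closedBall.measurableSet.prod
    (Metric.isClosed_closedBall.measurableSet.prod MeasurableSet.univ)
  have hAρ : ρ A ≠ ⊤ := by
    rw [hρ, torusMeasure_eq_prod, hA, Measure.prod_prod, Measure.prod_prod]
    refine ENNReal.mul_ne_top ?_ (ENNReal.mul_ne_top ?_ (measure_ne_top _ _))
    · exact ((Measure.restrict_apply_le _ _).trans_lt measure_closedBall_lt_top).ne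
    · exact ((Measure.restrict_apply_le _ _).trans_lt measure_closedBall_lt_top).ne
  have hout : ∀ y : ℝ × Euc (k + 1) × Euc m, y ∉ A → ∀ i, c i (y.2.1, y.1) = 0 := by
    intro y hy i
    refine h0 i _ fun h => hy ?_
    rw [← Prod.mk_zero_zero, ← closedBall_prod_same] at h
    exact ⟨h.2, h.1, trivial⟩
  set g : ι → ℝ × Euc (k + 1) × Euc m → CVec N := fun i y =>
    tmode (n i - ν) y.2.2 • c i (y.2.1, y.1) with hg
  have hgm : ∀ i, StronglyMeasurable (g i) := fun i =>
    ((continuous_tmode (n i - ν)).comp (continuous_snd.comp continuous_snd)).stronglyMeasurable.smul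
      ((hc i).comp_measurable (by fun_prop))
  have hgn : ∀ i y, ‖g i y‖ = ‖c i (y.2.1, y.1)‖ := fun i y => by
    rw [hg]; simp only; rw [norm_smul, norm_tmode, one_mul]
  obtain ⟨hgi, hgs, -, -⟩ := integral_tsum_of_bound (μ := ρ) hgm hAm hAρ
    (fun y => by simpa only [hgn] using hs _) (fun y => by simpa only [hgn] using hB _)
    (fun i y hy => by rw [hg]; simp only; rw [hout y hy, smul_zero])
  have hW : ∀ ψ, W ψ = ∑' i, Complex.exp (Complex.I * (r i * ψ : ℝ)) • ∫ y, g i y ∂ρ := by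
    intro ψ
    have hn : ∀ i y, ‖Complex.exp (Complex.I * (r i * ψ : ℝ)) • g i y‖ = ‖c i (y.2.1, y.1)‖ :=
      fun i y => by rw [norm_smul, norm_exp_I_mul_ofReal, one_mul, hgn]
    obtain ⟨-, -, h3, h4⟩ := integral_tsum_of_bound (μ := ρ)
      (f := fun i y => Complex.exp (Complex.I * (r i * ψ : ℝ)) • g i y)
      (fun i => (hgm i).const_smul (Complex.exp (Complex.I * (r i * ψ : ℝ)))) hAm hAρ
      (fun y => by simpa only [hn] using hs _) (fun y => by simpa only [hn] using hB _)
      (fun i y hy => by rw [hg]; simp only; rw [hout y hy, smul_zero, smul_zero])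
    rw [integral_prod _ h3] at h4
    simp only [integral_smul] at h4
    rw [← h4]
    refine integral_congr_ae (Eventually.of_forall fun x => ?_)
    simp only
    refine integral_congr_ae (Eventually.of_forall fun p => ?_)
    simp only [hg]
    rw [← tsum_const_smul'']
    refine tsum_congr fun i => ?_
    rw [smul_comm (tmode (-ν) p.2), smul_smul (tmode (-ν) p.2), ← tmode_add, neg_add_eq_sub]
  -- the integral in `θ` selects the terms of frequency `ν`
  have hCi : ∀ i, ∫ y, g i y ∂ρ = if n i = ν then ((2 * Real.pi) ^ m : ℝ) •
      ∫ q in D ×ˢ Set.Ioi (0 : ℝ), c i q else 0 := by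
    intro i
    have hci : Integrable (c i) ((volume.restrict D).prod (volume.restrict (Set.Ioi (0 : ℝ)))) := by
      obtain ⟨h, -⟩ := integral_tsum_of_bound
        (μ := (volume.restrict D).prod (volume.restrict (Set.Ioi (0 : ℝ)))) hc
        (A := Metric.closedBall 0 R) Metric.isClosed_closedBall.measurableSet (by
          rw [Measure.prod_restrict, ← Measure.volume_eq_prod]
          exact ((Measure.restrict_apply_le _ _).trans_lt measure_closedBall_lt_top).ne)
        hs hB h0
      exact h i
    rw [integral_prod _ (hgi i)]
    have e1 : ∀ᵐ x ∂(volume.restrict (Set.Ioi (0 : ℝ))), ∫ p, g i (x, p) ∂(torusMeasure D m) =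
        (∫ θ in box m, tmode (n i - ν) θ) • ∫ z in D, c i (z, x) := by
      filter_upwards [(hgi i).prod_right_ae] with x hx
      have hx' : Integrable (fun p => g i (x, p))
          ((volume.restrict D).prod (volume.restrict (box m))) := by
        rw [← torusMeasure_eq_prod]; exact hx
      rw [torusMeasure_eq_prod, integral_prod _ hx', ← integral_smul]
      refine integral_congr_ae (Eventually.of_forall fun z => ?_)
      simp only [hg]
      rw [integral_smul_const]
    rw [integral_congr_ae e1, integral_smul, integral_tmode, Measure.volume_eq_prod,
      ← Measure.prod_restrict, integral_prod_symm _ hci]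
    by_cases h : n i = ν
    · rw [if_pos (sub_eq_zero.2 h), if_pos h, Complex.coe_smul]
    · rw [if_neg (sub_ne_zero.2 h), if_neg h, zero_smul]
  have hfin : ∑' i, (if r i = ξ then ∫ y, g i y ∂ρ else 0) = ((2 * Real.pi) ^ m : ℝ) •
      ∫ q in D ×ˢ Set.Ioi (0 : ℝ), ∑' i, if n i = ν ∧ r i = ξ then c i q else 0 := by
    have hle : ∀ i q, ‖(if n i = ν ∧ r i = ξ then c i q else 0)‖ ≤ ‖c i q‖ := fun i q => by
      split_ifs
      · exact le_rfl
      · rw [norm_zero]; exact norm_nonneg _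
    have hs' : ∀ q, Summable fun i => ‖(if n i = ν ∧ r i = ξ then c i q else 0)‖ := fun q =>
      (hs q).of_nonneg_of_le (fun _ => norm_nonneg _) fun i => hle i q
    obtain ⟨-, -, -, h⟩ := integral_tsum_of_bound
      (μ := volume.restrict (D ×ˢ Set.Ioi (0 : ℝ)))
      (f := fun i q => if n i = ν ∧ r i = ξ then c i q else 0)
      (A := Metric.closedBall (0 : Euc (k + 1) × ℝ) R) (B := B)
      (fun i => by
        split_ifs
        · exact hc i
        · exact stronglyMeasurable_const)
      Metric.isClosed_closedBall.measurableSet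
      ((Measure.restrict_apply_le _ _).trans_lt measure_closedBall_lt_top).ne hs'
      (fun q => ((hs' q).tsum_le_tsum (fun i => hle i q) (hs q)).trans (hB q))
      (fun i q hq => by rw [h0 i q hq, ite_self])
    rw [h, ← tsum_const_smul'']
    refine tsum_congr fun i => ?_
    rw [hCi]
    by_cases h1 : n i = ν <;> by_cases h2 : r i = ξ <;> simp [h1, h2]
  have hW' : W = fun ψ => ∑' i, Complex.exp (Complex.I * (r i * ψ : ℝ)) • ∫ y, g i y ∂ρ :=
    funext hW
  rw [hW', ← hfin]
  refine ⟨continuous_tsum (fun i => by fun_prop) hgs fun i ψ => ?_, isFreqPart_tsum r hgs ξ⟩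
  rw [norm_smul, norm_exp_I_mul_ofReal, one_mul]

end

noncomputable section

variable {k m N M n : ℕ} {T : ℝ}

/-! ### Continuity of the tested equation -/

/-- Testing a function of `L^q` in `(z', θ)` against a compactly supported function of `(z', x_d)`
is continuous, jointly with respect to `x_d`. -/
theorem exists_pairing {q : ℝ≥0∞} [Fact (1 ≤ q)] (D : Set (Euc (k + 1)))
    {g : Euc (k + 1) × ℝ → ℝ} (hg : Continuous g) (hgc : HasCompactSupport g) (ν : Fin m → ℤ) :
    ∃ (P : ℝ → Lp (CVec N) q (torusMeasure D m) → CVec N) (C : ℝ), 0 ≤ C ∧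
      (∀ x G, P x G = ∫ p, tmode ν p.2 • g (p.1, x) • G p ∂(torusMeasure D m)) ∧
      (∀ x (G : Lp (CVec N) q (torusMeasure D m)),
        Integrable (fun p => tmode ν p.2 • g (p.1, x) • G p) (torusMeasure D m)) ∧
      (∀ x G, ‖P x G‖ ≤ C * ‖G‖) ∧ (∀ x G G', P x (G - G') = P x G - P x G') ∧
      Continuous fun y : ℝ × Lp (CVec N) q (torusMeasure D m) => P y.1 y.2 := by
  set μ := torusMeasure D m with hμ
  have hq : 1 ≤ q := Fact.out
  obtain ⟨C₀, hC₀⟩ := hg.bounded_above_of_compact_support hgc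
  have hC₀0 : 0 ≤ C₀ := (norm_nonneg _).trans (hC₀ 0)
  obtain ⟨R, hR⟩ := hgc.isCompact.isBounded.exists_norm_le
  set A : Set (Euc (k + 1) × Euc m) := Metric.closedBall 0 R ×ˢ Set.univ with hA
  have hAm : MeasurableSet A := Metric.isClosed_closedBall.measurableSet.prod MeasurableSet.univ
  have hμA : μ A < ⊤ := by
    rw [hμ, torusMeasure_eq_prod, hA, Measure.prod_prod]
    exact ENNReal.mul_lt_top
      ((Measure.restrict_apply_le _ _).trans_lt measure_closedBall_lt_top) (measure_lt_top _ _)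
  have : IsFiniteMeasure (μ.restrict A) := ⟨by rwa [Measure.restrict_apply_univ]⟩
  have hout : ∀ x (p : Euc (k + 1) × Euc m), p ∉ A → g (p.1, x) = 0 := by
    intro x p hp
    by_contra h
    refine hp ⟨?_, trivial⟩
    have := hR _ (subset_tsupport g h)
    rw [mem_closedBall_zero_iff]
    exact (norm_fst_le (p.1, x)).trans this
  have hint : ∀ G : Lp (CVec N) q μ, IntegrableOn (fun p => ‖G p‖) A μ := fun G =>
    (((Lp.memLp G).restrict A).mono_exponent hq |> memLp_one_iff_integrable.1).norm
  have hbd : ∀ (G : Lp (CVec N) q μ) x p,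
      ‖tmode ν p.2 • g (p.1, x) • G p‖ ≤ A.indicator (fun p => C₀ * ‖G p‖) p := by
    intro G x p
    by_cases hp : p ∈ A
    · rw [Set.indicator_of_mem hp, norm_smul, norm_smul, norm_tmode, one_mul]
      exact mul_le_mul_of_nonneg_right (hC₀ _) (norm_nonneg _)
    · rw [hout x p hp, zero_smul, smul_zero, norm_zero, Set.indicator_of_notMem hp]
  have hbi : ∀ G : Lp (CVec N) q μ, Integrable (A.indicator fun p => C₀ * ‖G p‖) μ := fun G =>
    (integrable_indicator_iff hAm).2 ((hint G).const_mul C₀)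
  have hmeas : ∀ (G : Lp (CVec N) q μ) x,
      AEStronglyMeasurable (fun p => tmode ν p.2 • g (p.1, x) • G p) μ := fun G x => by
    have h1 : Continuous fun p : Euc (k + 1) × Euc m => tmode ν p.2 :=
      (continuous_tmode ν).comp continuous_snd
    have h2 : Continuous fun p : Euc (k + 1) × Euc m => g (p.1, x) := by fun_prop
    exact h1.aestronglyMeasurable.smul (h2.aestronglyMeasurable.smul (Lp.aestronglyMeasurable G))
  have hi : ∀ x (G : Lp (CVec N) q μ), Integrable (fun p => tmode ν p.2 • g (p.1, x) • G p) μ :=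
    fun x G => (hbi G).mono' (hmeas G x) (Eventually.of_forall (hbd G x))
  obtain ⟨C₁, hC₁, hC₁b⟩ : ∃ C₁ : ℝ, 0 ≤ C₁ ∧ ∀ G : Lp (CVec N) q μ,
      ∫ p in A, ‖G p‖ ∂μ ≤ C₁ * ‖G‖ := by
    set c := μ A ^ (1 / (1 : ℝ≥0∞).toReal - 1 / q.toReal) with hc
    have hexp : 0 ≤ 1 / (1 : ℝ≥0∞).toReal - 1 / q.toReal := by
      rw [ENNReal.toReal_one, div_one, sub_nonneg]
      rcases eq_or_ne q ⊤ with rfl | hq'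
      · simp
      · rw [div_le_one (ENNReal.toReal_pos (by positivity) hq')]
        exact (ENNReal.toReal_one).symm.le.trans (ENNReal.toReal_mono hq' hq)
    have hctop : c ≠ ⊤ := ENNReal.rpow_ne_top_of_nonneg hexp hμA.ne
    refine ⟨c.toReal, ENNReal.toReal_nonneg, fun G => ?_⟩
    have h1 := eLpNorm_le_eLpNorm_mul_rpow_measure_univ (μ := μ.restrict A) hq
      (Lp.aestronglyMeasurable G).restrict
    rw [Measure.restrict_apply_univ] at h1
    have h2 : eLpNorm G 1 (μ.restrict A) ≤ ‖G‖ₑ * c := by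
      refine h1.trans (mul_le_mul_left ?_ _)
      rw [Lp.enorm_def]
      exact eLpNorm_mono_measure _ Measure.restrict_le_self
    rw [integral_norm_eq_lintegral_enorm (Lp.aestronglyMeasurable G).restrict,
      ← eLpNorm_one_eq_lintegral_enorm, mul_comm, ← toReal_enorm G, ← ENNReal.toReal_mul]
    exact ENNReal.toReal_mono (ENNReal.mul_ne_top enorm_ne_top hctop) h2
  have hle : ∀ x (G : Lp (CVec N) q μ),
      ‖∫ p, tmode ν p.2 • g (p.1, x) • G p ∂μ‖ ≤ C₀ * C₁ * ‖G‖ := by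
    intro x G
    refine (norm_integral_le_of_norm_le (hbi G) (Eventually.of_forall (hbd G x))).trans ?_
    rw [integral_indicator hAm, integral_const_mul, mul_assoc]
    exact mul_le_mul_of_nonneg_left (hC₁b G) hC₀0
  have hsub : ∀ x (G G' : Lp (CVec N) q μ), ∫ p, tmode ν p.2 • g (p.1, x) • (G - G') p ∂μ =
      ∫ p, tmode ν p.2 • g (p.1, x) • G p ∂μ - ∫ p, tmode ν p.2 • g (p.1, x) • G' p ∂μ := by
    intro x G G'
    rw [← integral_sub (hi x G) (hi x G')]
    refine integral_congr_ae ?_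
    filter_upwards [Lp.coeFn_sub G G'] with p hp
    rw [hp, Pi.sub_apply, smul_sub, smul_sub]
  refine ⟨fun x G => ∫ p, tmode ν p.2 • g (p.1, x) • G p ∂μ, C₀ * C₁, by positivity,
    fun _ _ => rfl, hi, hle, hsub, ?_⟩
  have hcx : ∀ G : Lp (CVec N) q μ,
      Continuous fun x => ∫ p, tmode ν p.2 • g (p.1, x) • G p ∂μ := fun G =>
    continuous_of_dominated (hmeas G) (fun x => Eventually.of_forall (hbd G x)) (hbi G)
      (Eventually.of_forall fun p => by fun_prop)
  -- uniformly Lipschitz in `G`, and continuous in `x` for fixed `G`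
  rw [continuous_iff_continuousAt]
  rintro ⟨x₀, G₀⟩
  have h1 : Tendsto (fun y : ℝ × Lp (CVec N) q μ => C₀ * C₁ * ‖y.2 - G₀‖) (𝓝 (x₀, G₀)) (𝓝 0) := by
    have : Continuous fun y : ℝ × Lp (CVec N) q μ => C₀ * C₁ * ‖y.2 - G₀‖ := by fun_prop
    simpa using this.tendsto (x₀, G₀)
  have h2 : Tendsto (fun y : ℝ × Lp (CVec N) q μ => ∫ p, tmode ν p.2 • g (p.1, y.1) • (y.2 - G₀) p ∂μ)
      (𝓝 (x₀, G₀)) (𝓝 0) := squeeze_zero_norm (fun y => hle y.1 (y.2 - G₀)) h1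
  have h3 : Tendsto (fun y : ℝ × Lp (CVec N) q μ => ∫ p, tmode ν p.2 • g (p.1, y.1) • G₀ p ∂μ)
      (𝓝 (x₀, G₀)) (𝓝 (∫ p, tmode ν p.2 • g (p.1, x₀) • G₀ p ∂μ)) :=
    ((hcx G₀).tendsto x₀).comp (continuous_fst.tendsto (x₀, G₀))
  have h4 := h2.add h3
  rw [zero_add] at h4
  refine h4.congr fun y => ?_
  rw [hsub, sub_add_cancel]

/-- The inner integral in the tested equation. -/
def innerMode (S : BVP k N M) (ζ : Fin m → Euc (k + 1)) (χ : Euc (k + 1) × ℝ → ℝ)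
    (ν : Fin m → ℤ) (x : ℝ) (u : L2 (omegaT k T) m N) (d : Fin m → L2 (omegaT k T) m N) : CVec N :=
  ∫ p, tmode (-ν) p.2 •
      (-(∑ i, fderiv ℝ χ (p.1, x) (EuclideanSpace.single i 1, 0) • cAct (S.Atil i 0) (u p))
        - fderiv ℝ χ (p.1, x) (0, 1) • u p
        + χ (p.1, x) • ∑ j, S.L1 (u p) (ζ j) (d j p)) ∂(torusMeasure (omegaT k T) m)

theorem testedMode_eq (S : BVP k N M) (ζ : Fin m → Euc (k + 1)) (U : Profile k m N T)
    (DU : Fin m → Profile k m N T) (χ : Euc (k + 1) × ℝ → ℝ) (ν : Fin m → ℤ) (ψ : ℝ) :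
    testedMode S ζ U DU χ ν ψ =
      ∫ x in Set.Ioi (0 : ℝ), innerMode S ζ χ ν x (U x ψ) fun j => DU j x ψ := by
  simp only [testedMode, innerMode, exp_neg_eq_tmode]

/-- The inner integral is the sum of a part linear in `u` and of a bilinear part, which factors through
the products in `L¹`. -/
theorem exists_innerMode_eq (S : BVP k N M) (ζ : Fin m → Euc (k + 1))
    {χ : Euc (k + 1) × ℝ → ℝ} (hχ : ContDiff ℝ ∞ χ) (hχc : HasCompactSupport χ)
    (ν : Fin m → ℤ) : ∃ (Λ : ℝ → L2 (omegaT k T) m N → CVec N)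
    (P : ℝ → Lp (CVec N) 1 (torusMeasure (omegaT k T) m) → CVec N) (C : ℝ), 0 ≤ C ∧
    (∀ x u, ‖Λ x u‖ ≤ C * ‖u‖) ∧ (∀ x u, ‖P x u‖ ≤ C * ‖u‖) ∧
    (∀ x u u', Λ x (u - u') = Λ x u - Λ x u') ∧ (∀ x u u', P x (u - u') = P x u - P x u') ∧
    (Continuous fun y : ℝ × L2 (omegaT k T) m N => Λ y.1 y.2) ∧
    (Continuous fun y : ℝ × Lp (CVec N) 1 (torusMeasure (omegaT k T) m) => P y.1 y.2) ∧
    ∀ x u d, innerMode S ζ χ ν x u d = Λ x u + ∑ j, P x ((S.L1Bilin (ζ j)).holder 1 u (d j)) := by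
  have hd : ∀ v, Continuous fun q => fderiv ℝ χ q v := fun v =>
    (hχ.continuous_fderiv (by norm_num)).clm_apply continuous_const
  have hdc : ∀ v, HasCompactSupport fun q => fderiv ℝ χ q v := fun v => hχc.fderiv_apply ℝ v
  have H1 := fun i : Fin (k + 1) => exists_pairing (N := N) (q := 2) (omegaT k T)
    (hd (EuclideanSpace.single i 1, 0)) (hdc _) (-ν)
  choose P1 C1 hC1 hP1 hI1 hB1 hS1 hc1 using H1
  obtain ⟨P2, C2, hC2, hP2, hI2, hB2, hS2, hc2⟩ := exists_pairing (N := N) (q := 2) (omegaT k T)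
    (hd (0, 1)) (hdc _) (-ν)
  obtain ⟨P3, C3, hC3, hP3, hI3, hB3, hS3, hc3⟩ := exists_pairing (N := N) (q := 1) (omegaT k T)
    hχ.continuous hχc (-ν)
  set Q := fun i : Fin (k + 1) => LinearMap.toContinuousLinearMap (cAct (S.Atil i 0)) with hQ
  have e : ∀ x u d, innerMode S ζ χ ν x u d =
      -(∑ i, Q i (P1 i x u)) - P2 x u + ∑ j, P3 x ((S.L1Bilin (ζ j)).holder 1 u (d j)) := by
    intro x u d
    have h3 : ∀ j, P3 x ((S.L1Bilin (ζ j)).holder 1 u (d j)) = ∫ p, tmode (-ν) p.2 • χ (p.1, x) •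
        S.L1 (u p) (ζ j) (d j p) ∂(torusMeasure (omegaT k T) m) := by
      intro j
      rw [hP3]
      refine integral_congr_ae ?_
      filter_upwards [(S.L1Bilin (ζ j)).coeFn_holder (r := 1) u (d j)] with p hp
      rw [hp]; rfl
    have hI3' : ∀ j, Integrable (fun p => tmode (-ν) p.2 • χ (p.1, x) •
        S.L1 (u p) (ζ j) (d j p)) (torusMeasure (omegaT k T) m) := by
      intro j
      refine (hI3 x ((S.L1Bilin (ζ j)).holder 1 u (d j))).congr ?_
      filter_upwards [(S.L1Bilin (ζ j)).coeFn_holder (r := 1) u (d j)] with p hp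
      rw [hp]; rfl
    have hI1' : ∀ i, Integrable (fun p => Q i (tmode (-ν) p.2 •
        fderiv ℝ χ (p.1, x) (EuclideanSpace.single i 1, 0) • u p))
        (torusMeasure (omegaT k T) m) := fun i => (Q i).integrable_comp (hI1 i x u)
    have h1 : ∀ i, Q i (P1 i x u) = ∫ p, Q i (tmode (-ν) p.2 •
        fderiv ℝ χ (p.1, x) (EuclideanSpace.single i 1, 0) • u p)
        ∂(torusMeasure (omegaT k T) m) := fun i => by
      rw [hP1]
      exact ((Q i).integral_comp_comm (hI1 i x u)).symm
    have i1 : Integrable (fun p => -∑ i, Q i (tmode (-ν) p.2 •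
        fderiv ℝ χ (p.1, x) (EuclideanSpace.single i 1, 0) • u p))
        (torusMeasure (omegaT k T) m) := (integrable_finsetSum _ fun i _ => hI1' i).neg
    have i2 : Integrable (fun p => -∑ i, Q i (tmode (-ν) p.2 •
        fderiv ℝ χ (p.1, x) (EuclideanSpace.single i 1, 0) • u p) -
        tmode (-ν) p.2 • fderiv ℝ χ (p.1, x) (0, 1) • u p)
        (torusMeasure (omegaT k T) m) := i1.sub (hI2 x u)
    simp only [h1, h3]
    rw [hP2, ← integral_finsetSum _ fun i _ => hI1' i, ← integral_finsetSum _ fun j _ => hI3' j,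
      ← integral_neg, ← integral_sub i1 (hI2 x u),
      ← integral_add i2 (integrable_finsetSum _ fun j _ => hI3' j), innerMode]
    refine integral_congr_ae (Eventually.of_forall fun p => ?_)
    simp only [smul_add, smul_sub, smul_neg, Finset.smul_sum]
    congr 2
    congr 1
    refine Finset.sum_congr rfl fun i _ => ?_
    rw [map_smul, ← Complex.coe_smul, ← Complex.coe_smul, map_smul]
    rfl
  refine ⟨fun x u => -(∑ i, Q i (P1 i x u)) - P2 x u, P3, ∑ i, ‖Q i‖ * C1 i + C2 + C3, ?_, ?_, ?_,
    ?_, hS3, ?_, hc3, e⟩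
  · exact add_nonneg (add_nonneg (Finset.sum_nonneg fun i _ =>
      mul_nonneg (norm_nonneg _) (hC1 i)) hC2) hC3
  · intro x u
    have h1 : ∀ i, ‖Q i (P1 i x u)‖ ≤ ‖Q i‖ * C1 i * ‖u‖ := fun i => by
      rw [mul_assoc]
      exact ((Q i).le_opNorm _).trans (mul_le_mul_of_nonneg_left (hB1 i x u) (norm_nonneg _))
    have h2 : ‖∑ i, Q i (P1 i x u)‖ ≤ (∑ i, ‖Q i‖ * C1 i) * ‖u‖ := by
      rw [Finset.sum_mul]
      exact (norm_sum_le _ _).trans (Finset.sum_le_sum fun i _ => h1 i)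
    have h3 := norm_sub_le (-(∑ i, Q i (P1 i x u))) (P2 x u)
    rw [norm_neg] at h3
    nlinarith [hB2 x u, mul_nonneg hC3 (norm_nonneg u)]
  · intro x u
    have h1 : 0 ≤ ∑ i, ‖Q i‖ * C1 i :=
      Finset.sum_nonneg fun i _ => mul_nonneg (norm_nonneg _) (hC1 i)
    exact (hB3 x u).trans (mul_le_mul_of_nonneg_right (by linarith) (norm_nonneg u))
  · intro x u u'
    simp only [hS1, hS2, map_sub, Finset.sum_sub_distrib]
    abel
  · exact (continuous_finsetSum _ fun i _ => (Q i).continuous.comp (hc1 i)).neg.sub hc2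

/-- The inner integral is Lipschitz on bounded sets and jointly continuous. -/
theorem exists_innerMode_bound (S : BVP k N M) (ζ : Fin m → Euc (k + 1))
    {χ : Euc (k + 1) × ℝ → ℝ} (hχ : ContDiff ℝ ∞ χ) (hχc : HasCompactSupport χ)
    (ν : Fin m → ℤ) : ∃ C : ℝ, 0 ≤ C ∧
    (∀ x (u u' : L2 (omegaT k T) m N) d d', ‖innerMode S ζ χ ν x u d - innerMode S ζ χ ν x u' d'‖ ≤
      C * (‖u - u'‖ * (1 + ∑ j, ‖d j‖) + ‖u'‖ * ∑ j, ‖d j - d' j‖)) ∧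
    Continuous fun y : ℝ × L2 (omegaT k T) m N × (Fin m → L2 (omegaT k T) m N) =>
      innerMode S ζ χ ν y.1 y.2.1 y.2.2 := by
  obtain ⟨Λ, P, C, hC, hΛ, hP, hΛs, hPs, hΛc, hPc, e⟩ := exists_innerMode_eq (T := T) S ζ hχ hχc ν
  set H := fun (j : Fin m) => (S.L1Bilin (ζ j)).holderL (torusMeasure (omegaT k T) m) 2 2 1 with hH
  replace e : ∀ x u d, innerMode S ζ χ ν x u d = Λ x u + ∑ j, P x (H j u (d j)) := e
  obtain ⟨b, hb, hHb⟩ : ∃ b : Fin m → ℝ, (∀ j, 0 ≤ b j) ∧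
      ∀ j u v, ‖H j u v‖ ≤ b j * ‖u‖ * ‖v‖ :=
    ⟨fun j => ‖S.L1Bilin (ζ j)‖, fun j => ContinuousLinearMap.opNorm_nonneg _, fun j u v =>
      (S.L1Bilin (ζ j)).norm_holder_apply_apply_le (r := 1) u v⟩
  clear_value H
  refine ⟨C + C * ∑ j, b j, add_nonneg hC (mul_nonneg hC (Finset.sum_nonneg fun j _ => hb j)), ?_, ?_⟩
  · intro x u u' d d'
    have h1 : ∀ j, H j u (d j) - H j u' (d' j) = H j (u - u') (d j) + H j u' (d j - d' j) := by
      intro j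
      rw [map_sub, map_sub, _root_.sub_apply]; abel
    have e2 : innerMode S ζ χ ν x u d - innerMode S ζ χ ν x u' d' =
        Λ x (u - u') + ∑ j, P x (H j (u - u') (d j) + H j u' (d j - d' j)) := by
      rw [e, e, hΛs, add_sub_add_comm, ← Finset.sum_sub_distrib]
      simp only [← hPs, h1]
    have hn1 : ∀ j, ‖d j‖ ≤ ∑ j, ‖d j‖ := fun j =>
      Finset.single_le_sum (f := fun j => ‖d j‖) (fun i _ => norm_nonneg _) (Finset.mem_univ j)
    have hn2 : ∀ j, ‖d j - d' j‖ ≤ ∑ j, ‖d j - d' j‖ := fun j =>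
      Finset.single_le_sum (f := fun j => ‖d j - d' j‖) (fun i _ => norm_nonneg _)
        (Finset.mem_univ j)
    have hb3 : ∀ j, ‖P x (H j (u - u') (d j) + H j u' (d j - d' j))‖ ≤ C * (b j *
        (‖u - u'‖ * (1 + ∑ j, ‖d j‖) + ‖u'‖ * ∑ j, ‖d j - d' j‖)) := fun j => by
      refine (hP x _).trans (mul_le_mul_of_nonneg_left ?_ hC)
      refine (norm_add_le _ _).trans ((add_le_add (hHb _ _ _) (hHb _ _ _)).trans ?_)
      rw [mul_assoc, mul_assoc, ← mul_add]
      refine mul_le_mul_of_nonneg_left (add_le_add ?_ ?_) (hb j)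
      · exact mul_le_mul_of_nonneg_left (by linarith [hn1 j]) (norm_nonneg _)
      · exact mul_le_mul_of_nonneg_left (hn2 j) (norm_nonneg _)
    rw [e2, add_mul]
    refine (norm_add_le _ _).trans (add_le_add ?_ ?_)
    · refine (hΛ x _).trans (mul_le_mul_of_nonneg_left ?_ hC)
      have h3 : 0 ≤ ‖u - u'‖ * ∑ j, ‖d j‖ + ‖u'‖ * ∑ j, ‖d j - d' j‖ := by positivity
      linarith
    · rw [mul_assoc, Finset.sum_mul, Finset.mul_sum]
      exact (norm_sum_le _ _).trans (Finset.sum_le_sum fun j _ => hb3 j)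
  · simp only [e]
    have c0 : Continuous fun y : ℝ × L2 (omegaT k T) m N × (Fin m → L2 (omegaT k T) m N) =>
        (y.1, y.2.1) := continuous_fst.prodMk (continuous_fst.comp continuous_snd)
    have c3 : ∀ j, Continuous fun y : ℝ × L2 (omegaT k T) m N × (Fin m → L2 (omegaT k T) m N) =>
        P y.1 (H j y.2.1 (y.2.2 j)) := fun j => by
      have h1 : Continuous fun y : ℝ × L2 (omegaT k T) m N × (Fin m → L2 (omegaT k T) m N) =>
          H j y.2.1 (y.2.2 j) :=
        ((H j).continuous.comp (continuous_fst.comp continuous_snd)).clm_apply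
          ((continuous_apply j).comp (continuous_snd.comp continuous_snd))
      exact hPc.comp (continuous_fst.prodMk h1)
    exact (hΛc.comp c0).add (continuous_finsetSum _ fun j _ => c3 j)

end

noncomputable section

variable {k m N M n : ℕ} {T : ℝ} {s : ℕ} {S : BVP k N M} {ζ : Fin m → Euc (k + 1)}

/-! ### Elimination of the evanescent part -/

theorem innerMode_zero (χ : Euc (k + 1) × ℝ → ℝ) (ν : Fin m → ℤ) (x : ℝ) :
    innerMode (T := T) S ζ χ ν x 0 0 = 0 := by
  refine integral_eq_zero_of_ae ?_
  filter_upwards [Lp.coeFn_zero (CVec N) 2 (torusMeasure (omegaT k T) m)] with p hp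
  rw [hp]
  simp [BVP.L1]

theorem exists_innerMode_eq_zero {χ : Euc (k + 1) × ℝ → ℝ} (hχc : HasCompactSupport χ) :
    ∃ b : ℝ, ∀ (x : ℝ), b < x → ∀ (ν : Fin m → ℤ) (u : L2 (omegaT k T) m N) d,
      innerMode S ζ χ ν x u d = 0 := by
  obtain ⟨b, hb⟩ := hχc.isCompact.isBounded.exists_norm_le
  refine ⟨b, fun x hx ν u d => integral_eq_zero_of_ae (Eventually.of_forall fun p => ?_)⟩
  have hp : (p.1, x) ∉ tsupport χ := fun h => by
    have h1 := (norm_snd_le (p.1, x)).trans (hb _ h)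
    have h2 := le_abs_self x
    rw [Real.norm_eq_abs] at h1
    simp only at h1
    linarith
  have h1 : fderiv ℝ χ (p.1, x) = 0 := by
    by_contra h
    exact hp (support_fderiv_subset ℝ h)
  simp [h1, image_eq_zero_of_notMem_tsupport hp]

/-- A pair of profiles, bounded and continuous with values in `L²`, with finitely many companions. -/
structure BddCont (X : Profile k m N T) (DX : Fin m → Profile k m N T) (K : ℝ) : Prop where
  cont : ContinuousOn (fun q : ℝ × ℝ => X q.1 q.2) (Set.Ici 0 ×ˢ Set.Ici 0)
  cont' : ∀ j, ContinuousOn (fun q : ℝ × ℝ => DX j q.1 q.2) (Set.Ici 0 ×ˢ Set.Ici 0)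
  bdd : ∀ x ψ, 0 ≤ x → 0 ≤ ψ → ‖X x ψ‖ ≤ K
  bdd' : ∀ j x ψ, 0 ≤ x → 0 ≤ ψ → ‖DX j x ψ‖ ≤ K

theorem BddCont.continuousOn_inner {X : Profile k m N T} {DX : Fin m → Profile k m N T} {K : ℝ}
    (h : BddCont X DX K) {χ : Euc (k + 1) × ℝ → ℝ} (hχ : ContDiff ℝ ∞ χ)
    (hχc : HasCompactSupport χ) (ν : Fin m → ℤ) :
    ContinuousOn (fun q : ℝ × ℝ => innerMode S ζ χ ν q.1 (X q.1 q.2) fun j => DX j q.1 q.2)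
      (Set.Ici 0 ×ˢ Set.Ici 0) := by
  obtain ⟨C, -, -, hc⟩ := exists_innerMode_bound (T := T) S ζ hχ hχc ν
  have h1 : ContinuousOn (fun q : ℝ × ℝ => fun j => DX j q.1 q.2) (Set.Ici 0 ×ˢ Set.Ici 0) :=
    continuousOn_pi.2 h.cont'
  have h2 : ContinuousOn (fun q : ℝ × ℝ => (q.1, X q.1 q.2, fun j => DX j q.1 q.2))
      (Set.Ici 0 ×ˢ Set.Ici 0) := continuousOn_fst.prodMk (h.cont.prodMk h1)
  have h3 := hc.comp_continuousOn h2
  simp only [Function.comp_def] at h3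
  exact h3

/-- The inner integral is dominated, uniformly in `ψ_d`, by an integrable function of `x_d`. -/
theorem BddCont.exists_bound_inner {X : Profile k m N T} {DX : Fin m → Profile k m N T} {K : ℝ}
    (h : BddCont X DX K) {χ : Euc (k + 1) × ℝ → ℝ} (hχ : ContDiff ℝ ∞ χ)
    (hχc : HasCompactSupport χ) (ν : Fin m → ℤ) :
    ∃ bd : ℝ → ℝ, Integrable bd (volume.restrict (Set.Ioi 0)) ∧ ∀ x ψ, 0 ≤ x → 0 ≤ ψ →
      ‖innerMode S ζ χ ν x (X x ψ) fun j => DX j x ψ‖ ≤ bd x := by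
  obtain ⟨C, hC, hb, -⟩ := exists_innerMode_bound (T := T) S ζ hχ hχc ν
  obtain ⟨b, hb0⟩ := exists_innerMode_eq_zero (m := m) (T := T) (S := S) (ζ := ζ) hχc
  refine ⟨(Set.Iic b).indicator fun _ => C * (K * (1 + m * K)), ?_, fun x ψ hx hψ => ?_⟩
  · refine (integrable_indicator_iff measurableSet_Iic).2 ?_
    rw [IntegrableOn, Measure.restrict_restrict measurableSet_Iic]
    refine integrableOn_const ?_ enorm_ne_top
    rw [Set.inter_comm, Set.Ioi_inter_Iic]
    simp
  · by_cases hxb : x ≤ b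
    · rw [Set.indicator_of_mem (show x ∈ Set.Iic b from hxb)]
      have h1 := hb x (X x ψ) 0 (fun j => DX j x ψ) 0
      rw [innerMode_zero, sub_zero, sub_zero, norm_zero, zero_mul, add_zero] at h1
      refine h1.trans (mul_le_mul_of_nonneg_left ?_ hC)
      have h2 : ∑ j, ‖DX j x ψ‖ ≤ m * K := by
        refine (Finset.sum_le_sum fun j _ => h.bdd' j x ψ hx hψ).trans_eq ?_
        simp
      have h3 := h.bdd x ψ hx hψ
      exact mul_le_mul h3 (by linarith) (by positivity) ((norm_nonneg _).trans h3)
    · rw [hb0 x (not_le.1 hxb), norm_zero, Set.indicator_of_notMem (s := Set.Iic b) hxb]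

theorem BddCont.integrable_inner {X : Profile k m N T} {DX : Fin m → Profile k m N T} {K : ℝ}
    (h : BddCont X DX K) {χ : Euc (k + 1) × ℝ → ℝ} (hχ : ContDiff ℝ ∞ χ)
    (hχc : HasCompactSupport χ) (ν : Fin m → ℤ) {ψ : ℝ} (hψ : 0 ≤ ψ) :
    Integrable (fun x => innerMode S ζ χ ν x (X x ψ) fun j => DX j x ψ)
      (volume.restrict (Set.Ioi 0)) := by
  obtain ⟨bd, hbd, hb⟩ := h.exists_bound_inner (S := S) (ζ := ζ) hχ hχc ν
  refine hbd.mono' ?_ ((ae_restrict_iff' measurableSet_Ioi).2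
    (Eventually.of_forall fun x hx => hb x ψ (le_of_lt hx) hψ))
  refine ContinuousOn.aestronglyMeasurable ?_ measurableSet_Ioi
  have h1 : ContinuousOn (fun x : ℝ => (x, ψ)) (Set.Ioi 0) := by fun_prop
  have h2 := (h.continuousOn_inner (S := S) (ζ := ζ) hχ hχc ν).comp h1
    fun x hx => ⟨Set.mem_Ici.2 (le_of_lt hx), hψ⟩
  simp only [Function.comp_def] at h2
  exact h2

theorem BddCont.continuousOn_testedMode {X : Profile k m N T} {DX : Fin m → Profile k m N T} {K : ℝ}
    (h : BddCont X DX K) {χ : Euc (k + 1) × ℝ → ℝ} (hχ : ContDiff ℝ ∞ χ)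
    (hχc : HasCompactSupport χ) (ν : Fin m → ℤ) :
    ContinuousOn (testedMode S ζ X DX χ ν) (Set.Ici 0) := by
  obtain ⟨bd, hbd, hb⟩ := h.exists_bound_inner (S := S) (ζ := ζ) hχ hχc ν
  have e : testedMode S ζ X DX χ ν = fun ψ => ∫ x in Set.Ioi (0 : ℝ),
      innerMode S ζ χ ν x (X x ψ) fun j => DX j x ψ := funext fun ψ => testedMode_eq ..
  rw [e]
  refine continuousOn_of_dominated (bound := bd)
    (fun ψ hψ => (h.integrable_inner (S := S) (ζ := ζ) hχ hχc ν hψ).1)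
    (fun ψ hψ => (ae_restrict_iff' measurableSet_Ioi).2
      (Eventually.of_forall fun x hx => hb x ψ (le_of_lt hx) hψ)) hbd
    ((ae_restrict_iff' measurableSet_Ioi).2 (Eventually.of_forall fun x hx => ?_))
  have h1 : ContinuousOn (fun ψ : ℝ => (x, ψ)) (Set.Ici 0) := by fun_prop
  have h2 := (h.continuousOn_inner (S := S) (ζ := ζ) hχ hχc ν).comp h1
    fun ψ hψ => ⟨Set.mem_Ici.2 (le_of_lt hx), hψ⟩
  simp only [Function.comp_def] at h2
  exact h2

/-- The tested equation only sees the oscillating part, in the limit `ψ_d → ∞`. -/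
theorem BddCont.tendsto_testedMode_sub {X Y : Profile k m N T} {DX DY : Fin m → Profile k m N T}
    {K K' : ℝ} (hX : BddCont X DX K) (hY : BddCont Y DY K')
    (h : ∀ x, 0 ≤ x → Tendsto (fun ψ => X x ψ - Y x ψ) atTop (𝓝 0))
    (h' : ∀ j x, 0 ≤ x → Tendsto (fun ψ => DX j x ψ - DY j x ψ) atTop (𝓝 0))
    {χ : Euc (k + 1) × ℝ → ℝ} (hχ : ContDiff ℝ ∞ χ) (hχc : HasCompactSupport χ)
    (ν : Fin m → ℤ) :
    Tendsto (fun ψ => testedMode S ζ X DX χ ν ψ - testedMode S ζ Y DY χ ν ψ) atTop (𝓝 0) := by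
  obtain ⟨C, hC, hb, -⟩ := exists_innerMode_bound (T := T) S ζ hχ hχc ν
  obtain ⟨b1, hbi1, hb1⟩ := hX.exists_bound_inner (S := S) (ζ := ζ) hχ hχc ν
  obtain ⟨b2, hbi2, hb2⟩ := hY.exists_bound_inner (S := S) (ζ := ζ) hχ hχc ν
  have e : ∀ᶠ ψ : ℝ in atTop, ∫ x in Set.Ioi (0 : ℝ), (innerMode S ζ χ ν x (X x ψ)
      (fun j => DX j x ψ) - innerMode S ζ χ ν x (Y x ψ) fun j => DY j x ψ) =
      testedMode S ζ X DX χ ν ψ - testedMode S ζ Y DY χ ν ψ := by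
    filter_upwards [eventually_ge_atTop 0] with ψ hψ
    rw [testedMode_eq, testedMode_eq, integral_sub
      (hX.integrable_inner (S := S) (ζ := ζ) hχ hχc ν hψ)
      (hY.integrable_inner (S := S) (ζ := ζ) hχ hχc ν hψ)]
  refine Tendsto.congr' e ?_
  rw [← integral_zero ℝ (CVec N) (μ := volume.restrict (Set.Ioi 0))]
  refine tendsto_integral_filter_of_dominated_convergence (fun x => b1 x + b2 x) ?_ ?_
    (hbi1.add hbi2) ?_
  · filter_upwards [eventually_ge_atTop 0] with ψ hψ
    exact ((hX.integrable_inner (S := S) (ζ := ζ) hχ hχc ν hψ).sub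
      (hY.integrable_inner (S := S) (ζ := ζ) hχ hχc ν hψ)).1
  · filter_upwards [eventually_ge_atTop 0] with ψ hψ
    refine (ae_restrict_iff' measurableSet_Ioi).2 (Eventually.of_forall fun x hx => ?_)
    exact (norm_sub_le _ _).trans (add_le_add (hb1 x ψ (le_of_lt hx) hψ)
      (hb2 x ψ (le_of_lt hx) hψ))
  · refine (ae_restrict_iff' measurableSet_Ioi).2 (Eventually.of_forall fun x hx => ?_)
    have hx' : 0 ≤ x := le_of_lt hx
    have t1 : Tendsto (fun ψ => ‖X x ψ - Y x ψ‖) atTop (𝓝 0) := by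
      simpa using (h x hx').norm
    have t2 : Tendsto (fun ψ => ∑ j, ‖DX j x ψ - DY j x ψ‖) atTop (𝓝 0) := by
      have := tendsto_finsetSum (Finset.univ : Finset (Fin m)) fun j _ => (h' j x hx').norm
      simpa using this
    have t3 : Tendsto (fun ψ => C * (‖X x ψ - Y x ψ‖ * (1 + m * K) +
        K' * ∑ j, ‖DX j x ψ - DY j x ψ‖)) atTop (𝓝 0) := by
      have := ((t1.mul_const (1 + m * K)).add (t2.const_mul K')).const_mul C
      simpa using this
    refine squeeze_zero_norm' ?_ t3
    filter_upwards [eventually_ge_atTop 0] with ψ hψ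
    refine (hb x _ _ _ _).trans (mul_le_mul_of_nonneg_left (add_le_add ?_ ?_) hC)
    · refine mul_le_mul_of_nonneg_left (add_le_add le_rfl ?_) (norm_nonneg _)
      refine (Finset.sum_le_sum fun j _ => hX.bdd' j x ψ hx' hψ).trans_eq ?_
      simp
    · exact mul_le_mul_of_nonneg_right (hY.bdd x ψ hx' hψ) (by positivity)

theorem MemE.exists_bddCont {U : Profile k m N T} (hU : MemE s U) (hs : 1 ≤ s)
    {DU : Fin m → Profile k m N T}
    (h : ∀ j x ψ, 0 ≤ x → 0 ≤ ψ → IsWeakDeriv (Sum.inr j) (U x ψ) (DU j x ψ)) :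
    ∃ K, BddCont U DU K := by
  obtain ⟨K, hK, hb⟩ := hU.exists_bound
  have e : ∀ u : L2 (omegaT k T) m N, ‖u‖ₑ ≤ ENNReal.ofReal K → ‖u‖ ≤ K := fun u hu => by
    rw [← ofReal_norm] at hu
    exact (ENNReal.ofReal_le_ofReal_iff hK.le).1 hu
  exact ⟨K, hU.continuousOn, fun j => hU.continuousOn_deriv hs (h j),
    fun x ψ hx hψ => e _ ((enorm_le_sobolevENorm s _).trans (hb x ψ hx hψ).le),
    fun j x ψ hx hψ => e _ (((h j x ψ hx hψ).enorm_le hs).trans (hb x ψ hx hψ).le)⟩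

/-- The interior equation, for the oscillating part alone. -/
theorem IsLeadingProfile.isFreqPart_osc {G : L2 (Set.univ : Set (Euc (k + 1))) m M}
    {U Uosc Uev : Profile k m N T} (hU : IsLeadingProfile S ζ s G U Uosc Uev) (hs : 1 ≤ s)
    {DO : Fin m → Profile k m N T}
    (hDO : ∀ j x ψ, 0 ≤ x → 0 ≤ ψ → IsWeakDeriv (Sum.inr j) (Uosc x ψ) (DO j x ψ))
    (ν : Fin m → ℤ) (ξ : ℝ) {χ : Euc (k + 1) × ℝ → ℝ} (hχ : ContDiff ℝ ∞ χ)
    (hχc : HasCompactSupport χ) (hsupp : tsupport χ ⊆ {q | q.1 0 < T ∧ 0 < q.2}) :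
    IsFreqPart (fun ψ => S.projTil (bfreq ζ ν) ξ (testedMode S ζ Uosc DO χ ν ψ)) ξ 0 := by
  obtain ⟨DU, hDU, heq⟩ := hU.interior
  have h0 := heq ν ξ χ hχ hχc hsupp
  choose DE hDE using fun j : Fin m => hU.memEv.1.exists_deriv hs (Sum.inr j)
  have hadd : ∀ j x ψ, 0 ≤ x → 0 ≤ ψ → DU j x ψ = DO j x ψ + DE j x ψ := fun j x ψ hx hψ =>
    (hDO j x ψ hx hψ).eq_add (hDE j x ψ hx hψ) (by
      rw [← hU.decomp x ψ hx hψ]; exact hDU j x ψ hx hψ)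
  obtain ⟨K, hK⟩ := hU.memOsc.1.exists_bddCont hs hDO
  obtain ⟨K', hK'⟩ := hU.memEv.1.exists_bddCont hs hDE
  have hX : BddCont (fun x ψ => Uosc x ψ + Uev x ψ) (fun j x ψ => DO j x ψ + DE j x ψ) (K + K') :=
    { cont := hK.cont.add hK'.cont
      cont' := fun j => (hK.cont' j).add (hK'.cont' j)
      bdd := fun x ψ hx hψ => (norm_add_le _ _).trans
        (add_le_add (hK.bdd x ψ hx hψ) (hK'.bdd x ψ hx hψ))
      bdd' := fun j x ψ hx hψ => (norm_add_le _ _).trans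
        (add_le_add (hK.bdd' j x ψ hx hψ) (hK'.bdd' j x ψ hx hψ)) }
  have hev : ∀ (W : ℝ → L2 (omegaT k T) m N) x, 0 ≤ x →
      (∀ ψ, 0 ≤ ψ → ‖W ψ‖ₑ ≤ sobolevENorm s (Uev x ψ)) → Tendsto W atTop (𝓝 0) := by
    intro W x hx hW
    refine tendsto_zero_iff_enorm_tendsto_zero.2 ?_
    refine tendsto_of_tendsto_of_tendsto_of_le_of_le' tendsto_const_nhds (hU.memEv.2 x hx)
      (Eventually.of_forall fun _ => zero_le) ?_
    filter_upwards [eventually_ge_atTop 0] with ψ hψ using hW ψ hψ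
  have hlim := hX.tendsto_testedMode_sub (S := S) (ζ := ζ) hK
    (fun x hx => hev _ x hx fun ψ hψ => by
      rw [add_sub_cancel_left]; exact enorm_le_sobolevENorm s _)
    (fun j x hx => hev _ x hx fun ψ hψ => by
      rw [add_sub_cancel_left]; exact (hDE j x ψ hx hψ).enorm_le hs) hχ hχc ν
  set l := LinearMap.toContinuousLinearMap (S.projTil (bfreq ζ ν) ξ) with hl
  have c1 := hX.continuousOn_testedMode (S := S) (ζ := ζ) hχ hχc ν
  have c2 := hK.continuousOn_testedMode (S := S) (ζ := ζ) hχ hχc ν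
  have h1 : IsFreqPart (fun ψ => l (testedMode S ζ (fun x ψ => Uosc x ψ + Uev x ψ)
      (fun j x ψ => DO j x ψ + DE j x ψ) χ ν ψ)) ξ 0 := by
    refine h0.congr fun ψ hψ => ?_
    rw [testedMode_eq, testedMode_eq]
    refine congrArg _ (setIntegral_congr_fun measurableSet_Ioi fun x hx => ?_)
    simp only [hU.decomp x ψ (le_of_lt hx) hψ, hadd _ x ψ (le_of_lt hx) hψ]
  have h2 := (IsFreqPart.of_tendsto_zero (c1.sub c2) hlim ξ).clm (c1.sub c2) l
  have h3 := h1.sub h2 (l.continuous.comp_continuousOn c1)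
    (l.continuous.comp_continuousOn (c1.sub c2))
  rw [map_zero, sub_zero] at h3
  refine h3.congr fun ψ _ => ?_
  change l _ - l (_ - _) = l _
  rw [← map_sub, sub_sub_cancel]

end

noncomputable section

variable {k m N M n : ℕ} {T : ℝ} {s : ℕ} {L : ℝ} {φ : Euc (k + 1) → ℝ}
variable {S : BVP k N M} {ζ : Fin m → Euc (k + 1)} {U Uosc Uev : Profile k m N T} {K : ℝ}

/-! ### The equation of a mode -/

theorem hasSum_bilin {ι ι' E F H : Type*} [NormedAddCommGroup E] [NormedSpace ℂ E] [CompleteSpace E]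
    [NormedAddCommGroup F] [NormedSpace ℂ F] [CompleteSpace F] [NormedAddCommGroup H]
    [NormedSpace ℂ H] [CompleteSpace H] (B : E →L[ℂ] F →L[ℂ] H) {a : ι → E} {b : ι' → F}
    (ha : Summable fun i => ‖a i‖) (hb : Summable fun i => ‖b i‖) :
    HasSum (fun g : ι × ι' => B (a g.1) (b g.2)) (B (∑' i, a i) (∑' i, b i)) := by
  have h1 : Summable fun g : ι × ι' => B (a g.1) (b g.2) := by
    refine Summable.of_norm_bounded ((ha.mul_of_nonneg hb (fun _ => norm_nonneg _)
      fun _ => norm_nonneg _).mul_left ‖B‖) fun g => ?_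
    rw [← mul_assoc]
    exact B.le_opNorm₂ _ _
  have h2 : ∀ i, HasSum (fun j => B (a i) (b j)) (B (a i) (∑' j, b j)) := fun i =>
    hb.of_norm.hasSum.mapL (B (a i))
  have h3 : HasSum (fun i => B (a i) (∑' j, b j)) (B (∑' i, a i) (∑' i, b i)) :=
    ha.of_norm.hasSum.mapL (B.flip (∑' j, b j))
  rw [← (h1.hasSum.prod_fiberwise h2).unique h3]
  exact h1.hasSum

/-- The transpose of `L̃(0, ∂_z)`, applied to the test function `χ`. -/
def linTerm (S : BVP k N M) (χ : Euc (k + 1) × ℝ → ℝ) (q : Euc (k + 1) × ℝ) : CVec N →ₗ[ℂ] CVec N :=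
  -(∑ i, fderiv ℝ χ q (EuclideanSpace.single i 1, 0) • cAct (S.Atil i 0)) -
    fderiv ℝ χ q (0, 1) • LinearMap.id

theorem linTerm_apply (χ : Euc (k + 1) × ℝ → ℝ) (q : Euc (k + 1) × ℝ) (v : CVec N) :
    linTerm S χ q v =
      -(∑ i, fderiv ℝ χ q (EuclideanSpace.single i 1, 0) • cAct (S.Atil i 0) v) -
        fderiv ℝ χ q (0, 1) • v := by
  simp [linTerm]

theorem exists_linTerm_bound (S : BVP k N M) {χ : Euc (k + 1) × ℝ → ℝ} (hχ : ContDiff ℝ ∞ χ)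
    (hχc : HasCompactSupport χ) : ∃ C : ℝ, 0 ≤ C ∧ ∀ q v, ‖linTerm S χ q v‖ ≤ C * ‖v‖ := by
  have hd : ∀ v, ∃ C : ℝ, ∀ q, ‖fderiv ℝ χ q v‖ ≤ C := fun v =>
    ((hχ.continuous_fderiv (by norm_num)).clm_apply
      continuous_const).bounded_above_of_compact_support (hχc.fderiv_apply ℝ v)
  choose C hC using hd
  have hC0 : ∀ v, 0 ≤ C v := fun v => (norm_nonneg _).trans (hC v 0)
  refine ⟨∑ i : Fin (k + 1), C (EuclideanSpace.single i 1, 0) *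
    ‖LinearMap.toContinuousLinearMap (cAct (S.Atil i 0))‖ + C (0, 1), add_nonneg
      (Finset.sum_nonneg fun i _ => mul_nonneg (hC0 _) (norm_nonneg _)) (hC0 _), fun q v => ?_⟩
  rw [linTerm_apply, add_mul, Finset.sum_mul]
  refine (norm_sub_le _ _).trans (add_le_add ?_ ?_)
  · rw [norm_neg]
    refine (norm_sum_le _ _).trans (Finset.sum_le_sum fun i _ => ?_)
    rw [norm_smul, mul_assoc]
    exact mul_le_mul (hC _ q)
      ((LinearMap.toContinuousLinearMap (cAct (S.Atil i 0))).le_opNorm v) (norm_nonneg _) (hC0 _)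
  · rw [norm_smul]
    exact mul_le_mul_of_nonneg_right (hC _ q) (norm_nonneg _)

theorem stronglyMeasurable_linTerm {χ : Euc (k + 1) × ℝ → ℝ} (hχ : ContDiff ℝ ∞ χ)
    {f : Euc (k + 1) × ℝ → CVec N} (hf : StronglyMeasurable f) :
    StronglyMeasurable fun q => linTerm S χ q (f q) := by
  have hd : ∀ v, StronglyMeasurable fun q => fderiv ℝ χ q v := fun v =>
    ((hχ.continuous_fderiv (by norm_num)).clm_apply continuous_const).stronglyMeasurable
  simp only [linTerm_apply]
  refine ((Finset.stronglyMeasurable_fun_sum _ fun i _ => (hd _).smul ?_).neg).sub ((hd _).smul hf)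
  exact (LinearMap.toContinuousLinearMap (cAct (S.Atil i 0))).continuous.comp_stronglyMeasurable hf

/-- The quadratic source of the mode `(ν, ξ)`: the sum over all the ways of producing `(ν, ξ)`
as a sum of two modes. -/
def quadSource (S : BVP k N M) (ζ : Fin m → Euc (k + 1)) (L : ℝ) (φ : Euc (k + 1) → ℝ)
    (U : Profile k m N T) (ν : Fin m → ℤ) (ξ : ℝ) (q : Euc (k + 1) × ℝ) : CVec N :=
  ∑' g : Mode S ζ × Mode S ζ, if g.1.1 + g.2.1 = ν ∧ (g.1.2 + g.2.2 : ℝ) = ξ then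
    Complex.I • S.L1 (modeAmp L φ U g.1.1 g.1.2 q) (bfreq ζ g.2.1) (modeAmp L φ U g.2.1 g.2.2 q)
    else 0

theorem exists_bfreq_bound (ζ : Fin m → Euc (k + 1)) :
    ∃ C : ℝ, 0 ≤ C ∧ ∀ n, ‖bfreq ζ n‖ ≤ C * ‖n‖ := by
  refine ⟨∑ j, ‖ζ j‖, by positivity, fun n => ?_⟩
  rw [bfreq, Finset.sum_mul]
  refine (norm_sum_le _ _).trans (Finset.sum_le_sum fun j _ => ?_)
  rw [norm_smul, mul_comm]
  refine mul_le_mul_of_nonneg_left ?_ (norm_nonneg _)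
  rw [Real.norm_eq_abs, ← Int.norm_eq_abs]
  exact norm_le_pi_norm n j

namespace ModeBound

/-- The terms of the quadratic sources are summable. -/
theorem exists_quad_bound (hK : ModeBound S ζ L φ U K) (hL : 0 < L) : ∃ C : ℝ, 0 ≤ C ∧ ∀ q,
    (Summable fun g : Mode S ζ × Mode S ζ => ‖S.L1 (modeAmp L φ U g.1.1 g.1.2 q) (bfreq ζ g.2.1)
      (modeAmp L φ U g.2.1 g.2.2 q)‖) ∧
    ∑' g : Mode S ζ × Mode S ζ, ‖S.L1 (modeAmp L φ U g.1.1 g.1.2 q) (bfreq ζ g.2.1)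
      (modeAmp L φ U g.2.1 g.2.2 q)‖ ≤ C * ∑' α : Mode S ζ, ‖modeAmp L φ U α.1 α.2 q‖ := by
  have hv := torusVol_pos k m hL
  obtain ⟨C₁, hC₁, h1⟩ := S.exists_L1_bound
  obtain ⟨C₂, hC₂, h2⟩ := exists_bfreq_bound ζ
  refine ⟨C₁ * C₂ * ((torusVol k m L)⁻¹ * K), by have := hK.pos; positivity, fun q => ?_⟩
  obtain ⟨hs, hle⟩ := hK.summable_modeAmp hL q
  have hs1 : Summable fun α : Mode S ζ => ‖modeAmp L φ U α.1 α.2 q‖ :=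
    hs.of_nonneg_of_le (fun _ => norm_nonneg _) fun α =>
      le_mul_of_one_le_left (norm_nonneg _) (by simp)
  have hp := hs1.mul_of_nonneg hs (fun _ => norm_nonneg _) fun _ => by positivity
  have hb : ∀ g : Mode S ζ × Mode S ζ, ‖S.L1 (modeAmp L φ U g.1.1 g.1.2 q) (bfreq ζ g.2.1)
      (modeAmp L φ U g.2.1 g.2.2 q)‖ ≤ C₁ * C₂ * (‖modeAmp L φ U g.1.1 g.1.2 q‖ *
        ((1 + ‖g.2.1‖) * ‖modeAmp L φ U g.2.1 g.2.2 q‖)) := fun g => by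
    refine (h1 _ _ _).trans ?_
    have h3 := h2 g.2.1
    calc C₁ * ‖modeAmp L φ U g.1.1 g.1.2 q‖ * ‖bfreq ζ g.2.1‖ * ‖modeAmp L φ U g.2.1 g.2.2 q‖
        ≤ C₁ * ‖modeAmp L φ U g.1.1 g.1.2 q‖ * (C₂ * (1 + ‖g.2.1‖)) *
          ‖modeAmp L φ U g.2.1 g.2.2 q‖ := by
          gcongr
          nlinarith
      _ = _ := by ring
  have hs2 := (hp.mul_left (C₁ * C₂)).of_nonneg_of_le (fun _ => norm_nonneg _) hb
  refine ⟨hs2, (hs2.tsum_le_tsum hb (hp.mul_left _)).trans ?_⟩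
  rw [tsum_mul_left, ← hs1.tsum_mul_tsum hs hp, mul_assoc (C₁ * C₂),
    mul_comm ((torusVol k m L)⁻¹ * K)]
  exact mul_le_mul_of_nonneg_left (mul_le_mul_of_nonneg_left hle
    (tsum_nonneg fun _ => norm_nonneg _)) (by positivity)

end ModeBound

end

noncomputable section

variable {k m N M n : ℕ} {T : ℝ} {s : ℕ} {L : ℝ} {φ : Euc (k + 1) → ℝ}
variable {S : BVP k N M} {ζ : Fin m → Euc (k + 1)} {U Uosc Uev : Profile k m N T} {K : ℝ}

/-! ### The equation as a trigonometric series -/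

/-- The terms of the equation, tested against `χ`: a linear one for each mode, and a quadratic one
for each pair of modes. -/
def modeTerm (S : BVP k N M) (ζ : Fin m → Euc (k + 1)) (L : ℝ) (φ : Euc (k + 1) → ℝ)
    (U : Profile k m N T) (χ : Euc (k + 1) × ℝ → ℝ) (i : Mode S ζ ⊕ Mode S ζ × Mode S ζ)
    (q : Euc (k + 1) × ℝ) : CVec N :=
  Sum.elim (fun α => linTerm S χ q (modeAmp L φ U α.1 α.2 q))
    (fun g => χ q • Complex.I • S.L1 (modeAmp L φ U g.1.1 g.1.2 q) (bfreq ζ g.2.1)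
      (modeAmp L φ U g.2.1 g.2.2 q)) i

theorem modeTerm_inl (χ : Euc (k + 1) × ℝ → ℝ) (α : Mode S ζ) (q : Euc (k + 1) × ℝ) :
    modeTerm S ζ L φ U χ (Sum.inl α) q = linTerm S χ q (modeAmp L φ U α.1 α.2 q) := rfl

theorem modeTerm_inr (χ : Euc (k + 1) × ℝ → ℝ) (g : Mode S ζ × Mode S ζ) (q : Euc (k + 1) × ℝ) :
    modeTerm S ζ L φ U χ (Sum.inr g) q = χ q • Complex.I • S.L1 (modeAmp L φ U g.1.1 g.1.2 q)
      (bfreq ζ g.2.1) (modeAmp L φ U g.2.1 g.2.2 q) := rfl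

/-- A sum over a disjoint union. -/
theorem HasSum.of_inl_inr {ι ι' E : Type*} [NormedAddCommGroup E] {f : ι ⊕ ι' → E} {a b : E}
    (h1 : HasSum (fun i => f (Sum.inl i)) a) (h2 : HasSum (fun i => f (Sum.inr i)) b) :
    HasSum f (a + b) := HasSum.sum h1 h2

/-- The frequency in `θ` of a term. -/
def termFreq : Mode S ζ ⊕ Mode S ζ × Mode S ζ → Fin m → ℤ :=
  Sum.elim (fun α => α.1) fun g => g.1.1 + g.2.1

/-- The frequency in `ψ_d` of a term. -/
def termRoot : Mode S ζ ⊕ Mode S ζ × Mode S ζ → ℝ :=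
  Sum.elim (fun α => α.2) fun g => g.1.2 + g.2.2

theorem exp_mul_add (r r' ψ : ℝ) : Complex.exp (Complex.I * ((r + r') * ψ : ℝ)) =
    Complex.exp (Complex.I * (r * ψ : ℝ)) * Complex.exp (Complex.I * (r' * ψ : ℝ)) := by
  rw [← Complex.exp_add, ← mul_add, ← Complex.ofReal_add, add_mul]

namespace ModeBound

theorem summable_modeAmp_one (hK : ModeBound S ζ L φ U K) (hL : 0 < L) (q : Euc (k + 1) × ℝ) :
    (Summable fun α : Mode S ζ => ‖modeAmp L φ U α.1 α.2 q‖) ∧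
    ∑' α : Mode S ζ, ‖modeAmp L φ U α.1 α.2 q‖ ≤ (torusVol k m L)⁻¹ * K := by
  obtain ⟨hs, hle⟩ := hK.summable_modeAmp hL q
  have h : ∀ α : Mode S ζ, ‖modeAmp L φ U α.1 α.2 q‖ ≤
      (1 + ‖α.1‖) * ‖modeAmp L φ U α.1 α.2 q‖ := fun α =>
    le_mul_of_one_le_left (norm_nonneg _) (by simp)
  have hs1 := hs.of_nonneg_of_le (fun _ => norm_nonneg _) h
  exact ⟨hs1, (hs1.tsum_le_tsum h hs).trans hle⟩

theorem measurable_modeTerm (hK : ModeBound S ζ L φ U K) (hL : 0 < L)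
    (hφ : IsCutoff (omegaT k T) L φ) (hU : MemOsc s U) {χ : Euc (k + 1) × ℝ → ℝ}
    (hχ : ContDiff ℝ ∞ χ) (i : Mode S ζ ⊕ Mode S ζ × Mode S ζ) :
    StronglyMeasurable (modeTerm S ζ L φ U χ i) := by
  rcases i with α | g
  · exact stronglyMeasurable_linTerm hχ (hK.measurable_modeAmp hU hφ hL α)
  · have h1 := (hK.measurable_modeAmp hU hφ hL g.1)
    have h2 := (hK.measurable_modeAmp hU hφ hL g.2)
    have h3 : Continuous fun y : CVec N × CVec N => S.L1Bilin (bfreq ζ g.2.1) y.1 y.2 :=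
      (S.L1Bilin (bfreq ζ g.2.1)).continuous₂
    exact hχ.continuous.stronglyMeasurable.smul
      ((h3.comp_stronglyMeasurable (h1.prodMk h2)).const_smul Complex.I)

theorem exists_modeTerm_bound (hK : ModeBound S ζ L φ U K) (hL : 0 < L)
    {χ : Euc (k + 1) × ℝ → ℝ} (hχ : ContDiff ℝ ∞ χ) (hχc : HasCompactSupport χ) :
    ∃ B : ℝ, ∀ q, (Summable fun i => ‖modeTerm S ζ L φ U χ i q‖) ∧
      ∑' i, ‖modeTerm S ζ L φ U χ i q‖ ≤ B := by
  obtain ⟨C₁, hC₁, h1⟩ := exists_linTerm_bound S hχ hχc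
  obtain ⟨C₂, hC₂, h2⟩ := hK.exists_quad_bound hL
  obtain ⟨C₃, h3⟩ := hχ.continuous.bounded_above_of_compact_support hχc
  have hC₃ : 0 ≤ C₃ := (norm_nonneg _).trans (h3 0)
  have hv := torusVol_pos k m hL
  refine ⟨C₁ * ((torusVol k m L)⁻¹ * K) + C₃ * (C₂ * ((torusVol k m L)⁻¹ * K)), fun q => ?_⟩
  obtain ⟨hs1, hle1⟩ := hK.summable_modeAmp_one hL q
  obtain ⟨hs2, hle2⟩ := h2 q
  have s1 : (Summable fun α => ‖modeTerm S ζ L φ U χ (Sum.inl α) q‖) ∧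
      ∑' α, ‖modeTerm S ζ L φ U χ (Sum.inl α) q‖ ≤ C₁ * ((torusVol k m L)⁻¹ * K) := by
    simp only [modeTerm_inl]
    have s := (hs1.mul_left C₁).of_nonneg_of_le (fun _ => norm_nonneg _) fun α => h1 q _
    refine ⟨s, (s.tsum_le_tsum (fun α => h1 q _) (hs1.mul_left C₁)).trans ?_⟩
    rw [tsum_mul_left]
    exact mul_le_mul_of_nonneg_left hle1 hC₁
  have s2 : (Summable fun g => ‖modeTerm S ζ L φ U χ (Sum.inr g) q‖) ∧
      ∑' g, ‖modeTerm S ζ L φ U χ (Sum.inr g) q‖ ≤ C₃ * (C₂ * ((torusVol k m L)⁻¹ * K)) := by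
    simp only [modeTerm_inr, norm_smul (χ q), norm_smul Complex.I, Complex.norm_I, one_mul]
    refine ⟨hs2.mul_left _, ?_⟩
    rw [tsum_mul_left]
    exact mul_le_mul (h3 q) (hle2.trans (mul_le_mul_of_nonneg_left hle1 hC₂))
      (tsum_nonneg fun _ => norm_nonneg _) hC₃
  have h5 := HasSum.of_inl_inr (f := fun i => ‖modeTerm S ζ L φ U χ i q‖) s1.1.hasSum s2.1.hasSum
  exact ⟨h5.summable, h5.tsum_eq.trans_le (add_le_add s1.2 s2.2)⟩

/-- The equation, at a point, as a sum of modes. -/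
theorem eq_tsum_modeTerm (hK : ModeBound S ζ L φ U K) (hL : 0 < L) (χ : Euc (k + 1) × ℝ → ℝ)
    (q : Euc (k + 1) × ℝ) (θ : Euc m) (ψ : ℝ) {u : CVec N} {d : Fin m → CVec N}
    (hu : u = ∑' α : Mode S ζ, Complex.exp (Complex.I * (α.2 * ψ : ℝ)) • tmode α.1 θ •
      modeAmp L φ U α.1 α.2 q)
    (hd : ∀ j, d j = ∑' α : Mode S ζ, (Complex.I * α.1 j) • Complex.exp (Complex.I * (α.2 * ψ : ℝ)) •
      tmode α.1 θ • modeAmp L φ U α.1 α.2 q) :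
    linTerm S χ q u + χ q • ∑ j, S.L1 u (ζ j) (d j) =
      ∑' i, Complex.exp (Complex.I * (termRoot i * ψ : ℝ)) • tmode (termFreq i) θ •
        modeTerm S ζ L φ U χ i q := by
  set a : Mode S ζ → CVec N := fun α => Complex.exp (Complex.I * (α.2 * ψ : ℝ)) • tmode α.1 θ •
      modeAmp L φ U α.1 α.2 q with ha
  have hn : ∀ α, ‖a α‖ = ‖modeAmp L φ U α.1 α.2 q‖ := fun α => by
    simp only [ha]
    rw [norm_smul, norm_smul, norm_exp_I_mul_ofReal, norm_tmode, one_mul, one_mul]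
  obtain ⟨hs, -⟩ := hK.summable_modeAmp hL q
  obtain ⟨hs1, -⟩ := hK.summable_modeAmp_one hL q
  have hsa : Summable fun α => ‖a α‖ := by simpa only [hn] using hs1
  have hsd : ∀ j, Summable fun α : Mode S ζ => ‖(Complex.I * α.1 j) • a α‖ := fun j => by
    refine hs.of_nonneg_of_le (fun _ => norm_nonneg _) fun α => ?_
    rw [norm_smul, hn, norm_mul, Complex.norm_I, one_mul, Complex.norm_intCast, ← Int.norm_eq_abs]
    exact mul_le_mul_of_nonneg_right (by linarith [norm_le_pi_norm α.1 j]) (norm_nonneg _)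
  have h1 : HasSum (fun α => linTerm S χ q (a α)) (linTerm S χ q u) := by
    rw [hu]
    exact hsa.of_norm.hasSum.mapL (LinearMap.toContinuousLinearMap (linTerm S χ q))
  have h2 : HasSum (fun g : Mode S ζ × Mode S ζ => ∑ j, S.L1 (a g.1) (ζ j)
      ((Complex.I * g.2.1 j) • a g.2)) (∑ j, S.L1 u (ζ j) (d j)) := by
    refine hasSum_sum fun j _ => ?_
    have h := hasSum_bilin (S.L1Bilin (ζ j)) hsa (hsd j)
    rw [← hu] at h
    simp only [S.L1Bilin_apply] at h
    rw [hd]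
    exact h
  have e1 : ∀ α : Mode S ζ, linTerm S χ q (a α) =
      Complex.exp (Complex.I * (termRoot (Sum.inl α : Mode S ζ ⊕ Mode S ζ × Mode S ζ) * ψ : ℝ)) •
      tmode (termFreq (Sum.inl α : Mode S ζ ⊕ Mode S ζ × Mode S ζ)) θ •
        modeTerm S ζ L φ U χ (Sum.inl α) q := fun α => by
    simp only [termRoot, termFreq, Sum.elim_inl, modeTerm_inl, ha, map_smul]
  have e2 : ∀ g : Mode S ζ × Mode S ζ, χ q • ∑ j, S.L1 (a g.1) (ζ j)
      ((Complex.I * g.2.1 j) • a g.2) =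
      Complex.exp (Complex.I * (termRoot (Sum.inr g : Mode S ζ ⊕ Mode S ζ × Mode S ζ) * ψ : ℝ)) •
      tmode (termFreq (Sum.inr g : Mode S ζ ⊕ Mode S ζ × Mode S ζ)) θ •
        modeTerm S ζ L φ U χ (Sum.inr g) q := fun g => by
    simp only [termRoot, termFreq, Sum.elim_inr, modeTerm_inr, exp_mul_add, tmode_add,
      S.L1_bfreq, LinearMap.sum_apply, LinearMap.smul_apply]
    rw [smul_comm (tmode _ _ * tmode _ _) (χ q), smul_comm (Complex.exp _ * Complex.exp _) (χ q)]
    congr 1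
    simp only [Finset.smul_sum]
    refine Finset.sum_congr rfl fun j _ => ?_
    simp only [ha, S.L1_smul, map_smul, LinearMap.smul_apply, smul_smul]
    congr 1
    ring
  simp only [e1] at h1
  have h3 := h2.const_smul (χ q)
  simp only [e2] at h3
  have h4 := HasSum.of_inl_inr (f := fun i : Mode S ζ ⊕ Mode S ζ × Mode S ζ =>
    Complex.exp (Complex.I * (termRoot i * ψ : ℝ)) • tmode (termFreq i) θ •
      modeTerm S ζ L φ U χ i q) h1 h3
  exact h4.tsum_eq.symm

end ModeBound

end

noncomputable section

variable {k m N M n : ℕ} {T : ℝ} {s : ℕ} {L : ℝ} {φ : Euc (k + 1) → ℝ}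
variable {S : BVP k N M} {ζ : Fin m → Euc (k + 1)} {U Uosc Uev : Profile k m N T} {K : ℝ}
variable {G : L2 (Set.univ : Set (Euc (k + 1))) m M}

theorem Mode.ext {α β : Mode S ζ} (h1 : α.1 = β.1) (h2 : (α.2 : ℝ) = β.2) : α = β := by
  obtain ⟨ν, ξ, hξ⟩ := α
  obtain ⟨ν', ξ', hξ'⟩ := β
  subst h1
  obtain rfl : ξ = ξ' := h2
  rfl

theorem modeTerm_eq_zero {χ : Euc (k + 1) × ℝ → ℝ} {q : Euc (k + 1) × ℝ} (hq : q ∉ tsupport χ)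
    (i : Mode S ζ ⊕ Mode S ζ × Mode S ζ) : modeTerm S ζ L φ Uosc χ i q = 0 := by
  have h1 : fderiv ℝ χ q = 0 := by
    by_contra h
    exact hq (support_fderiv_subset ℝ h)
  rcases i with α | g
  · rw [modeTerm_inl, linTerm_apply]
    simp [h1]
  · rw [modeTerm_inr, image_eq_zero_of_notMem_tsupport hq, zero_smul]

/-- The tested equation of the oscillating part as a trigonometric series. -/
theorem ModeBound.testedMode_eq_series (hK : ModeBound S ζ L φ Uosc K) (hL : 0 < L)
    (hφ : IsCutoff (omegaT k T) L φ) (hchar : S.Noncharacteristic)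
    (hU : IsLeadingProfile S ζ s G U Uosc Uev) {DO : Fin m → Profile k m N T}
    (hDO : ∀ j x ψ, 0 ≤ x → 0 ≤ ψ → IsWeakDeriv (Sum.inr j) (Uosc x ψ) (DO j x ψ))
    (ν : Fin m → ℤ) {χ : Euc (k + 1) × ℝ → ℝ} (hφ1 : ∀ q ∈ tsupport χ, φ q.1 = 1) {ψ : ℝ}
    (hψ : 0 ≤ ψ) :
    testedMode S ζ Uosc DO χ ν ψ = ∫ x in Set.Ioi (0 : ℝ), ∫ p, tmode (-ν) p.2 •
      ∑' i : Mode S ζ ⊕ Mode S ζ × Mode S ζ, Complex.exp (Complex.I * (termRoot i * ψ : ℝ)) •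
        tmode (termFreq i) p.2 • modeTerm S ζ L φ Uosc χ i (p.1, x)
      ∂(torusMeasure (omegaT k T) m) := by
  rw [testedMode_eq]
  refine setIntegral_congr_fun measurableSet_Ioi fun x hx => ?_
  have hx' : 0 ≤ x := le_of_lt hx
  rw [innerMode]
  refine integral_congr_ae ?_
  filter_upwards [hK.ae_osc_eq hL hφ hchar hU.memOsc hU.polarization hx' hψ,
    ae_all_iff.2 fun j => hK.ae_deriv_eq hL hφ hchar hU.memOsc hU.polarization hx' hψ
      (hDO j x ψ hx' hψ)] with p h1 h2
  by_cases hq : (p.1, x) ∈ tsupport χ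
  · have hone := hφ1 _ hq
    have hc : p.1 ∈ cube k L := (hφ.support (subset_tsupport φ (by
      rw [Function.mem_support]
      simp only at hone
      rw [hone]; exact one_ne_zero))).2
    have e1 := h1 hc
    have e2 := fun j => h2 j hc
    simp only at hone
    simp only [hone, one_smul] at e1 e2
    rw [← hK.eq_tsum_modeTerm hL χ (p.1, x) p.2 ψ e1 e2, linTerm_apply]
  · have h1 : fderiv ℝ χ (p.1, x) = 0 := by
      by_contra h
      exact hq (support_fderiv_subset ℝ h)
    simp [h1, image_eq_zero_of_notMem_tsupport hq, modeTerm_eq_zero hq]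

/-- The weak equation satisfied by the amplitude of a mode. -/
theorem ModeBound.mode_equation (hK : ModeBound S ζ L φ Uosc K) (hL : 0 < L)
    (hφ : IsCutoff (omegaT k T) L φ) (hchar : S.Noncharacteristic)
    (hU : IsLeadingProfile S ζ s G U Uosc Uev) (hs : 1 ≤ s) (α : Mode S ζ)
    {χ : Euc (k + 1) × ℝ → ℝ} (hχ : ContDiff ℝ ∞ χ)
    (hχc : HasCompactSupport χ) (hsupp : tsupport χ ⊆ {q | q.1 0 < T ∧ 0 < q.2})
    (hφ1 : ∀ q ∈ tsupport χ, φ q.1 = 1) :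
    S.projTil (bfreq ζ α.1) α.2 (∫ q in omegaT k T ×ˢ Set.Ioi (0 : ℝ),
      (linTerm S χ q (modeAmp L φ Uosc α.1 α.2 q) +
        χ q • quadSource S ζ L φ Uosc α.1 α.2 q)) = 0 := by
  classical
  choose DO hDO using fun j : Fin m => hU.memOsc.1.exists_deriv hs (Sum.inr j)
  obtain ⟨R, hR⟩ := hχc.isCompact.isBounded.exists_norm_le
  obtain ⟨B, hB⟩ := hK.exists_modeTerm_bound hL hχ hχc
  have h0 := hU.isFreqPart_osc hs hDO α.1 α.2 hχ hχc hsupp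
  have hser := isFreqPart_integral_series (D := omegaT k T)
    (hK.measurable_modeTerm hL hφ hU.memOsc hχ) (R := R) (B := B) (fun q => (hB q).1)
    (fun q => (hB q).2) (fun i q hq => modeTerm_eq_zero (fun h => hq (by
      rw [mem_closedBall_zero_iff]; exact hR q h)) i) termFreq termRoot α.1 α.2
  obtain ⟨hc, hf⟩ := hser
  set l := LinearMap.toContinuousLinearMap (S.projTil (bfreq ζ α.1) α.2) with hl
  have h1 := hf.clm hc.continuousOn l
  have h2 := h1.unique (h0.congr fun ψ hψ => by
    rw [hK.testedMode_eq_series hL hφ hchar hU hDO α.1 hφ1 hψ]; rfl)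
  rw [← Complex.coe_smul, map_smul, smul_eq_zero] at h2
  have h3 := h2.resolve_left (by
    have := Real.pi_pos
    exact_mod_cast (by positivity : ((2 * Real.pi) ^ m : ℝ) ≠ 0))
  change l _ = 0
  rw [← h3]
  refine congrArg l (integral_congr_ae (Eventually.of_forall fun q => ?_))
  simp only
  have s1 : HasSum (fun β : Mode S ζ => if termFreq (Sum.inl β : Mode S ζ ⊕ Mode S ζ × Mode S ζ) =
      α.1 ∧ termRoot (Sum.inl β : Mode S ζ ⊕ Mode S ζ × Mode S ζ) = α.2 then
      modeTerm S ζ L φ Uosc χ (Sum.inl β) q else 0)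
      (linTerm S χ q (modeAmp L φ Uosc α.1 α.2 q)) := by
    have h := hasSum_single (f := fun β : Mode S ζ =>
      if termFreq (Sum.inl β : Mode S ζ ⊕ Mode S ζ × Mode S ζ) = α.1 ∧
        termRoot (Sum.inl β : Mode S ζ ⊕ Mode S ζ × Mode S ζ) = α.2 then
      modeTerm S ζ L φ Uosc χ (Sum.inl β) q else 0) α fun β hβ => by
        rw [if_neg]
        rintro ⟨h1, h2⟩
        simp only [termFreq, termRoot, Sum.elim_inl] at h1 h2
        exact hβ (Mode.ext h1 h2)
    simp only [termFreq, termRoot, Sum.elim_inl, and_self, if_true, modeTerm_inl] at h ⊢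
    exact h
  have s2 : HasSum (fun g : Mode S ζ × Mode S ζ =>
      if termFreq (Sum.inr g : Mode S ζ ⊕ Mode S ζ × Mode S ζ) = α.1 ∧
        termRoot (Sum.inr g : Mode S ζ ⊕ Mode S ζ × Mode S ζ) = α.2 then
      modeTerm S ζ L φ Uosc χ (Sum.inr g) q else 0) (χ q • quadSource S ζ L φ Uosc α.1 α.2 q) := by
    obtain ⟨C, hC, hq⟩ := hK.exists_quad_bound hL
    have hs2 : Summable fun g : Mode S ζ × Mode S ζ =>
        if g.1.1 + g.2.1 = α.1 ∧ (g.1.2 + g.2.2 : ℝ) = α.2 then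
        Complex.I • S.L1 (modeAmp L φ Uosc g.1.1 g.1.2 q) (bfreq ζ g.2.1)
          (modeAmp L φ Uosc g.2.1 g.2.2 q) else 0 := by
      refine Summable.of_norm_bounded (hq q).1 fun g => ?_
      split_ifs
      · rw [norm_smul, Complex.norm_I, one_mul]
      · rw [norm_zero]; exact norm_nonneg _
    have h := hs2.hasSum.const_smul (χ q)
    simp only [smul_ite, smul_zero] at h
    simp only [termFreq, termRoot, Sum.elim_inr, modeTerm_inr]
    exact h
  have h4 := HasSum.of_inl_inr (f := fun i : Mode S ζ ⊕ Mode S ζ × Mode S ζ =>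
    if termFreq i = α.1 ∧ termRoot i = α.2 then modeTerm S ζ L φ Uosc χ i q else 0) s1 s2
  exact h4.tsum_eq.symm

end

noncomputable section

variable {k m N M n : ℕ} {T : ℝ} {s : ℕ} {L : ℝ} {φ : Euc (k + 1) → ℝ}
variable {S : BVP k N M} {ζ : Fin m → Euc (k + 1)} {U Uosc Uev : Profile k m N T} {K : ℝ}
variable {G : L2 (Set.univ : Set (Euc (k + 1))) m M}

/-! ### Transport of the oscillating modes -/

/-- The space-time direction of a transport at unit speed in time, with spatial velocity `v`; the
last component of `v` is the one normal to the boundary. -/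
def transportDir (v : Fin (k + 1) → ℝ) : Euc (k + 1) × ℝ :=
  (WithLp.toLp 2 (Fin.cons 1 fun i : Fin k => v i.castSucc), v (Fin.last k))

theorem fderiv_transportDir (χ : Euc (k + 1) × ℝ → ℝ) (q : Euc (k + 1) × ℝ)
    (v : Fin (k + 1) → ℝ) : fderiv ℝ χ q (transportDir v) =
      fderiv ℝ χ q (EuclideanSpace.single 0 1, 0) + ∑ i : Fin k, v i.castSucc *
        fderiv ℝ χ q (EuclideanSpace.single i.succ 1, 0) + v (Fin.last k) * fderiv ℝ χ q (0, 1) := by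
  have h : transportDir v = ((EuclideanSpace.single 0 1, 0) : Euc (k + 1) × ℝ) +
      ∑ i : Fin k, v i.castSucc • ((EuclideanSpace.single i.succ 1, 0) : Euc (k + 1) × ℝ) +
      v (Fin.last k) • ((0, 1) : Euc (k + 1) × ℝ) := by
    refine Prod.ext ?_ ?_
    · simp only [Prod.fst_add, Prod.fst_sum, Prod.smul_mk, smul_zero, add_zero]
      ext i
      refine Fin.cases ?_ (fun i => ?_) i
      · simp [transportDir]
      · simp [transportDir, Finset.sum_apply, Pi.single_apply]
    · simp [transportDir, Prod.snd_sum]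
  rw [h, map_add, map_add, map_sum]
  simp only [map_smul, smul_eq_mul]

theorem integrable_of_bound_of_tsupport {E F : Type*} [NormedAddCommGroup E] [MeasurableSpace E]
    [BorelSpace E] [NormedAddCommGroup F] {μ : Measure E} [IsFiniteMeasureOnCompacts μ]
    {χ : E → ℝ} (hχc : HasCompactSupport χ) {f : E → F} (hf : AEStronglyMeasurable f μ) {B : ℝ}
    (hB : ∀ q, ‖f q‖ ≤ B) (h0 : ∀ q ∉ tsupport χ, f q = 0) : Integrable f μ := by
  rw [← integrableOn_iff_integrable_of_support_subset (s := tsupport χ)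
    (fun q hq => by by_contra h; exact hq (h0 q h))]
  exact Measure.integrableOn_of_bounded (hχc.isCompact.measure_lt_top.ne) hf
    (Eventually.of_forall hB)

theorem ModeBound.measurable_quadSource (hK : ModeBound S ζ L φ Uosc K) (hL : 0 < L)
    (hφ : IsCutoff (omegaT k T) L φ) (hU : MemOsc s Uosc) (ν : Fin m → ℤ) (ξ : ℝ) :
    StronglyMeasurable (quadSource S ζ L φ Uosc ν ξ) := by
  obtain ⟨C, hC, hq⟩ := hK.exists_quad_bound hL
  refine stronglyMeasurable_tsum (fun g => ?_) fun q => ?_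
  · have h1 := (hK.measurable_modeAmp hU hφ hL g.1)
    have h2 := (hK.measurable_modeAmp hU hφ hL g.2)
    have h3 : Continuous fun y : CVec N × CVec N => S.L1Bilin (bfreq ζ g.2.1) y.1 y.2 :=
      (S.L1Bilin (bfreq ζ g.2.1)).continuous₂
    split_ifs
    · exact (h3.comp_stronglyMeasurable (h1.prodMk h2)).const_smul Complex.I
    · exact stronglyMeasurable_const
  · refine Summable.of_norm_bounded (hq q).1 fun g => ?_
    split_ifs
    · rw [norm_smul, Complex.norm_I, one_mul]
    · rw [norm_zero]; exact norm_nonneg _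


/-- The sum of the absolute values of the quadratic sources of all the modes is controlled by that
of the amplitudes: a pair of modes contributes to a single mode. -/
theorem ModeBound.exists_quadSource_bound (hK : ModeBound S ζ L φ Uosc K) (hL : 0 < L) :
    ∃ C : ℝ≥0, ∀ q, ∑' α : Mode S ζ, ‖quadSource S ζ L φ Uosc α.1 α.2 q‖ₑ ≤
      C * ∑' α : Mode S ζ, ‖modeAmp L φ Uosc α.1 α.2 q‖ₑ := by
  classical
  obtain ⟨C, hC, hq⟩ := hK.exists_quad_bound hL
  refine ⟨C.toNNReal, fun q => ?_⟩
  obtain ⟨hs, hle⟩ := hq q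
  obtain ⟨hs1, -⟩ := hK.summable_modeAmp_one hL q
  set t : Mode S ζ × Mode S ζ → CVec N := fun g => S.L1 (modeAmp L φ Uosc g.1.1 g.1.2 q)
    (bfreq ζ g.2.1) (modeAmp L φ Uosc g.2.1 g.2.2 q) with ht
  have hone : ∀ g : Mode S ζ × Mode S ζ, ∑' α : Mode S ζ,
      (if g.1.1 + g.2.1 = α.1 ∧ (g.1.2 + g.2.2 : ℝ) = α.2 then ‖t g‖ₑ else 0) ≤ ‖t g‖ₑ := by
    intro g
    by_cases h : ∃ α : Mode S ζ, g.1.1 + g.2.1 = α.1 ∧ (g.1.2 + g.2.2 : ℝ) = α.2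
    · obtain ⟨α, h1, h2⟩ := h
      rw [tsum_eq_single α]
      · split_ifs <;> simp
      · intro β hβ
        rw [if_neg]
        rintro ⟨h3, h4⟩
        exact hβ (Mode.ext (h3.symm.trans h1) (h4.symm.trans h2))
    · simp only [not_exists] at h
      simp [h]
  calc ∑' α : Mode S ζ, ‖quadSource S ζ L φ Uosc α.1 α.2 q‖ₑ
      ≤ ∑' α : Mode S ζ, ∑' g : Mode S ζ × Mode S ζ,
        (if g.1.1 + g.2.1 = α.1 ∧ (g.1.2 + g.2.2 : ℝ) = α.2 then ‖t g‖ₑ else 0) := by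
        refine ENNReal.tsum_le_tsum fun α => ?_
        refine enorm_tsum_le_tsum_enorm.trans (ENNReal.tsum_le_tsum fun g => ?_)
        split_ifs
        · rw [enorm_smul, ← ofReal_norm Complex.I, Complex.norm_I, ENNReal.ofReal_one, one_mul]
        · simp
    _ = ∑' g : Mode S ζ × Mode S ζ, ∑' α : Mode S ζ,
        (if g.1.1 + g.2.1 = α.1 ∧ (g.1.2 + g.2.2 : ℝ) = α.2 then ‖t g‖ₑ else 0) :=
        ENNReal.tsum_comm
    _ ≤ ∑' g : Mode S ζ × Mode S ζ, ‖t g‖ₑ := ENNReal.tsum_le_tsum hone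
    _ = ENNReal.ofReal (∑' g, ‖t g‖) := by
        rw [ENNReal.ofReal_tsum_of_nonneg (fun _ => norm_nonneg _) hs]
        simp only [ofReal_norm, ht]
    _ ≤ ENNReal.ofReal (C * ∑' α : Mode S ζ, ‖modeAmp L φ Uosc α.1 α.2 q‖) :=
        ENNReal.ofReal_le_ofReal hle
    _ = _ := by
        rw [ENNReal.ofReal_mul hC, ENNReal.ofReal_tsum_of_nonneg (fun _ => norm_nonneg _) hs1]
        simp only [ofReal_norm]
        rfl

theorem ModeBound.exists_quadSource_norm_le (hK : ModeBound S ζ L φ Uosc K) (hL : 0 < L) :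
    ∃ C : ℝ, ∀ (α : Mode S ζ) q, ‖quadSource S ζ L φ Uosc α.1 α.2 q‖ ≤ C := by
  obtain ⟨C, hC⟩ := hK.exists_quadSource_bound hL
  refine ⟨C * ((torusVol k m L)⁻¹ * K), fun α q => ?_⟩
  obtain ⟨hs1, hle⟩ := hK.summable_modeAmp_one hL q
  have hpos : 0 ≤ ∑' α : Mode S ζ, ‖modeAmp L φ Uosc α.1 α.2 q‖ := tsum_nonneg fun _ => norm_nonneg _
  have h := (ENNReal.le_tsum α).trans (hC q)
  simp only [← ofReal_norm] at h
  rw [← ENNReal.ofReal_tsum_of_nonneg (fun _ => norm_nonneg _) hs1, ← ENNReal.ofReal_coe_nnreal,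
    ← ENNReal.ofReal_mul (NNReal.coe_nonneg C)] at h
  exact ((ENNReal.ofReal_le_ofReal_iff (mul_nonneg C.2 hpos)).1 h).trans (mul_le_mul_of_nonneg_left hle C.2)

/-- The source in the transport equation of the amplitude of a mode. -/
def modeSource (S : BVP k N M) (ζ : Fin m → Euc (k + 1)) (L : ℝ) (φ : Euc (k + 1) → ℝ)
    (U : Profile k m N T) (ν : Fin m → ℤ) (ξ : ℝ) (q : Euc (k + 1) × ℝ) : CVec N :=
  -S.proj (bfreq ζ ν) ξ (cAct (S.An 0) (quadSource S ζ L φ U ν ξ q))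

theorem proj_An_linTerm (hchar : S.Noncharacteristic) {b : Euc (k + 1)} {ξ : ℝ}
    {v : Fin (k + 1) → ℝ} (hv : ∀ i u, S.proj b ξ (S.symbEnd (EuclideanSpace.single i 1)
      (S.proj b ξ u)) = (v i : ℂ) • S.proj b ξ u) (χ : Euc (k + 1) × ℝ → ℝ)
    (q : Euc (k + 1) × ℝ) {w : CVec N} (hw : S.proj b ξ w = w) :
    S.proj b ξ (cAct (S.An 0) (linTerm S χ q w)) = -(fderiv ℝ χ q (transportDir v) • w) := by
  have h1 : ∀ i, S.proj b ξ (S.symbEnd (EuclideanSpace.single i 1) w) = v i • w := fun i => by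
    have := hv i w
    rwa [hw, Complex.coe_smul] at this
  have h2 : S.proj b ξ (cAct (S.An 0) w) = v (Fin.last k) • w := by
    rw [← h1, BVP.symbEnd, S.symb_single_last]
  have h3 : ∀ i : Fin k, S.proj b ξ (cAct (S.A i 0) w) = v i.castSucc • w := fun i => by
    rw [← h1, BVP.symbEnd, S.symb_single_castSucc]
  have hr : ∀ (r : ℝ) (f : CVec N →ₗ[ℂ] CVec N) u, f (r • u) = r • f u := fun r f u => by
    rw [← Complex.coe_smul, map_smul, Complex.coe_smul]
  rw [linTerm_apply, fderiv_transportDir, map_sub, map_sub, map_neg, map_neg, map_sum, map_sum,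
    hr, hr, h2, Fin.sum_univ_succ, hr, hr, S.cAct_An_Atil_zero hchar, hw]
  simp only [hr, S.cAct_An_Atil hchar, h3, add_smul, Finset.sum_smul, smul_smul, mul_comm]
  abel

/-- Each oscillating mode satisfies a transport equation. -/
theorem ModeBound.mode_transport (hK : ModeBound S ζ L φ Uosc K) (hL : 0 < L)
    (hφ : IsCutoff (omegaT k T) L φ) (hchar : S.Noncharacteristic)
    (hU : IsLeadingProfile S ζ s G U Uosc Uev) (hs : 1 ≤ s) (α : Mode S ζ)
    {v : Fin (k + 1) → ℝ} (hv : ∀ i u, S.proj (bfreq ζ α.1) α.2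
      (S.symbEnd (EuclideanSpace.single i 1) (S.proj (bfreq ζ α.1) α.2 u)) =
        (v i : ℂ) • S.proj (bfreq ζ α.1) α.2 u)
    {χ : Euc (k + 1) × ℝ → ℝ} (hχ : ContDiff ℝ ∞ χ)
    (hχc : HasCompactSupport χ) (hsupp : tsupport χ ⊆ {q | q.1 0 < T ∧ 0 < q.2})
    (hφ1 : ∀ q ∈ tsupport χ, φ q.1 = 1) :
    ∫ q, fderiv ℝ χ q (transportDir v) • modeAmp L φ Uosc α.1 α.2 q =
      -∫ q, χ q • modeSource S ζ L φ Uosc α.1 α.2 q := by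
  obtain ⟨Cq, hCq⟩ := hK.exists_quadSource_norm_le hL
  obtain ⟨Cl, hCl0, hCl⟩ := exists_linTerm_bound S hχ hχc
  obtain ⟨Cχ, hCχ⟩ := hχ.continuous.bounded_above_of_compact_support hχc
  have hf : ∀ q, ‖modeAmp L φ Uosc α.1 α.2 q‖ ≤ (torusVol k m L)⁻¹ * K := fun q => by
    obtain ⟨hs1, hle⟩ := hK.summable_modeAmp_one hL q
    exact (hs1.le_tsum α fun _ _ => norm_nonneg _).trans hle
  have hm1 := stronglyMeasurable_linTerm (S := S) hχ (hK.measurable_modeAmp hU.memOsc hφ hL α)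
  have hm2 := hχ.continuous.stronglyMeasurable.smul
    (hK.measurable_quadSource hL hφ hU.memOsc α.1 α.2)
  have hfd : ∀ q ∉ tsupport χ, fderiv ℝ χ q = 0 := fun q hq => by
    by_contra h
    exact hq (support_fderiv_subset ℝ h)
  have hl0 : ∀ q ∉ tsupport χ, linTerm S χ q (modeAmp L φ Uosc α.1 α.2 q) = 0 := fun q hq => by
    rw [linTerm_apply]; simp [hfd q hq]
  have hχ0 : ∀ q ∉ tsupport χ, χ q = 0 := fun q hq => image_eq_zero_of_notMem_tsupport hq
  have hi1 : Integrable (fun q => linTerm S χ q (modeAmp L φ Uosc α.1 α.2 q)) :=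
    integrable_of_bound_of_tsupport hχc hm1.aestronglyMeasurable (fun q => (hCl q _).trans
      (mul_le_mul_of_nonneg_left (hf q) hCl0)) hl0
  have hi2 : Integrable (fun q => χ q • quadSource S ζ L φ Uosc α.1 α.2 q) :=
    integrable_of_bound_of_tsupport (B := Cχ * Cq) hχc hm2.aestronglyMeasurable (fun q => by
      rw [norm_smul]
      exact mul_le_mul (hCχ q) (hCq α q) (norm_nonneg _) ((norm_nonneg _).trans (hCχ q)))
      fun q hq => by simp [hχ0 q hq]
  have h := hK.mode_equation hL hφ hchar hU hs α hχ hχc hsupp hφ1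
  rw [setIntegral_eq_integral_of_forall_compl_eq_zero (fun q hq => by
    have : q ∉ tsupport χ := fun h => hq ⟨(hsupp h).1.le, (hsupp h).2⟩
    rw [hl0 q this, hχ0 q this, zero_smul, add_zero])] at h
  have h2 := S.projTil_eq_zero hchar h
  set P := LinearMap.toContinuousLinearMap (S.proj (bfreq ζ α.1) α.2 ∘ₗ cAct (S.An 0)) with hP
  have h3 : P (∫ q, (linTerm S χ q (modeAmp L φ Uosc α.1 α.2 q) +
      χ q • quadSource S ζ L φ Uosc α.1 α.2 q)) = 0 := h2
  have e1 : ∀ q, P (linTerm S χ q (modeAmp L φ Uosc α.1 α.2 q)) =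
      -(fderiv ℝ χ q (transportDir v) • modeAmp L φ Uosc α.1 α.2 q) := fun q =>
    proj_An_linTerm hchar hv χ q (hK.proj_modeAmp hU.memOsc hU.polarization hφ q α)
  have e2 : ∀ q, P (χ q • quadSource S ζ L φ Uosc α.1 α.2 q) =
      -(χ q • modeSource S ζ L φ Uosc α.1 α.2 q) := fun q => by
    rw [← Complex.coe_smul, map_smul, Complex.coe_smul, modeSource, smul_neg, neg_neg]; rfl
  rw [integral_add hi1 hi2, map_add, ← P.integral_comp_comm hi1, ← P.integral_comp_comm hi2] at h3
  simp only [e1, e2, integral_neg] at h3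
  exact neg_inj.1 (eq_neg_of_add_eq_zero_left h3)

theorem ModeBound.measurable_modeSource (hK : ModeBound S ζ L φ Uosc K) (hL : 0 < L)
    (hφ : IsCutoff (omegaT k T) L φ) (hU : MemOsc s Uosc) (ν : Fin m → ℤ) (ξ : ℝ) :
    StronglyMeasurable (modeSource S ζ L φ Uosc ν ξ) :=
  ((LinearMap.toContinuousLinearMap
    (S.proj (bfreq ζ ν) ξ ∘ₗ cAct (S.An 0))).continuous.comp_stronglyMeasurable
      (hK.measurable_quadSource hL hφ hU ν ξ)).neg

/-- The sources of the oscillating modes are controlled, uniformly in the mode. -/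
theorem BVP.StrictlyHyperbolic.exists_modeSource_le {τ : Fin N → Euc (k + 1) → ℝ}
    (hτ : S.StrictlyHyperbolic τ) (ζ : Fin m → Euc (k + 1)) (L : ℝ) (φ : Euc (k + 1) → ℝ)
    (U : Profile k m N T) : ∃ C : ℝ≥0, ∀ ν ξ q, bfreq ζ ν ≠ 0 →
      ‖modeSource S ζ L φ U ν ξ q‖ₑ ≤ C * ‖quadSource S ζ L φ U ν ξ q‖ₑ := by
  obtain ⟨C, hC, h⟩ := hτ.exists_proj_bound
  set A := LinearMap.toContinuousLinearMap (cAct (S.An 0))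
  refine ⟨C.toNNReal * ‖A‖₊, fun ν ξ q hν => ?_⟩
  rw [modeSource, enorm_neg, enorm_eq_nnnorm, enorm_eq_nnnorm, ← ENNReal.coe_mul,
    ENNReal.coe_le_coe, ← NNReal.coe_le_coe]
  push_cast
  rw [Real.coe_toNNReal _ hC, mul_assoc]
  exact (h _ _ _ hν).trans (mul_le_mul_of_nonneg_left (A.le_opNorm _) hC)

end

noncomputable section

variable {k m N M n : ℕ} {T : ℝ} {s : ℕ} {L : ℝ} {φ : Euc (k + 1) → ℝ}
variable {S : BVP k N M} {ζ : Fin m → Euc (k + 1)} {U Uosc Uev : Profile k m N T} {K : ℝ}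
variable {G : L2 (Set.univ : Set (Euc (k + 1))) m M}

/-! ### The mean mode -/

theorem bfreq_eq_neg {ν ν' : Fin m → ℤ} (h : ν + ν' = 0) : bfreq ζ ν = -bfreq ζ ν' := by
  rw [eq_neg_of_add_eq_zero_left h]
  simp [bfreq]

/-- The oscillating modes do not act on the mean mode: the contributions of the pairs `(α, -α)`
and `(-α, α)` cancel, because both amplitudes lie on the same line. -/
theorem ModeBound.quadSource_mean (hK : ModeBound S ζ L φ Uosc K) (hU : MemOsc s Uosc)
    (hpol : IsProjE S ζ Uosc Uev Uosc Uev) (hφ : IsCutoff (omegaT k T) L φ)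
    {τ : Fin N → Euc (k + 1) → ℝ} (hτ : S.StrictlyHyperbolic τ) (q : Euc (k + 1) × ℝ) :
    quadSource S ζ L φ Uosc 0 0 q = 0 := by
  set t : Mode S ζ × Mode S ζ → CVec N := fun g =>
    if g.1.1 + g.2.1 = 0 ∧ (g.1.2 + g.2.2 : ℝ) = 0 then
      Complex.I • S.L1 (modeAmp L φ Uosc g.1.1 g.1.2 q) (bfreq ζ g.2.1)
        (modeAmp L φ Uosc g.2.1 g.2.2 q) else 0 with ht
  have hflip : ∀ {b b' : Euc (k + 1)} {ξ ξ' : ℝ} {u w : CVec N}, b = -b' → ξ = -ξ' →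
      S.proj b ξ u = u → S.proj b' ξ' w = w → S.L1 w b u = -S.L1 u b' w := by
    rintro b b' ξ ξ' u w rfl rfl hu hw
    rw [S.L1_neg, LinearMap.neg_apply]
    by_cases hb : b' = 0
    · rw [hb]; simp [BVP.L1]
    · rw [S.proj_neg] at hu
      rw [hτ.L1_comm_of_polarized hb _ hw hu]
  have hswap : ∀ g : Mode S ζ × Mode S ζ, t g.swap = -t g := by
    rintro ⟨α, β⟩
    simp only [ht, Prod.fst_swap, Prod.snd_swap, add_comm β.1, add_comm (β.2 : ℝ)]
    split_ifs with h
    · rw [← smul_neg, hflip (bfreq_eq_neg h.1) (eq_neg_of_add_eq_zero_left h.2)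
        (hK.proj_modeAmp hU hpol hφ q α) (hK.proj_modeAmp hU hpol hφ q β)]
    · simp
  change ∑' g, t g = 0
  have h := (Equiv.prodComm (Mode S ζ) (Mode S ζ)).tsum_eq t
  simp only [Equiv.prodComm_apply] at h
  rw [tsum_congr hswap, tsum_neg] at h
  have h2 : (2 : ℂ) • ∑' g, t g = 0 := by
    rw [two_smul]
    nth_rewrite 1 [← h]
    exact neg_add_cancel _
  exact (smul_eq_zero.1 h2).resolve_left two_ne_zero

/-- The mean mode. -/
def meanMode (S : BVP k N M) (ζ : Fin m → Euc (k + 1)) (hchar : S.Noncharacteristic)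
    (hN : 1 ≤ N) : Mode S ζ :=
  ⟨0, 0, by
    have h : bfreq ζ 0 = 0 := by simp [bfreq]
    rw [h]
    exact S.zero_mem_charFreqs_zero hchar hN⟩

theorem bfreq_zero : bfreq ζ 0 = 0 := by simp [bfreq]

theorem bfreq_ne_zero_of_ne_meanMode (hchar : S.Noncharacteristic) (hN : 1 ≤ N)
    (hζ : RationallyIndependent ζ) {α : Mode S ζ} (hα : α ≠ meanMode S ζ hchar hN) :
    bfreq ζ α.1 ≠ 0 := by
  intro h
  refine hα (Mode.ext (hζ _ h) ?_)
  obtain ⟨ν, ξ, hξ⟩ := α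
  simp only at h
  rw [h] at hξ
  exact S.charFreqs_zero_subset hchar hN hξ

/-- The mean mode satisfies a linear system. -/
theorem ModeBound.mean_equation (hK : ModeBound S ζ L φ Uosc K) (hL : 0 < L)
    (hφ : IsCutoff (omegaT k T) L φ) (hchar : S.Noncharacteristic) (hN : 1 ≤ N)
    {τ : Fin N → Euc (k + 1) → ℝ} (hτ : S.StrictlyHyperbolic τ)
    (hU : IsLeadingProfile S ζ s G U Uosc Uev) (hs : 1 ≤ s)
    {χ : Euc (k + 1) × ℝ → ℝ} (hχ : ContDiff ℝ ∞ χ)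
    (hχc : HasCompactSupport χ) (hsupp : tsupport χ ⊆ {q | q.1 0 < T ∧ 0 < q.2})
    (hφ1 : ∀ q ∈ tsupport χ, φ q.1 = 1) :
    ∫ q in omegaT k T ×ˢ Set.Ioi (0 : ℝ), linTerm S χ q (modeAmp L φ Uosc 0 0 q) = 0 := by
  have h := hK.mode_equation hL hφ hchar hU hs (meanMode S ζ hchar hN) hχ hχc hsupp hφ1
  simp only [meanMode, bfreq_zero, S.projTil_zero hchar,
    hK.quadSource_mean hU.memOsc hU.polarization hφ hτ, smul_zero, add_zero] at h
  exact h

end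

noncomputable section

variable {k N : ℕ}

/-! ### Band-limited functions -/

open scoped FourierTransform SchwartzMap LineDeriv in
/-- Real parts of Fourier transforms of Schwartz functions supported in the ball of radius `R`, with
`L²` norm at most `1`. -/
def bandLimited (k : ℕ) (R : ℝ) : Set (Euc k → ℝ) :=
  {ψ | ∃ h : 𝓢(Euc k, ℂ), (∀ w, R < ‖w‖ → h w = 0) ∧ ∫ w, ‖h w‖ ^ 2 ≤ 1 ∧
    ψ = fun y => (𝓕 h y).re}

theorem contDiff_of_mem_bandLimited {R : ℝ} {ψ : Euc k → ℝ} (hψ : ψ ∈ bandLimited k R) :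
    ContDiff ℝ ∞ ψ := by
  obtain ⟨h, -, -, rfl⟩ := hψ
  exact Complex.reCLM.contDiff.comp (SchwartzMap.smooth _ ⊤)

open scoped FourierTransform SchwartzMap LineDeriv in
theorem lintegral_sq_of_mem_bandLimited {R : ℝ} {ψ : Euc k → ℝ} (hψ : ψ ∈ bandLimited k R) :
    ∫⁻ y, ‖ψ y‖ₑ ^ 2 ≤ 1 := by
  obtain ⟨h, -, h1, rfl⟩ := hψ
  rw [← h.integral_norm_sq_fourier] at h1
  have hi : Integrable fun y => ‖𝓕 h y‖ ^ 2 :=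
    (memLp_two_iff_integrable_sq_norm (𝓕 h).continuous.aestronglyMeasurable).1 ((𝓕 h).memLp 2)
  calc ∫⁻ y, ‖(𝓕 h y).re‖ₑ ^ 2 ≤ ∫⁻ y, ENNReal.ofReal (‖𝓕 h y‖ ^ 2) := by
        refine lintegral_mono fun y => ?_
        rw [← ofReal_norm, ← ENNReal.ofReal_pow (norm_nonneg _)]
        refine ENNReal.ofReal_le_ofReal ?_
        rw [Real.norm_eq_abs]
        exact pow_le_pow_left₀ (abs_nonneg _) (Complex.abs_re_le_norm _) 2
    _ = ENNReal.ofReal (∫ y, ‖𝓕 h y‖ ^ 2) :=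
        (ofReal_integral_eq_lintegral_ofReal hi (Eventually.of_forall fun _ => by positivity)).symm
    _ ≤ 1 := by
        rw [← ENNReal.ofReal_one]
        exact ENNReal.ofReal_le_ofReal h1

open scoped FourierTransform SchwartzMap LineDeriv in
/-- Bernstein's inequality: derivatives of band limited functions are band limited. -/
theorem fderiv_mem_bandLimited {R : ℝ} (hR : 0 < R) {ψ : Euc k → ℝ} (hψ : ψ ∈ bandLimited k R)
    (i : Fin k) : (fun y => (2 * Real.pi * R)⁻¹ * fderiv ℝ ψ y (EuclideanSpace.single i 1)) ∈
      bandLimited k R := by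
  obtain ⟨h, h0, h1, rfl⟩ := hψ
  set e : Euc k := EuclideanSpace.single i 1 with he
  have hpi := Real.pi_pos
  have ht : (fun w : Euc k => inner ℝ w e).HasTemperateGrowth :=
    ((innerSL ℝ).flip e).hasTemperateGrowth
  set c : ℝ := (2 * Real.pi * R)⁻¹ with hc
  set g : 𝓢(Euc k, ℂ) := -(2 * Real.pi * Complex.I) • SchwartzMap.smulLeftCLM ℂ (inner ℝ · e) h
    with hg
  have hgw : ∀ w, g w = -(2 * Real.pi * Complex.I) * ((inner ℝ w e : ℝ) • h w) := fun w => by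
    rw [hg, _root_.smul_apply, SchwartzMap.smulLeftCLM_apply_apply ht, smul_eq_mul]
  have hb : ∀ w, ‖(c : ℂ) * g w‖ ≤ ‖h w‖ := fun w => by
    by_cases hw : R < ‖w‖
    · rw [hgw, h0 w hw]; simp
    · have h2 : |inner ℝ w e| ≤ R := by
        refine (abs_real_inner_le_norm w e).trans ?_
        rw [he, PiLp.norm_single, norm_one, mul_one]
        exact not_lt.1 hw
      rw [hgw, norm_mul, norm_mul, norm_smul, norm_neg, norm_mul, norm_mul, Complex.norm_I,
        Complex.norm_real, Complex.norm_real, Real.norm_eq_abs, Real.norm_eq_abs, Real.norm_eq_abs,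
        abs_of_pos hpi, abs_of_pos (by positivity : 0 < c), Complex.norm_ofNat, hc]
      calc (2 * Real.pi * R)⁻¹ * (2 * Real.pi * 1 * (|inner ℝ w e| * ‖h w‖))
          ≤ (2 * Real.pi * R)⁻¹ * (2 * Real.pi * 1 * (R * ‖h w‖)) := by gcongr
        _ = ‖h w‖ := by field_simp
  refine ⟨(c : ℂ) • g, fun w hw => ?_, ?_, ?_⟩
  · have := hb w
    rw [h0 w hw, norm_zero] at this
    rw [_root_.smul_apply, smul_eq_mul]
    exact norm_le_zero_iff.1 this
  · refine le_trans (integral_mono_of_nonneg (Eventually.of_forall fun _ => by positivity)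
      ?_ (Eventually.of_forall fun w => ?_)) h1
    · exact (memLp_two_iff_integrable_sq_norm h.continuous.aestronglyMeasurable).1 (h.memLp 2)
    · simp only [_root_.smul_apply, smul_eq_mul]
      exact pow_le_pow_left₀ (norm_nonneg _) (hb w) 2
  · funext y
    have h2 : 𝓕 ((c : ℂ) • g) y = c * ∂_{e} (𝓕 h) y := by
      rw [SchwartzMap.lineDerivOp_fourier_eq, FourierTransform.fourier_smul]
      rfl
    have h3 : fderiv ℝ (fun y => (𝓕 h y).re) y e = (∂_{e} (𝓕 h) y).re := by
      set f : 𝓢(Euc k, ℂ) := 𝓕 h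
      have h4 := Complex.reCLM.hasFDerivAt.comp y (f.differentiableAt (x := y)).hasFDerivAt
      have h5 : HasFDerivAt (fun y => (f y).re) (Complex.reCLM.comp (fderiv ℝ f y)) y := h4
      rw [h5.fderiv, SchwartzMap.lineDerivOp_apply_eq_fderiv]
      rfl
    rw [h2, h3, Complex.re_ofReal_mul]

open scoped FourierTransform SchwartzMap LineDeriv in
theorem ae_eq_zero_of_integral_mul_fourier {D : Set (Lp ℂ 2 (volume : Measure (Euc k)))}
    (hD : Dense D) {u : Euc k → ℂ} (hu : MemLp u 2)
    (h : ∀ f ∈ D, ∃ g : 𝓢(Euc k, ℂ), g.toLp 2 = f ∧ ∫ y, u y * 𝓕 g y = 0) : u =ᵐ[volume] 0 := by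
  have hv : MemLp (fun y => star (u y)) 2 := hu.star
  set v := hv.toLp with hvdef
  set Φ := Lp.fourierTransformₗᵢ (Euc k) ℂ with hΦ
  have h1 : ∀ f ∈ D, innerSL ℂ v (Φ f) = 0 := by
    intro f hf
    obtain ⟨g, hg, h0⟩ := h f hf
    have e : Φ f = (𝓕 g).toLp 2 := by rw [← SchwartzMap.toLp_fourier_eq, hg]; rfl
    rw [e, innerSL_apply_apply, L2.inner_def, ← h0]
    refine integral_congr_ae ?_
    filter_upwards [hv.coeFn_toLp, (𝓕 g).coeFn_toLp 2 volume] with y h1 h2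
    rw [h1, h2]
    simp [mul_comm]
  have h2 := Continuous.ext_on hD ((innerSL ℂ v).continuous.comp Φ.continuous)
    (continuous_const (y := (0 : ℂ))) h1
  have h3 := congrFun h2 (Φ.symm v)
  simp only [Function.comp_apply, Φ.apply_symm_apply, innerSL_apply_apply] at h3
  have h4 : v = 0 := inner_self_eq_zero.1 h3
  filter_upwards [hv.coeFn_toLp, (Lp.eq_zero_iff_ae_eq_zero).1 h4] with y h1 h2
  rw [h2] at h1
  exact star_eq_zero.1 h1.symm

open scoped FourierTransform SchwartzMap LineDeriv in
/-- The band limited functions separate the functions of `L²`; countably many of them do. -/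
theorem exists_countable_bandLimited (k : ℕ) : ∃ D : Set (Euc k → ℝ), D.Countable ∧
    (∀ ψ ∈ D, ∃ R, 0 < R ∧ ψ ∈ bandLimited k R) ∧
    ∀ (N : ℕ) (u : Euc k → CVec N), MemLp u 2 → (∀ ψ ∈ D, ∫ y, ψ y • u y = 0) → u =ᵐ[volume] 0 := by
  have : Fact ((2 : ℝ≥0∞) ≠ ⊤) := ⟨by norm_num⟩
  obtain ⟨D₀, hD₀, hc, hd⟩ := (Lp.dense_hasCompactSupport_contDiff (E := Euc k) (F := ℂ)
    (μ := volume) (p := 2) (by norm_num)).exists_countable_dense_subset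
  have hex : ∀ f : Lp ℂ 2 (volume : Measure (Euc k)), f ∈ D₀ → ∃ g : 𝓢(Euc k, ℂ), ∃ R : ℝ, 0 < R ∧
      (∀ w, R < ‖w‖ → g w = 0) ∧ g.toLp 2 = f := by
    intro f hf
    obtain ⟨g, hg, hgc, hgs⟩ := hD₀ hf
    obtain ⟨R, hR⟩ := hgc.isCompact.isBounded.exists_norm_le
    refine ⟨hgc.toSchwartzMap hgs, max R 1, by positivity, fun w hw => ?_, ?_⟩
    · have : w ∉ tsupport g := fun h => absurd (hR w h) (not_le.2 ((le_max_left _ _).trans_lt hw))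
      exact image_eq_zero_of_notMem_tsupport this
    · refine Lp.ext ?_
      filter_upwards [(hgc.toSchwartzMap hgs).coeFn_toLp 2 volume, hg] with w h1 h2
      rw [h1, h2]
      rfl
  choose! g R hR h0 hg using hex
  set a : Lp ℂ 2 (volume : Measure (Euc k)) → ℝ := fun f => (1 + ∫ w, ‖g f w‖ ^ 2)⁻¹ with ha
  have hint : ∀ f, 0 ≤ ∫ w, ‖g f w‖ ^ 2 := fun f => integral_nonneg fun _ => by positivity
  have hapos : ∀ f, 0 < a f := fun f => inv_pos.2 (by have := hint f; linarith)
  have hmem : ∀ f ∈ D₀, ∀ c : ℂ, ‖c‖ = 1 →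
      (fun y => (𝓕 (((a f : ℂ) * c) • g f) y).re) ∈ bandLimited k (R f) := by
    intro f hf c hcn
    refine ⟨((a f : ℂ) * c) • g f, fun w hw => ?_, ?_, rfl⟩
    · rw [_root_.smul_apply, h0 f hf w hw, smul_zero]
    · have e : ∀ w, ‖(((a f : ℂ) * c) • g f) w‖ ^ 2 = a f ^ 2 * ‖g f w‖ ^ 2 := fun w => by
        rw [_root_.smul_apply, norm_smul, norm_mul, hcn, mul_one, Complex.norm_real,
          Real.norm_of_nonneg (hapos f).le, mul_pow]
      simp only [e]
      rw [integral_const_mul, ha]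
      have := hint f
      rw [inv_pow, inv_mul_le_one₀ (by positivity)]
      nlinarith
  -- the factors `1` and `-i` give the real and imaginary parts of the transform of `g f`
  refine ⟨(fun f y => (𝓕 (((a f : ℂ) * 1) • g f) y).re) '' D₀ ∪
    (fun f y => (𝓕 (((a f : ℂ) * (-Complex.I)) • g f) y).re) '' D₀,
    (hc.image _).union (hc.image _), ?_, ?_⟩
  · rintro ψ (⟨f, hf, rfl⟩ | ⟨f, hf, rfl⟩)
    · exact ⟨R f, hR f hf, hmem f hf 1 norm_one⟩
    · exact ⟨R f, hR f hf, hmem f hf (-Complex.I) (by simp)⟩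
  intro N u hu hψ
  have key : ∀ f ∈ D₀, ∀ j, ∫ y, u y j * 𝓕 (g f) y = 0 := by
    intro f hf j
    have h1 := hψ _ (Or.inl ⟨f, hf, rfl⟩)
    have h2 := hψ _ (Or.inr ⟨f, hf, rfl⟩)
    have hL : ∀ c : ℂ, MemLp (fun y => (𝓕 (((a f : ℂ) * c) • g f) y).re) 2 := fun c =>
      ((𝓕 (((a f : ℂ) * c) • g f)).memLp 2).re
    have hi : ∀ c : ℂ, Integrable fun y => (𝓕 (((a f : ℂ) * c) • g f) y).re • u y := fun c =>
      memLp_one_iff_integrable.1 (hu.smul (r := 1) (hL c))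
    have h3 : (a f : ℂ) • ∫ y, 𝓕 (g f) y • u y = 0 := by
      have e : ∀ y, (𝓕 (((a f : ℂ) * 1) • g f) y).re • u y +
          Complex.I • (𝓕 (((a f : ℂ) * (-Complex.I)) • g f) y).re • u y =
          (a f : ℂ) • 𝓕 (g f) y • u y := fun y => by
        simp only [FourierTransform.fourier_smul, _root_.smul_apply, smul_eq_mul]
        rw [← Complex.coe_smul, ← Complex.coe_smul, smul_smul, smul_smul, ← add_smul]
        congr 1
        apply Complex.ext <;> simp
      rw [← integral_smul]
      simp only [← e]
      have hi2 : Integrable fun y =>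
        Complex.I • (𝓕 (((a f : ℂ) * (-Complex.I)) • g f) y).re • u y := (hi _).smul Complex.I
      rw [integral_add (hi 1) hi2, integral_smul, h1, h2, smul_zero, add_zero]
    have h4 := (smul_eq_zero.1 h3).resolve_left (by exact_mod_cast (hapos f).ne')
    have hiu : Integrable fun y => 𝓕 (g f) y • u y :=
      memLp_one_iff_integrable.1 (hu.smul (r := 1) ((𝓕 (g f)).memLp 2))
    have h5 := congrArg (EuclideanSpace.proj j : CVec N →L[ℂ] ℂ) h4
    rw [← ContinuousLinearMap.integral_comp_comm _ hiu, map_zero] at h5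
    rw [← h5]
    refine integral_congr_ae (Eventually.of_forall fun y => ?_)
    simp [mul_comm]
  have hj : ∀ j : Fin N, ∀ᵐ y, u y j = 0 := fun j =>
    ae_eq_zero_of_integral_mul_fourier hd
      (ContinuousLinearMap.comp_memLp' (EuclideanSpace.proj j : CVec N →L[ℂ] ℂ) hu)
      fun f hf => ⟨g f, hg f hf, key f hf j⟩
  filter_upwards [ae_all_iff.2 hj] with y hy
  exact PiLp.ext hy

end

noncomputable section

variable {k N : ℕ}

/-- An identity tested against functions of compact support extends to the square integrable
functions with square integrable derivatives. -/
theorem integral_eq_zero_of_hasCompactSupport {α E : Type*} [MeasurableSpace α] {μ : Measure α}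
    [IsFiniteMeasure μ] [NormedAddCommGroup E] [NormedSpace ℝ E]
    {X : α × Euc k → E} {Y : Fin k → α × Euc k → E} (hX : MemLp X 2 (μ.prod volume))
    (hY : ∀ i, MemLp (Y i) 2 (μ.prod volume))
    (h : ∀ ψ : Euc k → ℝ, ContDiff ℝ ∞ ψ → HasCompactSupport ψ →
      ∫ p, (ψ p.2 • X p + ∑ i, fderiv ℝ ψ p.2 (EuclideanSpace.single i 1) • Y i p)
        ∂(μ.prod volume) = 0)
    {ψ : Euc k → ℝ} (hψ : ContDiff ℝ ∞ ψ) (hψ2 : MemLp ψ 2)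
    (hψ' : ∀ i, MemLp (fun y => fderiv ℝ ψ y (EuclideanSpace.single i 1)) 2) :
    ∫ p, (ψ p.2 • X p + ∑ i, fderiv ℝ ψ p.2 (EuclideanSpace.single i 1) • Y i p)
      ∂(μ.prod volume) = 0 := by
  set b : ContDiffBump (0 : Euc k) := ⟨1, 2, one_pos, one_lt_two⟩ with hb
  have hbs : ContDiff ℝ ∞ b := b.contDiff
  have hbc : HasCompactSupport b := b.hasCompactSupport
  set c : ℕ → ℝ := fun n => ((n : ℝ) + 1)⁻¹ with hc
  have hc0 : ∀ n, 0 < c n := fun n => by positivity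
  have hc1 : ∀ n, c n ≤ 1 := fun n => inv_le_one_of_one_le₀ (by simp)
  have hct : Tendsto c atTop (𝓝 0) := tendsto_inv_atTop_zero.comp
    (tendsto_atTop_add_const_right _ 1 tendsto_natCast_atTop_atTop)
  have hex : ∀ i : Fin k, ∃ B : ℝ, ∀ y, ‖fderiv ℝ b y (EuclideanSpace.single i 1)‖ ≤ B := fun i =>
    ((hbs.continuous_fderiv (by norm_num)).clm_apply
      continuous_const).bounded_above_of_compact_support (hbc.fderiv_apply ℝ _)
  choose B hB using hex
  have hbn : ∀ n y, ‖b (c n • y)‖ ≤ 1 := fun n y => by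
    rw [Real.norm_of_nonneg b.nonneg]; exact b.le_one
  -- truncation of `ψ` at distance `1 / c n`
  set Ψ : ℕ → Euc k → ℝ := fun n y => b (c n • y) * ψ y with hΨ
  have hsc : ∀ n, ContDiff ℝ ∞ fun y : Euc k => b (c n • y) := fun n =>
    hbs.comp (contDiff_const_smul (c n))
  have hderiv : ∀ n y i, fderiv ℝ (Ψ n) y (EuclideanSpace.single i 1) =
      b (c n • y) * fderiv ℝ ψ y (EuclideanSpace.single i 1) +
        c n * fderiv ℝ b (c n • y) (EuclideanSpace.single i 1) * ψ y := by
    intro n y i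
    have h1 : HasFDerivAt (fun y : Euc k => b (c n • y))
        ((fderiv ℝ b (c n • y)).comp (c n • ContinuousLinearMap.id ℝ (Euc k))) y :=
      HasFDerivAt.comp (g := b) y
        ((hbs.differentiable (by norm_num)) _).hasFDerivAt ((hasFDerivAt_id y).const_smul (c n))
    have h2 := h1.mul ((hψ.differentiable (by norm_num)) y).hasFDerivAt
    have h3 : fderiv ℝ (Ψ n) y = _ := h2.fderiv
    rw [h3]
    simp only [_root_.add_apply, _root_.smul_apply, ContinuousLinearMap.comp_apply,
      ContinuousLinearMap.id_apply, map_smul, smul_eq_mul]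
    ring
  have hint : ∀ {v : Euc k → ℝ} {W : α × Euc k → E}, MemLp v 2 → MemLp W 2 (μ.prod volume) →
      Integrable (fun p => v p.2 • W p) (μ.prod volume) := fun hv hW =>
    memLp_one_iff_integrable.1 (hW.smul (r := 1) (hv.comp_snd μ))
  have hlim := tendsto_integral_of_dominated_convergence
    (F := fun n p => Ψ n p.2 • X p + ∑ i, fderiv ℝ (Ψ n) p.2 (EuclideanSpace.single i 1) • Y i p)
    (f := fun p => ψ p.2 • X p + ∑ i, fderiv ℝ ψ p.2 (EuclideanSpace.single i 1) • Y i p)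
    (μ := μ.prod volume)
    (fun p => ‖ψ p.2 • X p‖ + ∑ i, (‖fderiv ℝ ψ p.2 (EuclideanSpace.single i 1) • Y i p‖ +
      B i * ‖ψ p.2 • Y i p‖)) (fun n => ?_) ?_ (fun n => Eventually.of_forall fun p => ?_)
    (Eventually.of_forall fun p => ?_)
  · refine tendsto_nhds_unique hlim (tendsto_const_nhds.congr fun n => (h (Ψ n) ?_ ?_).symm)
    · exact (hsc n).mul hψ
    · exact (hbc.comp_smul (hc0 n).ne').mul_right
  · have hm : ∀ {v : Euc k → ℝ}, Continuous v →
        AEStronglyMeasurable (fun p : α × Euc k => v p.2) (μ.prod volume) := fun hv =>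
      (hv.measurable.comp measurable_snd).aestronglyMeasurable
    refine ((hm ((hsc n).mul hψ).continuous).smul hX.1).add
      (Finset.aestronglyMeasurable_fun_sum _ fun i _ => ?_)
    exact (hm (v := fun y => fderiv ℝ (Ψ n) y (EuclideanSpace.single i 1))
      ((((hsc n).mul hψ).continuous_fderiv (by norm_num)).clm_apply continuous_const)).smul (hY i).1
  · refine (hint hψ2 hX).norm.add (integrable_finsetSum _ fun i _ => ?_)
    exact (hint (hψ' i) (hY i)).norm.add ((hint hψ2 (hY i)).norm.const_mul _)
  · refine (norm_add_le _ _).trans (add_le_add ?_ ((norm_sum_le _ _).trans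
      (Finset.sum_le_sum fun i _ => ?_)))
    · rw [norm_smul, norm_smul, hΨ, norm_mul]
      exact mul_le_mul_of_nonneg_right (mul_le_of_le_one_left (norm_nonneg _) (hbn _ _))
        (norm_nonneg _)
    · rw [hderiv, add_smul, norm_smul (fderiv ℝ ψ p.2 _), norm_smul (ψ p.2)]
      refine (norm_add_le _ _).trans (add_le_add ?_ ?_)
      · rw [norm_smul, norm_mul]
        exact mul_le_mul_of_nonneg_right (mul_le_of_le_one_left (norm_nonneg _) (hbn _ _))
          (norm_nonneg _)
      · rw [norm_smul, norm_mul, norm_mul, ← mul_assoc, Real.norm_of_nonneg (hc0 n).le]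
        refine mul_le_mul_of_nonneg_right (mul_le_mul_of_nonneg_right ?_ (norm_nonneg _))
          (norm_nonneg _)
        exact (mul_le_of_le_one_left (norm_nonneg _) (hc1 n)).trans (hB i _)
  · have h1 : Tendsto (fun n => b (c n • p.2)) atTop (𝓝 1) := by
      have h2 : Tendsto (fun n => c n • p.2) atTop (𝓝 0) := by
        simpa using hct.smul_const p.2
      have h3 := (b.continuous.tendsto 0).comp h2
      rwa [b.one_of_mem_closedBall (by simp [hb])] at h3
    refine Tendsto.add ?_ (tendsto_finsetSum _ fun i _ => ?_)
    · simpa using (h1.mul_const (ψ p.2)).smul_const (X p)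
    · simp only [hderiv]
      have h4 : Tendsto (fun n => c n * fderiv ℝ b (c n • p.2) (EuclideanSpace.single i 1))
          atTop (𝓝 0) := by
        refine squeeze_zero_norm (a := fun n => c n * B i) (fun n => ?_) (by
          simpa using hct.mul_const (B i))
        rw [norm_mul, Real.norm_of_nonneg (hc0 n).le]
        exact mul_le_mul_of_nonneg_left (hB i _) (hc0 n).le
      simpa using ((h1.mul_const _).add (h4.mul_const (ψ p.2))).smul_const (Y i p)

end

noncomputable section

variable {k N : ℕ}

/-- The integral of `G(r, ·)` against `ψ`. -/
def pairing (G : (ℝ × ℝ) × Euc k → CVec N) (ψ : Euc k → ℝ) (r : ℝ × ℝ) : CVec N :=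
  ∫ y, ψ y • G (r, y)

section Pairing

variable {μ : Measure (ℝ × ℝ)} [IsFiniteMeasure μ] {G : (ℝ × ℝ) × Euc k → CVec N}
  {ψ : Euc k → ℝ}

/-! ### Systems of transport equations in domains of dependence -/

theorem integrable_smul_of_memLp {E : Type*} [NormedAddCommGroup E] [NormedSpace ℝ E]
    {W : (ℝ × ℝ) × Euc k → E} (hW : MemLp W 2 (μ.prod volume)) (hψ : MemLp ψ 2) :
    Integrable (fun p => ψ p.2 • W p) (μ.prod volume) :=
  memLp_one_iff_integrable.1 (hW.smul (r := 1) (hψ.comp_snd μ))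

theorem integrable_pairing (hG : MemLp G 2 (μ.prod volume)) (hψ : MemLp ψ 2) :
    Integrable (pairing G ψ) μ :=
  (integrable_smul_of_memLp hG hψ).integral_prod_left

theorem ae_pairing_comp (hG : MemLp G 2 (μ.prod volume)) (hψ : MemLp ψ 2)
    (Λ : CVec N →L[ℂ] CVec N) :
    ∀ᵐ r ∂μ, pairing (fun p => Λ (G p)) ψ r = Λ (pairing G ψ r) := by
  filter_upwards [(integrable_smul_of_memLp hG hψ).prod_right_ae] with r hr
  rw [pairing, pairing, ← Λ.integral_comp_comm hr]
  simp only [Λ.map_smul_of_tower]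

theorem pairing_const_mul (c : ℝ) (r : ℝ × ℝ) :
    pairing G (fun y => c * ψ y) r = c • pairing G ψ r := by
  simp only [pairing, mul_smul, integral_smul]

theorem lintegral_pairing_le (hψ : MemLp ψ 2) (h1 : ∫⁻ y, ‖ψ y‖ₑ ^ 2 ≤ 1)
    (hG : MemLp G 2 (μ.prod volume)) :
    ∫⁻ r, ‖pairing G ψ r‖ₑ ∂μ ≤ μ Set.univ + ∫⁻ p, ‖G p‖ₑ ^ 2 ∂(μ.prod volume) := by
  have hm : AEMeasurable (fun p : (ℝ × ℝ) × Euc k => ‖ψ p.2‖ₑ ^ 2) (μ.prod volume) :=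
    (hψ.comp_snd μ).1.enorm.pow_const 2
  calc ∫⁻ r, ‖pairing G ψ r‖ₑ ∂μ ≤ ∫⁻ r, ∫⁻ y, ‖ψ y • G (r, y)‖ₑ ∂volume ∂μ :=
        lintegral_mono fun r => enorm_integral_le_lintegral_enorm _
    _ = ∫⁻ p, ‖ψ p.2 • G p‖ₑ ∂(μ.prod volume) :=
        (lintegral_prod _ (integrable_smul_of_memLp hG hψ).1.enorm).symm
    _ ≤ ∫⁻ p, (‖ψ p.2‖ₑ ^ 2 + ‖G p‖ₑ ^ 2) ∂(μ.prod volume) := by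
        refine lintegral_mono fun p => ?_
        rw [enorm_smul]
        rcases le_total ‖ψ p.2‖ₑ ‖G p‖ₑ with h | h
        · exact (mul_le_mul' h le_rfl).trans (by rw [sq (‖G p‖ₑ)]; exact le_add_self)
        · exact (mul_le_mul' le_rfl h).trans (by rw [sq (‖ψ p.2‖ₑ)]; exact le_self_add)
    _ = ∫⁻ p, ‖ψ p.2‖ₑ ^ 2 ∂(μ.prod volume) + ∫⁻ p, ‖G p‖ₑ ^ 2 ∂(μ.prod volume) :=
        lintegral_add_left' hm _
    _ ≤ _ := by
        refine add_le_add ?_ le_rfl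
        rw [lintegral_prod _ hm]
        simp only [lintegral_const]
        exact mul_le_of_le_one_left' h1

end Pairing

/-- The domain of dependence, in the variables `(t, x_d)`, of an interval that moves away from the
boundary. -/
def trapezoid (δ T V a b : ℝ) : Set (ℝ × ℝ) :=
  {r | -δ < r.1 ∧ r.1 < T ∧ a + V * r.1 < r.2 ∧ r.2 < b - V * r.1}

theorem isOpen_trapezoid (δ T V a b : ℝ) : IsOpen (trapezoid δ T V a b) := by
  simp only [trapezoid, Set.ofPred_and]
  exact (isOpen_lt (by fun_prop) (by fun_prop)).inter ((isOpen_lt (by fun_prop) (by fun_prop)).inter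
    ((isOpen_lt (by fun_prop) (by fun_prop)).inter (isOpen_lt (by fun_prop) (by fun_prop))))

theorem trapezoid_subset {δ T V : ℝ} (hV : 0 ≤ V) (a b : ℝ) :
    trapezoid δ T V a b ⊆ Set.Icc (-δ, a - V * δ) (T, b + V * δ) := by
  rintro ⟨t, x⟩ ⟨h1, h2, h3, h4⟩
  simp only at h1 h2 h3 h4
  refine ⟨⟨h1.le, ?_⟩, ⟨h2.le, ?_⟩⟩ <;> simp only <;> nlinarith

theorem volume_trapezoid_lt_top {δ T V : ℝ} (hV : 0 ≤ V) (a b : ℝ) :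
    volume (trapezoid δ T V a b) < ⊤ :=
  (measure_mono (trapezoid_subset hV a b)).trans_lt isCompact_Icc.measure_lt_top

/-- The transport estimate for a component of the pairing with `ψ`. -/
theorem transport_pairing {δ T V a b : ℝ} (hδ : 0 < δ) (hT : 0 < T) (hV : 0 ≤ V)
    {G : (ℝ × ℝ) × Euc k → CVec N}
    (hG : MemLp G 2 ((volume.restrict (trapezoid δ T V a b)).prod volume))
    (hpast : ∀ᵐ p ∂((volume.restrict (trapezoid δ T V a b)).prod volume), p.1.1 < 0 → G p = 0)
    {Q P : CVec N →L[ℂ] CVec N} {Q' : Fin k → CVec N →L[ℂ] CVec N} {l : ℝ} (hl : |l| ≤ V)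
    (hPQ : ∀ v, P (Q v) = (l : ℂ) • P v)
    (heq : ∀ χ : ℝ × ℝ → ℝ, ContDiff ℝ ∞ χ → HasCompactSupport χ →
      tsupport χ ⊆ trapezoid δ T V a b → ∀ ψ : Euc k → ℝ, ContDiff ℝ ∞ ψ → HasCompactSupport ψ →
      ∫ p, (ψ p.2 • (fderiv ℝ χ p.1 (1, 0) • G p + fderiv ℝ χ p.1 (0, 1) • Q (G p)) +
        ∑ i, fderiv ℝ ψ p.2 (EuclideanSpace.single i 1) • χ p.1 • Q' i (G p))
        ∂((volume.restrict (trapezoid δ T V a b)).prod volume) = 0)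
    {ψ : Euc k → ℝ} (hψ : ContDiff ℝ ∞ ψ) (hψ2 : MemLp ψ 2)
    (hψ' : ∀ i, MemLp (fun y => fderiv ℝ ψ y (EuclideanSpace.single i 1)) 2) {γ : ℝ}
    (hγ : 0 < γ) :
    ENNReal.ofReal γ * ∫⁻ r in trapezoid δ T V a b, ENNReal.ofReal (Real.exp (-γ * r.1)) *
        ‖P (pairing G ψ r)‖ₑ ≤
      ∫⁻ r in trapezoid δ T V a b, ENNReal.ofReal (Real.exp (-γ * r.1)) *
        ‖∑ i, P (Q' i (pairing G (fun y => fderiv ℝ ψ y (EuclideanSpace.single i 1)) r))‖ₑ := by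
  set C := trapezoid δ T V a b with hC
  set μ : Measure (ℝ × ℝ) := volume.restrict C with hμ
  have hfin : IsFiniteMeasure μ :=
    ⟨by rw [hμ, Measure.restrict_apply_univ]; exact volume_trapezoid_lt_top hV a b⟩
  have hCm : MeasurableSet C := (isOpen_trapezoid δ T V a b).measurableSet
  set D : Fin k → Euc k → ℝ := fun i y => fderiv ℝ ψ y (EuclideanSpace.single i 1) with hD
  have hPG : ∀ Λ : CVec N →L[ℂ] CVec N, MemLp (fun p => Λ (G p)) 2 (μ.prod volume) := fun Λ =>
    Λ.comp_memLp' hG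
  have hf : Integrable (fun r => P (pairing G ψ r)) μ := P.integrable_comp (integrable_pairing hG hψ2)
  have hh : Integrable (fun r => ∑ i, P (Q' i (pairing G (D i) r))) μ :=
    integrable_finsetSum _ fun i _ => (P.comp (Q' i)).integrable_comp (integrable_pairing hG (hψ' i))
  refine transport_estimate (μ := volume) (l := ContinuousLinearMap.fst ℝ ℝ ℝ) (e := (1, l)) rfl
    (isOpen_trapezoid δ T V a b) hδ hT.le (fun z hz => ⟨hz.1, hz.2.1⟩) ?_ hf hh ?_ ?_ hγ
  · rintro ⟨t, x⟩ ⟨h1, h2, h3, h4⟩ r hr h5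
    simp only [Prod.smul_mk, Prod.mk_sub_mk, smul_eq_mul, ContinuousLinearMap.coe_fst', mul_one]
      at h1 h2 h3 h4 h5 ⊢
    obtain ⟨hl1, hl2⟩ := abs_le.1 hl
    refine ⟨h5, ?_, ?_, ?_⟩ <;> simp only <;> nlinarith
  · rw [← ae_restrict_iff' hCm]
    filter_upwards [Measure.ae_ae_of_ae_prod hpast] with r hr h0
    rw [pairing, integral_eq_zero_of_ae, map_zero]
    filter_upwards [hr] with y hy
    rw [hy h0, smul_zero]; rfl
  intro χ hχ hχc hsupp
  have hχb : ∃ B, ∀ r, ‖χ r‖ ≤ B := hχ.continuous.bounded_above_of_compact_support hχc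
  have hχd : ∀ v, Continuous fun r => fderiv ℝ χ r v := fun v =>
    (hχ.continuous_fderiv (by norm_num)).clm_apply continuous_const
  have hχdb : ∀ v, ∃ B, ∀ r, ‖fderiv ℝ χ r v‖ ≤ B := fun v =>
    (hχd v).bounded_above_of_compact_support (hχc.fderiv_apply ℝ v)
  have hmem : ∀ {c : ℝ × ℝ → ℝ}, Continuous c → (∃ B, ∀ r, ‖c r‖ ≤ B) →
      ∀ Λ : CVec N →L[ℂ] CVec N, MemLp (fun p => c p.1 • Λ (G p)) 2 (μ.prod volume) := by
    rintro c hc ⟨B, hB⟩ Λ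
    refine (hPG Λ).of_le_mul (c := B)
      ((hc.measurable.comp measurable_fst).aestronglyMeasurable.smul (hPG Λ).1)
      (Eventually.of_forall fun p => ?_)
    rw [norm_smul]
    exact mul_le_mul_of_nonneg_right (hB _) (norm_nonneg _)
  have he : ∀ r, fderiv ℝ χ r (1, l) = fderiv ℝ χ r (1, 0) + l * fderiv ℝ χ r (0, 1) := fun r => by
    have : ((1, l) : ℝ × ℝ) = (1, 0) + l • (0, 1) := by simp
    rw [this, map_add, map_smul, smul_eq_mul]
  -- the equation projected on the component, tested against `ψ`
  have h1 := integral_eq_zero_of_hasCompactSupport (μ := μ)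
    (X := fun p => fderiv ℝ χ p.1 (1, l) • P (G p)) (Y := fun i p => χ p.1 • P.comp (Q' i) (G p))
    (hmem (hχd _) (hχdb _) P) (fun i => hmem hχ.continuous hχb (P.comp (Q' i)))
    (fun η hη hηc => by
      have hη2 : MemLp η 2 := hη.continuous.memLp_of_hasCompactSupport hηc
      have hη' : ∀ i, MemLp (fun y => fderiv ℝ η y (EuclideanSpace.single i 1)) 2 := fun i =>
        ((hη.continuous_fderiv (by norm_num)).clm_apply
          continuous_const).memLp_of_hasCompactSupport (hηc.fderiv_apply ℝ _)
      have h := congrArg P (heq χ hχ hχc hsupp η hη hηc)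
      have i0 := hmem (hχd (1, 0)) (hχdb _) (ContinuousLinearMap.id ℂ (CVec N))
      have i1 := hmem (hχd (0, 1)) (hχdb _) Q
      have i2 : Integrable (fun p => η p.2 • (fderiv ℝ χ p.1 (1, 0) • G p +
          fderiv ℝ χ p.1 (0, 1) • Q (G p))) (μ.prod volume) :=
        integrable_smul_of_memLp (i0.add i1) hη2
      have i3 := integrable_finsetSum Finset.univ fun i _ =>
        integrable_smul_of_memLp (hmem hχ.continuous hχb (Q' i)) (hη' i)
      have i4 : Integrable (fun p => η p.2 • (fderiv ℝ χ p.1 (1, 0) • G p +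
          fderiv ℝ χ p.1 (0, 1) • Q (G p)) + ∑ i, fderiv ℝ η p.2 (EuclideanSpace.single i 1) •
          χ p.1 • Q' i (G p)) (μ.prod volume) := i2.add i3
      rw [← P.integral_comp_comm i4, map_zero] at h
      rw [← h]
      refine integral_congr_ae (Eventually.of_forall fun p => ?_)
      simp only [map_add, map_sum, P.map_smul_of_tower, hPQ, he, ContinuousLinearMap.comp_apply]
      congr 2
      rw [add_smul, mul_smul, smul_comm l, Complex.coe_smul]) hψ hψ2 hψ'
  have hi1 := integrable_smul_of_memLp (hmem (hχd (1, l)) (hχdb _) P) hψ2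
  have hi2 : ∀ i, Integrable (fun p => D i p.2 • χ p.1 • P.comp (Q' i) (G p)) (μ.prod volume) :=
    fun i => integrable_smul_of_memLp (hmem hχ.continuous hχb (P.comp (Q' i))) (hψ' i)
  have hi3 : Integrable (fun p => ∑ i, D i p.2 • χ p.1 • P.comp (Q' i) (G p)) (μ.prod volume) :=
    integrable_finsetSum _ fun i _ => hi2 i
  rw [integral_add hi1 hi3, integral_finsetSum _ fun i _ => hi2 i, integral_prod _ hi1] at h1
  have e1 : ∫ r, ∫ y, ψ y • fderiv ℝ χ r (1, l) • P (G (r, y)) ∂volume ∂μ =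
      ∫ r, fderiv ℝ χ r (1, l) • P (pairing G ψ r) := by
    refine Eq.trans ?_ (setIntegral_eq_integral_of_forall_compl_eq_zero (s := C) ?_)
    · refine integral_congr_ae ?_
      filter_upwards [ae_pairing_comp hG hψ2 P] with r hr
      rw [← hr, pairing, ← integral_smul]
      simp only [smul_comm (ψ _)]
    · intro r hr
      have : fderiv ℝ χ r = 0 := by
        by_contra h
        exact hr (hsupp (support_fderiv_subset ℝ h))
      simp [this]
  have e2 : ∑ i, ∫ p, D i p.2 • χ p.1 • P.comp (Q' i) (G p) ∂(μ.prod volume) =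
      ∫ r, χ r • ∑ i, P (Q' i (pairing G (D i) r)) := by
    refine Eq.trans ?_ (setIntegral_eq_integral_of_forall_compl_eq_zero (s := C) ?_)
    · have : ∀ i, ∫ p, D i p.2 • χ p.1 • P.comp (Q' i) (G p) ∂(μ.prod volume) =
          ∫ r, χ r • P (Q' i (pairing G (D i) r)) ∂μ := by
        intro i
        rw [integral_prod _ (hi2 i)]
        refine integral_congr_ae ?_
        filter_upwards [ae_pairing_comp hG (hψ' i) (P.comp (Q' i))] with r hr
        rw [ContinuousLinearMap.comp_apply] at hr
        rw [← hr, pairing, ← integral_smul]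
        simp only [smul_comm (D i _)]
        rfl
      simp only [this]
      rw [← integral_finsetSum]
      · simp only [Finset.smul_sum]
        rfl
      · intro i _
        obtain ⟨B, hB⟩ := hχb
        exact ((P.comp (Q' i)).integrable_comp (integrable_pairing hG (hψ' i))).bdd_smul B
          hχ.continuous.aestronglyMeasurable (Eventually.of_forall hB)
    · intro r hr
      rw [image_eq_zero_of_notMem_tsupport (fun h => hr (hsupp h)), zero_smul]
  rw [← e1, ← e2]
  exact eq_neg_of_add_eq_zero_left h1

end

noncomputable section

variable {k N : ℕ}

theorem memLp_of_mem_bandLimited {R : ℝ} {ψ : Euc k → ℝ} (hψ : ψ ∈ bandLimited k R) :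
    MemLp ψ 2 := by
  refine ⟨(contDiff_of_mem_bandLimited hψ).continuous.aestronglyMeasurable, ?_⟩
  rw [eLpNorm_lt_top_iff_lintegral_rpow_enorm_lt_top (by norm_num) (by norm_num)]
  have h := lintegral_sq_of_mem_bandLimited hψ
  simp only [ENNReal.toReal_ofNat, ENNReal.rpow_ofNat]
  exact h.trans_lt ENNReal.one_lt_top

section System

variable {δ T V a b : ℝ} {G : (ℝ × ℝ) × Euc k → CVec N}

/-- The pairings with band limited functions vanish: these functions are stable by derivation, so
that the tangential derivatives act on them as a bounded operator, which a large weight absorbs. -/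
theorem ae_pairing_eq_zero (hδ : 0 < δ) (hT : 0 < T) (hV : 0 ≤ V)
    (hG : MemLp G 2 ((volume.restrict (trapezoid δ T V a b)).prod volume))
    (hpast : ∀ᵐ p ∂((volume.restrict (trapezoid δ T V a b)).prod volume), p.1.1 < 0 → G p = 0)
    {Q : CVec N →L[ℂ] CVec N} {P : Fin N → CVec N →L[ℂ] CVec N}
    {Q' : Fin k → CVec N →L[ℂ] CVec N} {l : Fin N → ℝ} (hl : ∀ j, |l j| ≤ V)
    (hP : ∀ v, ∑ j, P j v = v) (hPQ : ∀ j v, P j (Q v) = (l j : ℂ) • P j v)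
    (heq : ∀ χ : ℝ × ℝ → ℝ, ContDiff ℝ ∞ χ → HasCompactSupport χ →
      tsupport χ ⊆ trapezoid δ T V a b → ∀ ψ : Euc k → ℝ, ContDiff ℝ ∞ ψ → HasCompactSupport ψ →
      ∫ p, (ψ p.2 • (fderiv ℝ χ p.1 (1, 0) • G p + fderiv ℝ χ p.1 (0, 1) • Q (G p)) +
        ∑ i, fderiv ℝ ψ p.2 (EuclideanSpace.single i 1) • χ p.1 • Q' i (G p))
        ∂((volume.restrict (trapezoid δ T V a b)).prod volume) = 0)
    {R : ℝ} (hR : 0 < R) {ψ : Euc k → ℝ} (hψ : ψ ∈ bandLimited k R) :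
    ∀ᵐ r ∂(volume.restrict (trapezoid δ T V a b)), pairing G ψ r = 0 := by
  set C := trapezoid δ T V a b with hC
  set μ : Measure (ℝ × ℝ) := volume.restrict C with hμ
  have hfin : IsFiniteMeasure μ :=
    ⟨by rw [hμ, Measure.restrict_apply_univ]; exact volume_trapezoid_lt_top hV a b⟩
  have hpi := Real.pi_pos
  set c : ℝ := 2 * Real.pi * R with hc
  have hc0 : 0 < c := by positivity
  set A : ℝ≥0∞ := ∑ j, ∑ i, ‖(P j).comp (Q' i)‖ₑ * ENNReal.ofReal c with hA
  have hAt : A ≠ ⊤ := ENNReal.sum_ne_top.2 fun j _ => ENNReal.sum_ne_top.2 fun i _ =>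
    ENNReal.mul_ne_top enorm_ne_top ENNReal.ofReal_ne_top
  set γ : ℝ := A.toReal + 1 with hγ
  have hγ0 : 0 < γ := by positivity
  set w : ℝ × ℝ → ℝ≥0∞ := fun r => ENNReal.ofReal (Real.exp (-γ * r.1)) with hw
  have hwm : Measurable w := by
    have : Continuous fun r : ℝ × ℝ => Real.exp (-γ * r.1) := by fun_prop
    exact this.measurable.ennreal_ofReal
  set Y : (Euc k → ℝ) → ℝ≥0∞ := fun η => ∫⁻ r, w r * ‖pairing G η r‖ₑ ∂μ with hY
  have hpm : ∀ η ∈ bandLimited k R, AEMeasurable (fun r => ‖pairing G η r‖ₑ) μ := fun η hη =>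
    (integrable_pairing hG (memLp_of_mem_bandLimited hη)).1.enorm
  -- the normalized derivatives
  set D : (Euc k → ℝ) → Fin k → Euc k → ℝ := fun η i y =>
    c⁻¹ * fderiv ℝ η y (EuclideanSpace.single i 1) with hD
  have hDm : ∀ η ∈ bandLimited k R, ∀ i, D η i ∈ bandLimited k R := fun η hη i =>
    fderiv_mem_bandLimited hR hη i
  have hDc : ∀ η i, (fun y => fderiv ℝ η y (EuclideanSpace.single i 1)) = fun y => c * D η i y :=
    fun η i => by
      funext y
      simp only [hD]
      rw [mul_inv_cancel_left₀ hc0.ne']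
  -- the equation bounds `Y η` by the `Y (D η i)`: the supremum over the class closes the estimate
  set M : ℝ≥0∞ := ⨆ η : bandLimited k R, Y η with hM
  have hYM : ∀ η ∈ bandLimited k R, Y η ≤ M := fun η hη =>
    le_iSup (fun η : bandLimited k R => Y η) ⟨η, hη⟩
  have hMt : M ≠ ⊤ := by
    refine ne_top_of_le_ne_top (b := ENNReal.ofReal (Real.exp (γ * δ)) *
      (μ Set.univ + ∫⁻ p, ‖G p‖ₑ ^ 2 ∂(μ.prod volume))) ?_ (iSup_le fun η => ?_)
    · refine ENNReal.mul_ne_top ENNReal.ofReal_ne_top (ENNReal.add_ne_top.2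
        ⟨measure_ne_top _ _, ?_⟩)
      have h := (eLpNorm_lt_top_iff_lintegral_rpow_enorm_lt_top (by norm_num) (by norm_num)).1 hG.2
      simp only [ENNReal.toReal_ofNat, ENNReal.rpow_ofNat] at h
      exact h.ne
    · refine le_trans ?_ (mul_le_mul_right (lintegral_pairing_le (memLp_of_mem_bandLimited η.2)
        (lintegral_sq_of_mem_bandLimited η.2) hG) _)
      rw [← lintegral_const_mul'' _ (hpm η η.2)]
      refine lintegral_mono_ae ?_
      filter_upwards [ae_restrict_mem (isOpen_trapezoid δ T V a b).measurableSet] with r hr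
      refine mul_le_mul_left (ENNReal.ofReal_le_ofReal (Real.exp_le_exp.2 ?_)) _
      nlinarith [hr.1]
  have hmain : ∀ η ∈ bandLimited k R, ENNReal.ofReal γ * Y η ≤ A * M := by
    intro η hη
    have hη2 := memLp_of_mem_bandLimited hη
    have hη' : ∀ i, MemLp (fun y => fderiv ℝ η y (EuclideanSpace.single i 1)) 2 := fun i => by
      rw [hDc]
      exact (memLp_of_mem_bandLimited (hDm η hη i)).const_mul c
    have hpj : ∀ j, AEMeasurable (fun r => w r * ‖P j (pairing G η r)‖ₑ) μ := fun j =>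
      hwm.aemeasurable.mul ((P j).integrable_comp (integrable_pairing hG hη2)).1.enorm
    have hpi : ∀ i, AEMeasurable (fun r => w r * ‖pairing G (D η i) r‖ₑ) μ := fun i =>
      hwm.aemeasurable.mul (hpm _ (hDm η hη i))
    calc ENNReal.ofReal γ * Y η
        ≤ ENNReal.ofReal γ * ∑ j, ∫⁻ r, w r * ‖P j (pairing G η r)‖ₑ ∂μ := by
          rw [← lintegral_finsetSum' _ fun j _ => hpj j]
          refine mul_le_mul_right (lintegral_mono fun r => ?_) _
          rw [← Finset.mul_sum]
          refine mul_le_mul_right ?_ _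
          nth_rewrite 1 [← hP (pairing G η r)]
          exact enorm_sum_le _ _
      _ = ∑ j, ENNReal.ofReal γ * ∫⁻ r, w r * ‖P j (pairing G η r)‖ₑ ∂μ := Finset.mul_sum _ _ _
      _ ≤ ∑ j, ∑ i, ‖(P j).comp (Q' i)‖ₑ * ENNReal.ofReal c * M := by
          refine Finset.sum_le_sum fun j _ => ?_
          refine (transport_pairing hδ hT hV hG hpast (hl j) (hPQ j) heq
            (contDiff_of_mem_bandLimited hη) hη2 hη' hγ0).trans ?_
          calc ∫⁻ r, w r * ‖∑ i, P j (Q' i (pairing G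
                (fun y => fderiv ℝ η y (EuclideanSpace.single i 1)) r))‖ₑ ∂μ
              ≤ ∫⁻ r, ∑ i, ‖(P j).comp (Q' i)‖ₑ * ENNReal.ofReal c *
                (w r * ‖pairing G (D η i) r‖ₑ) ∂μ := by
                refine lintegral_mono fun r => ?_
                rw [← Finset.sum_congr rfl fun i _ => mul_left_comm (w r) _ _, ← Finset.mul_sum]
                refine mul_le_mul_right ((enorm_sum_le _ _).trans (Finset.sum_le_sum
                  fun i _ => ?_)) _
                rw [hDc, pairing_const_mul, mul_assoc, ← Real.enorm_of_nonneg hc0.le, ← enorm_smul]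
                exact ((P j).comp (Q' i)).le_opENorm _
            _ = ∑ i, ‖(P j).comp (Q' i)‖ₑ * ENNReal.ofReal c * Y (D η i) := by
                rw [lintegral_finsetSum' _ fun i _ => (hpi i).const_mul _]
                exact Finset.sum_congr rfl fun i _ => lintegral_const_mul'' _ (hpi i)
            _ ≤ _ := Finset.sum_le_sum fun i _ => mul_le_mul_right (hYM _ (hDm η hη i)) _
      _ = A * M := by simp only [hA, Finset.sum_mul]
  have hM0 : M = 0 := by
    by_contra h0
    have h1 : ENNReal.ofReal γ * M ≤ A * M := by
      rw [hM, ENNReal.mul_iSup]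
      exact iSup_le fun η => hmain η η.2
    have h2 := (ENNReal.mul_le_mul_iff_left h0 hMt).1 h1
    rw [← ENNReal.ofReal_toReal hAt, ENNReal.ofReal_le_ofReal_iff ENNReal.toReal_nonneg] at h2
    linarith
  have h3 : Y ψ = 0 := le_antisymm (hM0 ▸ hYM ψ hψ) bot_le
  have h5 := (lintegral_eq_zero_iff' (hwm.aemeasurable.mul (hpm ψ hψ))).1 h3
  filter_upwards [h5] with r hr
  have h4 : w r ≠ 0 := (ENNReal.ofReal_pos.2 (Real.exp_pos _)).ne'
  exact enorm_eq_zero.1 ((mul_eq_zero.1 hr).resolve_left h4)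

/-- Uniqueness for a system of first order with constant coefficients, hyperbolic in the direction
normal to the boundary, in a domain of dependence that is invariant by tangential translations. -/
theorem ae_eq_zero_of_system (hδ : 0 < δ) (hT : 0 < T) (hV : 0 ≤ V) (hGm : StronglyMeasurable G)
    (hG : MemLp G 2 ((volume.restrict (trapezoid δ T V a b)).prod volume))
    (hpast : ∀ᵐ p ∂((volume.restrict (trapezoid δ T V a b)).prod volume), p.1.1 < 0 → G p = 0)
    {Q : CVec N →L[ℂ] CVec N} {P : Fin N → CVec N →L[ℂ] CVec N}
    {Q' : Fin k → CVec N →L[ℂ] CVec N} {l : Fin N → ℝ} (hl : ∀ j, |l j| ≤ V)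
    (hP : ∀ v, ∑ j, P j v = v) (hPQ : ∀ j v, P j (Q v) = (l j : ℂ) • P j v)
    (heq : ∀ χ : ℝ × ℝ → ℝ, ContDiff ℝ ∞ χ → HasCompactSupport χ →
      tsupport χ ⊆ trapezoid δ T V a b → ∀ ψ : Euc k → ℝ, ContDiff ℝ ∞ ψ → HasCompactSupport ψ →
      ∫ p, (ψ p.2 • (fderiv ℝ χ p.1 (1, 0) • G p + fderiv ℝ χ p.1 (0, 1) • Q (G p)) +
        ∑ i, fderiv ℝ ψ p.2 (EuclideanSpace.single i 1) • χ p.1 • Q' i (G p))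
        ∂((volume.restrict (trapezoid δ T V a b)).prod volume) = 0) :
    ∀ᵐ p ∂((volume.restrict (trapezoid δ T V a b)).prod volume), G p = 0 := by
  obtain ⟨D, hDc, hD, hsep⟩ := exists_countable_bandLimited k
  have h1 : ∀ᵐ r ∂(volume.restrict (trapezoid δ T V a b)), ∀ ψ ∈ D, pairing G ψ r = 0 := by
    rw [ae_ball_iff hDc]
    intro ψ hψ
    obtain ⟨R, hR, h⟩ := hD ψ hψ
    exact ae_pairing_eq_zero hδ hT hV hG hpast hl hP hPQ heq hR h
  have h2 : ∀ᵐ r ∂(volume.restrict (trapezoid δ T V a b)), MemLp (fun y => G (r, y)) 2 := by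
    have h := (eLpNorm_lt_top_iff_lintegral_rpow_enorm_lt_top (by norm_num) (by norm_num)).1 hG.2
    simp only [ENNReal.toReal_ofNat, ENNReal.rpow_ofNat] at h
    have hm : Measurable fun p => ‖G p‖ₑ ^ 2 := hGm.enorm.pow_const 2
    rw [lintegral_prod _ hm.aemeasurable] at h
    filter_upwards [ae_lt_top hm.lintegral_prod_right' h.ne] with r hr
    refine ⟨(hGm.comp_measurable measurable_prodMk_left).aestronglyMeasurable, ?_⟩
    rw [eLpNorm_lt_top_iff_lintegral_rpow_enorm_lt_top (by norm_num) (by norm_num)]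
    simpa only [ENNReal.toReal_ofNat, ENNReal.rpow_ofNat] using hr
  refine (Measure.ae_prod_iff_ae_ae (hGm.measurable (measurableSet_singleton 0))).2 ?_
  filter_upwards [h1, h2] with r h1 h2
  exact hsep N _ h2 h1

end System

end

noncomputable section

variable {k m N M n : ℕ} {T : ℝ} {s : ℕ} {L : ℝ} {φ : Euc (k + 1) → ℝ}
variable {S : BVP k N M} {ζ : Fin m → Euc (k + 1)} {U Uosc Uev : Profile k m N T} {K : ℝ}
variable {G : L2 (Set.univ : Set (Euc (k + 1))) m M}

/-! ### A measurable representative of the mean mode -/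

theorem sq_lintegral_le {α : Type*} [MeasurableSpace α] {μ : Measure α} {f : α → ℝ≥0∞}
    (hf : AEMeasurable f μ) : (∫⁻ a, f a ∂μ) ^ 2 ≤ μ Set.univ * ∫⁻ a, f a ^ 2 ∂μ := by
  have h := ENNReal.lintegral_mul_le_Lp_mul_Lq μ Real.HolderConjugate.two_two hf
    (aemeasurable_const (b := (1 : ℝ≥0∞)))
  simp only [Pi.mul_apply, mul_one, lintegral_const, ENNReal.rpow_ofNat] at h
  have h2 := pow_le_pow_left' h 2
  rw [mul_pow, ← ENNReal.rpow_natCast, ← ENNReal.rpow_natCast, ← ENNReal.rpow_natCast,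
    ← ENNReal.rpow_mul, ← ENNReal.rpow_mul] at h2
  norm_num at h2
  rwa [mul_comm] at h2

theorem lintegral_enorm_sq_eq {D : Set (Euc (k + 1))} (u : L2 D m n) :
    ∫⁻ p, ‖u p‖ₑ ^ 2 ∂(torusMeasure D m) = ‖u‖ₑ ^ 2 := by
  rw [Lp.enorm_def, eLpNorm_eq_lintegral_rpow_enorm_toReal (by norm_num) (by norm_num),
    ← ENNReal.rpow_natCast, ← ENNReal.rpow_mul]
  norm_num

/-- Taking a Fourier coefficient is continuous on `L²`. -/
theorem exists_lintegral_thetaCoef_le (D : Set (Euc (k + 1))) (m n : ℕ) :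
    ∃ C : ℝ≥0, ∀ (u : L2 D m n) ν,
      ∫⁻ z in D, ‖thetaCoef u ν z‖ₑ ^ 2 ≤ C * ‖u‖ₑ ^ 2 := by
  set c : ℝ := ((2 * Real.pi) ^ m)⁻¹ with hc
  have hb : (volume.restrict (box m)) Set.univ ≠ ⊤ := measure_ne_top _ _
  refine ⟨‖c‖₊ ^ 2 * ((volume.restrict (box m)) Set.univ).toNNReal, fun u ν => ?_⟩
  have hm : AEMeasurable (fun p => ‖u p‖ₑ ^ 2) ((volume.restrict D).prod (volume.restrict (box m))) := by
    rw [← torusMeasure_eq_prod]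
    exact (Lp.aestronglyMeasurable u).enorm.pow_const 2
  have hm1 : AEStronglyMeasurable u ((volume.restrict D).prod (volume.restrict (box m))) := by
    rw [← torusMeasure_eq_prod]
    exact Lp.aestronglyMeasurable u
  have hprod : ∀ F : Euc (k + 1) × Euc m → ℝ≥0∞,
      AEMeasurable F ((volume.restrict D).prod (volume.restrict (box m))) →
      ∫⁻ p, F p ∂(torusMeasure D m) = ∫⁻ z in D, ∫⁻ θ in box m, F (z, θ) := fun F hF => by
    rw [torusMeasure_eq_prod, lintegral_prod _ hF]
  calc ∫⁻ z in D, ‖thetaCoef u ν z‖ₑ ^ 2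
      ≤ ∫⁻ z in D, ‖c‖ₑ ^ 2 * ((volume.restrict (box m)) Set.univ *
          ∫⁻ θ in box m, ‖u (z, θ)‖ₑ ^ 2) := by
        refine lintegral_mono_ae ?_
        filter_upwards [hm1.prodMk_left] with z hz
        rw [thetaCoef_eq, enorm_smul, mul_pow]
        refine mul_le_mul_right ((pow_le_pow_left' (enorm_integral_le_lintegral_enorm _) 2).trans ?_) _
        simp only [enorm_smul]
        have : ∀ θ, ‖tmode (-ν) θ‖ₑ = 1 := fun θ => by
          rw [← ofReal_norm, norm_tmode, ENNReal.ofReal_one]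
        simp only [this, one_mul]
        exact sq_lintegral_le hz.enorm
    _ = ‖c‖ₑ ^ 2 * ((volume.restrict (box m)) Set.univ * ‖u‖ₑ ^ 2) := by
        rw [lintegral_const_mul' _ _ (by simp), lintegral_const_mul' _ _ hb,
          ← lintegral_enorm_sq_eq, hprod _ hm]
    _ = _ := by
        push_cast
        rw [ENNReal.coe_toNNReal hb, ← mul_assoc]
        rfl

/-- A property that holds almost everywhere in each slice holds almost everywhere. -/
theorem ae_of_forall_ae_slice {P : Set (Euc (k + 1) × ℝ)} (hP : MeasurableSet P)
    (h : ∀ x : ℝ, 0 ≤ x → ∀ᵐ z ∂(volume.restrict (omegaT k T)), (z, x) ∈ P) :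
    ∀ᵐ q : Euc (k + 1) × ℝ, q.1 ∈ omegaT k T → 0 ≤ q.2 → q ∈ P := by
  have hm : MeasurableSet {q : Euc (k + 1) × ℝ | q.1 ∈ omegaT k T → 0 ≤ q.2 → q ∈ P} :=
    (measurable_fst (measurableSet_omegaT T)).imp
      ((measurableSet_le measurable_const measurable_snd).imp hP)
  rw [Measure.volume_eq_prod]
  refine (Measure.ae_prod_iff_ae_ae hm).2 ((Measure.ae_ae_comm hm).2 ?_)
  refine Eventually.of_forall fun x => ?_
  by_cases hx : 0 ≤ x
  · filter_upwards [(ae_restrict_iff' (measurableSet_omegaT T)).1 (h x hx)] with z hz hzT _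
    exact hz hzT
  · exact Eventually.of_forall fun z _ h => absurd h hx

/-- The mean mode of an oscillating profile has a jointly measurable representative. -/
theorem MemOsc.exists_mean (ζ : Fin m → Euc (k + 1)) (hU : MemOsc s U) (hchar : S.Noncharacteristic)
    (hN : 1 ≤ N) (hpol : IsProjE S ζ U Uev U Uev) (hs : k + 1 + m + 2 < 2 * s) :
    ∃ g : Euc (k + 1) × ℝ → CVec N, StronglyMeasurable g ∧ ∀ x : ℝ, 0 ≤ x →
      ∀ᵐ z ∂(volume.restrict (omegaT k T)), g (z, x) = thetaCoef (freqPart (U x) 0) 0 z := by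
  have hex : ∀ j : ℕ, ∃ L : ℝ, 1 ≤ L ∧ ∃ φ, IsCutoff (omegaT k T) L φ ∧
      ∀ z ∈ exhaust k T j, φ z = 1 := fun j => exists_isCutoff (isCompact_exhaust j)
    ((exhaust_subset j).trans (lt_time_subset_interior T))
  choose L hL φ hφ h1 using hex
  have hL0 : ∀ j, 0 < L j := fun j => one_pos.trans_le (hL j)
  choose K hK using fun j => hU.exists_modeBound ζ S (hφ j) (hL j) hs
  set f : ℕ → Euc (k + 1) × ℝ → CVec N := fun j => modeAmp (L j) (φ j) U 0 0 with hf
  have hval : ∀ j, ∀ x : ℝ, 0 ≤ x → ∀ᵐ z ∂(volume.restrict (omegaT k T)), z ∈ exhaust k T j →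
      f j (z, x) = thetaCoef (freqPart (U x) 0) 0 z := by
    intro j x hx
    filter_upwards [(hK j).ae_thetaCoef_eq (hL0 j) (hφ j) hchar hU hpol hx 0] with z hz hzj
    have h2 := h1 j z hzj
    have h3 : z ∈ cube k (L j) := ((hφ j).support (subset_tsupport _ (by
      rw [Function.mem_support, h2]; exact one_ne_zero))).2
    simp only [hf]
    rw [← hz h3 0, h2, one_smul]
  have hmeas : ∀ j, Measurable (f j) := fun j =>
    ((hK j).measurable_modeAmp hU (hφ j) (hL0 j) (meanMode S ζ hchar hN)).measurable
  obtain ⟨g, hg, hgf⟩ := exists_measurable_piecewise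
    (fun j => disjointed (exhaust k T) j ×ˢ (Set.univ : Set ℝ))
    (fun j => (MeasurableSet.disjointed (fun j => (isCompact_exhaust j).measurableSet) j).prod
      MeasurableSet.univ) f hmeas fun i j hij => by
        rintro q ⟨hi, hj⟩
        exact absurd hj.1 (Set.disjoint_left.1 (disjoint_disjointed _ hij) hi.1)
  refine ⟨g, hg.stronglyMeasurable, fun x hx => ?_⟩
  filter_upwards [ae_all_iff.2 fun j => hval j x hx, ae_restrict_of_ae (ae_apply_zero_ne T),
    ae_restrict_mem (measurableSet_omegaT T)] with z hz hT hzT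
  have h3 : z ∈ ⋃ j, disjointed (exhaust k T) j := by
    rw [iUnion_disjointed]
    exact Set.mem_iUnion.2 (exists_mem_exhaust (lt_of_le_of_ne hzT hT))
  obtain ⟨j, hj⟩ := Set.mem_iUnion.1 h3
  rw [hgf j (show (z, x) ∈ _ from ⟨hj, trivial⟩)]
  exact hz j (disjointed_subset _ _ hj)

/-- Where the cutoff equals `1`, the representative is the amplitude of the mean mode. -/
theorem ModeBound.ae_mean_eq_modeAmp (hK : ModeBound S ζ L φ Uosc K) (hL : 0 < L)
    (hφ : IsCutoff (omegaT k T) L φ) (hchar : S.Noncharacteristic) (hN : 1 ≤ N)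
    (hU : MemOsc s Uosc) (hpol : IsProjE S ζ Uosc Uev Uosc Uev)
    {g : Euc (k + 1) × ℝ → CVec N} (hg : StronglyMeasurable g)
    (hgx : ∀ x : ℝ, 0 ≤ x → ∀ᵐ z ∂(volume.restrict (omegaT k T)),
      g (z, x) = thetaCoef (freqPart (Uosc x) 0) 0 z) :
    ∀ᵐ q : Euc (k + 1) × ℝ, q.1 ∈ omegaT k T → 0 ≤ q.2 → φ q.1 = 1 →
      g q = modeAmp L φ Uosc 0 0 q := by
  have hfm := hK.measurable_modeAmp hU hφ hL (meanMode S ζ hchar hN)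
  refine ae_of_forall_ae_slice
    (P := {q : Euc (k + 1) × ℝ | φ q.1 = 1 → g q = modeAmp L φ Uosc 0 0 q}) ?_ fun x hx => ?_
  · exact (measurableSet_eq_fun (hφ.smooth.continuous.measurable.comp measurable_fst)
      measurable_const).imp (measurableSet_eq_fun hg.measurable hfm.measurable)
  · filter_upwards [hK.ae_thetaCoef_eq hL hφ hchar hU hpol hx 0, hgx x hx]
      with z h2 h3 (h4 : φ z = 1)
    rw [h3, ← h2 (hφ.mem_cube h4) 0, h4, one_smul]

/-- The system satisfied by the mean mode, in the whole domain. -/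
theorem mean_system (hchar : S.Noncharacteristic) (hN : 1 ≤ N)
    {τ : Fin N → Euc (k + 1) → ℝ} (hτ : S.StrictlyHyperbolic τ)
    (hU : IsLeadingProfile S ζ s G U Uosc Uev) (hs1 : 1 ≤ s) (hs : k + 1 + m + 2 < 2 * s)
    {g : Euc (k + 1) × ℝ → CVec N} (hg : StronglyMeasurable g)
    (hgx : ∀ x : ℝ, 0 ≤ x → ∀ᵐ z ∂(volume.restrict (omegaT k T)),
      g (z, x) = thetaCoef (freqPart (Uosc x) 0) 0 z)
    {χ : Euc (k + 1) × ℝ → ℝ} (hχ : ContDiff ℝ ∞ χ) (hχc : HasCompactSupport χ)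
    (hsupp : tsupport χ ⊆ {q | q.1 0 < T ∧ 0 < q.2}) :
    ∫ q in omegaT k T ×ˢ Set.Ioi (0 : ℝ), linTerm S χ q (g q) = 0 := by
  obtain ⟨L, hL, φ, hφ, h1⟩ := exists_isCutoff (D := omegaT k T) (hχc.isCompact.image continuous_fst)
    (fun z hz => by
      obtain ⟨q, hq, rfl⟩ := hz
      exact lt_time_subset_interior T (hsupp hq).1)
  have hL0 : 0 < L := one_pos.trans_le hL
  obtain ⟨K, hK⟩ := hU.memOsc.exists_modeBound ζ S hφ hL hs
  have hφ1 : ∀ q ∈ tsupport χ, φ q.1 = 1 := fun q hq => h1 _ (Set.mem_image_of_mem _ hq)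
  rw [← hK.mean_equation hL0 hφ hchar hN hτ hU hs1 hχ hχc hsupp hφ1]
  have hae := hK.ae_mean_eq_modeAmp hL0 hφ hchar hN hU.memOsc hU.polarization hg hgx
  refine integral_congr_ae ?_
  filter_upwards [ae_restrict_of_ae hae, ae_restrict_mem
    ((measurableSet_omegaT T).prod measurableSet_Ioi)] with q h2 h3
  by_cases hq : q ∈ tsupport χ
  · rw [h2 h3.1 (le_of_lt h3.2) (hφ1 q hq)]
  · have h4 : fderiv ℝ χ q = 0 := by
      by_contra h
      exact hq (support_fderiv_subset ℝ h)
    simp [linTerm_apply, h4]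

end

noncomputable section

variable {k m N M n : ℕ} {T : ℝ} {s : ℕ}
variable {S : BVP k N M} {ζ : Fin m → Euc (k + 1)} {U Uosc Uev : Profile k m N T}
variable {G : L2 (Set.univ : Set (Euc (k + 1))) m M}

/-! ### Vanishing of the mean mode -/

/-- The coordinates `((t, x_d), y) ↦ ((t, y), x_d)`. -/
def joinCoord (k : ℕ) : ((ℝ × ℝ) × Euc k) ≃L[ℝ] Euc (k + 1) × ℝ :=
  LinearEquiv.toContinuousLinearEquiv
    { toFun := fun p => (WithLp.toLp 2 (Fin.cons p.1.1 fun i => p.2 i), p.1.2)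
      invFun := fun q => ((q.1 0, q.2), WithLp.toLp 2 fun i => q.1 i.succ)
      map_add' := fun p p' => by
        refine Prod.ext (PiLp.ext fun i => ?_) rfl
        refine Fin.cases ?_ (fun i => ?_) i <;> simp
      map_smul' := fun c p => by
        refine Prod.ext (PiLp.ext fun i => ?_) rfl
        refine Fin.cases ?_ (fun i => ?_) i <;> simp
      left_inv := fun p => by simp
      right_inv := fun q => by
        refine Prod.ext (PiLp.ext fun i => ?_) rfl
        refine Fin.cases ?_ (fun i => ?_) i <;> simp }

theorem joinCoord_apply (p : (ℝ × ℝ) × Euc k) :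
    joinCoord k p = (WithLp.toLp 2 (Fin.cons p.1.1 fun i => p.2 i), p.1.2) := rfl

theorem measurePreserving_joinCoord : MeasurePreserving (joinCoord k) := by
  have h1 : MeasurePreserving (fun p : (ℝ × ℝ) × Euc k => ((p.1.1, p.2), p.1.2)) := by
    have a := measurePreserving_prodAssoc (volume : Measure ℝ) (volume : Measure ℝ)
      (volume : Measure (Euc k))
    have b := (MeasurePreserving.id (volume : Measure ℝ)).prod
      (Measure.measurePreserving_swap (μ := (volume : Measure ℝ)) (ν := (volume : Measure (Euc k))))
    have c := (measurePreserving_prodAssoc (volume : Measure ℝ) (volume : Measure (Euc k))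
      (volume : Measure ℝ)).symm
    exact c.comp (b.comp a)
  have h2 : MeasurePreserving (fun p : ℝ × Euc k => (WithLp.toLp 2 (Fin.cons p.1 fun i => p.2 i) :
      Euc (k + 1))) := by
    have a := (MeasurePreserving.id (volume : Measure ℝ)).prod (PiLp.volume_preserving_ofLp (Fin k))
    have b := (volume_preserving_piFinSuccAbove (fun _ : Fin (k + 1) => ℝ) 0).symm
    have c := (PiLp.volume_preserving_toLp (Fin (k + 1))).comp (b.comp a)
    convert c using 1
    · funext p
      refine PiLp.ext fun i => ?_
      refine Fin.cases ?_ (fun i => ?_) i <;> simp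
    · exact Measure.volume_eq_prod ℝ (Euc k)
  exact (h2.prod (MeasurePreserving.id (volume : Measure ℝ))).comp h1

theorem measurableEmbedding_joinCoord : MeasurableEmbedding (joinCoord k) :=
  (joinCoord k).toHomeomorph.measurableEmbedding

/-- A product of test functions, in the coordinates of the domain. -/
def tensor (χ : ℝ × ℝ → ℝ) (ψ : Euc k → ℝ) (q : Euc (k + 1) × ℝ) : ℝ :=
  ψ ((joinCoord k).symm q).2 * χ ((joinCoord k).symm q).1

section Tensor

variable {χ : ℝ × ℝ → ℝ} {ψ : Euc k → ℝ}

theorem contDiff_tensor (hχ : ContDiff ℝ ∞ χ) (hψ : ContDiff ℝ ∞ ψ) :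
    ContDiff ℝ ∞ (tensor χ ψ) :=
  (hψ.comp (contDiff_snd.comp (joinCoord k).symm.contDiff)).mul
    (hχ.comp (contDiff_fst.comp (joinCoord k).symm.contDiff))

theorem tsupport_tensor (hχ : HasCompactSupport χ) (hψ : HasCompactSupport ψ) :
    tsupport (tensor χ ψ) ⊆ joinCoord k '' (tsupport χ ×ˢ tsupport ψ) := by
  refine closure_minimal (fun q hq => ?_)
    ((hχ.isCompact.prod hψ.isCompact).image (joinCoord k).continuous).isClosed
  refine ⟨(joinCoord k).symm q, ⟨?_, ?_⟩, (joinCoord k).apply_symm_apply q⟩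
  · by_contra h
    exact hq (by rw [tensor, image_eq_zero_of_notMem_tsupport h, mul_zero])
  · by_contra h
    exact hq (by rw [tensor, image_eq_zero_of_notMem_tsupport h, zero_mul])

theorem hasCompactSupport_tensor (hχ : HasCompactSupport χ) (hψ : HasCompactSupport ψ) :
    HasCompactSupport (tensor χ ψ) :=
  ((hχ.isCompact.prod hψ.isCompact).image (joinCoord k).continuous).of_isClosed_subset
    (isClosed_tsupport _) (tsupport_tensor hχ hψ)

theorem fderiv_tensor (hχ : ContDiff ℝ ∞ χ) (hψ : ContDiff ℝ ∞ ψ) (p v : (ℝ × ℝ) × Euc k) :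
    fderiv ℝ (tensor χ ψ) (joinCoord k p) (joinCoord k v) =
      ψ p.2 * fderiv ℝ χ p.1 v.1 + χ p.1 * fderiv ℝ ψ p.2 v.2 := by
  set J := (joinCoord k).symm
  have e : J (joinCoord k p) = p := (joinCoord k).symm_apply_apply p
  have h1 : HasFDerivAt (fun q => ψ (J q).2) ((fderiv ℝ ψ (J (joinCoord k p)).2).comp
      ((ContinuousLinearMap.snd ℝ (ℝ × ℝ) (Euc k)).comp (J : Euc (k + 1) × ℝ →L[ℝ] (ℝ × ℝ) × Euc k))) (joinCoord k p) :=
    HasFDerivAt.comp (g := ψ) (joinCoord k p)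
      ((hψ.differentiable (by norm_num)) _).hasFDerivAt
      ((ContinuousLinearMap.snd ℝ (ℝ × ℝ) (Euc k)).comp (J : Euc (k + 1) × ℝ →L[ℝ] (ℝ × ℝ) × Euc k)).hasFDerivAt
  have h2 : HasFDerivAt (fun q => χ (J q).1) ((fderiv ℝ χ (J (joinCoord k p)).1).comp
      ((ContinuousLinearMap.fst ℝ (ℝ × ℝ) (Euc k)).comp (J : Euc (k + 1) × ℝ →L[ℝ] (ℝ × ℝ) × Euc k))) (joinCoord k p) :=
    HasFDerivAt.comp (g := χ) (joinCoord k p)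
      ((hχ.differentiable (by norm_num)) _).hasFDerivAt
      ((ContinuousLinearMap.fst ℝ (ℝ × ℝ) (Euc k)).comp (J : Euc (k + 1) × ℝ →L[ℝ] (ℝ × ℝ) × Euc k)).hasFDerivAt
  have h3 : fderiv ℝ (tensor χ ψ) (joinCoord k p) = _ := (h1.mul h2).fderiv
  rw [h3]
  have e2 : J (joinCoord k v) = v := (joinCoord k).symm_apply_apply v
  simp [e, e2]

end Tensor

theorem joinCoord_time : joinCoord k ((1, 0), 0) = (EuclideanSpace.single 0 1, 0) := by
  rw [joinCoord_apply]
  refine Prod.ext (PiLp.ext fun i => ?_) rfl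
  refine Fin.cases ?_ (fun i => ?_) i <;> simp

theorem joinCoord_normal : joinCoord k ((0, 1), 0) = (0, 1) := by
  rw [joinCoord_apply]
  refine Prod.ext (PiLp.ext fun i => ?_) rfl
  refine Fin.cases ?_ (fun i => ?_) i <;> simp

theorem joinCoord_tangential (i : Fin k) :
    joinCoord k ((0, 0), EuclideanSpace.single i 1) = (EuclideanSpace.single i.succ 1, 0) := by
  rw [joinCoord_apply]
  refine Prod.ext (PiLp.ext fun j => ?_) rfl
  refine Fin.cases ?_ (fun j => ?_) j <;> simp

theorem An_linTerm_tensor (hchar : S.Noncharacteristic) {χ : ℝ × ℝ → ℝ} {ψ : Euc k → ℝ}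
    (hχ : ContDiff ℝ ∞ χ) (hψ : ContDiff ℝ ∞ ψ) (p : (ℝ × ℝ) × Euc k) (w : CVec N) :
    cAct (S.An 0) (linTerm S (tensor χ ψ) (joinCoord k p) w) =
      -(ψ p.2 • (fderiv ℝ χ p.1 (1, 0) • w + fderiv ℝ χ p.1 (0, 1) • cAct (S.An 0) w) +
        ∑ i, fderiv ℝ ψ p.2 (EuclideanSpace.single i 1) • χ p.1 • cAct (S.A i 0) w) := by
  have hr : ∀ (r : ℝ) u, cAct (S.An 0) (r • u) = r • cAct (S.An 0) u := fun r u => by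
    rw [← Complex.coe_smul, map_smul, Complex.coe_smul]
  rw [linTerm_apply, map_sub, map_neg, map_sum, hr, Fin.sum_univ_succ, hr,
    S.cAct_An_Atil_zero hchar]
  simp only [hr, S.cAct_An_Atil hchar]
  rw [← joinCoord_time, ← joinCoord_normal]
  simp only [← joinCoord_tangential, fderiv_tensor hχ hψ, map_zero, mul_zero, add_zero,
    smul_add, smul_smul]
  have h0 : fderiv ℝ χ p.1 (0, 0) = 0 := map_zero _
  simp only [h0, mul_zero, zero_add, mul_comm (χ _)]
  abel

/-- The mean mode vanishes over each trapezoid outside the dihedron. -/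
theorem mean_eq_zero (hchar : S.Noncharacteristic) (hN : 1 ≤ N)
    {τ : Fin N → Euc (k + 1) → ℝ} (hτ : S.StrictlyHyperbolic τ)
    {V : ℝ} (hV : BoundsGroupVelocities τ V) (hT : 0 < T)
    (hU : IsLeadingProfile S ζ s G U Uosc Uev) (hs1 : 1 ≤ s) (hs : k + 1 + m + 2 < 2 * s)
    {g : Euc (k + 1) × ℝ → CVec N} (hg : StronglyMeasurable g)
    (hgx : ∀ x : ℝ, 0 ≤ x → ∀ᵐ z ∂(volume.restrict (omegaT k T)),
      g (z, x) = thetaCoef (freqPart (Uosc x) 0) 0 z)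
    {δ a b : ℝ} (hδ : 0 < δ) (ha : V * δ ≤ a) :
    ∀ᵐ p ∂((volume.restrict (trapezoid δ T V a b)).prod volume), g (joinCoord k p) = 0 := by
  have hV0 : 0 ≤ V := BoundsGroupVelocities.nonneg hN hV
  obtain ⟨P, l, hl, hP, hPQ⟩ := hτ.exists_An_decomposition hV
  have hCm := (isOpen_trapezoid δ T V a b).measurableSet
  set C := trapezoid δ T V a b with hC
  set X : ℝ := b + V * δ with hX
  have hCs : ∀ r ∈ C, r.1 < T ∧ 0 < r.2 ∧ r.2 ≤ X := fun r hr =>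
    ⟨hr.2.1, by nlinarith [hr.1, hr.2.2.1], (trapezoid_subset hV0 a b hr).2.2⟩
  have hμ : (volume.restrict C).prod (volume : Measure (Euc k)) =
      (volume : Measure ((ℝ × ℝ) × Euc k)).restrict (C ×ˢ Set.univ) := by
    rw [Measure.volume_eq_prod (ℝ × ℝ) (Euc k), ← Measure.prod_restrict, Measure.restrict_univ]
  have hCu : MeasurableSet (C ×ˢ (Set.univ : Set (Euc k))) := hCm.prod MeasurableSet.univ
  have hGm : StronglyMeasurable fun p => g (joinCoord k p) :=
    hg.comp_measurable (joinCoord k).continuous.measurable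
  have hmp := measurePreserving_joinCoord (k := k)
  have hme := measurableEmbedding_joinCoord (k := k)
  -- the square integrability comes from the uniform bound in the normal variable
  obtain ⟨Kb, hKb0, hKb⟩ := hU.memOsc.1.exists_bound
  obtain ⟨Ct, hCt⟩ := exists_lintegral_thetaCoef_le (omegaT k T) m N
  have hsl : ∀ x : ℝ, 0 ≤ x → ∫⁻ z in omegaT k T, ‖g (z, x)‖ₑ ^ 2 ≤
      Ct * ENNReal.ofReal Kb ^ 2 := by
    intro x hx
    rw [lintegral_congr_ae ((hgx x hx).mono fun z hz => by rw [hz])]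
    refine (hCt _ _).trans (mul_le_mul_right (pow_le_pow_left' ?_ 2) _)
    rw [← ofReal_norm]
    refine ENNReal.ofReal_le_ofReal
      (((hU.memOsc.isAlmostPeriodic hx).isFreqPart_freqPart 0).norm_le fun ψ hψ => ?_)
    have h := (enorm_le_sobolevENorm s (Uosc x ψ)).trans (hKb x ψ hx hψ).le
    rwa [← ofReal_norm, ENNReal.ofReal_le_ofReal_iff hKb0.le] at h
  have hG : MemLp (fun p => g (joinCoord k p)) 2 ((volume.restrict C).prod volume) := by
    refine ⟨hGm.aestronglyMeasurable, ?_⟩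
    rw [eLpNorm_lt_top_iff_lintegral_rpow_enorm_lt_top (by norm_num) (by norm_num)]
    simp only [ENNReal.toReal_ofNat, ENNReal.rpow_ofNat]
    have hgm2 : Measurable fun q => ‖g q‖ₑ ^ 2 := hg.enorm.pow_const 2
    calc ∫⁻ p, ‖g (joinCoord k p)‖ₑ ^ 2 ∂((volume.restrict C).prod volume)
        ≤ ∫⁻ p in joinCoord k ⁻¹' (omegaT k T ×ˢ Set.Icc 0 X), ‖g (joinCoord k p)‖ₑ ^ 2 := by
          rw [hμ]
          refine lintegral_mono_set fun p hp => ?_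
          obtain ⟨h1, h2, h3⟩ := hCs p.1 hp.1
          exact ⟨h1.le, h2.le, h3⟩
      _ = ∫⁻ q in omegaT k T ×ˢ Set.Icc 0 X, ‖g q‖ₑ ^ 2 :=
          hmp.setLIntegral_comp_preimage ((measurableSet_omegaT T).prod measurableSet_Icc) hgm2
      _ = ∫⁻ x in Set.Icc 0 X, ∫⁻ z in omegaT k T, ‖g (z, x)‖ₑ ^ 2 := by
          rw [Measure.volume_eq_prod (Euc (k + 1)) ℝ, ← Measure.prod_restrict,
            lintegral_prod_symm _ hgm2.aemeasurable]
      _ ≤ ∫⁻ x in Set.Icc 0 X, Ct * ENNReal.ofReal Kb ^ 2 :=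
          setLIntegral_mono measurable_const fun x hx => hsl x hx.1
      _ < ⊤ := by
          rw [setLIntegral_const]
          exact ENNReal.mul_lt_top (ENNReal.mul_lt_top ENNReal.coe_lt_top
            (ENNReal.pow_lt_top ENNReal.ofReal_lt_top)) isCompact_Icc.measure_lt_top
  have hpast : ∀ᵐ p ∂((volume.restrict C).prod volume), p.1.1 < 0 → g (joinCoord k p) = 0 := by
    have h1 : ∀ᵐ q : Euc (k + 1) × ℝ, q.1 ∈ omegaT k T → 0 ≤ q.2 →
        q ∈ {q : Euc (k + 1) × ℝ | q.1 0 < 0 → g q = 0} := by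
      refine ae_of_forall_ae_slice ?_ fun x hx => ?_
      · exact (measurableSet_lt (by fun_prop) measurable_const).imp
          (hg.measurable (measurableSet_singleton 0))
      · filter_upwards [hgx x hx, hU.memOsc.thetaCoef_freqPart_eq_zero hx 0 0] with z h1 h2
        intro h0
        rw [h1, h2 h0]
    rw [hμ]
    filter_upwards [ae_restrict_of_ae (hmp.quasiMeasurePreserving.ae h1), ae_restrict_mem hCu]
      with p hp hpC
    obtain ⟨h1, h2, h3⟩ := hCs p.1 hpC.1
    exact hp h1.le h2.le
  refine ae_eq_zero_of_system hδ hT hV0 hGm hG hpast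
    (Q := LinearMap.toContinuousLinearMap (cAct (S.An 0)))
    (P := fun j => LinearMap.toContinuousLinearMap (P j))
    (Q' := fun i => LinearMap.toContinuousLinearMap (cAct (S.A i 0))) hl hP hPQ ?_
  intro χ hχ hχc hsupp ψ hψ hψc
  have hts := tsupport_tensor hχc hψc
  have hsub : tsupport (tensor χ ψ) ⊆ {q | q.1 0 < T ∧ 0 < q.2} := by
    intro q hq
    obtain ⟨p, hp, rfl⟩ := hts hq
    obtain ⟨h1, h2, h3⟩ := hCs p.1 (hsupp hp.1)
    exact ⟨h1, h2⟩
  have h1 := mean_system hchar hN hτ hU hs1 hs hg hgx (contDiff_tensor hχ hψ)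
    (hasCompactSupport_tensor hχc hψc) hsub
  have h0 : ∀ q ∉ tsupport (tensor χ ψ), linTerm S (tensor χ ψ) q (g q) = 0 := fun q hq => by
    have : fderiv ℝ (tensor χ ψ) q = 0 := by
      by_contra h
      exact hq (support_fderiv_subset ℝ h)
    simp [linTerm_apply, this]
  have h4 : ∀ p ∉ C ×ˢ (Set.univ : Set (Euc k)),
      linTerm S (tensor χ ψ) (joinCoord k p) (g (joinCoord k p)) = 0 := fun p hp => h0 _ fun h => by
    obtain ⟨p', hp', e⟩ := hts h
    have hpp : p' = p := (joinCoord k).injective e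
    exact hp (hpp ▸ ⟨hsupp hp'.1, trivial⟩)
  have h5 : ∀ q ∉ omegaT k T ×ˢ Set.Ioi (0 : ℝ), linTerm S (tensor χ ψ) q (g q) = 0 := fun q hq =>
    h0 q fun h => hq ⟨(hsub h).1.le, (hsub h).2⟩
  rw [setIntegral_eq_integral_of_forall_compl_eq_zero h5, ← hmp.integral_comp hme,
    ← setIntegral_eq_integral_of_forall_compl_eq_zero h4, ← hμ] at h1
  have hinv : Function.Injective (cAct (S.An 0)) := fun u w h => by
    have h2 := congrArg (cAct (S.An 0)⁻¹) (show cAct (S.An 0) u = cAct (S.An 0) w from h)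
    rwa [← cAct_mul, ← cAct_mul, Matrix.nonsing_inv_mul _ (hchar 0 S.zero_mem), cAct_one,
      cAct_one] at h2
  let Ae := (LinearEquiv.ofInjectiveEndo (cAct (S.An 0)) hinv).toContinuousLinearEquiv
  have h2 := Ae.integral_comp_comm (μ := (volume.restrict C).prod (volume : Measure (Euc k)))
    (fun p => linTerm S (tensor χ ψ) (joinCoord k p) (g (joinCoord k p)))
  rw [h1, map_zero] at h2
  have h3 : ∀ p, Ae (linTerm S (tensor χ ψ) (joinCoord k p) (g (joinCoord k p))) = _ := fun p =>
    An_linTerm_tensor hchar hχ hψ p (g (joinCoord k p))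
  simp only [h3] at h2
  rw [integral_neg, neg_eq_zero] at h2
  exact h2

end

noncomputable section

variable {k m N M n : ℕ} {T : ℝ} {s : ℕ} {L K : ℝ} {φ : Euc (k + 1) → ℝ}
variable {S : BVP k N M} {ζ : Fin m → Euc (k + 1)} {U Uosc Uev : Profile k m N T}
variable {G : L2 (Set.univ : Set (Euc (k + 1))) m M}

/-! ### Vanishing of the modes outside the dihedron -/

/-- The mean mode vanishes outside the dihedron, at almost every point of nonnegative time. -/
theorem ae_mean_eq_zero (hchar : S.Noncharacteristic) (hN : 1 ≤ N)
    {τ : Fin N → Euc (k + 1) → ℝ} (hτ : S.StrictlyHyperbolic τ)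
    {V : ℝ} (hV : BoundsGroupVelocities τ V) (hT : 0 < T)
    (hU : IsLeadingProfile S ζ s G U Uosc Uev) (hs1 : 1 ≤ s) (hs : k + 1 + m + 2 < 2 * s)
    {g : Euc (k + 1) × ℝ → CVec N} (hg : StronglyMeasurable g)
    (hgx : ∀ x : ℝ, 0 ≤ x → ∀ᵐ z ∂(volume.restrict (omegaT k T)),
      g (z, x) = thetaCoef (freqPart (Uosc x) 0) 0 z) :
    ∀ᵐ q : Euc (k + 1) × ℝ, 0 ≤ q.1 0 → q.1 0 < T → V * q.1 0 < q.2 → g q = 0 := by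
  have hV0 : 0 ≤ V := BoundsGroupVelocities.nonneg hN hV
  set δ : ℕ → ℝ := fun j => 1 / ((j + 1) * (V + 1)) with hδ
  have h1 : ∀ j : ℕ, ∀ᵐ p : (ℝ × ℝ) × Euc k, p.1 ∈ trapezoid (δ j) T V (1 / (j + 1)) j →
      g (joinCoord k p) = 0 := fun j => by
    have hδj : 0 < δ j := by positivity
    have ha : V * δ j ≤ 1 / ((j : ℝ) + 1) := by
      rw [hδ, mul_one_div, div_le_div_iff₀ (by positivity) (by positivity)]
      nlinarith [(Nat.cast_nonneg j : (0 : ℝ) ≤ j)]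
    have h := mean_eq_zero hchar hN hτ hV hT hU hs1 hs hg hgx (b := j) hδj ha
    have hCm := (isOpen_trapezoid (δ j) T V (1 / (j + 1)) j).measurableSet
    have hμ : (volume.restrict (trapezoid (δ j) T V (1 / (j + 1)) j)).prod
        (volume : Measure (Euc k)) = (volume : Measure ((ℝ × ℝ) × Euc k)).restrict
          (trapezoid (δ j) T V (1 / (j + 1)) j ×ˢ Set.univ) := by
      rw [Measure.volume_eq_prod (ℝ × ℝ) (Euc k), ← Measure.prod_restrict, Measure.restrict_univ]
    rw [hμ, ae_restrict_iff' (hCm.prod MeasurableSet.univ)] at h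
    filter_upwards [h] with p hp hpC using hp ⟨hpC, trivial⟩
  have hmp : MeasurePreserving (joinCoord k).symm :=
    measurePreserving_joinCoord.symm (joinCoord k).toHomeomorph.toMeasurableEquiv
  filter_upwards [hmp.quasiMeasurePreserving.ae (ae_all_iff.2 h1)] with q hq h0 hqT hqV
  obtain ⟨j₁, hj₁⟩ := exists_nat_one_div_lt (sub_pos.2 hqV)
  obtain ⟨j₂, hj₂⟩ := exists_nat_gt (q.2 + V * q.1 0)
  have hle : 1 / ((max j₁ j₂ : ℕ) + 1 : ℝ) ≤ 1 / ((j₁ : ℝ) + 1) := by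
    refine one_div_le_one_div_of_le (by positivity) ?_
    have : (j₁ : ℝ) ≤ (max j₁ j₂ : ℕ) := by exact_mod_cast le_max_left _ _
    linarith
  have hle2 : (j₂ : ℝ) ≤ (max j₁ j₂ : ℕ) := by exact_mod_cast le_max_right _ _
  have hδj : 0 < δ (max j₁ j₂) := by positivity
  have h := hq (max j₁ j₂) ⟨lt_of_lt_of_le (neg_lt_zero.2 hδj) h0, hqT,
    show _ + V * q.1 0 < q.2 by linarith, show q.2 < _ - V * q.1 0 by linarith⟩
  rwa [(joinCoord k).apply_symm_apply] at h

/-- A bounded region outside the dihedron, stable under the backward flow of every velocity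
whose components are at most `V`. -/
def backwardRegion (k : ℕ) (δ A V a b : ℝ) : Set (Euc (k + 1) × ℝ) :=
  {q | -δ < q.1 0 ∧ q.1 0 < A ∧ a + V * q.1 0 < q.2 ∧ q.2 < b - V * q.1 0 ∧
    ∀ i : Fin k, |q.1 i.succ| < b - V * q.1 0}

section Region

variable {δ A V a b : ℝ}

theorem isOpen_backwardRegion : IsOpen (backwardRegion k δ A V a b) := by
  have : {q : Euc (k + 1) × ℝ | ∀ i : Fin k, |q.1 i.succ| < b - V * q.1 0} =
      ⋂ i : Fin k, {q | |q.1 i.succ| < b - V * q.1 0} := by ext; simp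
  have h5 : IsOpen {q : Euc (k + 1) × ℝ | ∀ i : Fin k, |q.1 i.succ| < b - V * q.1 0} := by
    rw [this]
    exact isOpen_iInter_of_finite fun i => isOpen_lt (by fun_prop) (by fun_prop)
  have h1 : IsOpen {q : Euc (k + 1) × ℝ | -δ < q.1 0} := isOpen_lt continuous_const (by fun_prop)
  have h2 : IsOpen {q : Euc (k + 1) × ℝ | q.1 0 < A} := isOpen_lt (by fun_prop) continuous_const
  have h3 : IsOpen {q : Euc (k + 1) × ℝ | a + V * q.1 0 < q.2} :=
    isOpen_lt (by fun_prop) (by fun_prop)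
  have h4 : IsOpen {q : Euc (k + 1) × ℝ | q.2 < b - V * q.1 0} :=
    isOpen_lt (by fun_prop) (by fun_prop)
  exact h1.inter (h2.inter (h3.inter (h4.inter h5)))

theorem backwardRegion_normal_pos (hV : 0 ≤ V) (ha : V * δ ≤ a) {q : Euc (k + 1) × ℝ}
    (hq : q ∈ backwardRegion k δ A V a b) : 0 < q.2 := by
  nlinarith [hq.1, hq.2.2.1]

theorem backwardRegion_sub_smul {v : Fin (k + 1) → ℝ} (hv : ∀ i, |v i| ≤ V)
    {q : Euc (k + 1) × ℝ} (hq : q ∈ backwardRegion k δ A V a b) {r : ℝ} (hr : 0 ≤ r)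
    (h : -δ < (q - r • transportDir v).1 0) :
    q - r • transportDir v ∈ backwardRegion k δ A V a b := by
  have e0 : (q - r • transportDir v).1 0 = q.1 0 - r := by simp [transportDir]
  have e1 : ∀ i : Fin k, (q - r • transportDir v).1 i.succ = q.1 i.succ - r * v i.castSucc :=
    fun i => by simp [transportDir]
  have e2 : (q - r • transportDir v).2 = q.2 - r * v (Fin.last k) := by simp [transportDir]
  have hrv : ∀ i, |r * v i| ≤ r * V := fun i => by
    rw [abs_mul, abs_of_nonneg hr]
    exact mul_le_mul_of_nonneg_left (hv i) hr
  obtain ⟨-, h2, h3, h4, h5⟩ := hq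
  refine ⟨h, ?_, ?_, ?_, fun i => ?_⟩
  · rw [e0]; linarith
  · rw [e0, e2]; nlinarith [le_abs_self (r * v (Fin.last k)), hrv (Fin.last k)]
  · rw [e0, e2]; nlinarith [neg_abs_le (r * v (Fin.last k)), hrv (Fin.last k)]
  · rw [e0, e1]
    have := abs_sub (q.1 i.succ) (r * v i.castSucc)
    nlinarith [hrv i.castSucc, h5 i]

/-- The region projects into a compact set of times at most `A`. -/
theorem exists_isCompact_backwardRegion (k : ℕ) (hV : 0 ≤ V) : ∃ C : Set (Euc (k + 1)),
    IsCompact C ∧ (∀ z ∈ C, z 0 ≤ A) ∧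
      ∃ R : ℝ, backwardRegion k δ A V a b ⊆ C ×ˢ Set.Icc (-R) R := by
  set R : ℝ := |A| + |b| + |a| + (V + 1) * |δ| with hR
  have hd : 0 ≤ V * |δ| := by positivity
  refine ⟨WithLp.toLp 2 '' (Set.univ.pi fun _ => Set.Icc (-R) R) ∩ {z | z 0 ≤ A},
    ((isCompact_univ_pi fun _ => isCompact_Icc).image (PiLp.continuous_toLp 2 _)).inter_right
      (isClosed_le (by fun_prop) continuous_const), fun z hz => hz.2, R, ?_⟩
  rintro q ⟨h1, h2, h3, h4, h5⟩
  have hb : b - V * q.1 0 ≤ |b| + V * |δ| := by nlinarith [le_abs_self b, le_abs_self δ]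
  have ha : -|a| - V * |δ| ≤ a + V * q.1 0 := by nlinarith [neg_abs_le a, le_abs_self δ]
  have := abs_nonneg A
  have := abs_nonneg b
  have := abs_nonneg a
  have := abs_nonneg δ
  refine ⟨⟨⟨q.1.ofLp, fun i _ => ?_, rfl⟩, h2.le⟩, by constructor <;> linarith⟩
  refine Fin.cases ?_ (fun i => ?_) i
  · constructor <;> linarith [le_abs_self A, le_abs_self δ]
  · have := abs_lt.1 (h5 i)
    constructor <;> linarith [this.1, this.2]

end Region

/-- If the mean mode vanishes in a backward stable region, so do all the modes. -/
theorem ModeBound.ae_modeAmp_eq_zero_of_mean (hK : ModeBound S ζ L φ Uosc K) (hL : 0 < L)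
    (hφ : IsCutoff (omegaT k T) L φ) (hchar : S.Noncharacteristic) (hN : 1 ≤ N)
    {τ : Fin N → Euc (k + 1) → ℝ} (hτ : S.StrictlyHyperbolic τ)
    {V : ℝ} (hV : BoundsGroupVelocities τ V) (hζ : RationallyIndependent ζ)
    (hU : IsLeadingProfile S ζ s G U Uosc Uev) (hs1 : 1 ≤ s) {δ A a b : ℝ} (hδ : 0 < δ)
    (hA : 0 ≤ A) (hAT : A < T) (ha : V * δ ≤ a)
    (hφ1 : ∀ q ∈ backwardRegion k δ A V a b, φ q.1 = 1)
    (hmean : ∀ᵐ q : Euc (k + 1) × ℝ, q ∈ backwardRegion k δ A V a b → 0 ≤ q.1 0 →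
      modeAmp L φ Uosc 0 0 q = 0) :
    ∀ᵐ q : Euc (k + 1) × ℝ, q ∈ backwardRegion k δ A V a b → ∀ α : Mode S ζ,
      modeAmp L φ Uosc α.1 α.2 q = 0 := by
  classical
  have hV0 : 0 ≤ V := BoundsGroupVelocities.nonneg hN hV
  set C := backwardRegion k δ A V a b with hC
  have hCo : IsOpen C := isOpen_backwardRegion
  have hCm := hCo.measurableSet
  have : (volume : Measure (Euc (k + 1) × ℝ)).IsAddHaarMeasure := by
    rw [Measure.volume_eq_prod]
    infer_instance
  have hpos : ∀ q ∈ C, 0 < q.2 := fun q hq => backwardRegion_normal_pos hV0 ha hq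
  have hCv : volume C < ⊤ := by
    obtain ⟨Q, hQ, -, R, hR⟩ := exists_isCompact_backwardRegion (δ := δ) (A := A) (a := a) (b := b)
      k hV0
    exact (measure_mono hR).trans_lt (hQ.prod isCompact_Icc).measure_lt_top
  let l : Euc (k + 1) × ℝ →L[ℝ] ℝ :=
    (EuclideanSpace.proj (0 : Fin (k + 1))).comp (ContinuousLinearMap.fst ℝ (Euc (k + 1)) ℝ)
  have hlq : ∀ q, l q = q.1 0 := fun q => rfl
  set f : Mode S ζ → Euc (k + 1) × ℝ → CVec N := fun α => modeAmp L φ Uosc α.1 α.2 with hf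
  set Q : Mode S ζ → Euc (k + 1) × ℝ → CVec N := fun α => quadSource S ζ L φ Uosc α.1 α.2 with hQ
  set h : Mode S ζ → Euc (k + 1) × ℝ → CVec N := fun α => modeSource S ζ L φ Uosc α.1 α.2 with hh
  have hfm : ∀ α, StronglyMeasurable (f α) := fun α => hK.measurable_modeAmp hU.memOsc hφ hL α
  have hQm : ∀ α : Mode S ζ, StronglyMeasurable (Q α) := fun α =>
    hK.measurable_quadSource hL hφ hU.memOsc α.1 α.2
  have hhm : ∀ α : Mode S ζ, StronglyMeasurable (h α) := fun α =>
    hK.measurable_modeSource hL hφ hU.memOsc α.1 α.2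
  obtain ⟨C₁, hC₁⟩ := hτ.exists_modeSource_le ζ L φ Uosc
  obtain ⟨C₂, hC₂⟩ := hK.exists_quadSource_bound hL
  obtain ⟨C₃, hC₃⟩ := hK.exists_quadSource_norm_le hL
  have hsum : ∀ q, ∑' α, ‖f α q‖ₑ ≤ ENNReal.ofReal ((torusVol k m L)⁻¹ * K) := fun q => by
    obtain ⟨h1, h2⟩ := hK.summable_modeAmp_one hL q
    simp only [← ofReal_norm]
    rw [← ENNReal.ofReal_tsum_of_nonneg (fun _ => norm_nonneg _) h1]
    exact ENNReal.ofReal_le_ofReal h2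
  have hpast : ∀ α, ∀ᵐ q, q ∈ C → l q < 0 → f α q = 0 := fun α => by
    filter_upwards [hK.ae_modeAmp_eq_zero hL hφ hchar hU.memOsc hU.polarization α] with q hq hqC hl
    refine hq ⟨?_, ?_⟩ (hpos q hqC).le hl
    · exact (hqC.2.1.trans hAT).le
    · exact hφ.mem_cube (hφ1 q hqC)
  -- a weight whose decay beats the sources
  set γ : ℝ := C₁ * C₂ + 1 with hγ
  have hγ0 : 0 < γ := by positivity
  set w : Euc (k + 1) × ℝ → ℝ≥0∞ := fun q => ENNReal.ofReal (Real.exp (-γ * l q)) with hw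
  have hwm : Measurable w := by
    have : Continuous fun q => Real.exp (-γ * l q) := by fun_prop
    exact this.measurable.ennreal_ofReal
  have hwf : ∀ α, Measurable fun q => w q * ‖f α q‖ₑ := fun α => hwm.mul (hfm α).enorm
  have hwQ : ∀ α, Measurable fun q => w q * ‖Q α q‖ₑ := fun α => hwm.mul (hQm α).enorm
  have hfi : ∀ α, IntegrableOn (f α) C := fun α =>
    Measure.integrableOn_of_bounded hCv.ne (hfm α).aestronglyMeasurable
      (M := (torusVol k m L)⁻¹ * K) (Eventually.of_forall fun q => by
        have h1 := (ENNReal.le_tsum α).trans (hsum q)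
        rw [← ofReal_norm] at h1
        exact (ENNReal.ofReal_le_ofReal_iff
          (mul_nonneg (inv_nonneg.2 (torusVol_pos k m hL).le) hK.pos.le)).1 h1)
  have hstep : ∀ α, ENNReal.ofReal γ * ∫⁻ q in C, w q * ‖f α q‖ₑ ≤
      C₁ * ∫⁻ q in C, w q * ‖Q α q‖ₑ := by
    intro α
    by_cases hα : α = meanMode S ζ hchar hN
    · have h0 : ∫⁻ q in C, w q * ‖f α q‖ₑ = 0 := by
        rw [lintegral_eq_zero_iff' (hwf α).aemeasurable]
        filter_upwards [ae_restrict_of_ae hmean, ae_restrict_of_ae (hpast α),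
          ae_restrict_mem hCm] with q h1 h2 hq
        have h3 : f α q = 0 := by
          by_cases ht : 0 ≤ q.1 0
          · rw [hf, hα]; exact h1 hq ht
          · exact h2 hq (not_le.1 ht)
        simp [h3]
      rw [h0, mul_zero]
      exact zero_le
    · have hb := bfreq_ne_zero_of_ne_meanMode hchar hN hζ hα
      obtain ⟨v, hvV, hv⟩ := hτ.exists_velocity hV0 hV hb α.2
      have hle : ∀ q, ‖h α q‖ₑ ≤ C₁ * ‖Q α q‖ₑ := fun q => hC₁ _ _ q hb
      have hhi : IntegrableOn (h α) C :=
        Measure.integrableOn_of_bounded hCv.ne (hhm α).aestronglyMeasurable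
          (M := C₁ * C₃) (Eventually.of_forall fun q => by
            have h1 := hle q
            rw [enorm_eq_nnnorm, enorm_eq_nnnorm, ← ENNReal.coe_mul, ENNReal.coe_le_coe,
              ← NNReal.coe_le_coe] at h1
            push_cast at h1
            exact h1.trans (mul_le_mul_of_nonneg_left (hC₃ α q) C₁.2))
      have ht := transport_estimate (μ := volume) (l := l) (e := transportDir v)
        (by simp [hlq, transportDir]) hCo hδ hA (fun q hq => ⟨hq.1, hq.2.1⟩)
        (fun q hq r hr hl => backwardRegion_sub_smul hvV hq hr hl) (hfi α) hhi (hpast α)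
        (fun χ hχ hχc hsupp => hK.mode_transport hL hφ hchar hU hs1 α hv hχ hχc
          (fun q hq => ⟨(hsupp hq).2.1.trans hAT, hpos q (hsupp hq)⟩)
          (fun q hq => hφ1 q (hsupp hq))) hγ0
      refine ht.trans ?_
      rw [← lintegral_const_mul' _ _ ENNReal.coe_ne_top]
      refine lintegral_mono fun q => ?_
      rw [mul_left_comm]
      exact mul_le_mul_right (hle q) _
  -- the total weighted mass of the modes
  set Y : ℝ≥0∞ := ∑' α, ∫⁻ q in C, w q * ‖f α q‖ₑ with hY
  have hYeq : Y = ∫⁻ q in C, w q * ∑' α, ‖f α q‖ₑ := by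
    simp only [← ENNReal.tsum_mul_left]
    rw [lintegral_tsum fun α => (hwf α).aemeasurable]
  have hYfin : Y ≠ ⊤ := by
    rw [hYeq]
    refine ne_top_of_le_ne_top ?_ (setLIntegral_mono (g := fun _ => ENNReal.ofReal
      (Real.exp (γ * δ)) * ENNReal.ofReal ((torusVol k m L)⁻¹ * K)) measurable_const
        fun q hq => mul_le_mul' (ENNReal.ofReal_le_ofReal (Real.exp_le_exp.2 ?_)) (hsum q))
    · rw [setLIntegral_const]
      exact ENNReal.mul_ne_top (ENNReal.mul_ne_top ENNReal.ofReal_ne_top ENNReal.ofReal_ne_top)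
        hCv.ne
    · rw [hlq]; nlinarith [hq.1]
  have hYle : ENNReal.ofReal γ * Y ≤ C₁ * C₂ * Y := by
    calc ENNReal.ofReal γ * Y = ∑' α, ENNReal.ofReal γ * ∫⁻ q in C, w q * ‖f α q‖ₑ := by
          rw [hY, ENNReal.tsum_mul_left]
      _ ≤ ∑' α, C₁ * ∫⁻ q in C, w q * ‖Q α q‖ₑ := ENNReal.tsum_le_tsum hstep
      _ = C₁ * ∫⁻ q in C, w q * ∑' α, ‖Q α q‖ₑ := by
          rw [ENNReal.tsum_mul_left, ← lintegral_tsum fun α => (hwQ α).aemeasurable]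
          simp only [ENNReal.tsum_mul_left]
      _ ≤ C₁ * ∫⁻ q in C, C₂ * (w q * ∑' α, ‖f α q‖ₑ) := by
          refine mul_le_mul_right (lintegral_mono fun q => ?_) _
          rw [mul_left_comm]
          exact mul_le_mul_right (hC₂ q) _
      _ = C₁ * C₂ * Y := by
          rw [lintegral_const_mul' _ _ ENNReal.coe_ne_top, ← hYeq, mul_assoc]
  have hY0 : Y = 0 := by
    have e : ENNReal.ofReal γ = C₁ * C₂ + 1 := by
      rw [hγ, ENNReal.ofReal_add (by positivity) zero_le_one, ENNReal.ofReal_mul (NNReal.coe_nonneg C₁)]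
      simp
    rw [e, add_mul, one_mul] at hYle
    by_contra h0
    have hfin : (C₁ * C₂ * Y : ℝ≥0∞) ≠ ⊤ :=
      ENNReal.mul_ne_top (ENNReal.mul_ne_top ENNReal.coe_ne_top ENNReal.coe_ne_top) hYfin
    exact absurd hYle (not_le.2 (ENNReal.lt_add_right hfin h0))
  have hall : ∀ α, ∀ᵐ q, q ∈ C → f α q = 0 := fun α => by
    have h1 := ENNReal.tsum_eq_zero.1 hY0 α
    rw [lintegral_eq_zero_iff' (hwf α).aemeasurable] at h1
    filter_upwards [(ae_restrict_iff' hCm).1 h1] with q hq hqC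
    have h2 := hq hqC
    exact enorm_eq_zero.1 ((mul_eq_zero.1 h2).resolve_left
      (ENNReal.ofReal_pos.2 (Real.exp_pos _)).ne')
  filter_upwards [ae_all_iff.2 hall] with q hq hqC α using hq α hqC

end

noncomputable section

variable {k m N M n : ℕ} {T : ℝ} {s : ℕ}
variable {S : BVP k N M} {ζ : Fin m → Euc (k + 1)} {U Uosc Uev : Profile k m N T}
variable {G : L2 (Set.univ : Set (Euc (k + 1))) m M}

/-! ### Vanishing of the oscillating part -/

/-- The oscillating part vanishes in every backward stable region, for almost every value of the
normal variable. -/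
theorem ae_osc_eq_zero_of_backwardRegion (hchar : S.Noncharacteristic) (hN : 1 ≤ N)
    {τ : Fin N → Euc (k + 1) → ℝ} (hτ : S.StrictlyHyperbolic τ)
    {V : ℝ} (hV : BoundsGroupVelocities τ V) (hζ : RationallyIndependent ζ) (hT : 0 < T)
    (hU : IsLeadingProfile S ζ s G U Uosc Uev) (hs1 : 1 ≤ s) (hs : k + 1 + m + 2 < 2 * s)
    {δ A a b : ℝ} (hδ : 0 < δ) (hA : 0 ≤ A) (hAT : A < T) (ha0 : 0 < a) (ha : V * δ ≤ a) :
    ∀ᵐ x : ℝ, 0 < x → ∀ ψ : ℝ, 0 ≤ ψ → ∀ᵐ p ∂(torusMeasure (omegaT k T) m),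
      (p.1, x) ∈ backwardRegion k δ A V a b → Uosc x ψ p = 0 := by
  have hV0 : 0 ≤ V := BoundsGroupVelocities.nonneg hN hV
  obtain ⟨Q, hQ, hQA, R, hR⟩ := exists_isCompact_backwardRegion (δ := δ) (A := A) (a := a) (b := b)
      k hV0
  obtain ⟨L, hL, φ, hφ, h1⟩ := exists_isCutoff (D := omegaT k T) hQ
    (fun z hz => lt_time_subset_interior T ((hQA z hz).trans_lt hAT))
  have hL0 : 0 < L := one_pos.trans_le hL
  obtain ⟨K, hK⟩ := hU.memOsc.exists_modeBound ζ S hφ hL hs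
  have hφ1 : ∀ q ∈ backwardRegion k δ A V a b, φ q.1 = 1 := fun q hq => h1 _ (hR hq).1
  obtain ⟨g, hg, hgx⟩ := hU.memOsc.exists_mean ζ hchar hN hU.polarization hs
  have hae := hK.ae_mean_eq_modeAmp hL0 hφ hchar hN hU.memOsc hU.polarization hg hgx
  have hmean : ∀ᵐ q : Euc (k + 1) × ℝ, q ∈ backwardRegion k δ A V a b → 0 ≤ q.1 0 →
      modeAmp L φ Uosc 0 0 q = 0 := by
    filter_upwards [hae, ae_mean_eq_zero hchar hN hτ hV hT hU hs1 hs hg hgx] with q h2 h3 hq ht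
    have h4 := hq.2.1.trans hAT
    rw [← h2 h4.le (backwardRegion_normal_pos hV0 ha hq).le (hφ1 q hq)]
    exact h3 ht h4 (by linarith [hq.2.2.1])
  have hall := hK.ae_modeAmp_eq_zero_of_mean hL0 hφ hchar hN hτ hV hζ hU hs1 hδ hA hAT ha hφ1 hmean
  have hswap : ∀ᵐ x : ℝ, ∀ᵐ z : Euc (k + 1), (z, x) ∈ backwardRegion k δ A V a b →
      ∀ α : Mode S ζ, modeAmp L φ Uosc α.1 α.2 (z, x) = 0 := by
    have hsw := (Measure.measurePreserving_swap (μ := (volume : Measure ℝ))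
      (ν := (volume : Measure (Euc (k + 1))))).quasiMeasurePreserving.ae hall
    exact Measure.ae_ae_of_ae_prod hsw
  filter_upwards [hswap] with x hx hx0 ψ hψ
  have h2 : ∀ᵐ p ∂(torusMeasure (omegaT k T) m), (p.1, x) ∈ backwardRegion k δ A V a b →
      ∀ α : Mode S ζ, modeAmp L φ Uosc α.1 α.2 (p.1, x) = 0 :=
    ae_restrict_of_ae (Measure.quasiMeasurePreserving_fst.ae hx)
  filter_upwards [h2, hK.ae_osc_eq hL0 hφ hchar hU.memOsc hU.polarization hx0.le hψ]
    with p h3 h4 hp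
  have h5 := h4 (hφ.mem_cube (hφ1 _ hp))
  rw [hφ1 _ hp, one_smul] at h5
  rw [h5]
  simp only [h3 hp, smul_zero, tsum_zero]

/-- The oscillating part vanishes outside the dihedron, for almost every value of the normal
variable. -/
theorem ae_osc_eq_zero (hchar : S.Noncharacteristic) (hN : 1 ≤ N)
    {τ : Fin N → Euc (k + 1) → ℝ} (hτ : S.StrictlyHyperbolic τ)
    {V : ℝ} (hV : BoundsGroupVelocities τ V) (hζ : RationallyIndependent ζ) (hT : 0 < T)
    (hU : IsLeadingProfile S ζ s G U Uosc Uev) (hs1 : 1 ≤ s) (hs : k + 1 + m + 2 < 2 * s) :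
    ∀ᵐ x : ℝ, 0 < x → ∀ ψ : ℝ, 0 ≤ ψ → ∀ᵐ p ∂(torusMeasure (omegaT k T) m),
      V * p.1 0 < x → Uosc x ψ p = 0 := by
  have hV0 : 0 ≤ V := BoundsGroupVelocities.nonneg hN hV
  set ε : ℕ → ℝ := fun j => 1 / ((j : ℝ) + 1) with hε
  have hε0 : ∀ j, 0 < ε j := fun j => by positivity
  have hεt : Tendsto ε atTop (𝓝 0) := tendsto_one_div_add_atTop_nhds_zero_nat
  have h1 : ∀ j : ℕ, ∀ᵐ x : ℝ, 0 < x → ∀ ψ : ℝ, 0 ≤ ψ → ∀ᵐ p ∂(torusMeasure (omegaT k T) m),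
      (p.1, x) ∈ backwardRegion k (ε j / (V + 1)) (T - T * ε j) V (ε j) j → Uosc x ψ p = 0 :=
    fun j => ae_osc_eq_zero_of_backwardRegion hchar hN hτ hV hζ hT hU hs1 hs
      (div_pos (hε0 j) (by positivity))
      (by
        have : ε j ≤ 1 := (div_le_one (by positivity)).2 (by linarith [(Nat.cast_nonneg j : (0 : ℝ) ≤ j)])
        nlinarith)
      (by nlinarith [hε0 j]) (hε0 j)
      (by
        rw [← mul_div_assoc, div_le_iff₀ (by positivity)]
        nlinarith [hε0 j])
  filter_upwards [ae_all_iff.2 h1] with x hx hx0 ψ hψ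
  filter_upwards [ae_all_iff.2 fun j => hx j hx0 ψ hψ, ae_time_lt T, hU.memOsc.1.zero x ψ hx0.le hψ]
    with p hp hpT hp0 hpV
  by_cases ht : p.1 0 < 0
  · exact hp0 ht
  have hjt : Tendsto (fun j : ℕ => (j : ℝ)) atTop atTop := tendsto_natCast_atTop_atTop
  have e1 : ∀ᶠ j in atTop, p.1 0 < T - T * ε j := by
    have : Tendsto (fun j => T - T * ε j) atTop (𝓝 (T - T * 0)) := (hεt.const_mul T).const_sub T
    exact this.eventually_const_lt (by linarith)
  have e2 : ∀ᶠ j in atTop, ε j + V * p.1 0 < x := by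
    have : Tendsto (fun j => ε j + V * p.1 0) atTop (𝓝 (0 + V * p.1 0)) := hεt.add_const _
    exact this.eventually_lt_const (by linarith)
  have e3 : ∀ᶠ j : ℕ in atTop, x + V * p.1 0 < j := hjt.eventually_gt_atTop _
  have e4 : ∀ᶠ j : ℕ in atTop, ∀ i : Fin k, |p.1 i.succ| + V * p.1 0 < j :=
    eventually_all.2 fun i => hjt.eventually_gt_atTop _
  obtain ⟨j, h1, h2, h3, h4⟩ := (e1.and (e2.and (e3.and e4))).exists
  have hδj : 0 < ε j / (V + 1) := div_pos (hε0 j) (by positivity)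
  exact hp j ⟨by show _ < p.1 0; linarith, h1, h2, by show x < _ - V * p.1 0; linarith,
    fun i => by show |p.1 i.succ| < _ - V * p.1 0; linarith [h4 i]⟩

/-- The oscillating part vanishes outside the dihedron. The exceptional values of the normal
variable are reached from above, by continuity. -/
theorem osc_eq_zero (hchar : S.Noncharacteristic) (hN : 1 ≤ N)
    {τ : Fin N → Euc (k + 1) → ℝ} (hτ : S.StrictlyHyperbolic τ)
    {V : ℝ} (hV : BoundsGroupVelocities τ V) (hζ : RationallyIndependent ζ) (hT : 0 < T)
    (hU : IsLeadingProfile S ζ s G U Uosc Uev) (hs1 : 1 ≤ s) (hs : k + 1 + m + 2 < 2 * s)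
    {x ψ : ℝ} (hx : 0 ≤ x) (hψ : 0 ≤ ψ) :
    ∀ᵐ p ∂(torusMeasure (omegaT k T) m), V * p.1 0 < x → Uosc x ψ p = 0 := by
  set A : Set (Euc (k + 1) × Euc m) := {p | V * p.1 0 < x} with hA
  have hAm : MeasurableSet A := measurableSet_lt (by fun_prop) measurable_const
  set Λ := LpToLpRestrictCLM (Euc (k + 1) × Euc m) (CVec N) ℂ (torusMeasure (omegaT k T) m) 2 A
  have hae := ae_osc_eq_zero hchar hN hτ hV hζ hT hU hs1 hs
  set D : Set ℝ := {x' | 0 < x' → ∀ ψ : ℝ, 0 ≤ ψ → ∀ᵐ p ∂(torusMeasure (omegaT k T) m),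
      V * p.1 0 < x' → Uosc x' ψ p = 0} with hD
  have hdense : Dense D := Measure.dense_of_ae hae
  have hcl : x ∈ closure (Set.Ioi x ∩ D) := by
    have h1 := closure_mono (hdense.open_subset_closure_inter (isOpen_Ioi (a := x)))
    rw [closure_closure, closure_Ioi] at h1
    exact h1 Set.self_mem_Ici
  have hne : (𝓝[Set.Ioi x ∩ D] x).NeBot := mem_closure_iff_nhdsWithin_neBot.1 hcl
  have hlim : Tendsto (fun x' => Λ (Uosc x' ψ)) (𝓝[Set.Ioi x ∩ D] x) (𝓝 (Λ (Uosc x ψ))) := by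
    refine (Λ.continuous.tendsto _).comp ?_
    have h1 : ContinuousWithinAt (fun q : ℝ × ℝ => Uosc q.1 q.2) (Set.Ici 0 ×ˢ Set.Ici 0) (x, ψ) :=
      hU.memOsc.1.continuousOn (x, ψ) ⟨hx, hψ⟩
    refine Tendsto.comp (g := fun q : ℝ × ℝ => Uosc q.1 q.2) (f := fun x' => (x', ψ)) h1.tendsto
      (tendsto_nhdsWithin_iff.2 ⟨?_, ?_⟩)
    · exact ((Continuous.prodMk_left ψ).tendsto x).mono_left nhdsWithin_le_nhds
    · filter_upwards [self_mem_nhdsWithin] with x' hx'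
      exact ⟨hx.trans (le_of_lt hx'.1), hψ⟩
  have hzero : ∀ᶠ x' in 𝓝[Set.Ioi x ∩ D] x, Λ (Uosc x' ψ) = 0 := by
    filter_upwards [self_mem_nhdsWithin] with x' hx'
    refine (Lp.eq_zero_iff_ae_eq_zero).2 ?_
    have h1 := hx'.2 (hx.trans_lt hx'.1) ψ hψ
    filter_upwards [LpToLpRestrictCLM_coeFn ℂ A (Uosc x' ψ), ae_restrict_of_ae h1,
      ae_restrict_mem hAm] with p hp h2 hpA
    rw [hp, h2 (lt_trans hpA hx'.1)]
    rfl
  have h0 : Λ (Uosc x ψ) = 0 :=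
    tendsto_nhds_unique hlim (tendsto_const_nhds.congr' (hzero.mono fun _ h => h.symm))
  refine (ae_restrict_iff' hAm).1 ?_
  filter_upwards [(Lp.eq_zero_iff_ae_eq_zero).1 h0, LpToLpRestrictCLM_coeFn ℂ A (Uosc x ψ)]
    with p hp hp'
  rw [← hp', hp]
  rfl

end

end MultiphaseOptics

theorem mainTheorem5 {k N M m : ℕ} (hk : 1 ≤ k) (hN : 1 ≤ N) (hm : 2 ≤ m)
    (S : BVP k N M) (hchar : S.Noncharacteristic)
    (τ : Fin N → Euc (k + 1) → ℝ) (hτ : S.StrictlyHyperbolic τ)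
    (hKL : S.UniformKreissLopatinskii)
    (hmult : NondegenerateGlancing τ)
    (ζ : Fin m → Euc (k + 1)) (hζ0 : ∀ j, ζ j ≠ 0) (hζ : RationallyIndependent ζ)
    (hglanc : NoGlancing τ ζ)
    (a₁ : ℝ) (hdiv : SmallDivisors τ ζ a₁)
    (hmixed : NoMixedResonance τ ζ)
    (hres : ControlledResonances S τ ζ)
    (G : L2 (Set.univ : Set (Euc (k + 1))) m M) (hG : IsBoundarySource G)
    (V : ℝ) (hV : BoundsGroupVelocities τ V)
    (h : ℤ) (hh : (3 + a₁) / 2 ≤ h) (hh1 : 1 ≤ h)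
    (T : ℝ) (hT : 0 < T)
    (s : ℕ) (hs : (h : ℝ) + ((k + 1 : ℕ) + m : ℝ) / 2 < s)
    (U Uosc Uev : Profile k m N T) (hU : IsLeadingProfile S ζ s G U Uosc Uev) :
    ∀ x ψ : ℝ, 0 ≤ x → 0 ≤ ψ → ∀ᵐ p ∂(torusMeasure (omegaT k T) m),
      ¬ (0 ≤ x ∧ x ≤ V * p.1 0) → Uosc x ψ p = 0 := by
  intro x ψ hx hψ
  have hh1' : (1 : ℝ) ≤ h := by exact_mod_cast hh1
  have hs2 : k + 1 + m + 2 < 2 * s := by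
    have h1 : ((k + 1 + m + 2 : ℕ) : ℝ) < (2 * s : ℕ) := by
      push_cast at hs ⊢
      linarith
    exact_mod_cast h1
  have hs1 : 1 ≤ s := by omega
  filter_upwards [osc_eq_zero hchar hN hτ hV hζ hT hU hs1 hs2 hx hψ] with p hp hpV
  exact hp (not_le.1 fun hle => hpV ⟨hx, hle⟩)
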